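/- **Setting.** Let $k>0$, $s>0$, $-1<\delta<0$. Let $n\in C^m(\mathbb R^3;\mathbb C)$ for some integer $m\ge s+2$, such that $n-1$ has compact support and $n(x)\notin(-\infty,0]$ for all $x$. Put $\alpha=\nabla n/n$ and let $n^{\pm1/2}$ denote principal powers. For $a,b\in\mathbb C^3$ write $a\cdot b=\sum_j a_jb_j$ (no conjugation) and $|a|^2=\sum_j|a_j|^2$. Let $H^s_\delta(\mathbb R^3)$ be the completion of $C_0^\infty(\mathbb R^3)$ with respect to $$\|u\|_{H^s_\delta}=\Big(\int_{\mathbb R^3}(1+|x|^2)^{\delta}\,\big|(I-\Delta)^{s/2}u\big|^2\,dx\Big)^{1/2},$$ that is, the space of (scalar or $\mathbb C^3$-valued) functions $u$ for which the distribution $(I-\Delta)^{s/2}u$ is a function and this norm is finite; here $(I-\Delta)^{s/2}$ is the Fourier multiplier with symbol $(1+|\xi|^2)^{s/2}$. For $\zeta\in\mathbb C^3\setminus\mathbb R^3$ put $$G_\zeta v=F^{-1}\Big(\frac{\hat v}{|\xi|^2+2\zeta\cdot\xi}\Big).$$ **Proposition 3.2.** There are constants $c,C>0$, depending only on $k,s,\delta,n$,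 such that for all $\zeta\in\mathbb C^3\setminus\mathbb R^3$ and $\eta\in\mathbb C^3$ with $\zeta\cdot\zeta=k^2$, $\zeta\cdot\eta=0$ and $|\zeta|\ge c$, the following hold. 1. There is a unique (up to null sets) $R_\zeta\in H^s_\delta(\mathbb R^3)$ with values in $\mathbb C^3$ that solves, in the sense of distributions on $\mathbb R^3$, $$(\Delta+2i\zeta\cdot\nabla)R_\zeta=-(\nabla+i\zeta)\big(\alpha\cdot(\eta+R_\zeta)\big)+k^2(1-n)(\eta+R_\zeta).$$ 2. The field $E(x)=e^{i\zeta\cdot x}(\eta+R_\zeta(x))$ satisfies, in the sense of distributions on $\mathbb R^3$, $$\nabla\times\nabla\times E-k^2nE=0,\qquad \nabla\cdot(nE)=0.$$ 3. $$\big\|R_\zeta-i\,n^{-1/2}\,G_\zeta\big(n^{1/2}\,\alpha\cdot\eta\big)\,\zeta\big\|_{H^s_\delta}\le \frac{C\,|\eta|}{|\zeta|}.$$ -/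

import Mathlib

open MeasureTheory
open scoped SchwartzMap FourierTransform Distributions LineDeriv ENNReal

noncomputable section

namespace CGO

/-- Physical space `ℝ³`. -/
abbrev E3 := EuclideanSpace ℝ (Fin 3)

/-- Complex vectors `ℂ³`, with the Hermitian norm `|ζ|² = ∑ |ζ_j|²`. -/
abbrev C3 := EuclideanSpace ℂ (Fin 3)

/-- The complex *bilinear* product `a · b = ∑ a_j b_j` (no conjugation). -/
def dot (a b : C3) : ℂ := ∑ j, a j * b j

/-- `ζ · x` for `ζ ∈ ℂ³` and `x ∈ ℝ³`. -/
def dotR (ζ : C3) (x : E3) : ℂ := ∑ j, ζ j * (x j : ℂ)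

/-- The `j`-th standard basis vector of `ℝ³`. -/
def e (j : Fin 3) : E3 := EuclideanSpace.single j 1

/-! ### Weighted Sobolev spaces -/

section Sobolev

variable {F : Type*} [NormedAddCommGroup F] [NormedSpace ℂ F]

/-- The tempered distribution `U` is the function `u`, i.e. `U φ = ∫ φ u` for all Schwartz `φ`
(with absolutely convergent integrals). -/
def IsFunction (U : 𝓢'(E3, F)) (u : E3 → F) : Prop :=
  ∀ φ : 𝓢(E3, ℂ), Integrable (fun x ↦ φ x • u x) ∧ U φ = ∫ x, φ x • u x

/-- The symbol `⟨ξ⟩ˢ = (1 + |ξ|²)^{s/2}` of `(I - Δ)^{s/2}`. Mathlib's Fourier transform is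
normalized with `e^{-2πi x·ξ}`, so the frequency variable has to be rescaled by `2π`. -/
def besselSymbol (s : ℝ) (ξ : E3) : ℝ := (1 + ‖(2 * Real.pi) • ξ‖ ^ 2) ^ (s / 2)

/-- The symbol has temperate growth, so that it is a Fourier multiplier on tempered
distributions. -/
theorem hasTemperateGrowth_besselSymbol (s : ℝ) :
    (fun ξ ↦ (besselSymbol s ξ : ℂ)).HasTemperateGrowth := by
  have h : (fun ξ : E3 ↦ besselSymbol s ξ).HasTemperateGrowth :=
    (Function.hasTemperateGrowth_one_add_norm_sq_rpow E3 (s / 2)).comp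
      ((2 * Real.pi) • ContinuousLinearMap.id ℝ E3).hasTemperateGrowth
  exact (Complex.ofRealCLM.hasTemperateGrowth).comp h

/-- `(I - Δ)^{s/2} u = w`, for functions `u`, `w` that are tempered distributions. -/
def IsBesselImage (s : ℝ) (u w : E3 → F) : Prop :=
  ∃ U W : 𝓢'(E3, F), IsFunction U u ∧ IsFunction W w ∧
    TemperedDistribution.fourierMultiplierCLM F (fun ξ ↦ (besselSymbol s ξ : ℂ)) U = W

/-- The norm `‖u‖_{H^s_δ} = (∫ ⟨x⟩^{2δ} |(I - Δ)^{s/2} u|² dx)^{1/2}`, with value in `[0, ∞]`.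
The function `w = (I - Δ)^{s/2} u` is unique up to null sets, so the infimum is over the same value;
it is `∞` if `(I - Δ)^{s/2} u` is not a function. -/
def sobolevNorm (s δ : ℝ) (u : E3 → F) : ℝ≥0∞ :=
  ⨅ (w : E3 → F) (_ : IsBesselImage s u w),
    eLpNorm (fun x ↦ ((1 + ‖x‖ ^ 2) ^ (δ / 2) : ℝ) • ‖w x‖) 2 volume

/-- `u ∈ H^s_δ(ℝ³)`: the `H^s_δ` norm is finite. For `s > 0` these functions (modulo null sets)
are the completion of `C_0^∞(ℝ³)` for this norm. -/
def MemSobolev (s δ : ℝ) (u : E3 → F) : Prop := sobolevNorm s δ u < ∞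

end Sobolev

/-! ### Differential operators on distributions -/

/-- Complex-valued distributions on `ℝ³`. -/
abbrev Distr := 𝓓'((⊤ : TopologicalSpace.Opens E3), ℂ)

/-- The distribution `φ ↦ ∫ φ u` of a locally integrable function `u` on `ℝ³`. -/
def toDistr (u : E3 → ℂ) : Distr :=
  ContinuousLinearMap.toUniformConvergenceCLM (RingHom.id ℝ) ℂ {S | IsCompact S}
    (TestFunction.integralAgainstBilinCLM (ContinuousLinearMap.lsmul ℝ ℝ) volume u)

/-- The components of a vector field, as distributions. -/
def toDistr3 (u : E3 → C3) (j : Fin 3) : Distr := toDistr (fun x ↦ u x j)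

/-- The distributional derivative `∂_j`. -/
def pd (j : Fin 3) (T : Distr) : Distr := ∂_{e j} T

def laplacian (T : Distr) : Distr := ∑ j, pd j (pd j T)

/-- `ζ · ∇`. -/
def dirDeriv (ζ : C3) (T : Distr) : Distr := ∑ j, ζ j • pd j T

def divergence (T : Fin 3 → Distr) : Distr := ∑ j, pd j (T j)

def curl (T : Fin 3 → Distr) : Fin 3 → Distr :=
  ![pd 1 (T 2) - pd 2 (T 1), pd 2 (T 0) - pd 0 (T 2), pd 0 (T 1) - pd 1 (T 0)]

/-! ### The equations -/

/-- `α = ∇n / n`. -/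
def alpha (n : E3 → ℂ) (x : E3) : C3 := WithLp.toLp 2 fun j ↦ fderiv ℝ n x (e j) / n x

/-- `(Δ + 2iζ·∇) R = -(∇ + iζ)(α·(η + R)) + k²(1 - n)(η + R)` in the sense of distributions. -/
def SolvesRemainderEq (k : ℝ) (n : E3 → ℂ) (ζ η : C3) (R : E3 → C3) : Prop :=
  ∀ j : Fin 3,
    laplacian (toDistr3 R j) + (2 * Complex.I) • dirDeriv ζ (toDistr3 R j) =
      -(pd j (toDistr fun x ↦ dot (alpha n x) (η + R x)) +
          (Complex.I * ζ j) • toDistr fun x ↦ dot (alpha n x) (η + R x)) +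
        toDistr fun x ↦ (k : ℂ) ^ 2 * (1 - n x) * (η + R x) j

/-- The reduced Maxwell system `∇×∇×E - k²nE = 0`, `∇·(nE) = 0` on `ℝ³`, in the sense of
distributions. -/
def SolvesMaxwell (k : ℝ) (n : E3 → ℂ) (E : E3 → C3) : Prop :=
  (curl (curl (toDistr3 E)) - toDistr3 (fun x ↦ ((k : ℂ) ^ 2 * n x) • E x) = 0) ∧
    divergence (toDistr3 fun x ↦ n x • E x) = 0

/-- The complex geometrical optics field `E(x) = e^{iζ·x} (η + R(x))`. -/
def cgoField (ζ η : C3) (R : E3 → C3) (x : E3) : C3 :=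
  Complex.exp (Complex.I * dotR ζ x) • (η + R x)

/-- `G_ζ v = F⁻¹ (v̂ / (|ξ|² + 2ζ·ξ))`. The frequency variable is rescaled by `2π`, because of
Mathlib's normalization `e^{-2πi x·ξ}`. For `ζ ∉ ℝ³` the Fourier integrals converge absolutely if
`v ∈ L¹ ∩ L²`, in particular if `v` is continuous with compact support. -/
def Gop (ζ : C3) (v : E3 → ℂ) : E3 → ℂ :=
  𝓕⁻ fun ξ : E3 ↦ 𝓕 v ξ /
    (((‖(2 * Real.pi) • ξ‖ ^ 2 : ℝ) : ℂ) + 2 * dotR ζ ((2 * Real.pi) • ξ))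

/-- The leading term `i n^{-1/2} G_ζ(n^{1/2} α·η) ζ`, with the principal square root. -/
def leadingTerm (n : E3 → ℂ) (ζ η : C3) (x : E3) : C3 :=
  (Complex.I * (n x) ^ (-(1 / 2) : ℂ) *
    Gop ζ (fun y ↦ (n y) ^ (1 / 2 : ℂ) * dot (alpha n y) η) x) • ζ

end CGO

end

/-!
# Complex geometrical optics solutions of Maxwell's equations

Put `a = n^{1/2}`, and let `∂_j + iζ_j` be the derivative conjugated with `e^{iζ·x}` (`Dz`). The
operator `Δ + 2iζ·∇` is `∑ (∂_j + iζ_j)² + k²`, and `G_ζ` (`Gop`) inverts its negative.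

**The ansatz.** The remainder equation couples `R` to itself through the first-order term
`(∇ + iζ)(α·R)`, and the one power of `|ζ|` that `G_ζ` gains is lost to `∇ + iζ`. So the field is
sought as `η + R = X - (∇ + iζ) W` (`potE`) with potentials `X_j = η_j + G_ζ f_j` and
`W = a⁻¹ z`, `z = G_ζ f_∗`. The substitution `W = a⁻¹ z` removes the first-order terms: the compactly
supported sources `f` solve a system `f = f₀ + V (G_ζ f)` with multiplication operators `V` of compact support
(`IsPot`, `sysV`). Since `V G_ζ` has norm `O(1/|ζ|)` on `H^l`, the Neumann series converges for
large `ζ` (`exists_system_solution`), also with an additional forcing `Φ`.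

**Both Maxwell equations.** The remainder equation holds by construction
(`IsPot.zeroInt_remainder`). The scalar `Y = ∑ (∂_j + iζ_j) X_j + k² a z` solves the homogeneous
equation `(Δ + 2iζ·∇) Y = k²(1 - n) Y` (`zeroInt_gauge`), so it vanishes for large `ζ` by scalar
uniqueness (`exists_scalar_uniqueness`, `exists_gauge`). `Y = 0` says that `nE` is divergence free
(`IsPot.zeroInt_div`), and with `∇×∇× = ∇(∇·) - Δ` the remainder equation becomes Maxwell's
equation (`IsPot.zeroInt_curl`, `solvesMaxwell_of_weak`).

**The analytic core** is the bound of `G_ζ` by `O(1/|ζ|)`, and of `∂_j G_ζ` by `O(1)`, from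
compactly supported functions in `H^s` to `H^s_δ` (`exists_isBesselImage_mult_le`). The symbol
vanishes to first order on a circle, of codimension two, so `(|ζ|/|symb|)^p` is locally integrable
for `p < 2`, uniformly in `ζ` (`exists_lintegral_weight_invSymb_rpow_two_mul_le`). The weight
`⟨x⟩^δ` is split into dyadic cutoffs; a cutoff at radius `R` is a convolution with a kernel of
width `R⁻¹` on the Fourier side. By the Cauchy-Schwarz inequality the singularity `|symb|⁻²` is
shared out: the power `-δ` is integrated by the kernel and costs `R^{-δ}`, which the factor
`R^{2δ}` from the weight absorbs, and the power `2 + δ < 2` falls on `|f̂|²`. Since `f` has compact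
support, `f̂` is dominated by its own convolution with a rapidly decreasing kernel, and the second
factor is harmless as well.

**Uniqueness.** A function of class `H^s_δ` grows at most like `r^{-δ}` in the weak sense of
`Growth` (`growth_of_isBesselImage`). Solutions of this growth with compactly supported right-hand
side are represented by `G_ζ`: tested against `G_{-ζ} f`, the commutator with a cutoff at radius
`R` is `O(R^{-1-δ-δ'})` for every `δ' ∈ (-1, 0)`, and tends to zero if `δ'` is close to zero
(`representation`). For a solution `U` of the homogeneous remainder equation and a test field `Φ`,
the system for the potentials is solved for `-ζ` with forcing `Φ`; pairing `U` with that solution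
gives `∫ U·Φ = 0` (`exists_field_uniqueness`).

**The estimate.** To first order `z` is `-G_ζ(a α·η)`, and the leading term of `R` is `-iζ a⁻¹ G_ζ
src0` with `src0 = -a α·η` (`lead_eq`). All other terms are `O(|η|/|ζ|)`: either `G_ζ` acts without
a derivative, or it acts on a source that is itself `O(|η|/|ζ|)`, or the derivative falls on the
`C¹` function `src0` (`potE_sub_lead`, `exists_field_estimate`).
-/

namespace CGO

/-! ### The symbol of `Δ + 2iζ·∇` -/

/-- The symbol `|τ|² + 2ζ·τ`, `τ = 2πξ`, of `-(Δ + 2iζ·∇)`. -/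
noncomputable def symb (ζ : C3) (ξ : E3) : ℂ :=
  ((‖(2 * Real.pi) • ξ‖ ^ 2 : ℝ) : ℂ) + 2 * dotR ζ ((2 * Real.pi) • ξ)

/-- The normalized inverse symbol `|ζ| / |symb ζ|`, with value `0` at the zeros of the symbol
(which form a null set). -/
noncomputable def invSymb (ζ : C3) (ξ : E3) : ℝ := ‖ζ‖ * ‖(symb ζ ξ)⁻¹‖

/-- Real part of a complex vector. -/
noncomputable def rePart (ζ : C3) : E3 := WithLp.toLp 2 fun j ↦ (ζ j).re

/-- Imaginary part of a complex vector. -/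
noncomputable def imPart (ζ : C3) : E3 := WithLp.toLp 2 fun j ↦ (ζ j).im

/-- The frequency vectors for which the estimates are uniform: `ζ · ζ = k²`, and `|ζ|` is at least
`2k` and at least `1`. The bound by `2k` makes `|Re ζ|` and `|Im ζ|` both comparable to `|ζ|`. -/
structure Adm (k : ℝ) (ζ : C3) : Prop where
  dot_self : dot ζ ζ = (k : ℂ) ^ 2
  two_mul_le : 2 * k ≤ ‖ζ‖
  one_le : 1 ≤ ‖ζ‖

theorem dotR_re (ζ : C3) (x : E3) : (dotR ζ x).re = inner ℝ (rePart ζ) x := by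
  simp [dotR, rePart, PiLp.inner_apply, mul_comm]

theorem dotR_im (ζ : C3) (x : E3) : (dotR ζ x).im = inner ℝ (imPart ζ) x := by
  simp [dotR, imPart, PiLp.inner_apply, mul_comm]

theorem norm_sq_eq_re_add_im (ζ : C3) : ‖ζ‖ ^ 2 = ‖rePart ζ‖ ^ 2 + ‖imPart ζ‖ ^ 2 := by
  simp only [EuclideanSpace.norm_sq_eq, rePart, imPart, ← Finset.sum_add_distrib]
  refine Finset.sum_congr rfl fun j _ ↦ ?_
  rw [← Complex.normSq_eq_norm_sq, Complex.normSq_apply]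
  simp [sq]

theorem Adm.neg {k : ℝ} {ζ : C3} (h : Adm k ζ) : Adm k (-ζ) :=
  ⟨by simpa [dot] using h.dot_self, by simpa using h.two_mul_le, by simpa using h.one_le⟩

theorem Adm.norm_sub {k : ℝ} {ζ : C3} (h : Adm k ζ) :
    ‖rePart ζ‖ ^ 2 - ‖imPart ζ‖ ^ 2 = k ^ 2 := by
  have := congrArg Complex.re h.dot_self
  simp only [dot, Complex.re_sum, Complex.mul_re, ← Complex.ofReal_pow, Complex.ofReal_re] at this
  simp only [EuclideanSpace.norm_sq_eq, rePart, imPart, ← Finset.sum_sub_distrib]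
  rw [← this]
  refine Finset.sum_congr rfl fun j _ ↦ ?_
  simp [sq]

theorem Adm.inner_eq_zero {k : ℝ} {ζ : C3} (h : Adm k ζ) :
    inner ℝ (rePart ζ) (imPart ζ) = 0 := by
  have := congrArg Complex.im h.dot_self
  simp only [dot, Complex.im_sum, Complex.mul_im, ← Complex.ofReal_pow, Complex.ofReal_im] at this
  have h2 : ∑ j, 2 * ((ζ j).re * (ζ j).im) = 0 := by
    rw [← this]; exact Finset.sum_congr rfl fun j _ ↦ by ring
  rw [← Finset.mul_sum] at h2
  simp only [PiLp.inner_apply, rePart, imPart]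
  simpa [mul_comm] using h2

theorem Adm.norm_le_two_re {k : ℝ} (hk : 0 < k) {ζ : C3} (h : Adm k ζ) :
    ‖ζ‖ ≤ 2 * ‖rePart ζ‖ := by
  have h1 := norm_sq_eq_re_add_im ζ
  have h2 := h.norm_sub
  nlinarith [norm_nonneg ζ, norm_nonneg (rePart ζ), norm_nonneg (imPart ζ), sq_nonneg k]

theorem Adm.norm_le_two_im {k : ℝ} (hk : 0 < k) {ζ : C3} (h : Adm k ζ) :
    ‖ζ‖ ≤ 2 * ‖imPart ζ‖ := by
  have h1 := norm_sq_eq_re_add_im ζ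
  have h2 := h.norm_sub
  nlinarith [norm_nonneg ζ, norm_nonneg (rePart ζ), norm_nonneg (imPart ζ), h.two_mul_le]

theorem norm_dotR_le (ζ : C3) (x : E3) : ‖dotR ζ x‖ ≤ ‖ζ‖ * ‖x‖ := by
  have h : ‖dotR ζ x‖ ≤ ∑ j, ‖ζ j‖ * ‖x j‖ := by
    refine (norm_sum_le _ _).trans (le_of_eq ?_)
    simp
  refine h.trans ?_
  have := Finset.sum_mul_sq_le_sq_mul_sq Finset.univ (fun j ↦ ‖ζ j‖) (fun j ↦ ‖x j‖)
  rw [← EuclideanSpace.norm_sq_eq, ← EuclideanSpace.norm_sq_eq, ← mul_pow] at this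
  exact (le_abs_self _).trans (abs_le_of_sq_le_sq this (by positivity))

theorem continuous_symb (ζ : C3) : Continuous (symb ζ) := by
  unfold symb dotR; fun_prop

theorem measurable_symb (ζ : C3) : Measurable (symb ζ) := (continuous_symb ζ).measurable

theorem measurable_invSymb (ζ : C3) : Measurable (invSymb ζ) := by
  unfold invSymb
  exact ((measurable_symb ζ).inv.norm).const_mul _

theorem invSymb_nonneg (ζ : C3) (ξ : E3) : 0 ≤ invSymb ζ ξ := by unfold invSymb; positivity

theorem symb_re (ζ : C3) (ξ : E3) :
    (symb ζ ξ).re = ‖(2 * Real.pi) • ξ + rePart ζ‖ ^ 2 - ‖rePart ζ‖ ^ 2 := by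
  rw [norm_add_sq_real]
  simp only [symb, Complex.add_re, Complex.ofReal_re, Complex.mul_re, Complex.re_ofNat,
    Complex.im_ofNat, zero_mul, sub_zero, dotR_re, real_inner_comm]
  ring

theorem symb_im (ζ : C3) (ξ : E3) :
    (symb ζ ξ).im = 2 * inner ℝ (imPart ζ) ((2 * Real.pi) • ξ) := by
  simp [symb, dotR_im, Complex.mul_im, Complex.add_im, -Complex.ofReal_pow]

theorem symb_neg (ζ : C3) (ξ : E3) : symb (-ζ) (-ξ) = symb ζ ξ := by
  simp [symb, dotR, norm_smul]

/-- Away from a ball the symbol is comparable to `|τ|²`. -/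
theorem norm_sq_div_two_le_symb {ζ : C3} {ξ : E3} (h : 4 * ‖ζ‖ ≤ ‖(2 * Real.pi) • ξ‖) :
    ‖(2 * Real.pi) • ξ‖ ^ 2 / 2 ≤ ‖symb ζ ξ‖ := by
  set τ := (2 * Real.pi) • ξ with hτ
  have h2 : ‖τ‖ ^ 2 - 2 * (‖ζ‖ * ‖τ‖) ≤ ‖symb ζ ξ‖ := by
    have h3 := norm_sub_le_norm_add ((‖τ‖ ^ 2 : ℝ) : ℂ) (2 * dotR ζ τ)
    rw [Complex.norm_real, Real.norm_of_nonneg (by positivity), norm_mul,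
      Complex.norm_ofNat] at h3
    have := norm_dotR_le ζ τ
    unfold symb
    linarith
  nlinarith [norm_nonneg τ]

/-- The first-order symbol is controlled by the inverse symbol. -/
theorem norm_mul_symb_inv_le {ζ : C3} (h1 : 1 ≤ ‖ζ‖) (ξ : E3) :
    ‖(2 * Real.pi) • ξ‖ * ‖(symb ζ ξ)⁻¹‖ ≤ 4 * (invSymb ζ ξ + 1) := by
  set τ := (2 * Real.pi) • ξ with hτ
  rcases le_or_gt ‖τ‖ (4 * ‖ζ‖) with h | h
  · unfold invSymb
    nlinarith [mul_le_mul_of_nonneg_right h (norm_nonneg (symb ζ ξ)⁻¹)]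
  · have hP : ‖τ‖ ^ 2 / 2 ≤ ‖symb ζ ξ‖ := norm_sq_div_two_le_symb h.le
    have hpos : 0 < ‖symb ζ ξ‖ := lt_of_lt_of_le (by nlinarith) hP
    have : ‖τ‖ * ‖(symb ζ ξ)⁻¹‖ ≤ 1 := by
      rw [norm_inv, ← div_eq_mul_inv, div_le_one hpos]
      nlinarith
    linarith [invSymb_nonneg ζ ξ]

/-! ### Integrals with a one-dimensional power singularity -/

/-- The integral of a power singularity `|y - r|^(-γ)`, `γ < 1`, against the weight `(1 + (y -
c)²)⁻¹` is bounded uniformly in the positions of both. -/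
theorem lintegral_weight_rpow_bound {γ : ℝ} (h0 : 0 ≤ γ) (h1 : γ < 1) :
    ∃ C : ℝ≥0∞, C ≠ ∞ ∧ ∀ r c : ℝ,
      ∫⁻ y : ℝ, ENNReal.ofReal ((1 + (y - c) ^ 2)⁻¹) * ENNReal.ofReal |y - r| ^ (-γ) ≤ C := by
  have hK : ∫⁻ y in Set.Ioo (-1 : ℝ) 1, ENNReal.ofReal |y| ^ (-γ) ≠ ∞ := by
    have hi : IntegrableOn (fun y : ℝ ↦ |y| ^ (-γ)) (Set.Ioo (-1) 1) := by
      have h2 : IntervalIntegrable (fun y : ℝ ↦ |y| ^ (-γ)) volume 0 1 := by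
        refine (intervalIntegral.intervalIntegrable_rpow' (r := -γ) (by linarith)).congr ?_
        intro y hy
        rw [Set.uIoc_of_le zero_le_one] at hy
        simp [abs_of_pos hy.1]
      have h3 : IntervalIntegrable (fun y : ℝ ↦ |y| ^ (-γ)) volume (-1) 0 := by
        have := (IntervalIntegrable.iff_comp_neg (f := fun y : ℝ ↦ |y| ^ (-γ))
          (a := 0) (b := 1)).1 h2
        simpa using this.symm
      have h4 := h3.trans h2
      rw [intervalIntegrable_iff_integrableOn_Ioo_of_le (by norm_num)] at h4
      exact h4
    have := hi.lintegral_lt_top.ne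
    refine ne_of_eq_of_ne (lintegral_congr_ae ?_) this
    have h0' : ∀ᵐ y : ℝ ∂(volume.restrict (Set.Ioo (-1) 1)), y ≠ 0 :=
      ae_restrict_of_ae (by simp [ae_iff])
    filter_upwards [h0'] with y hy
    rw [ENNReal.ofReal_rpow_of_pos (abs_pos.2 hy)]
  have hK2 : ∫⁻ y : ℝ, ENNReal.ofReal ((1 + y ^ 2)⁻¹) ≠ ∞ :=
    integrable_inv_one_add_sq.lintegral_lt_top.ne
  refine ⟨_, ENNReal.add_ne_top.2 ⟨hK, hK2⟩, fun r c ↦ ?_⟩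
  -- Within distance `1` of `r` drop the weight, and elsewhere drop the singularity.
  have hpt : ∀ y : ℝ, ENNReal.ofReal ((1 + (y - c) ^ 2)⁻¹) * ENNReal.ofReal |y - r| ^ (-γ) ≤
      (Set.Ioo (-1 : ℝ) 1).indicator (fun y ↦ ENNReal.ofReal |y| ^ (-γ)) (y - r) +
        ENNReal.ofReal ((1 + (y - c) ^ 2)⁻¹) := by
    intro y
    have hw : ENNReal.ofReal ((1 + (y - c) ^ 2)⁻¹) ≤ 1 := by
      rw [ENNReal.ofReal_le_one]
      exact inv_le_one_of_one_le₀ (by nlinarith [sq_nonneg (y - c)])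
    by_cases hy : y - r ∈ Set.Ioo (-1 : ℝ) 1
    · rw [Set.indicator_of_mem hy]
      exact le_add_right (mul_le_of_le_one_left' hw)
    · rw [Set.indicator_of_notMem hy, zero_add]
      refine mul_le_of_le_one_right' ?_
      have : 1 ≤ |y - r| := by
        by_contra hlt
        exact hy (abs_lt.1 (not_le.1 hlt))
      rw [ENNReal.rpow_neg, ENNReal.inv_le_one]
      simpa using ENNReal.rpow_le_rpow (z := γ)
        (show 1 ≤ ENNReal.ofReal |y - r| by simpa using this) h0
  calc _ ≤ ∫⁻ y : ℝ, ((Set.Ioo (-1 : ℝ) 1).indicator (fun y ↦ ENNReal.ofReal |y| ^ (-γ)) (y - r) +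
        ENNReal.ofReal ((1 + (y - c) ^ 2)⁻¹)) := lintegral_mono hpt
    _ = (∫⁻ y : ℝ, (Set.Ioo (-1 : ℝ) 1).indicator (fun y ↦ ENNReal.ofReal |y| ^ (-γ)) (y - r)) +
        ∫⁻ y : ℝ, ENNReal.ofReal ((1 + (y - c) ^ 2)⁻¹) :=
        lintegral_add_right _ (by fun_prop)
    _ = _ := by
      rw [lintegral_sub_right_eq_self (fun y ↦ (Set.Ioo (-1 : ℝ) 1).indicator
        (fun y ↦ ENNReal.ofReal |y| ^ (-γ)) y) r,
        lintegral_sub_right_eq_self (fun y ↦ ENNReal.ofReal ((1 + y ^ 2)⁻¹)) c,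
        lintegral_indicator measurableSet_Ioo]

/-! ### Integration in orthonormal coordinates -/

/-- Tonelli's theorem in the coordinates of an orthonormal basis. -/
theorem lintegral_orthonormal (v : OrthonormalBasis (Fin 3) ℝ E3) (F : ℝ → ℝ → ℝ → ℝ≥0∞)
    (hF : Measurable fun p : ℝ × ℝ × ℝ ↦ F p.1 p.2.1 p.2.2) :
    ∫⁻ x : E3, F (inner ℝ (v 0) x) (inner ℝ (v 1) x) (inner ℝ (v 2) x) =
      ∫⁻ a, ∫⁻ b, ∫⁻ c, F a b c := by
  have h1 := v.measurePreserving_repr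
  have h2 := EuclideanSpace.volume_preserving_symm_measurableEquiv_toLp (Fin 3)
  have h3 := volume_preserving_piFinSuccAbove (fun _ : Fin 3 ↦ ℝ) 0
  have h4 := (volume_preserving_piFinTwo (fun _ : Fin 2 ↦ ℝ))
  let G : ℝ × ℝ × ℝ → ℝ≥0∞ := fun p ↦ F p.1 p.2.1 p.2.2
  have h5 := ((MeasurePreserving.id (volume : Measure ℝ)).prod h4).comp (h3.comp (h2.comp h1))
  have e1 : ∫⁻ x : E3, F (inner ℝ (v 0) x) (inner ℝ (v 1) x) (inner ℝ (v 2) x) =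
      ∫⁻ p : ℝ × ℝ × ℝ, G p := by
    have h6 := h5.lintegral_comp hF
    refine Eq.trans (lintegral_congr fun x ↦ ?_) h6
    simp [OrthonormalBasis.repr_apply_apply, Fin.tail]
  rw [e1, Measure.volume_eq_prod, lintegral_prod _ hF.aemeasurable]
  refine lintegral_congr fun a ↦ ?_
  rw [Measure.volume_eq_prod, lintegral_prod]
  exact (hF.comp (by fun_prop : Measurable fun p : ℝ × ℝ ↦ (a, p))).aemeasurable

/-- The rapidly decaying weight `(1 + |y|²)⁻³`, as an extended nonnegative real. -/
noncomputable def weight (y : E3) : ℝ≥0∞ := ENNReal.ofReal ((1 + ‖y‖ ^ 2) ^ 3)⁻¹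

theorem measurable_weight : Measurable weight := by unfold weight; fun_prop

/-- One-dimensional weight. -/
noncomputable def weight1 (a : ℝ) : ℝ≥0∞ := ENNReal.ofReal (1 + a ^ 2)⁻¹

theorem measurable_weight1 : Measurable weight1 := by unfold weight1; fun_prop

theorem weight_le (v : OrthonormalBasis (Fin 3) ℝ E3) (x : E3) :
    weight x ≤ weight1 (inner ℝ (v 0) x) * weight1 (inner ℝ (v 1) x) *
      weight1 (inner ℝ (v 2) x) := by
  have h : ‖x‖ ^ 2 = (inner ℝ (v 0) x) ^ 2 + (inner ℝ (v 1) x) ^ 2 + (inner ℝ (v 2) x) ^ 2 := by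
    rw [← v.sum_sq_norm_inner_right x, Fin.sum_univ_three]
    simp
  unfold weight weight1
  rw [← ENNReal.ofReal_mul (by positivity), ← ENNReal.ofReal_mul (by positivity)]
  refine ENNReal.ofReal_le_ofReal ?_
  rw [← mul_inv, ← mul_inv]
  refine inv_anti₀ (by positivity) ?_
  rw [h]
  generalize inner ℝ (v 0) x = a
  generalize inner ℝ (v 1) x = b
  generalize inner ℝ (v 2) x = c
  have ha := sq_nonneg a
  have hb := sq_nonneg b
  have hc := sq_nonneg c
  calc (1 + a ^ 2) * (1 + b ^ 2) * (1 + c ^ 2)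
      ≤ (1 + (a ^ 2 + b ^ 2 + c ^ 2)) * (1 + (a ^ 2 + b ^ 2 + c ^ 2)) *
        (1 + (a ^ 2 + b ^ 2 + c ^ 2)) := by gcongr <;> linarith
    _ = _ := by ring

/-- The direction of `Im ζ` is taken as the first coordinate axis. -/
theorem exists_orthonormalBasis_imPart (ζ : C3) :
    ∃ v : OrthonormalBasis (Fin 3) ℝ E3, imPart ζ = ‖imPart ζ‖ • v 0 := by
  by_cases h : imPart ζ = 0
  · exact ⟨EuclideanSpace.basisFun (Fin 3) ℝ, by simp [h]⟩
  · let w : Fin 3 → E3 := fun _ ↦ ‖imPart ζ‖⁻¹ • imPart ζ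
    have hw : Orthonormal ℝ (({0} : Set (Fin 3)).domRestrict w) := by
      rw [orthonormal_iff_ite]
      rintro ⟨i, hi⟩ ⟨j, hj⟩
      simp only [Set.mem_singleton_iff] at hi hj
      subst hi hj
      simp [w, Set.domRestrict_apply, norm_smul, h]
    obtain ⟨b, hb⟩ := hw.exists_orthonormalBasis_extension_of_card_eq (by simp)
    refine ⟨b, ?_⟩
    rw [hb 0 (by simp)]
    simp [w, smul_smul, h]

/-- The imaginary part of the symbol, `2 Im ζ · τ` with `τ = 2πξ`, controls `|ζ|` times the
component of `τ` along `Im ζ`. -/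
theorem Adm.norm_mul_abs_le {k : ℝ} (hk : 0 < k) {ζ : C3} (h : Adm k ζ)
    {v : OrthonormalBasis (Fin 3) ℝ E3} (hv : imPart ζ = ‖imPart ζ‖ • v 0) (ξ : E3) :
    ‖ζ‖ * |2 * Real.pi * inner ℝ (v 0) ξ| ≤ ‖symb ζ ξ‖ := by
  refine le_trans ?_ (Complex.abs_im_le_norm _)
  rw [symb_im, hv, inner_smul_left, inner_smul_right, RCLike.conj_to_real]
  have := h.norm_le_two_im hk
  rw [← mul_assoc 2, abs_mul (2 * ‖imPart ζ‖), abs_of_nonneg (by positivity : 0 ≤ 2 * ‖imPart ζ‖)]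
  exact mul_le_mul_of_nonneg_right this (abs_nonneg _)

/-- The inverse symbol is no more singular than the reciprocal of the coordinate along `Im ζ`. -/
theorem Adm.ofReal_invSymb_le {k : ℝ} (hk : 0 < k) {ζ : C3} (h : Adm k ζ)
    {v : OrthonormalBasis (Fin 3) ℝ E3} (hv : imPart ζ = ‖imPart ζ‖ • v 0) (ξ : E3) :
    ENNReal.ofReal (invSymb ζ ξ) ≤ (ENNReal.ofReal |inner ℝ (v 0) ξ|)⁻¹ := by
  set y := inner ℝ (v 0) ξ
  rcases eq_or_ne y 0 with hy | hy
  · simp [hy]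
  rw [← ENNReal.ofReal_inv_of_pos (abs_pos.2 hy)]
  refine ENNReal.ofReal_le_ofReal ?_
  have h1 := h.norm_mul_abs_le hk hv ξ
  have hz : 0 < ‖ζ‖ := lt_of_lt_of_le one_pos h.one_le
  have h2 : ‖ζ‖ * |y| ≤ ‖symb ζ ξ‖ := by
    refine le_trans (mul_le_mul_of_nonneg_left ?_ hz.le) h1
    rw [abs_mul]
    refine le_mul_of_one_le_left (abs_nonneg _) ?_
    rw [abs_of_pos (by positivity)]
    nlinarith [Real.pi_gt_three]
  have h3 : 0 < ‖symb ζ ξ‖ := lt_of_lt_of_le (by positivity) h2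
  unfold invSymb
  rw [norm_inv, ← div_eq_mul_inv, div_le_iff₀ h3, inv_mul_eq_div, le_div_iff₀ (abs_pos.2 hy)]
  exact h2

theorem lintegral_weight1_ne_top : ∫⁻ a, weight1 a ≠ ∞ :=
  integrable_inv_one_add_sq.lintegral_lt_top.ne

/-- Small powers of the inverse symbol are uniformly integrable at the scale `R⁻¹ ≤ 1`: the symbol
vanishes at least linearly in the direction of `Im ζ`. -/
theorem exists_lintegral_weight_invSymb_rpow_le {k : ℝ} (hk : 0 < k) {β : ℝ} (h0 : 0 ≤ β)
    (h1 : β < 1) :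
    ∃ C : ℝ≥0∞, C ≠ ∞ ∧ ∀ ζ : C3, Adm k ζ → ∀ c : E3, ∀ R : ℝ, 0 < R →
      ∫⁻ y, weight y * ENNReal.ofReal (invSymb ζ (c + R⁻¹ • y)) ^ β ≤ C * ENNReal.ofReal R ^ β := by
  obtain ⟨C, hC, hCb⟩ := lintegral_weight_rpow_bound h0 h1
  refine ⟨C * (∫⁻ a, weight1 a) * (∫⁻ a, weight1 a),
    ENNReal.mul_ne_top (ENNReal.mul_ne_top hC lintegral_weight1_ne_top) lintegral_weight1_ne_top,
    fun ζ hζ c R hR ↦ ?_⟩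
  obtain ⟨v, hv⟩ := exists_orthonormalBasis_imPart ζ
  -- After rescaling by `R`, the singular hyperplane is `y₀ = -R c₀`, where the integrand is a one-
  -- dimensional power singularity in the first of three orthonormal coordinates.
  let c0 : ℝ := inner ℝ (v 0) c
  let F : ℝ → ℝ → ℝ → ℝ≥0∞ := fun a b d ↦ weight1 a * (ENNReal.ofReal |a - (-(R * c0))| ^ (-β) *
    ENNReal.ofReal R ^ β) * (weight1 b * weight1 d)
  have hF : Measurable fun p : ℝ × ℝ × ℝ ↦ F p.1 p.2.1 p.2.2 := by
    have := measurable_weight1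
    fun_prop
  calc ∫⁻ y, weight y * ENNReal.ofReal (invSymb ζ (c + R⁻¹ • y)) ^ β
      ≤ ∫⁻ y : E3, F (inner ℝ (v 0) y) (inner ℝ (v 1) y) (inner ℝ (v 2) y) := by
        refine lintegral_mono fun y ↦ ?_
        have hS := ENNReal.rpow_le_rpow (hζ.ofReal_invSymb_le hk hv (c + R⁻¹ • y)) h0
        have hin : inner ℝ (v 0) (c + R⁻¹ • y) = R⁻¹ * (inner ℝ (v 0) y - (-(R * c0))) := by
          rw [inner_add_right, inner_smul_right]
          simp only [c0]
          field_simp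
          ring
        rw [hin, abs_mul, abs_of_pos (inv_pos.2 hR), ENNReal.ofReal_mul (by positivity),
          ENNReal.mul_inv (by simp [hR]) (by simp), ENNReal.ofReal_inv_of_pos hR, inv_inv,
          ENNReal.mul_rpow_of_nonneg _ _ h0, ENNReal.inv_rpow, ← ENNReal.rpow_neg] at hS
        calc _ ≤ (weight1 (inner ℝ (v 0) y) * weight1 (inner ℝ (v 1) y) *
              weight1 (inner ℝ (v 2) y)) * _ := mul_le_mul' (weight_le v y) hS
          _ = _ := by simp only [F]; ring
    _ = ∫⁻ a, ∫⁻ b, ∫⁻ d, F a b d := lintegral_orthonormal v F hF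
    _ = (∫⁻ a, weight1 a * ENNReal.ofReal |a - (-(R * c0))| ^ (-β)) * (∫⁻ a, weight1 a) *
        (∫⁻ a, weight1 a) * ENNReal.ofReal R ^ β := by
        have hm := measurable_weight1
        have e1 : ∀ a, ∫⁻ b, ∫⁻ d, F a b d = weight1 a * ENNReal.ofReal |a - (-(R * c0))| ^ (-β) *
            (ENNReal.ofReal R ^ β * ((∫⁻ a, weight1 a) * ∫⁻ a, weight1 a)) := by
          intro a
          simp only [F]
          have : ∀ b, ∫⁻ d, weight1 a * (ENNReal.ofReal |a - (-(R * c0))| ^ (-β) *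
              ENNReal.ofReal R ^ β) * (weight1 b * weight1 d) = weight1 a *
              (ENNReal.ofReal |a - (-(R * c0))| ^ (-β) * ENNReal.ofReal R ^ β) *
              (weight1 b * ∫⁻ d, weight1 d) := by
            intro b
            rw [lintegral_const_mul _ (by fun_prop), lintegral_const_mul _ (by fun_prop)]
          simp_rw [this]
          rw [lintegral_const_mul _ (by fun_prop), lintegral_mul_const _ (by fun_prop)]
          ring
        simp_rw [e1]
        rw [lintegral_mul_const _ (by fun_prop)]
        ring
    _ ≤ _ := by
        gcongr
        simpa [weight1] using hCb (-(R * c0)) 0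

/-- The algebra behind the estimate of the symbol near its zero set, the circle
`t = 0`, `u₁² + u₂² = M²`. -/
theorem symbol_trichotomy {t u w M Z P : ℝ} (hM : 0 ≤ M) (hZ : 1 ≤ Z) (hZM : Z ≤ 2 * M)
    (hP : 0 < P) (hre : |t ^ 2 + u ^ 2 + w ^ 2 - M ^ 2| ≤ P) (him : Z * |t| ≤ P) :
    Z / P ≤ 16 ∨ (Z / P) ^ 2 * (|t| * |(|u| - √(M ^ 2 - t ^ 2 - w ^ 2))|) ≤ 4 ∨
      (Z / P) ^ 2 * (|t| * |(|w| - √(M ^ 2 - t ^ 2 - u ^ 2))|) ≤ 4 := by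
  -- Where `|u| ≥ M / 2`, the real part factors as `(|u| - r) (|u| + r)` with second factor at
  -- least `M / 2`, so that it controls `|u| - r`.
  have key : ∀ u w : ℝ, |t ^ 2 + u ^ 2 + w ^ 2 - M ^ 2| ≤ P → M / 2 ≤ |u| →
      (Z / P) ^ 2 * (|t| * |(|u| - √(M ^ 2 - t ^ 2 - w ^ 2))|) ≤ 4 := by
    intro u w hre hu
    set r := √(M ^ 2 - t ^ 2 - w ^ 2) with hr
    have hr0 : 0 ≤ r := Real.sqrt_nonneg _
    have h1 : |(|u| - r)| * (M / 2) ≤ |t ^ 2 + u ^ 2 + w ^ 2 - M ^ 2| := by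
      rcases le_or_gt 0 (M ^ 2 - t ^ 2 - w ^ 2) with h | h
      · have h2 : r ^ 2 = M ^ 2 - t ^ 2 - w ^ 2 := Real.sq_sqrt h
        have h3 : t ^ 2 + u ^ 2 + w ^ 2 - M ^ 2 = (|u| - r) * (|u| + r) := by
          nlinarith [sq_abs u]
        rw [h3, abs_mul]
        refine mul_le_mul_of_nonneg_left ?_ (abs_nonneg _)
        rw [abs_of_nonneg (by positivity)]
        linarith
      · have h2 : r = 0 := Real.sqrt_eq_zero_of_nonpos h.le
        rw [h2, sub_zero, abs_abs]
        refine le_trans ?_ (le_abs_self _)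
        nlinarith [sq_abs u, abs_nonneg u]
    have h4 : |(|u| - r)| * (Z / 4) ≤ P := by
      refine le_trans ?_ (h1.trans hre)
      refine mul_le_mul_of_nonneg_left ?_ (abs_nonneg _)
      linarith
    rw [div_pow, div_mul_eq_mul_div, div_le_iff₀ (by positivity)]
    have h5 : (Z * |t|) * (|(|u| - r)| * (Z / 4)) ≤ P * P :=
      mul_le_mul him h4 (by positivity) hP.le
    nlinarith
  -- If neither `u` nor `w` is as large as `M / 2`, the point is far from the circle: either `|t| ≥
  -- M / 2` makes the imaginary part large, or all coordinates are small and the real part is.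
  rcases le_or_gt (M / 2) |u| with hu | hu
  · exact Or.inr (Or.inl (key u w hre hu))
  rcases le_or_gt (M / 2) |w| with hw | hw
  · refine Or.inr (Or.inr (key w u ?_ hw))
    rwa [show t ^ 2 + w ^ 2 + u ^ 2 = t ^ 2 + u ^ 2 + w ^ 2 by ring]
  left
  rw [div_le_iff₀ hP]
  rcases le_or_gt (M / 2) |t| with ht | ht
  · nlinarith [mul_le_mul_of_nonneg_left ht (by linarith : (0 : ℝ) ≤ Z)]
  · have h1 : u ^ 2 < M ^ 2 / 4 := by rw [← sq_abs]; nlinarith [abs_nonneg u]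
    have h2 : w ^ 2 < M ^ 2 / 4 := by rw [← sq_abs]; nlinarith [abs_nonneg w]
    have h3 : t ^ 2 < M ^ 2 / 4 := by rw [← sq_abs]; nlinarith [abs_nonneg t]
    have h4 := neg_abs_le (t ^ 2 + u ^ 2 + w ^ 2 - M ^ 2)
    nlinarith

/-- A product of two one-dimensional power singularities, the second of which moves with the other
coordinates, is uniformly integrable against the weight. -/
theorem lintegral_weight_two_rpow_le {γ : ℝ} {C : ℝ≥0∞}
    (hC : ∀ r c : ℝ,
      ∫⁻ y : ℝ, ENNReal.ofReal ((1 + (y - c) ^ 2)⁻¹) * ENNReal.ofReal |y - r| ^ (-γ) ≤ C)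
    (v : OrthonormalBasis (Fin 3) ℝ E3) (p : ℝ) {ρ : ℝ → ℝ → ℝ}
    (hρ : Measurable fun q : ℝ × ℝ ↦ ρ q.1 q.2) :
    ∫⁻ y : E3, weight y * (ENNReal.ofReal |inner ℝ (v 0) y - p| ^ (-γ) *
        ENNReal.ofReal |inner ℝ (v 2) y - ρ (inner ℝ (v 0) y) (inner ℝ (v 1) y)| ^ (-γ)) ≤
      C * C * ∫⁻ a, weight1 a := by
  have hm := measurable_weight1
  let F : ℝ → ℝ → ℝ → ℝ≥0∞ := fun a b d ↦ weight1 a * weight1 b * ENNReal.ofReal |a - p| ^ (-γ) *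
    (weight1 d * ENNReal.ofReal |d - ρ a b| ^ (-γ))
  have hρ' : Measurable fun q : ℝ × ℝ × ℝ ↦ ρ q.1 q.2.1 :=
    hρ.comp (by fun_prop : Measurable fun q : ℝ × ℝ × ℝ ↦ (q.1, q.2.1))
  have hF : Measurable fun p : ℝ × ℝ × ℝ ↦ F p.1 p.2.1 p.2.2 := by
    simp only [F]
    have h1 : Measurable fun q : ℝ × ℝ × ℝ ↦ q.2.2 - ρ q.1 q.2.1 := by fun_prop
    have h2 : Measurable fun q : ℝ × ℝ × ℝ ↦ ENNReal.ofReal |q.2.2 - ρ q.1 q.2.1| ^ (-γ) := by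
      fun_prop
    fun_prop
  calc _ ≤ ∫⁻ y : E3, F (inner ℝ (v 0) y) (inner ℝ (v 1) y) (inner ℝ (v 2) y) := by
        refine lintegral_mono fun y ↦ ?_
        refine (mul_le_mul_left (weight_le v y) _).trans (le_of_eq ?_)
        simp only [F]; ring
    _ = ∫⁻ a, ∫⁻ b, ∫⁻ d, F a b d := lintegral_orthonormal v F hF
    _ ≤ ∫⁻ a, ∫⁻ b, weight1 a * weight1 b * ENNReal.ofReal |a - p| ^ (-γ) * C := by
        gcongr with a b
        simp only [F]
        rw [lintegral_const_mul _ (by fun_prop)]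
        gcongr
        simpa [weight1] using hC (ρ a b) 0
    _ = ∫⁻ a, (weight1 a * ENNReal.ofReal |a - p| ^ (-γ)) * (C * ∫⁻ a, weight1 a) := by
        refine lintegral_congr fun a ↦ ?_
        rw [← lintegral_const_mul _ hm, ← lintegral_const_mul _ (by fun_prop)]
        refine lintegral_congr fun b ↦ ?_
        ring
    _ = (∫⁻ a, weight1 a * ENNReal.ofReal |a - p| ^ (-γ)) * (C * ∫⁻ a, weight1 a) :=
        lintegral_mul_const _ (by fun_prop)
    _ ≤ C * (C * ∫⁻ a, weight1 a) := by
        gcongr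
        simpa [weight1] using hC p 0
    _ = _ := by ring

theorem lintegral_weight_ne_top : ∫⁻ y, weight y ≠ ∞ := by
  let v := EuclideanSpace.basisFun (Fin 3) ℝ
  have hm := measurable_weight1
  have h : ∫⁻ y, weight y ≤ (∫⁻ a, weight1 a) * ((∫⁻ a, weight1 a) * ∫⁻ a, weight1 a) := by
    let F : ℝ → ℝ → ℝ → ℝ≥0∞ := fun a b d ↦ weight1 a * weight1 b * weight1 d
    have hF : Measurable fun p : ℝ × ℝ × ℝ ↦ F p.1 p.2.1 p.2.2 := by simp only [F]; fun_prop
    refine (lintegral_mono fun y ↦ weight_le v y).trans (le_of_eq ?_)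
    refine (lintegral_orthonormal v F hF).trans ?_
    simp only [F]
    have : ∀ a, ∫⁻ b, ∫⁻ d, weight1 a * weight1 b * weight1 d =
        weight1 a * ((∫⁻ a, weight1 a) * ∫⁻ a, weight1 a) := by
      intro a
      have : ∀ b, ∫⁻ d, weight1 a * weight1 b * weight1 d =
          weight1 a * (weight1 b * ∫⁻ a, weight1 a) := by
        intro b
        rw [lintegral_const_mul _ hm, mul_assoc]
      simp_rw [this]
      rw [lintegral_const_mul _ (by fun_prop), lintegral_mul_const _ hm]
    simp_rw [this]
    rw [lintegral_mul_const _ hm]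
  exact ne_top_of_le_ne_top (ENNReal.mul_ne_top lintegral_weight1_ne_top
    (ENNReal.mul_ne_top lintegral_weight1_ne_top lintegral_weight1_ne_top)) h

/-- Passage from the bound `S² |t| |d| ≤ 4` to powers in `ℝ≥0∞`; it remains true on the singular
set, where the right-hand side is infinite unless `γ = 0`. -/
theorem rpow_le_of_sq_mul_le {S t d γ : ℝ} (hγ0 : 0 ≤ γ) (hγ1 : γ ≤ 1) (hS : 0 ≤ S)
    (h : S ^ 2 * (|t| * |d|) ≤ 4) :
    ENNReal.ofReal S ^ (2 * γ) ≤ 4 * (ENNReal.ofReal |t| ^ (-γ) * ENNReal.ofReal |d| ^ (-γ)) := by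
  -- The cases `S = 0`, `t = 0`, `d = 0` have to be separated because of the conventions for `0 ^
  -- (-γ)` in `ℝ≥0∞`, in particular for `γ = 0`.
  rcases eq_or_ne S 0 with hS0 | hS0
  · rcases hγ0.eq_or_lt with h0 | h0
    · subst h0; simp
    · simp [hS0, h0]
  have hSp : 0 < S := lt_of_le_of_ne hS (Ne.symm hS0)
  rw [ENNReal.rpow_mul, ENNReal.rpow_ofNat, ENNReal.rpow_neg, ENNReal.rpow_neg,
    ← ENNReal.inv_rpow, ← ENNReal.inv_rpow]
  rcases eq_or_ne t 0 with ht | ht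
  · rcases hγ0.eq_or_lt with h0 | h0
    · subst h0; simp
    · subst ht
      have : (ENNReal.ofReal |d|)⁻¹ ^ γ ≠ 0 := by
        simp [ENNReal.rpow_eq_zero_iff, h0, not_lt.2 h0.le]
      simp [ENNReal.top_rpow_of_pos h0, ENNReal.top_mul this]
  rcases eq_or_ne d 0 with hd | hd
  · rcases hγ0.eq_or_lt with h0 | h0
    · subst h0; simp
    · subst hd
      have : (ENNReal.ofReal |t|)⁻¹ ^ γ ≠ 0 := by
        simp [ENNReal.rpow_eq_zero_iff, h0, not_lt.2 h0.le]
      simp [ENNReal.top_rpow_of_pos h0, ENNReal.mul_top this]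
  have h1 : ENNReal.ofReal S ^ 2 ≤ 4 * ((ENNReal.ofReal |t|)⁻¹ * (ENNReal.ofReal |d|)⁻¹) := by
    rw [← ENNReal.ofReal_inv_of_pos (abs_pos.2 ht), ← ENNReal.ofReal_inv_of_pos (abs_pos.2 hd),
      ← ENNReal.ofReal_mul (by positivity), ← ENNReal.ofReal_pow hS,
      show (4 : ℝ≥0∞) = ENNReal.ofReal 4 by simp, ← ENNReal.ofReal_mul (by norm_num)]
    refine ENNReal.ofReal_le_ofReal ?_
    rw [← mul_inv, ← div_eq_mul_inv, le_div_iff₀ (mul_pos (abs_pos.2 ht) (abs_pos.2 hd))]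
    exact h
  refine (ENNReal.rpow_le_rpow h1 hγ0).trans ?_
  rw [ENNReal.mul_rpow_of_nonneg _ _ hγ0, ENNReal.mul_rpow_of_nonneg _ _ hγ0]
  gcongr
  calc (4 : ℝ≥0∞) ^ γ ≤ 4 ^ (1 : ℝ) := ENNReal.rpow_le_rpow_of_exponent_le (by norm_num) hγ1
    _ = 4 := by simp

theorem measurable_ofReal_abs_rpow {f : E3 → ℝ} (hf : Measurable f) (γ : ℝ) :
    Measurable fun y ↦ ENNReal.ofReal |f y| ^ γ := by fun_prop

theorem ofReal_abs_abs_sub_rpow_le (γ u r : ℝ) :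
    ENNReal.ofReal |(|u| - r)| ^ (-γ) ≤
      ENNReal.ofReal |u - r| ^ (-γ) + ENNReal.ofReal |u - -r| ^ (-γ) := by
  rcases le_total 0 u with h | h
  · rw [abs_of_nonneg h]; exact le_self_add
  · rw [abs_of_nonpos h, show -u - r = -(u - -r) by ring, abs_neg]; exact le_add_self

/-- Rescaling a power singularity by the factor `2π ≥ 1`. -/
theorem rpow_two_pi_sub_le {γ : ℝ} (hγ : 0 ≤ γ) (y b r : ℝ) :
    ENNReal.ofReal |2 * Real.pi * y + b - r| ^ (-γ) ≤
      ENNReal.ofReal |y - (r - b) / (2 * Real.pi)| ^ (-γ) := by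
  rw [ENNReal.rpow_neg, ENNReal.rpow_neg, ENNReal.inv_le_inv]
  refine ENNReal.rpow_le_rpow (ENNReal.ofReal_le_ofReal ?_) hγ
  have hpi := Real.pi_gt_three
  have : 2 * Real.pi * y + b - r = 2 * Real.pi * (y - (r - b) / (2 * Real.pi)) := by
    field_simp; ring
  rw [this, abs_mul (2 * Real.pi), abs_of_pos (by positivity : 0 < 2 * Real.pi)]
  exact le_mul_of_one_le_left (abs_nonneg _) (by linarith)

theorem lintegral_weight_mul_le_of_le_add {f g₁ g₂ g₃ g₄ : E3 → ℝ≥0∞} {M K : ℝ≥0∞}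
    (h : ∀ y, f y ≤ M + 4 * (g₁ y + g₂ y + (g₃ y + g₄ y)))
    (m₁ : Measurable g₁) (m₂ : Measurable g₂) (m₃ : Measurable g₃) (m₄ : Measurable g₄)
    (h₁ : ∫⁻ y, weight y * g₁ y ≤ K) (h₂ : ∫⁻ y, weight y * g₂ y ≤ K)
    (h₃ : ∫⁻ y, weight y * g₃ y ≤ K) (h₄ : ∫⁻ y, weight y * g₄ y ≤ K) :
    ∫⁻ y, weight y * f y ≤ M * (∫⁻ y, weight y) + 4 * (4 * K) := by
  have hw := measurable_weight
  calc _ ≤ ∫⁻ y, (weight y * M + 4 * ((weight y * g₁ y + weight y * g₂ y) +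
        (weight y * g₃ y + weight y * g₄ y))) := by
        refine lintegral_mono fun y ↦ (mul_le_mul_right (h y) _).trans (le_of_eq ?_)
        ring
    _ = (∫⁻ y, weight y) * M + 4 * (((∫⁻ y, weight y * g₁ y) + ∫⁻ y, weight y * g₂ y) +
        ((∫⁻ y, weight y * g₃ y) + ∫⁻ y, weight y * g₄ y)) := by
        rw [lintegral_add_left (by fun_prop), lintegral_mul_const _ hw,
          lintegral_const_mul _ (by fun_prop), lintegral_add_left (by fun_prop),
          lintegral_add_left (by fun_prop), lintegral_add_left (by fun_prop)]
    _ ≤ (∫⁻ y, weight y) * M + 4 * ((K + K) + (K + K)) := by gcongr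
    _ = _ := by ring

/-- The powers below `2` of the inverse symbol are uniformly locally integrable: the zero set of
the symbol has codimension two, and the symbol vanishes to first order on it. -/
theorem exists_lintegral_weight_invSymb_rpow_two_mul_le {k : ℝ} (hk : 0 < k) {γ : ℝ} (h0 : 0 ≤ γ)
    (h1 : γ < 1) :
    ∃ C : ℝ≥0∞, C ≠ ∞ ∧ ∀ ζ : C3, Adm k ζ → ∀ c : E3,
      ∫⁻ y, weight y * ENNReal.ofReal (invSymb ζ (c + y)) ^ (2 * γ) ≤ C := by
  obtain ⟨C, hC, hCb⟩ := lintegral_weight_rpow_bound h0 h1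
  have hCC : C * C * ∫⁻ a, weight1 a ≠ ∞ :=
    ENNReal.mul_ne_top (ENNReal.mul_ne_top hC hC) lintegral_weight1_ne_top
  refine ⟨16 ^ (2 * γ) * (∫⁻ y, weight y) + 4 * (4 * (C * C * ∫⁻ a, weight1 a)),
    ENNReal.add_ne_top.2 ⟨ENNReal.mul_ne_top (by simp) lintegral_weight_ne_top,
      ENNReal.mul_ne_top (by simp) (ENNReal.mul_ne_top (by simp) hCC)⟩, fun ζ hζ c ↦ ?_⟩
  obtain ⟨v, hv⟩ := exists_orthonormalBasis_imPart ζ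
  set A := rePart ζ with hA
  let A' : Fin 3 → ℝ := fun i ↦ inner ℝ (v i) A
  let c' : Fin 3 → ℝ := fun i ↦ inner ℝ (v i) c
  let y' : Fin 3 → E3 → ℝ := fun i y ↦ inner ℝ (v i) y
  -- the coordinates `t`, `u₁`, `u₂` of `2π (c + y) + Re ζ`
  let b : Fin 3 → ℝ := fun i ↦ 2 * Real.pi * c' i + A' i
  -- The singular set of the symbol is `t = 0`, `|u₁| = r t u₂`; `sing i j ε` is the product of the
  -- power singularities on `t = 0` and on the sheet `uᵢ = ε r t uⱼ`, expressed in `y`.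
  let r : ℝ → ℝ → ℝ := fun t w ↦ √(‖A‖ ^ 2 - t ^ 2 - w ^ 2)
  let co : Fin 3 → ℝ → ℝ := fun i a ↦ 2 * Real.pi * a + b i
  let ρ : Fin 3 → Fin 3 → ℝ → ℝ → ℝ → ℝ := fun i j ε a d ↦
    (ε * r (co 0 a) (co j d) - b i) / (2 * Real.pi)
  have hρ : ∀ i j ε, Measurable fun q : ℝ × ℝ ↦ ρ i j ε q.1 q.2 := by
    intro i j ε
    have : Continuous fun q : ℝ × ℝ ↦ ρ i j ε q.1 q.2 := by
      simp only [ρ, r, co]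
      fun_prop
    exact this.measurable
  let sing : Fin 3 → Fin 3 → ℝ → E3 → ℝ≥0∞ := fun i j ε y ↦
    ENNReal.ofReal |y' 0 y - -(c' 0)| ^ (-γ) *
      ENNReal.ofReal |y' i y - ρ i j ε (y' 0 y) (y' j y)| ^ (-γ)
  -- `Re ζ` is orthogonal to `Im ζ`.
  have hA0 : A' 0 = 0 := by
    have h2 := hζ.inner_eq_zero
    have hB : ‖imPart ζ‖ ≠ 0 := by
      have := hζ.norm_le_two_im hk
      have := hζ.one_le
      intro h; linarith
    rw [hv, inner_smul_right] at h2
    have := (mul_eq_zero.1 h2).resolve_left hB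
    simp only [A']
    rw [real_inner_comm]; exact this
  have hM : ENNReal.ofReal 16 = (16 : ℝ≥0∞) := by simp
  -- By the trichotomy for the symbol, the inverse symbol is bounded, or is controlled by the
  -- singularities on one of the four sheets.
  have hpt : ∀ y, ENNReal.ofReal (invSymb ζ (c + y)) ^ (2 * γ) ≤ 16 ^ (2 * γ) +
      4 * (sing 1 2 1 y + sing 1 2 (-1) y + (sing 2 1 1 y + sing 2 1 (-1) y)) := by
    intro y
    by_cases hP0 : symb ζ (c + y) = 0
    · have : invSymb ζ (c + y) = 0 := by simp [invSymb, hP0]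
      rcases h0.eq_or_lt with h0 | h0
      · subst h0; simp
      · simp [this, h0]
    have hP : 0 < ‖symb ζ (c + y)‖ := norm_pos_iff.2 hP0
    have hco : ∀ i, inner ℝ (v i) ((2 * Real.pi) • (c + y) + A) = co i (y' i y) := by
      intro i
      rw [inner_add_right, inner_smul_right, inner_add_right]
      simp only [co, b, y', c', A']
      ring
    have hre : |co 0 (y' 0 y) ^ 2 + co 1 (y' 1 y) ^ 2 + co 2 (y' 2 y) ^ 2 - ‖A‖ ^ 2| ≤
        ‖symb ζ (c + y)‖ := by
      refine le_trans (le_of_eq ?_) (Complex.abs_re_le_norm _)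
      rw [symb_re, ← v.sum_sq_norm_inner_right ((2 * Real.pi) • (c + y) + rePart ζ),
        Fin.sum_univ_three]
      simp only [Real.norm_eq_abs, sq_abs]
      rw [← hA, hco, hco, hco]
    have hco0 : co 0 (y' 0 y) = 2 * Real.pi * inner ℝ (v 0) (c + y) := by
      simp only [co, b, hA0, inner_add_right, y', c']
      ring
    have him : ‖ζ‖ * |co 0 (y' 0 y)| ≤ ‖symb ζ (c + y)‖ := by
      rw [hco0]; exact hζ.norm_mul_abs_le hk hv _
    have hSe : invSymb ζ (c + y) = ‖ζ‖ / ‖symb ζ (c + y)‖ := by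
      rw [invSymb, norm_inv, div_eq_mul_inv]
    have ht : ENNReal.ofReal |co 0 (y' 0 y)| ^ (-γ) ≤
        ENNReal.ofReal |y' 0 y - -(c' 0)| ^ (-γ) := by
      have := rpow_two_pi_sub_le h0 (y' 0 y) (b 0) 0
      simp only [sub_zero, zero_sub] at this
      refine this.trans (le_of_eq ?_)
      congr 4
      simp only [b, hA0]
      field_simp
      ring
    have hcase : ∀ i j : Fin 3, (invSymb ζ (c + y)) ^ 2 * (|co 0 (y' 0 y)| *
        |(|co i (y' i y)| - r (co 0 (y' 0 y)) (co j (y' j y)))|) ≤ 4 →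
        ENNReal.ofReal (invSymb ζ (c + y)) ^ (2 * γ) ≤ 4 * (sing i j 1 y + sing i j (-1) y) := by
      intro i j h
      refine (rpow_le_of_sq_mul_le h0 h1.le (invSymb_nonneg _ _) h).trans ?_
      gcongr
      simp only [sing]
      rw [← mul_add]
      refine mul_le_mul' ht ((ofReal_abs_abs_sub_rpow_le γ _ _).trans ?_)
      refine add_le_add ?_ ?_
      · exact (rpow_two_pi_sub_le h0 (y' i y) (b i) _).trans (le_of_eq (by simp only [ρ, one_mul]))
      · exact (rpow_two_pi_sub_le h0 (y' i y) (b i) _).trans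
          (le_of_eq (by simp only [ρ, neg_one_mul]))
    rw [hSe] at hcase ⊢
    rcases symbol_trichotomy (norm_nonneg A) hζ.one_le (hζ.norm_le_two_re hk) hP hre him with
      h | h | h
    · refine le_add_right ?_
      rw [← hM]
      exact ENNReal.rpow_le_rpow (ENNReal.ofReal_le_ofReal h) (by positivity)
    · exact le_add_left ((hcase 1 2 h).trans (mul_le_mul' le_rfl le_self_add))
    · exact le_add_left ((hcase 2 1 h).trans (mul_le_mul' le_rfl le_add_self))
  clear_value ρ
  -- Each sheet is integrated by Tonelli, the coordinate that moves with the others innermost.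
  have hI : ∀ ε, ∫⁻ y, weight y * sing 2 1 ε y ≤ C * C * ∫⁻ a, weight1 a := fun ε ↦
    lintegral_weight_two_rpow_le hCb v (-(c' 0)) (hρ 2 1 ε)
  have hI' : ∀ ε, ∫⁻ y, weight y * sing 1 2 ε y ≤ C * C * ∫⁻ a, weight1 a := fun ε ↦ by
    have := lintegral_weight_two_rpow_le hCb (v.reindex (Equiv.swap 1 2)) (-(c' 0)) (hρ 1 2 ε)
    simpa [Equiv.swap_apply_of_ne_of_ne, sing, y'] using this
  have hy' : ∀ i, Measurable (y' i) := fun i ↦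
    (by fun_prop : Measurable fun y : E3 ↦ inner ℝ (v i) y)
  have hms : ∀ i j ε, Measurable (sing i j ε) := by
    intro i j ε
    have h2 : Measurable fun y : E3 ↦ ρ i j ε (y' 0 y) (y' j y) :=
      Measurable.comp (hρ i j ε) ((hy' 0).prodMk (hy' j))
    exact (measurable_ofReal_abs_rpow ((hy' 0).sub_const _) _).mul
      (measurable_ofReal_abs_rpow ((hy' i).sub h2) _)
  have hw := measurable_weight
  have m1 := hms 1 2 1
  have m2 := hms 1 2 (-1)
  have m3 := hms 2 1 1
  have m4 := hms 2 1 (-1)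
  clear_value sing
  clear_value y' c'
  exact lintegral_weight_mul_le_of_le_add hpt m1 m2 m3 m4 (hI' 1) (hI' (-1)) (hI 1) (hI (-1))

/-! ### Weighted convolution estimates -/

theorem lintegral_sub_left_mul (k f : E3 → ℝ≥0∞) (ξ : E3) :
    ∫⁻ τ, k (ξ - τ) * f τ = ∫⁻ y, k y * f (ξ - y) := by
  rw [← lintegral_sub_left_eq_self (fun y ↦ k y * f (ξ - y)) ξ]
  simp

theorem lintegral_sub_left_mul' (k f : E3 → ℝ≥0∞) (τ : E3) :
    ∫⁻ ξ, k (ξ - τ) * f ξ = ∫⁻ y, k y * f (τ + y) := by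
  rw [← lintegral_sub_right_eq_self (fun y ↦ k y * f (τ + y)) τ]
  simp

theorem lintegral_mul_sq_le {f A B : E3 → ℝ≥0∞} (hf : Measurable f)
    (hA : Measurable A) (hB : Measurable B) {H : E3 → ℝ≥0∞} (hH : ∀ τ, H τ ^ 2 ≤ A τ * B τ) :
    (∫⁻ τ, f τ * H τ) ^ 2 ≤ (∫⁻ τ, f τ * A τ) * ∫⁻ τ, f τ * B τ := by
  have h12 : (2 : ℝ).HolderConjugate 2 := Real.HolderConjugate.two_two
  have hle : ∫⁻ τ, f τ * H τ ≤
      ∫⁻ τ, (f τ * A τ) ^ (1 / 2 : ℝ) * (f τ * B τ) ^ (1 / 2 : ℝ) := by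
    refine lintegral_mono fun τ ↦ ?_
    rw [← ENNReal.mul_rpow_of_nonneg _ _ (by norm_num)]
    calc f τ * H τ = ((f τ * H τ) ^ (2 : ℝ)) ^ (1 / 2 : ℝ) := by
          rw [← ENNReal.rpow_mul]; norm_num
      _ ≤ _ := by
          refine ENNReal.rpow_le_rpow ?_ (by norm_num)
          rw [ENNReal.rpow_ofNat, mul_pow]
          calc f τ ^ 2 * H τ ^ 2 ≤ f τ ^ 2 * (A τ * B τ) := mul_le_mul_right (hH τ) _
            _ = _ := by ring
  have h := ENNReal.lintegral_mul_le_Lp_mul_Lq volume h12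
    (f := fun τ ↦ (f τ * A τ) ^ (1 / 2 : ℝ)) (g := fun τ ↦ (f τ * B τ) ^ (1 / 2 : ℝ))
    (by fun_prop) (by fun_prop)
  have hsq : ∀ x : ℝ≥0∞, (x ^ (1 / 2 : ℝ)) ^ (2 : ℝ) = x := by
    intro x; rw [← ENNReal.rpow_mul]; norm_num
  have hsq' : ∀ x : ℝ≥0∞, (x ^ (1 / 2 : ℝ)) ^ 2 = x := by
    intro x; rw [← ENNReal.rpow_ofNat, hsq]
  simp only [Pi.mul_apply, hsq] at h
  calc _ ≤ _ := pow_le_pow_left' (hle.trans h) 2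
    _ = _ := by rw [mul_pow, hsq', hsq']

/-- Schur-type estimate for a convolution: if `H² ≤ A B` and the convolution of the kernel with `A`
is bounded by `M`, then the `L²` norm of `f * H` is controlled by the integral of `B`. -/
theorem lintegral_conv_sq_le {f A B H : E3 → ℝ≥0∞} (hf : Measurable f) (hA : Measurable A)
    (hB : Measurable B) (hH : ∀ τ, H τ ^ 2 ≤ A τ * B τ) {M : ℝ≥0∞}
    (hM : ∀ ξ, ∫⁻ τ, f (ξ - τ) * A τ ≤ M) :
    ∫⁻ ξ, (∫⁻ τ, f (ξ - τ) * H τ) ^ 2 ≤ M * (∫⁻ y, f y) * ∫⁻ τ, B τ := by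
  calc _ ≤ ∫⁻ ξ, M * ∫⁻ τ, f (ξ - τ) * B τ := by
        refine lintegral_mono fun ξ ↦ ?_
        refine (lintegral_mul_sq_le (f := fun τ ↦ f (ξ - τ)) (by fun_prop) hA hB hH).trans ?_
        exact mul_le_mul_left (hM ξ) _
    _ = M * ∫⁻ ξ, ∫⁻ τ, f (ξ - τ) * B τ := by
        rw [lintegral_const_mul]
        exact Measurable.lintegral_prod_right (by fun_prop : Measurable
          fun p : E3 × E3 ↦ f (p.1 - p.2) * B p.2)
    _ = M * ∫⁻ τ, ∫⁻ ξ, f (ξ - τ) * B τ := by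
        rw [lintegral_lintegral_swap]
        exact (by fun_prop : Measurable fun p : E3 × E3 ↦ f (p.1 - p.2) * B p.2).aemeasurable
    _ = M * ∫⁻ τ, (∫⁻ y, f y) * B τ := by
        congr 1
        refine lintegral_congr fun τ ↦ ?_
        rw [lintegral_mul_const _ (by fun_prop), lintegral_sub_right_eq_self f τ]
    _ = _ := by rw [lintegral_const_mul _ hB, mul_assoc]

/-- Young's inequality for an integrable kernel, in squared form. -/
theorem lintegral_conv_sq_le' {f H : E3 → ℝ≥0∞} (hf : Measurable f) (hH : Measurable H) :
    ∫⁻ ξ, (∫⁻ τ, f (ξ - τ) * H τ) ^ 2 ≤ (∫⁻ y, f y) ^ 2 * ∫⁻ τ, H τ ^ 2 := by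
  have h := lintegral_conv_sq_le hf (A := fun _ ↦ 1) (B := fun τ ↦ H τ ^ 2) (H := H)
    (M := ∫⁻ y, f y) measurable_const (by fun_prop) (by simp)
    (fun ξ ↦ by simp [lintegral_sub_left_eq_self f ξ])
  rwa [← sq] at h

/-- The kernel `weight`, dilated to the scale `R⁻¹` and normalized in `L¹`. -/
noncomputable def weightR (R : ℝ) (y : E3) : ℝ≥0∞ := ENNReal.ofReal (R ^ 3) * weight (R • y)

theorem measurable_weightR (R : ℝ) : Measurable (weightR R) := by
  have := measurable_weight
  unfold weightR
  fun_prop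

theorem lintegral_weightR_mul {R : ℝ} (hR : 0 < R) {f : E3 → ℝ≥0∞} (hf : Measurable f) :
    ∫⁻ y, weightR R y * f y = ∫⁻ y, weight y * f (R⁻¹ • y) := by
  have hw := measurable_weight
  have h := Measure.map_addHaar_smul (volume : Measure E3) hR.ne'
  have h2 : ∫⁻ y, weight (R • y) * f y =
      ENNReal.ofReal |(R ^ 3)⁻¹| * ∫⁻ y, weight y * f (R⁻¹ • y) := by
    have h3 : ∫⁻ y, weight y * f (R⁻¹ • y) ∂(Measure.map (R • ·) (volume : Measure E3)) =
        ∫⁻ y, weight (R • y) * f y := by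
      rw [lintegral_map (by fun_prop) (by fun_prop)]
      simp [smul_smul, hR.ne']
    rw [← h3, h]
    simp
  unfold weightR
  simp_rw [mul_assoc]
  rw [lintegral_const_mul _ (by fun_prop), h2, ← mul_assoc, ← ENNReal.ofReal_mul (by positivity),
    abs_of_pos (by positivity), mul_inv_cancel₀ (by positivity)]
  simp

theorem lintegral_weightR {R : ℝ} (hR : 0 < R) : ∫⁻ y, weightR R y = ∫⁻ y, weight y := by
  simpa using lintegral_weightR_mul hR (f := fun _ ↦ 1) measurable_const

theorem weight_neg (y : E3) : weight (-y) = weight y := by simp [weight]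

theorem lintegral_weight_comp_neg (f : E3 → ℝ≥0∞) :
    ∫⁻ y, weight y * f (-y) = ∫⁻ y, weight y * f y := by
  rw [← lintegral_neg_eq_self (fun y ↦ weight y * f y)]
  simp [weight_neg]

/-- The inverse symbol as an extended nonnegative real. -/
noncomputable def eInvSymb (ζ : C3) (ξ : E3) : ℝ≥0∞ := ENNReal.ofReal (invSymb ζ ξ)

theorem measurable_eInvSymb (ζ : C3) : Measurable (eInvSymb ζ) :=
  (measurable_invSymb ζ).ennreal_ofReal

theorem eInvSymb_ne_top (ζ : C3) (ξ : E3) : eInvSymb ζ ξ ≠ ∞ := ENNReal.ofReal_ne_top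

/-- The convolution of `|ζ| / |symb ζ|` times a function `H` with a kernel of width `R⁻¹`, in `L²`:
the power `β` of the singularity is absorbed by the kernel, at the cost of `R^β`, and the power
`2 - β` by a weighted norm of `H`. -/
theorem exists_lintegral_conv_eInvSymb_sq_le {k : ℝ} (hk : 0 < k) {β : ℝ} (h0 : 0 < β)
    (h1 : β < 1) :
    ∃ C : ℝ≥0∞, C ≠ ∞ ∧ ∀ ζ : C3, Adm k ζ → ∀ R : ℝ, 0 < R → ∀ H : E3 → ℝ≥0∞, Measurable H →
      ∫⁻ ξ, (∫⁻ τ, weightR R (ξ - τ) * (eInvSymb ζ τ * H τ)) ^ 2 ≤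
        C * ENNReal.ofReal R ^ β * ∫⁻ τ, eInvSymb ζ τ ^ (2 - β) * H τ ^ 2 := by
  obtain ⟨C, hC, hCb⟩ := exists_lintegral_weight_invSymb_rpow_le hk h0.le h1
  refine ⟨C * ∫⁻ y, weight y, ENNReal.mul_ne_top hC lintegral_weight_ne_top,
    fun ζ hζ R hR H hH ↦ ?_⟩
  have hm := measurable_eInvSymb ζ
  have h := lintegral_conv_sq_le (measurable_weightR R) (A := fun τ ↦ eInvSymb ζ τ ^ β)
    (B := fun τ ↦ eInvSymb ζ τ ^ (2 - β) * H τ ^ 2) (H := fun τ ↦ eInvSymb ζ τ * H τ)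
    (M := C * ENNReal.ofReal R ^ β) (by fun_prop) (by fun_prop) ?_ ?_
  · rw [lintegral_weightR hR] at h
    refine h.trans (le_of_eq ?_)
    ring
  · intro τ
    rw [← mul_assoc, mul_pow]
    refine mul_le_mul_left (le_of_eq ?_) _
    rcases eq_or_ne (eInvSymb ζ τ) 0 with h | h
    · rw [h, ENNReal.zero_rpow_of_pos h0]; simp
    · rw [← ENNReal.rpow_add _ _ h (eInvSymb_ne_top ζ τ), ← ENNReal.rpow_ofNat]
      congr 1; ring
  · intro ξ
    rw [lintegral_sub_left_mul, lintegral_weightR_mul hR (by fun_prop)]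
    rw [← lintegral_weight_comp_neg]
    refine le_trans (le_of_eq ?_) (hCb ζ hζ ξ R hR)
    refine lintegral_congr fun y ↦ ?_
    rw [smul_neg, sub_neg_eq_add]
    rfl

/-- A function that is dominated by its own convolution with the weight behaves like a bounded
function near the zeros of the symbol. -/
theorem exists_lintegral_eInvSymb_rpow_mul_sq_le {k : ℝ} (hk : 0 < k) {β : ℝ} (h0 : 0 < β)
    (h1 : β < 1) :
    ∃ C : ℝ≥0∞, C ≠ ∞ ∧ ∀ ζ : C3, Adm k ζ → ∀ H : E3 → ℝ≥0∞, Measurable H → ∀ K : ℝ≥0∞,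
      (∀ ξ, H ξ ≤ K * ∫⁻ τ, weight (ξ - τ) * H τ) →
      ∫⁻ τ, eInvSymb ζ τ ^ (2 - β) * H τ ^ 2 ≤ C * K ^ 2 * ∫⁻ τ, H τ ^ 2 := by
  obtain ⟨C, hC, hCb⟩ := exists_lintegral_weight_invSymb_rpow_two_mul_le hk
    (γ := 1 - β / 2) (by linarith) (by linarith)
  have hw := measurable_weight
  refine ⟨C * ∫⁻ y, weight y, ENNReal.mul_ne_top hC lintegral_weight_ne_top,
    fun ζ hζ H hH K hK ↦ ?_⟩
  have hm := measurable_eInvSymb ζ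
  have hexp : 2 * (1 - β / 2) = 2 - β := by ring
  rw [hexp] at hCb
  calc ∫⁻ ξ, eInvSymb ζ ξ ^ (2 - β) * H ξ ^ 2
      ≤ ∫⁻ ξ, ∫⁻ τ, K ^ 2 * (∫⁻ y, weight y) *
          (weight (ξ - τ) * eInvSymb ζ ξ ^ (2 - β) * H τ ^ 2) := by
        refine lintegral_mono fun ξ ↦ ?_
        -- By Cauchy–Schwarz the domination passes to `H²`; integrating in `ξ` first then only
        -- involves the inverse symbol against a translate of the weight.
        have h2 := lintegral_mul_sq_le (f := fun τ ↦ weight (ξ - τ)) (A := fun _ ↦ 1)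
          (B := fun τ ↦ H τ ^ 2) (H := H) (by fun_prop) measurable_const (by fun_prop) (by simp)
        simp only [mul_one] at h2
        rw [lintegral_sub_left_eq_self weight ξ] at h2
        rw [lintegral_const_mul _ (by fun_prop)]
        simp_rw [mul_right_comm _ (eInvSymb ζ ξ ^ (2 - β))]
        rw [lintegral_mul_const _ (by fun_prop)]
        calc _ ≤ eInvSymb ζ ξ ^ (2 - β) * (K ^ 2 * ((∫⁻ y, weight y) *
              ∫⁻ τ, weight (ξ - τ) * H τ ^ 2)) := by
              gcongr
              refine (pow_le_pow_left' (hK ξ) 2).trans ?_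
              rw [mul_pow]
              gcongr
          _ = _ := by ring
    _ = ∫⁻ τ, ∫⁻ ξ, K ^ 2 * (∫⁻ y, weight y) *
          (weight (ξ - τ) * eInvSymb ζ ξ ^ (2 - β) * H τ ^ 2) := by
        rw [lintegral_lintegral_swap]
        exact (by fun_prop : Measurable fun p : E3 × E3 ↦ K ^ 2 * (∫⁻ y, weight y) *
          (weight (p.1 - p.2) * eInvSymb ζ p.1 ^ (2 - β) * H p.2 ^ 2)).aemeasurable
    _ ≤ ∫⁻ τ, K ^ 2 * (∫⁻ y, weight y) * (C * H τ ^ 2) := by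
        refine lintegral_mono fun τ ↦ ?_
        rw [lintegral_const_mul _ (by fun_prop), lintegral_mul_const _ (by fun_prop),
          lintegral_sub_left_mul']
        gcongr
        exact hCb ζ hζ τ
    _ = _ := by
        rw [lintegral_const_mul _ (by fun_prop), lintegral_const_mul _ (by fun_prop)]
        ring

/-! ### Bessel weights and Sobolev norms on the Fourier side -/

theorem besselSymbol_pos (s : ℝ) (ξ : E3) : 0 < besselSymbol s ξ := by
  unfold besselSymbol; positivity

theorem continuous_besselSymbol (s : ℝ) : Continuous (besselSymbol s) := by
  unfold besselSymbol
  exact Continuous.rpow_const (by fun_prop) fun x ↦ Or.inl (by positivity)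

theorem besselSymbol_mono {s t : ℝ} (h : s ≤ t) (ξ : E3) : besselSymbol s ξ ≤ besselSymbol t ξ := by
  unfold besselSymbol
  exact Real.rpow_le_rpow_of_exponent_le (by nlinarith [sq_nonneg ‖(2 * Real.pi) • ξ‖])
    (by linarith)

@[simp]
theorem besselSymbol_zero (ξ : E3) : besselSymbol 0 ξ = 1 := by simp [besselSymbol]

theorem one_le_besselSymbol {s : ℝ} (h : 0 ≤ s) (ξ : E3) : 1 ≤ besselSymbol s ξ := by
  simpa using besselSymbol_mono h ξ

theorem besselSymbol_add (s t : ℝ) (ξ : E3) :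
    besselSymbol (s + t) ξ = besselSymbol s ξ * besselSymbol t ξ := by
  unfold besselSymbol
  rw [← Real.rpow_add (by positivity)]
  congr 1; ring

theorem norm_le_besselSymbol_one (ξ : E3) : ‖(2 * Real.pi) • ξ‖ ≤ besselSymbol 1 ξ := by
  unfold besselSymbol
  rw [← Real.sqrt_eq_rpow]
  exact Real.le_sqrt_of_sq_le (by linarith)

theorem besselSymbol_one_le (ξ : E3) : besselSymbol 1 ξ ≤ 1 + ∑ j, |2 * Real.pi * ξ j| := by
  have h0 : 0 ≤ ∑ j, |2 * Real.pi * ξ j| := Finset.sum_nonneg fun j _ ↦ abs_nonneg _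
  unfold besselSymbol
  rw [← Real.sqrt_eq_rpow]
  refine Real.sqrt_le_iff.2 ⟨by linarith, ?_⟩
  have h : ‖(2 * Real.pi) • ξ‖ ^ 2 ≤ (∑ j, |2 * Real.pi * ξ j|) ^ 2 := by
    rw [EuclideanSpace.norm_sq_eq]
    refine (Finset.sum_sq_le_sq_sum_of_nonneg fun j _ ↦ abs_nonneg _).trans' (le_of_eq ?_)
    simp
  nlinarith

/-- Peetre's inequality. -/
theorem besselSymbol_le_mul {s : ℝ} (h : 0 ≤ s) (ξ τ : E3) :
    besselSymbol s ξ ≤ 2 ^ (s / 2) * (besselSymbol s (ξ - τ) * besselSymbol s τ) := by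
  unfold besselSymbol
  rw [← Real.mul_rpow (by positivity) (by positivity),
    ← Real.mul_rpow (by positivity) (by positivity)]
  refine Real.rpow_le_rpow (by positivity) ?_ (by positivity)
  set a := (2 * Real.pi) • (ξ - τ)
  set b := (2 * Real.pi) • τ
  have hab : (2 * Real.pi) • ξ = a + b := by simp [a, b, smul_sub]
  rw [hab]
  have h1 := norm_add_le a b
  nlinarith [sq_nonneg (‖a‖ - ‖b‖), mul_nonneg (sq_nonneg ‖a‖) (sq_nonneg ‖b‖), norm_nonneg (a + b),
    norm_nonneg a, norm_nonneg b]

/-- The Bessel weight as an extended nonnegative real. -/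
noncomputable def eBessel (s : ℝ) (ξ : E3) : ℝ≥0∞ := ENNReal.ofReal (besselSymbol s ξ)

theorem measurable_eBessel (s : ℝ) : Measurable (eBessel s) :=
  (continuous_besselSymbol s).measurable.ennreal_ofReal

theorem eBessel_le_mul {s : ℝ} (h : 0 ≤ s) (ξ τ : E3) :
    eBessel s ξ ≤ ENNReal.ofReal (2 ^ (s / 2)) * (eBessel s (ξ - τ) * eBessel s τ) := by
  unfold eBessel
  rw [← ENNReal.ofReal_mul (besselSymbol_pos _ _).le, ← ENNReal.ofReal_mul (by positivity)]
  exact ENNReal.ofReal_le_ofReal (besselSymbol_le_mul h ξ τ)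

theorem eBessel_mono {s t : ℝ} (h : s ≤ t) (ξ : E3) : eBessel s ξ ≤ eBessel t ξ :=
  ENNReal.ofReal_le_ofReal (besselSymbol_mono h ξ)

@[simp]
theorem eBessel_zero (ξ : E3) : eBessel 0 ξ = 1 := by simp [eBessel]

/-- The unweighted Sobolev norm `‖⟨ξ⟩ˢ 𝓕 f‖_{L²}` of order `s`. -/
noncomputable def sobN (s : ℝ) (f : E3 → ℂ) : ℝ≥0∞ :=
  eLpNorm (fun ξ ↦ (besselSymbol s ξ : ℂ) * 𝓕 f ξ) 2 volume

theorem eLpNorm_two_sq {F : Type*} [NormedAddCommGroup F] (f : E3 → F) :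
    eLpNorm f 2 volume ^ 2 = ∫⁻ ξ, ‖f ξ‖ₑ ^ 2 := by
  have h := eLpNorm_nnreal_pow_eq_lintegral (f := f) (μ := (volume : Measure E3)) (p := 2) (by simp)
  have h2 : (((2 : NNReal) : ℝ≥0∞)) = 2 := by norm_num
  have h3 : ((2 : NNReal) : ℝ) = 2 := by norm_num
  rw [h2, h3] at h
  simpa using h

theorem enorm_besselSymbol (s : ℝ) (ξ : E3) : ‖(besselSymbol s ξ : ℂ)‖ₑ = eBessel s ξ := by
  rw [← ofReal_norm, Complex.norm_real, Real.norm_of_nonneg (besselSymbol_pos s ξ).le]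
  rfl

theorem sobN_sq (s : ℝ) (f : E3 → ℂ) :
    sobN s f ^ 2 = ∫⁻ ξ, (eBessel s ξ * ‖𝓕 f ξ‖ₑ) ^ 2 := by
  rw [sobN, eLpNorm_two_sq]
  simp_rw [enorm_mul, enorm_besselSymbol]

theorem le_of_sq_le_sq_mul {a b : ℝ≥0∞} (h : a ^ 2 ≤ b ^ 2) : a ≤ b :=
  (ENNReal.pow_le_pow_left_iff two_ne_zero).1 h

theorem sobN_mono {s t : ℝ} (h : s ≤ t) (f : E3 → ℂ) : sobN s f ≤ sobN t f := by
  refine le_of_sq_le_sq_mul ?_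
  rw [sobN_sq, sobN_sq]
  gcongr with ξ
  exact eBessel_mono h ξ

/-! ### Elementary facts on the Fourier transform -/

theorem continuous_fourier {f : E3 → ℂ} (hf : Integrable f) : Continuous (𝓕 f) :=
  VectorFourier.fourierIntegral_continuous Real.continuous_fourierChar
    (innerSL ℝ).continuous₂ hf

theorem continuous_fourierInv {f : E3 → ℂ} (hf : Integrable f) : Continuous (𝓕⁻ f) := by
  rw [Real.fourierInv_eq_fourier_comp_neg]
  exact continuous_fourier hf.comp_neg

theorem fourier_add' {f g : E3 → ℂ} (hf : Integrable f) (hg : Integrable g) (ξ : E3) :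
    𝓕 (fun x ↦ f x + g x) ξ = 𝓕 f ξ + 𝓕 g ξ := by
  simp only [Real.fourier_eq, smul_add]
  exact integral_add ((Real.fourierIntegral_convergent_iff ξ).2 hf)
    ((Real.fourierIntegral_convergent_iff ξ).2 hg)

theorem fourierInv_add' {f g : E3 → ℂ} (hf : Integrable f) (hg : Integrable g) (x : E3) :
    𝓕⁻ (fun ξ ↦ f ξ + g ξ) x = 𝓕⁻ f x + 𝓕⁻ g x := by
  simp only [Real.fourierInv_eq_fourier_neg]
  exact fourier_add' hf hg _

theorem fourier_const_mul (c : ℂ) (f : E3 → ℂ) (ξ : E3) :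
    𝓕 (fun x ↦ c * f x) ξ = c * 𝓕 f ξ := by
  simp only [Real.fourier_eq, Circle.smul_def, smul_eq_mul]
  rw [← integral_const_mul]
  congr 1; ext x; ring

theorem fourierInv_const_mul (c : ℂ) (f : E3 → ℂ) (ξ : E3) :
    𝓕⁻ (fun x ↦ c * f x) ξ = c * 𝓕⁻ f ξ := by
  simp only [Real.fourierInv_eq_fourier_neg]
  exact fourier_const_mul c f _

theorem norm_fourier_le (f : E3 → ℂ) (ξ : E3) : ‖𝓕 f ξ‖ ≤ ∫ x, ‖f x‖ :=
  VectorFourier.norm_fourierIntegral_le_integral_norm _ _ _ _ _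

theorem norm_fourierInv_le (f : E3 → ℂ) (x : E3) : ‖𝓕⁻ f x‖ ≤ ∫ ξ, ‖f ξ‖ := by
  rw [Real.fourierInv_eq_fourier_neg]; exact norm_fourier_le f _

theorem integral_fourier_mul_flip {f g : E3 → ℂ} (hf : Integrable f) (hg : Integrable g) :
    ∫ ξ, 𝓕 f ξ * g ξ = ∫ x, f x * 𝓕 g x := by
  have := VectorFourier.integral_fourierIntegral_smul_eq_flip (L := innerₗ E3)
    (μ := volume) (ν := volume) Real.continuous_fourierChar
    (by simpa using continuous_inner) hf hg
  simp only [smul_eq_mul, flip_innerₗ] at this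
  exact this

theorem integral_fourierInv_mul_flip {f g : E3 → ℂ} (hf : Integrable f) (hg : Integrable g) :
    ∫ x, 𝓕⁻ f x * g x = ∫ ξ, f ξ * 𝓕⁻ g ξ := by
  rw [Real.fourierInv_eq_fourier_comp_neg f, integral_fourier_mul_flip hf.comp_neg hg,
    ← integral_neg_eq_self]
  simp [Real.fourierInv_eq_fourier_neg]

/-- The Fourier transform of a product is the convolution of the Fourier transforms. -/
theorem fourier_fourierInv_mul {A f : E3 → ℂ} (hA : Integrable A) (hf : Integrable f) (ξ : E3) :
    𝓕 (fun x ↦ 𝓕⁻ A x * f x) ξ = ∫ τ, A τ * 𝓕 f (ξ - τ) := by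
  have h1 : Integrable fun x ↦ (Real.fourierChar (-inner ℝ x ξ) : ℂ) * f x := by
    have := (Real.fourierIntegral_convergent_iff ξ).2 hf
    simpa [Circle.smul_def] using this
  have h2 := integral_fourierInv_mul_flip hA h1
  rw [Real.fourier_eq]
  simp only [Circle.smul_def, smul_eq_mul]
  calc _ = ∫ x, 𝓕⁻ A x * ((Real.fourierChar (-inner ℝ x ξ) : ℂ) * f x) := by
        congr 1; ext x; ring
    _ = _ := h2
    _ = _ := by
        congr 1; ext τ; congr 1
        rw [Real.fourierInv_eq, Real.fourier_eq]
        congr 1; ext x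
        simp only [Circle.smul_def, smul_eq_mul, ← mul_assoc]
        rw [← Circle.coe_mul, ← AddChar.map_add_eq_mul, inner_sub_right]
        congr 3; ring

theorem enorm_fourier_fourierInv_mul_le {A f : E3 → ℂ} (hA : Integrable A) (hf : Integrable f)
    (ξ : E3) :
    ‖𝓕 (fun x ↦ 𝓕⁻ A x * f x) ξ‖ₑ ≤ ∫⁻ τ, ‖A (ξ - τ)‖ₑ * ‖𝓕 f τ‖ₑ := by
  rw [fourier_fourierInv_mul hA hf]
  refine (enorm_integral_le_lintegral_enorm _).trans (le_of_eq ?_)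
  simp_rw [enorm_mul]
  rw [lintegral_sub_left_mul (fun τ ↦ ‖A τ‖ₑ) (fun τ ↦ ‖𝓕 f τ‖ₑ)]

theorem schwartz_fourierInv_fourier (φ : 𝓢(E3, ℂ)) : 𝓕⁻ (𝓕 (φ : E3 → ℂ)) = φ := by
  rw [← SchwartzMap.fourier_coe, ← SchwartzMap.fourierInv_coe,
    FourierTransform.fourierInv_fourier_eq]

/-- Multiplication by a Schwartz function on the Fourier side. -/
theorem enorm_fourier_schwartz_mul_le (φ : 𝓢(E3, ℂ)) {f : E3 → ℂ} (hf : Integrable f) (ξ : E3) :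
    ‖𝓕 (fun x ↦ φ x * f x) ξ‖ₑ ≤ ∫⁻ τ, ‖𝓕 (φ : E3 → ℂ) (ξ - τ)‖ₑ * ‖𝓕 f τ‖ₑ := by
  have h := enorm_fourier_fourierInv_mul_le (A := 𝓕 (φ : E3 → ℂ)) (f := f) (𝓕 φ).integrable hf ξ
  rwa [schwartz_fourierInv_fourier] at h

/-- A Schwartz function with Fourier transform `κ`, times the inverse Fourier transform of an
integrable function. -/
theorem enorm_fourier_schwartz_mul_fourierInv_le (φ : 𝓢(E3, ℂ)) {h : E3 → ℂ} (hh : Integrable h)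
    (ξ : E3) :
    ‖𝓕 (fun x ↦ φ x * 𝓕⁻ h x) ξ‖ₑ ≤ ∫⁻ τ, ‖𝓕 (φ : E3 → ℂ) (ξ - τ)‖ₑ * ‖h τ‖ₑ := by
  have h2 := enorm_fourier_fourierInv_mul_le (A := h) (f := φ) hh φ.integrable ξ
  simp_rw [mul_comm (𝓕⁻ h _)] at h2
  refine h2.trans (le_of_eq ?_)
  simp_rw [mul_comm ‖h _‖ₑ]
  rw [lintegral_sub_left_mul (fun τ ↦ ‖𝓕 (φ : E3 → ℂ) τ‖ₑ) (fun τ ↦ ‖h τ‖ₑ),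
    ← lintegral_sub_left_eq_self _ ξ]

theorem exists_schwartz_le_weight (φ : 𝓢(E3, ℂ)) :
    ∃ K : ℝ≥0∞, K ≠ ∞ ∧ ∀ y, ‖φ y‖ₑ ≤ K * weight y := by
  obtain ⟨C0, -, h0⟩ := φ.decay 0 0
  obtain ⟨C2, -, h2⟩ := φ.decay 2 0
  obtain ⟨C4, -, h4⟩ := φ.decay 4 0
  obtain ⟨C6, -, h6⟩ := φ.decay 6 0
  refine ⟨ENNReal.ofReal (C0 + 3 * C2 + 3 * C4 + C6), ENNReal.ofReal_ne_top, fun y ↦ ?_⟩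
  have h0 := h0 y
  have h2 := h2 y
  have h4 := h4 y
  have h6 := h6 y
  rw [norm_iteratedFDeriv_zero] at h0 h2 h4 h6
  rw [weight, ← ENNReal.ofReal_mul' (by positivity), ← ofReal_norm]
  refine ENNReal.ofReal_le_ofReal ?_
  rw [← div_eq_mul_inv, le_div_iff₀ (by positivity)]
  calc ‖φ y‖ * (1 + ‖y‖ ^ 2) ^ 3 = ‖y‖ ^ 0 * ‖φ y‖ + 3 * (‖y‖ ^ 2 * ‖φ y‖) +
        3 * (‖y‖ ^ 4 * ‖φ y‖) + ‖y‖ ^ 6 * ‖φ y‖ := by ring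
    _ ≤ _ := by gcongr

/-- The Fourier transform of a Schwartz function, with a Bessel weight, is dominated by the
kernel `weight`. -/
theorem exists_eBessel_mul_fourier_le_weight (s : ℝ) (φ : 𝓢(E3, ℂ)) :
    ∃ K : ℝ≥0∞, K ≠ ∞ ∧ ∀ y, eBessel s y * ‖𝓕 (φ : E3 → ℂ) y‖ₑ ≤ K * weight y := by
  obtain ⟨K, hK, h⟩ := exists_schwartz_le_weight
    (SchwartzMap.smulLeftCLM ℂ (fun ξ ↦ (besselSymbol s ξ : ℂ)) (𝓕 φ))
  refine ⟨K, hK, fun y ↦ ?_⟩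
  have := h y
  rw [SchwartzMap.smulLeftCLM_apply_apply (hasTemperateGrowth_besselSymbol s), smul_eq_mul,
    enorm_mul, enorm_besselSymbol] at this
  exact this

/-! ### Fourier pairs of functions -/

section

variable {F : Type*} [NormedAddCommGroup F] [NormedSpace ℂ F]

theorem IsFunction.locallyIntegrable {U : 𝓢'(E3, F)} {u : E3 → F} (h : IsFunction U u) :
    LocallyIntegrable u := by
  rw [locallyIntegrable_iff]
  intro K hK
  obtain ⟨r, hr⟩ := hK.isBounded.subset_closedBall 0
  let b : ContDiffBump (0 : E3) := ⟨max r 1, max r 1 + 1, by positivity, by linarith⟩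
  have hb1 : HasCompactSupport (Complex.ofRealCLM ∘ b) := b.hasCompactSupport.comp_left rfl
  have hb2 : ContDiff ℝ ((⊤ : ℕ∞) : WithTop ℕ∞) (Complex.ofRealCLM ∘ b) :=
    Complex.ofRealCLM.contDiff.comp b.contDiff
  have h1 := (h (hb1.toSchwartzMap hb2)).1
  refine (h1.integrableOn (s := K)).congr_fun ?_ hK.measurableSet
  intro x hx
  have : b x = 1 := b.one_of_mem_closedBall
    (Metric.closedBall_subset_closedBall (le_max_left _ _) (hr hx))
  simp [this]

theorem IsFunction.ae_eq [CompleteSpace F] {U : 𝓢'(E3, F)} {u v : E3 → F} (h : IsFunction U u)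
    (h' : IsFunction U v) : u =ᵐ[volume] v := by
  refine ae_eq_of_integral_contDiff_smul_eq h.locallyIntegrable h'.locallyIntegrable ?_
  intro g hg hgs
  have hb1 : HasCompactSupport (Complex.ofRealCLM ∘ g) := hgs.comp_left rfl
  have hb2 : ContDiff ℝ ((⊤ : ℕ∞) : WithTop ℕ∞) (Complex.ofRealCLM ∘ g) :=
    Complex.ofRealCLM.contDiff.comp hg
  have h1 := (h (hb1.toSchwartzMap hb2)).2
  rw [(h' (hb1.toSchwartzMap hb2)).2] at h1
  simpa using h1.symm

end

/-- `u` is the inverse Fourier transform of `h` in the sense of tempered distributions, where both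
are functions. -/
def IsFourierPair (u h : E3 → ℂ) : Prop :=
  ∃ H : 𝓢'(E3, ℂ), IsFunction H h ∧ IsFunction (𝓕⁻ H) u

theorem isFunction_toLp {p : ℝ≥0∞} [Fact (1 ≤ p)] {h : E3 → ℂ} (hh : MemLp h p) :
    IsFunction (Lp.toTemperedDistribution (hh.toLp h)) h := by
  intro φ
  have hae := hh.coeFn_toLp
  constructor
  · have := ENNReal.HolderConjugate.inv_one_sub_inv' (Fact.out : 1 ≤ p)
    have h1 := (φ.memLp (1 - p⁻¹)⁻¹ (volume : Measure E3))
    have := memLp_one_iff_integrable.1 (hh.smul (r := 1) h1)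
    exact this
  · rw [Lp.toTemperedDistribution_apply]
    refine integral_congr_ae ?_
    filter_upwards [hae] with x hx
    rw [hx]

theorem isFourierPair_fourierInv {h : E3 → ℂ} (hh : Integrable h) : IsFourierPair (𝓕⁻ h) h := by
  have h1 := memLp_one_iff_integrable.2 hh
  refine ⟨Lp.toTemperedDistribution (h1.toLp h), isFunction_toLp h1, fun φ ↦ ?_⟩
  rw [TemperedDistribution.fourierInv_apply, (isFunction_toLp h1 _).2]
  constructor
  · have hm : MemLp (𝓕⁻ h) ∞ := by
      refine memLp_top_of_bound (continuous_fourierInv hh).aestronglyMeasurable (∫ ξ, ‖h ξ‖) ?_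
      exact Filter.Eventually.of_forall fun x ↦ norm_fourierInv_le h x
    have := memLp_one_iff_integrable.1 (hm.smul (r := 1) (φ.memLp 1 (volume : Measure E3)))
    exact this
  · have := integral_fourierInv_mul_flip φ.integrable hh
    simp only [smul_eq_mul]
    rw [← this, SchwartzMap.fourierInv_coe]

theorem isFourierPair_fourier {f : E3 → ℂ} (hf : Integrable f) : IsFourierPair f (𝓕 f) := by
  have h1 := memLp_one_iff_integrable.2 hf
  refine ⟨𝓕 (Lp.toTemperedDistribution (h1.toLp f)), fun φ ↦ ?_, ?_⟩
  · rw [TemperedDistribution.fourier_apply, (isFunction_toLp h1 _).2]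
    constructor
    · have hm : MemLp (𝓕 f) ∞ := by
        refine memLp_top_of_bound (continuous_fourier hf).aestronglyMeasurable (∫ ξ, ‖f ξ‖) ?_
        exact Filter.Eventually.of_forall fun x ↦ norm_fourier_le f x
      have := memLp_one_iff_integrable.1 (hm.smul (r := 1) (φ.memLp 1 (volume : Measure E3)))
      exact this
    · have := integral_fourier_mul_flip φ.integrable hf
      simp only [smul_eq_mul]
      rw [← this, SchwartzMap.fourier_coe]
  · rw [FourierTransform.fourierInv_fourier_eq]
    exact isFunction_toLp h1

theorem IsFunction.add {U V : 𝓢'(E3, ℂ)} {u v : E3 → ℂ} (h : IsFunction U u)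
    (h' : IsFunction V v) : IsFunction (U + V) (fun x ↦ u x + v x) := by
  intro φ
  simp only [smul_add]
  refine ⟨(h φ).1.add (h' φ).1, ?_⟩
  rw [integral_add (h φ).1 (h' φ).1, ← (h φ).2, ← (h' φ).2]
  rfl

theorem IsFourierPair.add {u h v g : E3 → ℂ} (h1 : IsFourierPair u h) (h2 : IsFourierPair v g) :
    IsFourierPair (fun x ↦ u x + v x) (fun x ↦ h x + g x) := by
  obtain ⟨H, ha, hb⟩ := h1
  obtain ⟨G, hc, hd⟩ := h2
  refine ⟨H + G, ha.add hc, ?_⟩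
  rw [FourierTransform.fourierInv_add]
  exact hb.add hd

/-- Every `L²` function has an `L²` inverse Fourier transform of the same norm. -/
theorem exists_isFourierPair_of_memLp {h : E3 → ℂ} (hh : MemLp h 2) :
    ∃ w : E3 → ℂ, MemLp w 2 ∧ eLpNorm w 2 volume = eLpNorm h 2 volume ∧ IsFourierPair w h := by
  let g : Lp ℂ 2 (volume : Measure E3) := 𝓕⁻ (hh.toLp h)
  refine ⟨g, Lp.memLp g, ?_, Lp.toTemperedDistribution (hh.toLp h), isFunction_toLp hh, ?_⟩
  · have h1 : ‖g‖ = ‖hh.toLp h‖ := by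
      rw [← Lp.norm_fourier_eq g]
      simp only [g, FourierTransform.fourier_fourierInv_eq]
    rw [Lp.norm_def, Lp.norm_def, ENNReal.toReal_eq_toReal_iff' (Lp.eLpNorm_ne_top _)
      (Lp.eLpNorm_ne_top _)] at h1
    rw [h1, eLpNorm_congr_ae hh.coeFn_toLp]
  · rw [Lp.fourierInv_toTemperedDistribution_eq]
    have := isFunction_toLp (Lp.memLp g)
    rwa [Lp.toLp_coeFn] at this

theorem IsFourierPair.ae_eq {u v h : E3 → ℂ} (h1 : IsFourierPair u h) (h2 : IsFourierPair v h) :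
    u =ᵐ[volume] v := by
  obtain ⟨H, ha, hb⟩ := h1
  obtain ⟨G, hc, hd⟩ := h2
  have : H = G := by
    ext φ
    rw [(ha φ).2, (hc φ).2]
  subst this
  exact hb.ae_eq hd

theorem IsFourierPair.ae_eq_right {u h g : E3 → ℂ} (h1 : IsFourierPair u h)
    (h2 : IsFourierPair u g) : h =ᵐ[volume] g := by
  obtain ⟨H, ha, hb⟩ := h1
  obtain ⟨G, hc, hd⟩ := h2
  have : 𝓕⁻ H = 𝓕⁻ G := by
    ext φ
    rw [(hb φ).2, (hd φ).2]
  have h3 : H = G := by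
    calc H = 𝓕 (𝓕⁻ H) := (FourierTransform.fourier_fourierInv_eq H).symm
      _ = 𝓕 (𝓕⁻ G) := by rw [this]
      _ = G := FourierTransform.fourier_fourierInv_eq G
  subst h3
  exact ha.ae_eq hc

/-- Plancherel's theorem for integrable square-integrable functions. -/
theorem eLpNorm_fourier {f : E3 → ℂ} (hf : Integrable f) (hf2 : MemLp f 2) :
    eLpNorm (𝓕 f) 2 volume = eLpNorm f 2 volume := by
  let g : Lp ℂ 2 (volume : Measure E3) := 𝓕 (hf2.toLp f)
  have h0 : 𝓕⁻ g = hf2.toLp f := by simp only [g, FourierTransform.fourierInv_fourier_eq]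
  obtain ⟨w, -, hw2, hw3⟩ := exists_isFourierPair_of_memLp (Lp.memLp g)
  have hpair : IsFourierPair f g := by
    refine ⟨Lp.toTemperedDistribution g, ?_, ?_⟩
    · have := isFunction_toLp (Lp.memLp g)
      rwa [Lp.toLp_coeFn] at this
    · rw [Lp.fourierInv_toTemperedDistribution_eq, h0]
      exact isFunction_toLp hf2
  rw [eLpNorm_congr_ae ((isFourierPair_fourier hf).ae_eq_right hpair), ← hw2,
    eLpNorm_congr_ae (hw3.ae_eq hpair)]

theorem eLpNorm_fourierInv_of_memLp {h : E3 → ℂ} (hh : Integrable h) (hh2 : MemLp h 2) :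
    eLpNorm (𝓕⁻ h) 2 volume = eLpNorm h 2 volume := by
  obtain ⟨w, -, hw2, hw3⟩ := exists_isFourierPair_of_memLp hh2
  rw [← hw2, eLpNorm_congr_ae ((isFourierPair_fourierInv hh).ae_eq hw3)]

theorem isBesselImage_of_isFourierPair {s : ℝ} {u w h : E3 → ℂ} (h1 : IsFourierPair u h)
    (h2 : IsFourierPair w (fun ξ ↦ (besselSymbol s ξ : ℂ) * h ξ)) : IsBesselImage s u w := by
  obtain ⟨H, ha, hb⟩ := h1
  obtain ⟨G, hc, hd⟩ := h2
  refine ⟨𝓕⁻ H, 𝓕⁻ G, hb, hd, ?_⟩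
  rw [TemperedDistribution.fourierMultiplierCLM_apply, FourierTransform.fourier_fourierInv_eq]
  congr 1
  ext φ
  rw [TemperedDistribution.smulLeftCLM_apply_apply, (ha _).2, (hc _).2]
  refine integral_congr_ae (Filter.Eventually.of_forall fun ξ ↦ ?_)
  simp only [SchwartzMap.smulLeftCLM_apply_apply (hasTemperateGrowth_besselSymbol s), smul_eq_mul]
  ring

/-- Bessel images are compatible with continuous linear maps of the target space. -/
theorem IsBesselImage.clm {F G : Type*} [NormedAddCommGroup F] [NormedSpace ℂ F]
    [NormedAddCommGroup G] [NormedSpace ℂ G] [CompleteSpace F] [CompleteSpace G] {s : ℝ}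
    {u w : E3 → F} (h : IsBesselImage s u w) (L : F →L[ℂ] G) :
    IsBesselImage s (fun x ↦ L (u x)) (fun x ↦ L (w x)) := by
  obtain ⟨U, W, hU, hW, hUW⟩ := h
  have key : ∀ {V : 𝓢'(E3, F)} {f : E3 → F}, IsFunction V f →
      IsFunction (PointwiseConvergenceCLM.postcomp 𝓢(E3, ℂ) L V) (fun x ↦ L (f x)) := by
    intro V f hV φ
    have h1 : (fun x ↦ φ x • L (f x)) = fun x ↦ L (φ x • f x) := by
      ext x; simp
    rw [h1]
    refine ⟨L.integrable_comp (hV φ).1, ?_⟩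
    rw [L.integral_comp_comm (hV φ).1, ← (hV φ).2]
    rfl
  refine ⟨_, _, key hU, key hW, ?_⟩
  rw [← hUW]
  rfl

theorem IsBesselImage.add {F : Type*} [NormedAddCommGroup F] [NormedSpace ℂ F]
    {s : ℝ} {u w u' w' : E3 → F} (h : IsBesselImage s u w) (h' : IsBesselImage s u' w') :
    IsBesselImage s (fun x ↦ u x + u' x) (fun x ↦ w x + w' x) := by
  obtain ⟨U, W, hU, hW, hUW⟩ := h
  obtain ⟨U', W', hU', hW', hUW'⟩ := h'
  have key : ∀ {V V' : 𝓢'(E3, F)} {f f' : E3 → F}, IsFunction V f → IsFunction V' f' →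
      IsFunction (V + V') (fun x ↦ f x + f' x) := by
    intro V V' f f' hV hV' φ
    simp only [smul_add]
    refine ⟨(hV φ).1.add (hV' φ).1, ?_⟩
    rw [integral_add (hV φ).1 (hV' φ).1, ← (hV φ).2, ← (hV' φ).2]
    rfl
  refine ⟨_, _, key hU hU', key hW hW', ?_⟩
  rw [map_add, hUW, hUW']

/-! ### Derivatives and the Fourier transform -/

/-- The classical partial derivative `∂_j f`. -/
noncomputable def D (j : Fin 3) (f : E3 → ℂ) (x : E3) : ℂ := fderiv ℝ f x (e j)

theorem inner_e (x : E3) (j : Fin 3) : inner ℝ x (e j) = x j := by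
  simp [e, EuclideanSpace.inner_single_right]

theorem norm_e (j : Fin 3) : ‖e j‖ = 1 := by simp [e]

theorem abs_apply_le (x : E3) (j : Fin 3) : |x j| ≤ ‖x‖ := by
  rw [← inner_e x j]
  simpa [norm_e] using abs_real_inner_le_norm x (e j)

/-- The symbol `2πi ξ_j` of `∂_j`. -/
noncomputable def dSymb (j : Fin 3) (ξ : E3) : ℂ := 2 * Real.pi * Complex.I * (ξ j : ℂ)

theorem continuous_dSymb (j : Fin 3) : Continuous (dSymb j) := by unfold dSymb; fun_prop

theorem norm_dSymb (j : Fin 3) (ξ : E3) : ‖dSymb j ξ‖ = |2 * Real.pi * ξ j| := by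
  simp [dSymb, abs_mul, abs_of_pos Real.pi_pos]

theorem norm_dSymb_le (j : Fin 3) (ξ : E3) : ‖dSymb j ξ‖ ≤ ‖(2 * Real.pi) • ξ‖ := by
  rw [norm_dSymb, norm_smul, abs_mul, Real.norm_eq_abs]
  gcongr
  exact abs_apply_le ξ j

theorem fourier_D {f : E3 → ℂ} (hf : Integrable f) (h'f : Differentiable ℝ f)
    (hf' : Integrable (fderiv ℝ f)) (j : Fin 3) (ξ : E3) :
    𝓕 (D j f) ξ = dSymb j ξ * 𝓕 f ξ := by
  have h := congrArg (fun T ↦ T (e j)) (congrFun (Real.fourier_fderiv hf h'f hf') ξ)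
  have h2 : 𝓕 (D j f) ξ = (𝓕 (fderiv ℝ f) ξ) (e j) := by
    rw [Real.fourier_eq, Real.fourier_eq,
      ContinuousLinearMap.integral_apply ((Real.fourierIntegral_convergent_iff ξ).2 hf')]
    rfl
  rw [h2]
  refine h.trans ?_
  rw [VectorFourier.fourierSMulRight_apply]
  simp [dSymb, mul_assoc]
  exact Or.inl (inner_e ξ j)

theorem fourier_D_of_hasCompactSupport {f : E3 → ℂ} (hf : ContDiff ℝ 1 f)
    (hs : HasCompactSupport f) (j : Fin 3) (ξ : E3) :
    𝓕 (D j f) ξ = dSymb j ξ * 𝓕 f ξ :=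
  fourier_D (hf.continuous.integrable_of_hasCompactSupport hs) (hf.differentiable one_ne_zero)
    ((hf.continuous_fderiv one_ne_zero).integrable_of_hasCompactSupport (hs.fderiv ℝ)) j ξ

theorem integrable_norm_mul {h : E3 → ℂ} (hm : AEStronglyMeasurable h)
    (hh : Integrable (fun ξ ↦ (besselSymbol 1 ξ : ℂ) * h ξ)) :
    Integrable h ∧ Integrable (fun ξ ↦ ‖ξ‖ * ‖h ξ‖) := by
  have hb : ∀ ξ, ‖(besselSymbol 1 ξ : ℂ)‖ = besselSymbol 1 ξ := fun ξ ↦ by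
    rw [Complex.norm_real, Real.norm_of_nonneg (besselSymbol_pos _ _).le]
  refine ⟨hh.mono hm (.of_forall fun ξ ↦ ?_), hh.mono (by fun_prop) (.of_forall fun ξ ↦ ?_)⟩
  · rw [norm_mul, hb]
    exact le_mul_of_one_le_left (norm_nonneg _) (one_le_besselSymbol zero_le_one ξ)
  · rw [norm_mul, norm_norm, norm_norm, norm_mul, hb]
    gcongr
    refine le_trans ?_ (norm_le_besselSymbol_one ξ)
    rw [norm_smul, Real.norm_of_nonneg (by positivity)]
    nlinarith [norm_nonneg ξ, Real.pi_gt_three]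

theorem contDiff_fourierInv {h : E3 → ℂ} (h0 : Integrable h)
    (h1 : Integrable (fun ξ ↦ ‖ξ‖ * ‖h ξ‖)) : ContDiff ℝ 1 (𝓕⁻ h) := by
  have : 𝓕⁻ h = (𝓕 h) ∘ (fun x ↦ -x) := by
    ext x; rw [Real.fourierInv_eq_fourier_neg]; rfl
  rw [this]
  refine ContDiff.comp (Real.contDiff_fourier (N := 1) ?_) contDiff_neg
  intro n hn
  have hn : n ≤ 1 := by exact_mod_cast hn
  interval_cases n
  · simpa using h0.norm
  · simpa using h1

theorem D_fourierInv {h : E3 → ℂ} (h0 : Integrable h)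
    (h1 : Integrable (fun ξ ↦ ‖ξ‖ * ‖h ξ‖)) (j : Fin 3) (x : E3) :
    D j (𝓕⁻ h) x = 𝓕⁻ (fun ξ ↦ dSymb j ξ * h ξ) x := by
  have h2 : Integrable (VectorFourier.fourierSMulRight (innerSL ℝ) h) := by
    refine (h1.const_mul (2 * Real.pi * ‖(innerSL ℝ : E3 →L[ℝ] E3 →L[ℝ] ℝ)‖)).mono'
      (h0.aestronglyMeasurable.fourierSMulRight) (.of_forall fun ξ ↦ ?_)
    refine (VectorFourier.norm_fourierSMulRight_le _ _ _).trans (le_of_eq (by ring))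
  have h3 := (Real.hasFDerivAt_fourier h0 h1 (-x)).comp x (hasFDerivAt_id x).neg
  have h4 : (𝓕 h) ∘ (fun x ↦ -x) = 𝓕⁻ h := by
    ext x; rw [Real.fourierInv_eq_fourier_neg]; rfl
  have h5 : HasFDerivAt (𝓕⁻ h) _ x := h4 ▸ h3
  rw [D, h5.fderiv, Real.fourierInv_eq_fourier_neg, Real.fourier_eq, Real.fourier_eq]
  simp only [ContinuousLinearMap.comp_neg, neg_apply,
    ContinuousLinearMap.comp_id]
  rw [ContinuousLinearMap.integral_apply ((Real.fourierIntegral_convergent_iff _).2 h2),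
    ← integral_neg]
  congr 1; ext ξ
  rw [Circle.smul_def, smul_apply, VectorFourier.fourierSMulRight_apply,
    Circle.smul_def]
  simp [dSymb, mul_assoc]
  exact Or.inl (inner_e ξ j)

/-! ### Integrability of the inverse symbol against a Fourier transform -/

theorem lintegral_japanese_ne_top :
    ∫⁻ ξ : E3, ENNReal.ofReal ((1 + ‖ξ‖ ^ 2)⁻¹) ^ (2 : ℝ) ≠ ∞ := by
  have h := integrable_rpow_neg_one_add_norm_sq (E := E3) (μ := volume) (r := 4) (by simp; norm_num)
  have h2 := h.lintegral_lt_top.ne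
  convert h2 using 3 with ξ
  rw [ENNReal.ofReal_rpow_of_nonneg (by positivity) (by positivity), ← Real.rpow_neg_one,
    ← Real.rpow_mul (by positivity)]
  norm_num

theorem enorm_fourier_le (f : E3 → ℂ) (ξ : E3) : ‖𝓕 f ξ‖ₑ ≤ ∫⁻ x, ‖f x‖ₑ := by
  rw [Real.fourier_eq]
  refine (enorm_integral_le_lintegral_enorm _).trans (le_of_eq ?_)
  refine lintegral_congr fun x ↦ ?_
  rw [← ofReal_norm, Circle.norm_smul, ofReal_norm]

theorem lintegral_mul_le_sqrt {f g : E3 → ℝ≥0∞} (hf : Measurable f) (hg : Measurable g) :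
    ∫⁻ x, f x * g x ≤
      (∫⁻ x, f x ^ (2 : ℝ)) ^ (1 / 2 : ℝ) * (∫⁻ x, g x ^ (2 : ℝ)) ^ (1 / 2 : ℝ) :=
  ENNReal.lintegral_mul_le_Lp_mul_Lq volume Real.HolderConjugate.two_two hf.aemeasurable
    hg.aemeasurable

theorem sobN_eq (s : ℝ) (f : E3 → ℂ) :
    sobN s f = (∫⁻ ξ, (eBessel s ξ * ‖𝓕 f ξ‖ₑ) ^ (2 : ℝ)) ^ (1 / 2 : ℝ) := by
  simp_rw [ENNReal.rpow_ofNat]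
  rw [← sobN_sq, ← ENNReal.rpow_ofNat, ← ENNReal.rpow_mul]
  norm_num

theorem eInvSymb_le_of_large {ζ : C3} (h1 : 1 ≤ ‖ζ‖) {ξ : E3}
    (h : 4 * ‖ζ‖ ≤ ‖(2 * Real.pi) • ξ‖) :
    eInvSymb ζ ξ ≤ ENNReal.ofReal (2 * ‖ζ‖) * ENNReal.ofReal ((1 + ‖ξ‖ ^ 2)⁻¹) := by
  have h2 := norm_sq_div_two_le_symb h
  have h3 : ‖(2 * Real.pi) • ξ‖ = 2 * Real.pi * ‖ξ‖ := by
    rw [norm_smul, Real.norm_of_nonneg (by positivity)]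
  have h4 : 1 + ‖ξ‖ ^ 2 ≤ 2 * ‖symb ζ ξ‖ := by
    have h5 : 9 * ‖ξ‖ ^ 2 ≤ ‖(2 * Real.pi) • ξ‖ ^ 2 := by
      rw [h3]
      nlinarith [mul_le_mul_of_nonneg_right
        (by nlinarith [Real.pi_gt_three] : 9 ≤ (2 * Real.pi) ^ 2) (sq_nonneg ‖ξ‖)]
    have h6 : 16 ≤ ‖(2 * Real.pi) • ξ‖ ^ 2 := by nlinarith
    nlinarith
  rw [eInvSymb, invSymb, ← ENNReal.ofReal_mul (by positivity), norm_inv]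
  refine ENNReal.ofReal_le_ofReal ?_
  have h7 : ‖symb ζ ξ‖⁻¹ ≤ 2 * (1 + ‖ξ‖ ^ 2)⁻¹ := by
    have h8 : 0 < ‖symb ζ ξ‖ := by nlinarith [sq_nonneg ‖ξ‖]
    rw [← div_eq_mul_inv, inv_eq_one_div, div_le_div_iff₀ h8 (by positivity)]
    linarith
  nlinarith [norm_nonneg ζ]

/-- Integrability of `⟨ξ⟩^s` times the Fourier transform of `G_ζ f`. The constant may depend on
`ζ`: this fact only serves to justify Fourier inversion, never in the estimates. -/
theorem exists_lintegral_eBessel_eInvSymb_fourier_le {k : ℝ} (hk : 0 < k) {s : ℝ} (hs : 0 ≤ s)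
    {ζ : C3} (hζ : Adm k ζ) :
    ∃ C : ℝ≥0∞, C ≠ ∞ ∧ ∀ f : E3 → ℂ, Integrable f →
      ∫⁻ ξ, eBessel s ξ * (eInvSymb ζ ξ * ‖𝓕 f ξ‖ₑ) ≤ C * ((∫⁻ x, ‖f x‖ₑ) + sobN s f) := by
  obtain ⟨C, hC, hCb⟩ := exists_lintegral_weight_invSymb_rpow_two_mul_le hk (γ := 1 / 2)
    (by norm_num) (by norm_num)
  set M : ℝ := (1 + (4 * ‖ζ‖) ^ 2) ^ (s / 2) with hM
  set W : ℝ := (1 + (4 * ‖ζ‖) ^ 2) ^ 3 with hW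
  have hW0 : 0 < W := by positivity
  have hM0 : 0 < M := by positivity
  set J := (∫⁻ ξ : E3, ENNReal.ofReal ((1 + ‖ξ‖ ^ 2)⁻¹) ^ (2 : ℝ)) ^ (1 / 2 : ℝ) with hJ
  have hJt : J ≠ ∞ := ENNReal.rpow_ne_top_of_nonneg (by norm_num) lintegral_japanese_ne_top
  have hw := measurable_weight
  have hmS := measurable_eInvSymb ζ
  have hmB := measurable_eBessel s
  have hint : ∫⁻ ξ, weight ξ * eInvSymb ζ ξ ≤ C := by simpa [eInvSymb] using hCb ζ hζ 0
  refine ⟨ENNReal.ofReal (M * W) * C + ENNReal.ofReal (2 * ‖ζ‖) * J,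
    ENNReal.add_ne_top.2 ⟨ENNReal.mul_ne_top ENNReal.ofReal_ne_top hC,
      ENNReal.mul_ne_top ENNReal.ofReal_ne_top hJt⟩, fun f hf ↦ ?_⟩
  have hmf : Measurable fun ξ ↦ ‖𝓕 f ξ‖ₑ := (continuous_fourier hf).measurable.enorm
  calc ∫⁻ ξ, eBessel s ξ * (eInvSymb ζ ξ * ‖𝓕 f ξ‖ₑ)
      ≤ ∫⁻ ξ, (ENNReal.ofReal (M * W) * (∫⁻ x, ‖f x‖ₑ) * (weight ξ * eInvSymb ζ ξ) +
          ENNReal.ofReal (2 * ‖ζ‖) *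
            (ENNReal.ofReal ((1 + ‖ξ‖ ^ 2)⁻¹) * (eBessel s ξ * ‖𝓕 f ξ‖ₑ))) := by
        refine lintegral_mono fun ξ ↦ ?_
        -- On the ball, the transform is bounded and the inverse symbol locally integrable;
        -- outside, the inverse symbol decays like `|ξ|⁻²`, which is square integrable at infinity.
        rcases le_total ‖(2 * Real.pi) • ξ‖ (4 * ‖ζ‖) with h | h
        · refine le_add_right ?_
          have h1 : eBessel s ξ ≤ ENNReal.ofReal M := by
            refine ENNReal.ofReal_le_ofReal ?_
            unfold besselSymbol
            rw [hM]; gcongr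
          have h2 : 1 ≤ ENNReal.ofReal W * weight ξ := by
            rw [weight, ← ENNReal.ofReal_mul hW0.le, ENNReal.one_le_ofReal, ← div_eq_mul_inv,
              one_le_div (by positivity)]
            have : ‖ξ‖ ≤ ‖(2 * Real.pi) • ξ‖ := by
              rw [norm_smul, Real.norm_of_nonneg (by positivity)]
              nlinarith [norm_nonneg ξ, Real.pi_gt_three]
            rw [hW]
            gcongr
            exact this.trans h
          calc eBessel s ξ * (eInvSymb ζ ξ * ‖𝓕 f ξ‖ₑ)
              ≤ ENNReal.ofReal M * ((ENNReal.ofReal W * weight ξ) * eInvSymb ζ ξ *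
                  ∫⁻ x, ‖f x‖ₑ) := by
                gcongr
                · exact le_mul_of_one_le_left' h2
                · exact enorm_fourier_le f ξ
            _ = _ := by rw [ENNReal.ofReal_mul hM0.le]; ring
        · refine le_add_left ?_
          calc eBessel s ξ * (eInvSymb ζ ξ * ‖𝓕 f ξ‖ₑ)
              ≤ eBessel s ξ * ((ENNReal.ofReal (2 * ‖ζ‖) *
                  ENNReal.ofReal ((1 + ‖ξ‖ ^ 2)⁻¹)) * ‖𝓕 f ξ‖ₑ) := by
                gcongr
                exact eInvSymb_le_of_large hζ.one_le h
            _ = _ := by ring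
    _ ≤ ENNReal.ofReal (M * W) * (∫⁻ x, ‖f x‖ₑ) * C + ENNReal.ofReal (2 * ‖ζ‖) *
          (J * sobN s f) := by
        rw [lintegral_add_left (by fun_prop), lintegral_const_mul _ (by fun_prop),
          lintegral_const_mul _ (by fun_prop)]
        gcongr
        rw [hJ, sobN_eq]
        exact lintegral_mul_le_sqrt (by fun_prop) (by fun_prop)
    _ ≤ _ := by
        rw [add_mul, mul_add, mul_add]
        calc _ = ENNReal.ofReal (M * W) * C * (∫⁻ x, ‖f x‖ₑ) +
              ENNReal.ofReal (2 * ‖ζ‖) * J * sobN s f := by ring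
          _ ≤ _ := by gcongr <;> simp

/-! ### Cutoff functions -/

theorem exists_schwartz_bump (r : ℝ) :
    ∃ χ : 𝓢(E3, ℂ), HasCompactSupport χ ∧ (∀ x, ‖x‖ ≤ r → χ x = 1) ∧ ∀ x, ‖χ x‖ ≤ 1 := by
  let b : ContDiffBump (0 : E3) := ⟨max r 1, max r 1 + 1, by positivity, by linarith⟩
  have hb1 : HasCompactSupport (Complex.ofRealCLM ∘ b) := b.hasCompactSupport.comp_left rfl
  have hb2 : ContDiff ℝ ((⊤ : ℕ∞) : WithTop ℕ∞) (Complex.ofRealCLM ∘ b) :=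
    Complex.ofRealCLM.contDiff.comp b.contDiff
  refine ⟨hb1.toSchwartzMap hb2, hb1, fun x hx ↦ ?_, fun x ↦ ?_⟩
  · have : b x = 1 := b.one_of_mem_closedBall (by
      rw [mem_closedBall_zero_iff]; exact hx.trans (le_max_left _ _))
    simp [this]
  · change ‖((b x : ℝ) : ℂ)‖ ≤ 1
    rw [Complex.norm_real, Real.norm_of_nonneg b.nonneg]
    exact b.le_one

theorem exists_schwartz_bump_eq_one_on {f : E3 → ℂ} (hf : HasCompactSupport f) :
    ∃ χ : 𝓢(E3, ℂ), HasCompactSupport χ ∧ ∀ x, χ x * f x = f x := by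
  obtain ⟨r, hr⟩ := hf.isCompact.isBounded.subset_closedBall 0
  obtain ⟨χ, h1, h2, -⟩ := exists_schwartz_bump r
  refine ⟨χ, h1, fun x ↦ ?_⟩
  by_cases hx : f x = 0
  · simp [hx]
  · rw [h2 x (by simpa using hr (subset_tsupport f hx)), one_mul]

/-- The dilate `x ↦ χ (x / R)` of a Schwartz function. -/
theorem exists_schwartz_dilate (χ : 𝓢(E3, ℂ)) {R : ℝ} (hR : 0 < R) :
    ∃ χR : 𝓢(E3, ℂ), (∀ x, χR x = χ (R⁻¹ • x)) ∧
      ∀ ξ, 𝓕 (χR : E3 → ℂ) ξ = (R ^ 3 : ℝ) * 𝓕 (χ : E3 → ℂ) (R • ξ) := by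
  let L : E3 ≃L[ℝ] E3 := ContinuousLinearEquiv.smulLeft (Units.mk0 R⁻¹ (inv_ne_zero hR.ne'))
  refine ⟨SchwartzMap.compCLMOfContinuousLinearEquiv ℂ L χ, fun x ↦ rfl, fun ξ ↦ ?_⟩
  have h := Measure.integral_comp_inv_smul (volume : Measure E3)
    (fun x ↦ Real.fourierChar (-inner ℝ x (R • ξ)) • χ x) R
  rw [Real.fourier_eq, Real.fourier_eq]
  rw [finrank_euclideanSpace_fin, abs_of_pos (by positivity), Complex.real_smul] at h
  rw [← h]
  congr 1; ext x
  simp only [inner_smul_left, inner_smul_right, SchwartzMap.compCLMOfContinuousLinearEquiv_apply,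
    Function.comp_apply]
  have : L x = R⁻¹ • x := rfl
  rw [this]
  congr 3
  simp [hR.ne']

/-! ### Multipliers with the singularities of the inverse symbol -/

/-- A Fourier multiplier that is no more singular than `|ζ| / |symb ζ| + 1`. -/
structure IsMult (ζ : C3) (L : ℝ≥0∞) (m : E3 → ℂ) : Prop where
  measurable : Measurable m
  le : ∀ ξ, ‖m ξ‖ₑ ≤ L * (eInvSymb ζ ξ + 1)

theorem eBessel_ne_top (s : ℝ) (ξ : E3) : eBessel s ξ ≠ ∞ := ENNReal.ofReal_ne_top

/-- Multiplication by a Schwartz function on the Fourier side, with the Bessel weight moved inside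
the convolution by Peetre's inequality. -/
theorem exists_eBessel_conv_le {s : ℝ} (hs : 0 ≤ s) (χ : 𝓢(E3, ℂ)) :
    ∃ K : ℝ≥0∞, K ≠ ∞ ∧ ∀ (h : E3 → ℝ≥0∞), Measurable h → ∀ ξ,
      eBessel s ξ * ∫⁻ τ, ‖𝓕 (χ : E3 → ℂ) (ξ - τ)‖ₑ * h τ ≤
        K * ∫⁻ τ, weight (ξ - τ) * (eBessel s τ * h τ) := by
  obtain ⟨K, hK, hb⟩ := exists_eBessel_mul_fourier_le_weight s χ
  have hw := measurable_weight
  have hmB := measurable_eBessel s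
  refine ⟨ENNReal.ofReal (2 ^ (s / 2)) * K, ENNReal.mul_ne_top ENNReal.ofReal_ne_top hK,
    fun h hm ξ ↦ ?_⟩
  rw [← lintegral_const_mul' _ _ (eBessel_ne_top s ξ), ← lintegral_const_mul _ (by fun_prop)]
  refine lintegral_mono fun τ ↦ ?_
  calc _ ≤ ENNReal.ofReal (2 ^ (s / 2)) * (eBessel s (ξ - τ) * eBessel s τ) *
        (‖𝓕 (χ : E3 → ℂ) (ξ - τ)‖ₑ * h τ) := by
        gcongr
        exact eBessel_le_mul hs ξ τ
    _ = ENNReal.ofReal (2 ^ (s / 2)) * (eBessel s (ξ - τ) * ‖𝓕 (χ : E3 → ℂ) (ξ - τ)‖ₑ) *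
        (eBessel s τ * h τ) := by ring
    _ ≤ ENNReal.ofReal (2 ^ (s / 2)) * (K * weight (ξ - τ)) * (eBessel s τ * h τ) := by
        exact mul_le_mul' (mul_le_mul' le_rfl (hb _)) le_rfl
    _ = _ := by ring

/-- If `f` is cut off by a fixed Schwartz function, its weighted Fourier transform is dominated by
its own convolution with the weight: `f̂` is almost constant at unit scale. -/
theorem exists_eBessel_fourier_le_conv {s : ℝ} (hs : 0 ≤ s) (χ : 𝓢(E3, ℂ)) :
    ∃ K : ℝ≥0∞, K ≠ ∞ ∧ ∀ f : E3 → ℂ, Integrable f → (∀ x, χ x * f x = f x) → ∀ ξ,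
      eBessel s ξ * ‖𝓕 f ξ‖ₑ ≤ K * ∫⁻ τ, weight (ξ - τ) * (eBessel s τ * ‖𝓕 f τ‖ₑ) := by
  obtain ⟨K, hK, hb⟩ := exists_eBessel_conv_le hs χ
  refine ⟨K, hK, fun f hf hχ ξ ↦ ?_⟩
  refine le_trans ?_ (hb _ (continuous_fourier hf).measurable.enorm ξ)
  gcongr
  have h := enorm_fourier_schwartz_mul_le χ hf ξ
  simp_rw [hχ] at h
  exact h

/-- For compactly supported `f`, the singular factor `(|ζ| / |symb ζ|)^(2 - β)` costs no more than
a constant in the Sobolev norm. -/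
theorem exists_lintegral_eInvSymb_fourier_sq_le {k : ℝ} (hk : 0 < k) {s : ℝ} (hs : 0 ≤ s) {β : ℝ}
    (h0 : 0 < β) (h1 : β < 1) (χ : 𝓢(E3, ℂ)) :
    ∃ C : ℝ≥0∞, C ≠ ∞ ∧ ∀ ζ : C3, Adm k ζ → ∀ f : E3 → ℂ, Integrable f →
      (∀ x, χ x * f x = f x) →
      ∫⁻ τ, eInvSymb ζ τ ^ (2 - β) * (eBessel s τ * ‖𝓕 f τ‖ₑ) ^ 2 ≤ C * sobN s f ^ 2 := by
  obtain ⟨K, hK, hKb⟩ := exists_eBessel_fourier_le_conv hs χ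
  obtain ⟨C, hC, hCb⟩ := exists_lintegral_eInvSymb_rpow_mul_sq_le hk h0 h1
  refine ⟨C * K ^ 2, ENNReal.mul_ne_top hC (by simp [hK]), fun ζ hζ f hf hχ ↦ ?_⟩
  rw [sobN_sq]
  exact hCb ζ hζ _ ((measurable_eBessel s).mul (continuous_fourier hf).measurable.enorm) K
    (hKb f hf hχ)

theorem add_sq_le_two_mul (a b : ℝ≥0∞) : (a + b) ^ 2 ≤ 2 * (a ^ 2 + b ^ 2) := by
  have := ENNReal.rpow_add_le_mul_rpow_add_rpow a b (p := 2) (by norm_num)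
  simpa [show (2 : ℝ) - 1 = 1 by norm_num] using this

/-- Multipliers as singular as the inverse symbol are bounded on compactly supported functions,
with a further localization of the result. -/
theorem exists_sobN_mult_le {k : ℝ} (hk : 0 < k) {s : ℝ} (hs : 0 ≤ s) (χ χ' : 𝓢(E3, ℂ)) :
    ∃ C : ℝ≥0∞, C ≠ ∞ ∧ ∀ ζ : C3, Adm k ζ → ∀ (L : ℝ≥0∞) (m : E3 → ℂ), IsMult ζ L m →
      ∀ f : E3 → ℂ, Integrable f → (∀ x, χ x * f x = f x) → Integrable (fun ξ ↦ m ξ * 𝓕 f ξ) →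
        sobN s (fun x ↦ χ' x * 𝓕⁻ (fun ξ ↦ m ξ * 𝓕 f ξ) x) ≤ C * L * sobN s f := by
  obtain ⟨K, hK, hKb⟩ := exists_eBessel_conv_le hs χ'
  obtain ⟨C1, hC1, hC1b⟩ := exists_lintegral_conv_eInvSymb_sq_le hk (β := 1 / 2) (by norm_num)
    (by norm_num)
  obtain ⟨C2, hC2, hC2b⟩ := exists_lintegral_eInvSymb_fourier_sq_le hk hs (β := 1 / 2)
    (by norm_num) (by norm_num) χ
  set W := ∫⁻ y, weight y with hW
  have hWt : W ≠ ∞ := lintegral_weight_ne_top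
  set C := K ^ 2 * (2 * (C1 * C2 + W ^ 2)) with hCdef
  have hC : C ≠ ∞ := by
    refine ENNReal.mul_ne_top (by simp [hK]) (ENNReal.mul_ne_top (by simp)
      (ENNReal.add_ne_top.2 ⟨ENNReal.mul_ne_top hC1 hC2, by simp [hWt]⟩))
  have hw := measurable_weight
  have hmB := measurable_eBessel s
  refine ⟨C ^ (1 / 2 : ℝ), ENNReal.rpow_ne_top_of_nonneg (by norm_num) hC,
    fun ζ hζ L m hm f hf hχ hi ↦ le_of_sq_le_sq_mul ?_⟩
  have hmS := measurable_eInvSymb ζ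
  have hmm := hm.measurable
  have hmf : Measurable (𝓕 f) := (continuous_fourier hf).measurable
  have hsq : (C ^ (1 / 2 : ℝ)) ^ 2 = C := by
    rw [← ENNReal.rpow_ofNat, ← ENNReal.rpow_mul]; norm_num
  rw [mul_pow, mul_pow, hsq, sobN_sq]
  set g : E3 → ℝ≥0∞ := fun τ ↦ eBessel s τ * ‖𝓕 f τ‖ₑ with hg
  have hgm : Measurable g := by fun_prop
  -- With `g = ⟨ξ⟩^s |f̂|`: the singular part of the multiplier and its bounded part.
  have key : ∀ ξ, eBessel s ξ * ‖𝓕 (fun x ↦ χ' x * 𝓕⁻ (fun ξ ↦ m ξ * 𝓕 f ξ) x) ξ‖ₑ ≤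
      K * L * ((∫⁻ τ, weight (ξ - τ) * (eInvSymb ζ τ * g τ)) + ∫⁻ τ, weight (ξ - τ) * g τ) := by
    intro ξ
    calc _ ≤ eBessel s ξ * ∫⁻ τ, ‖𝓕 (χ' : E3 → ℂ) (ξ - τ)‖ₑ * ‖m τ * 𝓕 f τ‖ₑ := by
          gcongr
          exact enorm_fourier_schwartz_mul_fourierInv_le χ' hi ξ
      _ ≤ K * ∫⁻ τ, weight (ξ - τ) * (eBessel s τ * ‖m τ * 𝓕 f τ‖ₑ) := hKb _ (by fun_prop) ξ
      _ ≤ K * ∫⁻ τ, L * (weight (ξ - τ) * (eInvSymb ζ τ * g τ) + weight (ξ - τ) * g τ) := by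
          refine mul_le_mul' le_rfl (lintegral_mono fun τ ↦ ?_)
          calc _ ≤ weight (ξ - τ) * (eBessel s τ * (L * (eInvSymb ζ τ + 1) * ‖𝓕 f τ‖ₑ)) := by
                rw [enorm_mul]
                exact mul_le_mul' le_rfl (mul_le_mul' le_rfl (mul_le_mul' (hm.le τ) le_rfl))
            _ = _ := by simp only [hg]; ring
      _ = _ := by
          rw [lintegral_const_mul _ (by fun_prop), lintegral_add_left (by fun_prop), mul_assoc]
  calc _ ≤ ∫⁻ ξ, (K * L) ^ 2 * (2 * ((∫⁻ τ, weight (ξ - τ) * (eInvSymb ζ τ * g τ)) ^ 2 +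
        (∫⁻ τ, weight (ξ - τ) * g τ) ^ 2)) := by
        refine lintegral_mono fun ξ ↦ (pow_le_pow_left' (key ξ) 2).trans ?_
        rw [mul_pow]
        gcongr
        exact add_sq_le_two_mul _ _
    _ = (K * L) ^ 2 * (2 * ((∫⁻ ξ, (∫⁻ τ, weight (ξ - τ) * (eInvSymb ζ τ * g τ)) ^ 2) +
        ∫⁻ ξ, (∫⁻ τ, weight (ξ - τ) * g τ) ^ 2)) := by
        have hm1 : Measurable fun ξ ↦ ∫⁻ τ, weight (ξ - τ) * (eInvSymb ζ τ * g τ) :=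
          Measurable.lintegral_prod_right (by fun_prop : Measurable
            fun p : E3 × E3 ↦ weight (p.1 - p.2) * (eInvSymb ζ p.2 * g p.2))
        have hm2 : Measurable fun ξ ↦ ∫⁻ τ, weight (ξ - τ) * g τ :=
          Measurable.lintegral_prod_right (by fun_prop : Measurable
            fun p : E3 × E3 ↦ weight (p.1 - p.2) * g p.2)
        rw [lintegral_const_mul _ (by fun_prop), lintegral_const_mul _ (by fun_prop),
          lintegral_add_left (by fun_prop)]
    _ ≤ (K * L) ^ 2 * (2 * (C1 * (C2 * sobN s f ^ 2) + W ^ 2 * sobN s f ^ 2)) := by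
        gcongr
        · refine le_trans ?_ (mul_le_mul_right (hC2b ζ hζ f hf hχ) C1)
          have := hC1b ζ hζ 1 one_pos g hgm
          simpa [weightR] using this
        · rw [sobN_sq]
          exact lintegral_conv_sq_le' hw hgm
    _ = _ := by rw [hCdef]; ring

/-- The weight `⟨x⟩^δ`. -/
noncomputable def jap (δ : ℝ) (x : E3) : ℝ≥0∞ := ENNReal.ofReal ((1 + ‖x‖ ^ 2) ^ (δ / 2))

theorem measurable_jap (δ : ℝ) : Measurable (jap δ) := by
  unfold jap; fun_prop

theorem jap_le_one {δ : ℝ} (hδ : δ ≤ 0) (x : E3) : jap δ x ≤ 1 := by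
  unfold jap
  rw [ENNReal.ofReal_le_one]
  exact Real.rpow_le_one_of_one_le_of_nonpos (by nlinarith [sq_nonneg ‖x‖]) (by linarith)

/-- The weighted `L²` norm `‖⟨x⟩^δ w‖`. -/
noncomputable def wNorm {F : Type*} [NormedAddCommGroup F] (δ : ℝ) (w : E3 → F) : ℝ≥0∞ :=
  eLpNorm (fun x ↦ ((1 + ‖x‖ ^ 2) ^ (δ / 2) : ℝ) • ‖w x‖) 2 volume

theorem enorm_weighted {F : Type*} [NormedAddCommGroup F] (δ : ℝ) (w : E3 → F) (x : E3) :
    ‖((1 + ‖x‖ ^ 2) ^ (δ / 2) : ℝ) • ‖w x‖‖ₑ = jap δ x * ‖w x‖ₑ := by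
  rw [enorm_smul, enorm_norm, jap, ← ofReal_norm, Real.norm_of_nonneg (by positivity)]

theorem wNorm_sq {F : Type*} [NormedAddCommGroup F] (δ : ℝ) (w : E3 → F) :
    wNorm δ w ^ 2 = ∫⁻ x, (jap δ x * ‖w x‖ₑ) ^ 2 := by
  rw [wNorm, eLpNorm_two_sq]
  simp_rw [enorm_weighted]

theorem wNorm_le_eLpNorm {δ : ℝ} (hδ : δ ≤ 0) (w : E3 → ℂ) : wNorm δ w ≤ eLpNorm w 2 volume := by
  refine le_of_sq_le_sq_mul ?_
  rw [wNorm_sq, eLpNorm_two_sq]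
  gcongr with x
  exact mul_le_of_le_one_left' (jap_le_one hδ x)

theorem wNorm_add_le {F : Type*} [NormedAddCommGroup F] (δ : ℝ) {v w : E3 → F}
    (hv : AEStronglyMeasurable v)
    (hw : AEStronglyMeasurable w) : wNorm δ (fun x ↦ v x + w x) ≤ wNorm δ v + wNorm δ w := by
  have hm : Measurable fun x : E3 ↦ ((1 + ‖x‖ ^ 2) ^ (δ / 2) : ℝ) := by fun_prop
  refine le_trans ?_ (eLpNorm_add_le (hm.aestronglyMeasurable.smul hv.norm)
    (hm.aestronglyMeasurable.smul hw.norm) (by norm_num))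
  refine eLpNorm_mono fun x ↦ ?_
  simp only [Pi.add_apply, smul_eq_mul]
  rw [← mul_add, norm_mul, norm_mul]
  gcongr
  rw [norm_norm, Real.norm_of_nonneg (by positivity)]
  exact norm_add_le _ _

/-- Dyadic majorant of the weight `⟨x⟩^δ`. -/
theorem exists_dyadic {δ : ℝ} (hδ : -1 < δ) (hδ' : δ < 0) (x : E3) :
    ∃ n : ℕ, ‖x‖ ≤ 2 ^ n ∧ jap δ x ≤ 2 * ENNReal.ofReal (2 ^ δ) ^ n := by
  classical
  have hex : ∃ n : ℕ, ‖x‖ ≤ 2 ^ n := by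
    obtain ⟨n, hn⟩ := pow_unbounded_of_one_lt ‖x‖ (one_lt_two)
    exact ⟨n, hn.le⟩
  refine ⟨Nat.find hex, Nat.find_spec hex, ?_⟩
  rcases h : Nat.find hex with _ | n
  · exact (jap_le_one hδ'.le x).trans (by simp)
  · have h1 : (2 : ℝ) ^ n < ‖x‖ := by
      by_contra! h2
      have := Nat.find_min' hex h2
      omega
    refine (ENNReal.ofReal_le_ofReal (q := 2 * ((2 : ℝ) ^ δ) ^ (n + 1)) ?_).trans (le_of_eq ?_)
    swap
    · rw [ENNReal.ofReal_mul (by positivity), ENNReal.ofReal_pow (by positivity)]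
      simp
    have h2 : ((1 + ‖x‖ ^ 2) ^ (δ / 2) : ℝ) ≤ (((2 : ℝ) ^ n) ^ 2) ^ (δ / 2) := by
      refine Real.rpow_le_rpow_of_nonpos (by positivity) ?_ (by linarith)
      have : ((2 : ℝ) ^ n) ^ 2 ≤ ‖x‖ ^ 2 := by gcongr
      linarith
    refine h2.trans ?_
    have h3 : (((2 : ℝ) ^ n) ^ 2) ^ (δ / 2) = ((2 : ℝ) ^ δ) ^ n := by
      rw [← Real.rpow_natCast, ← Real.rpow_natCast, ← Real.rpow_natCast, ← Real.rpow_mul,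
        ← Real.rpow_mul, ← Real.rpow_mul] <;> try positivity
      congr 1; push_cast; ring
    rw [h3, pow_succ]
    have h4 : (1 : ℝ) ≤ 2 * 2 ^ δ := by
      have := Real.rpow_le_rpow_of_exponent_le (x := 2) one_le_two hδ.le
      rw [Real.rpow_neg_one] at this
      linarith
    nlinarith [show 0 < ((2 : ℝ) ^ δ) ^ n by positivity]

/-! ### The weighted estimate for singular multipliers -/

/-- The Fourier transform of the dilate `χ(x / R)` is an approximate identity of width `R⁻¹`. -/
theorem exists_schwartz_dilate_weight (χ : 𝓢(E3, ℂ)) :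
    ∃ K : ℝ≥0∞, K ≠ ∞ ∧ ∀ R : ℝ, 0 < R → ∃ χR : 𝓢(E3, ℂ), (∀ x, χR x = χ (R⁻¹ • x)) ∧
      ∀ ξ, ‖𝓕 (χR : E3 → ℂ) ξ‖ₑ ≤ K * weightR R ξ := by
  obtain ⟨K, hK, hb⟩ := exists_schwartz_le_weight (𝓕 χ)
  refine ⟨K, hK, fun R hR ↦ ?_⟩
  obtain ⟨χR, h1, h2⟩ := exists_schwartz_dilate χ hR
  refine ⟨χR, h1, fun ξ ↦ ?_⟩
  rw [h2, enorm_mul, weightR, mul_left_comm]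
  refine mul_le_mul' (le_of_eq ?_) (hb _)
  rw [← ofReal_norm, Complex.norm_real, Real.norm_of_nonneg (by positivity)]

/-- `⟨x⟩^δ`-weighted `L²` bound for the inverse Fourier transform of an integrable function with the
singularities of the inverse symbol. -/
theorem exists_wNorm_fourierInv_le {k : ℝ} (hk : 0 < k) {δ : ℝ} (hδ : -1 < δ) (hδ' : δ < 0) :
    ∃ C : ℝ≥0∞, C ≠ ∞ ∧ ∀ ζ : C3, Adm k ζ → ∀ (H : E3 → ℂ), Integrable H →
      ∀ (L : ℝ≥0∞) (g : E3 → ℝ≥0∞), Measurable g → (∀ ξ, ‖H ξ‖ₑ ≤ L * (eInvSymb ζ ξ * g ξ)) →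
        wNorm δ (𝓕⁻ H) ^ 2 ≤ C * L ^ 2 * ∫⁻ τ, eInvSymb ζ τ ^ (2 - -δ) * g τ ^ 2 := by
  obtain ⟨χ, -, hχ1, -⟩ := exists_schwartz_bump 1
  obtain ⟨K, hK, hKb⟩ := exists_schwartz_dilate_weight χ
  obtain ⟨C1, hC1, hC1b⟩ := exists_lintegral_conv_eInvSymb_sq_le hk (β := -δ) (by linarith)
    (by linarith)
  set Q : ℝ≥0∞ := ENNReal.ofReal (2 ^ δ) with hQ
  have hQ1 : Q < 1 := by
    rw [hQ, ENNReal.ofReal_lt_one]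
    exact Real.rpow_lt_one_of_one_lt_of_neg one_lt_two hδ'
  have hQs : ∑' n : ℕ, Q ^ n ≠ ∞ := by
    rw [ENNReal.tsum_geometric]
    exact ENNReal.inv_ne_top.2 (tsub_pos_of_lt hQ1).ne'
  refine ⟨4 * (K ^ 2 * C1) * ∑' n : ℕ, Q ^ n, ENNReal.mul_ne_top (ENNReal.mul_ne_top (by simp)
    (ENNReal.mul_ne_top (by simp [hK]) hC1)) hQs, fun ζ hζ H hH L g hg hle ↦ ?_⟩
  have hmS := measurable_eInvSymb ζ
  set I := ∫⁻ τ, eInvSymb ζ τ ^ (2 - -δ) * g τ ^ 2 with hI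
  have hR : ∀ n : ℕ, (0 : ℝ) < 2 ^ n := fun n ↦ by positivity
  choose χn hχn hχnb using fun n : ℕ ↦ hKb (2 ^ n) (hR n)
  have hcont := continuous_fourierInv hH
  have htop : MemLp (𝓕⁻ H) ∞ := memLp_top_of_bound hcont.aestronglyMeasurable (∫ ξ, ‖H ξ‖)
    (.of_forall fun x ↦ norm_fourierInv_le H x)
  -- A piece at the scale `R = 2ⁿ` has `L²` norm squared `O(R^(-δ))`.
  have hpiece : ∀ n, ∫⁻ x, ‖χn n x * 𝓕⁻ H x‖ₑ ^ 2 ≤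
      K ^ 2 * C1 * L ^ 2 * (ENNReal.ofReal (2 ^ n) ^ (-δ) * I) := by
    intro n
    have hint : Integrable (fun x ↦ χn n x * 𝓕⁻ H x) :=
      memLp_one_iff_integrable.1 (htop.mul (r := 1) ((χn n).memLp 1 volume))
    have hL2 : MemLp (fun x ↦ χn n x * 𝓕⁻ H x) 2 := htop.mul (r := 2) ((χn n).memLp 2 volume)
    rw [← eLpNorm_two_sq, ← eLpNorm_fourier hint hL2, eLpNorm_two_sq]
    calc _ ≤ ∫⁻ ξ, (K * L) ^ 2 *
          (∫⁻ τ, weightR (2 ^ n) (ξ - τ) * (eInvSymb ζ τ * g τ)) ^ 2 := by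
          refine lintegral_mono fun ξ ↦ ?_
          rw [← mul_pow]
          refine pow_le_pow_left' ?_ 2
          refine (enorm_fourier_schwartz_mul_fourierInv_le (χn n) hH ξ).trans ?_
          have := measurable_weightR (2 ^ n)
          rw [← lintegral_const_mul _ (by fun_prop)]
          refine lintegral_mono fun τ ↦ ?_
          calc _ ≤ (K * weightR (2 ^ n) (ξ - τ)) * (L * (eInvSymb ζ τ * g τ)) :=
                mul_le_mul' (hχnb n _) (hle τ)
            _ = _ := by ring
      _ ≤ (K * L) ^ 2 * (C1 * ENNReal.ofReal (2 ^ n) ^ (-δ) * I) := by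
          rw [lintegral_const_mul]
          · exact mul_le_mul' le_rfl (hC1b ζ hζ _ (hR n) g hg)
          · have := measurable_weightR (2 ^ n)
            exact (Measurable.lintegral_prod_right (by fun_prop : Measurable fun p : E3 × E3 ↦
              weightR (2 ^ n) (p.1 - p.2) * (eInvSymb ζ p.2 * g p.2))).pow_const 2
      _ = _ := by ring
  -- The weight contributes `R^(2δ)` on this piece, and `R^(2δ) R^(-δ) = R^δ` is summable.
  have hpow : ∀ n : ℕ, (Q ^ n) ^ 2 * ENNReal.ofReal (2 ^ n) ^ (-δ) = Q ^ n := by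
    intro n
    have h1 : ENNReal.ofReal (2 ^ n) ^ (-δ) * Q ^ n = 1 := by
      rw [hQ, ENNReal.ofReal_rpow_of_pos (hR n), ← ENNReal.ofReal_pow (by positivity),
        ← ENNReal.ofReal_mul (by positivity), ← Real.rpow_natCast, ← Real.rpow_natCast,
        ← Real.rpow_mul (by positivity), ← Real.rpow_mul (by positivity),
        ← Real.rpow_add (by positivity)]
      rw [show (n : ℝ) * -δ + δ * n = 0 by ring]; simp
    calc _ = Q ^ n * (ENNReal.ofReal (2 ^ n) ^ (-δ) * Q ^ n) := by ring
      _ = _ := by rw [h1, mul_one]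
  rw [wNorm_sq]
  calc _ ≤ ∫⁻ x, ∑' n : ℕ, 4 * (Q ^ n) ^ 2 * ‖χn n x * 𝓕⁻ H x‖ₑ ^ 2 := by
        refine lintegral_mono fun x ↦ ?_
        obtain ⟨n, hn1, hn2⟩ := exists_dyadic hδ hδ' x
        refine le_trans ?_ (ENNReal.le_tsum n)
        have : χn n x = 1 := by
          rw [hχn]
          refine hχ1 _ ?_
          rw [norm_smul, norm_inv, Real.norm_of_nonneg (hR n).le, inv_mul_le_iff₀ (hR n), mul_one]
          exact hn1
        rw [this, one_mul, mul_pow]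
        gcongr
        calc _ ≤ (2 * Q ^ n) ^ 2 := pow_le_pow_left' hn2 2
          _ = _ := by ring
    _ = ∑' n : ℕ, 4 * (Q ^ n) ^ 2 * ∫⁻ x, ‖χn n x * 𝓕⁻ H x‖ₑ ^ 2 := by
        rw [lintegral_tsum]
        · refine tsum_congr fun n ↦ ?_
          rw [lintegral_const_mul]
          exact (((χn n).continuous.mul hcont).measurable.enorm).pow_const 2
        · intro n
          exact ((((χn n).continuous.mul hcont).measurable.enorm.pow_const 2).const_mul
            _).aemeasurable
    _ ≤ ∑' n : ℕ, 4 * (Q ^ n) ^ 2 *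
          (K ^ 2 * C1 * L ^ 2 * (ENNReal.ofReal (2 ^ n) ^ (-δ) * I)) :=
        ENNReal.tsum_le_tsum fun n ↦ mul_le_mul' le_rfl (hpiece n)
    _ = ∑' n : ℕ, 4 * (K ^ 2 * C1) * L ^ 2 * I * Q ^ n := by
        refine tsum_congr fun n ↦ ?_
        nth_rewrite 2 [← hpow n]
        ring
    _ = _ := by rw [ENNReal.tsum_mul_left]; ring

theorem integrable_of_lintegral_ne_top {f : E3 → ℂ} {g : E3 → ℝ≥0∞} (hf : Measurable f)
    (hle : ∀ ξ, ‖f ξ‖ₑ ≤ g ξ) (hg : ∫⁻ ξ, g ξ ≠ ∞) : Integrable f :=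
  ⟨hf.aestronglyMeasurable, lt_of_le_of_lt (lintegral_mono hle) hg.lt_top⟩

/-- The main analytic estimate: multipliers with the singularities of the inverse symbol map
compactly supported functions in `H^s` to `H^s_δ`, uniformly in `ζ`. With `L` of size `|ζ|⁻¹` this
is the decay of `G_ζ` in `|ζ|`. -/
theorem exists_isBesselImage_mult_le {k : ℝ} (hk : 0 < k) {δ : ℝ} (hδ : -1 < δ) (hδ' : δ < 0)
    {s : ℝ} (hs : 0 ≤ s) (χ : 𝓢(E3, ℂ)) :
    ∃ C : ℝ≥0∞, C ≠ ∞ ∧ ∀ ζ : C3, Adm k ζ → ∀ (L : ℝ≥0∞) (m : E3 → ℂ), IsMult ζ L m → L ≠ ∞ →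
      ∀ f : E3 → ℂ, Integrable f → (∀ x, χ x * f x = f x) → sobN s f ≠ ∞ →
        Integrable (fun ξ ↦ m ξ * 𝓕 f ξ) →
        ∃ w : E3 → ℂ, AEStronglyMeasurable w ∧ IsBesselImage s (𝓕⁻ (fun ξ ↦ m ξ * 𝓕 f ξ)) w ∧
          wNorm δ w ≤ C * L * sobN s f := by
  obtain ⟨C1, hC1, hC1b⟩ := exists_wNorm_fourierInv_le hk hδ hδ'
  obtain ⟨C2, hC2, hC2b⟩ := exists_lintegral_eInvSymb_fourier_sq_le hk hs (β := -δ)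
    (by linarith) (by linarith) χ
  have hC12 : C1 * 4 * C2 ≠ ∞ := ENNReal.mul_ne_top (ENNReal.mul_ne_top hC1 (by simp)) hC2
  refine ⟨(C1 * 4 * C2) ^ (1 / 2 : ℝ) + 2, ENNReal.add_ne_top.2
    ⟨ENNReal.rpow_ne_top_of_nonneg (by norm_num) hC12, by simp⟩,
    fun ζ hζ L m hm hL f hf hχ hfs hi ↦ ?_⟩
  have hmS := measurable_eInvSymb ζ
  have hmB := measurable_eBessel s
  have hmm := hm.measurable
  have hmf : Measurable (𝓕 f) := (continuous_fourier hf).measurable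
  have hmb : Measurable fun ξ ↦ (besselSymbol s ξ : ℂ) :=
    (Complex.continuous_ofReal.comp (continuous_besselSymbol s)).measurable
  set g : E3 → ℝ≥0∞ := fun τ ↦ eBessel s τ * ‖𝓕 f τ‖ₑ with hg
  have hgm : Measurable g := by fun_prop
  set H : E3 → ℂ := fun ξ ↦ (besselSymbol s ξ : ℂ) * (m ξ * 𝓕 f ξ) with hH
  have hHm : Measurable H := by fun_prop
  have hHle : ∀ ξ, ‖H ξ‖ₑ ≤ L * ((eInvSymb ζ ξ + 1) * g ξ) := by
    intro ξ
    simp only [hH, enorm_mul, enorm_besselSymbol]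
    calc _ ≤ eBessel s ξ * (L * (eInvSymb ζ ξ + 1) * ‖𝓕 f ξ‖ₑ) := by
          gcongr; exact hm.le ξ
      _ = _ := by simp only [hg]; ring
  -- Near the zeros of the symbol the weighted `L²` bound applies; elsewhere the multiplier is
  -- bounded, and Plancherel's theorem suffices because `⟨x⟩^δ ≤ 1`.
  set A : Set E3 := {ξ | 1 < eInvSymb ζ ξ} with hA
  have hAm : MeasurableSet A := measurableSet_lt measurable_const hmS
  set H1 := A.indicator H with hH1
  set H2 := Aᶜ.indicator H with hH2
  have hH1m : Measurable H1 := hHm.indicator hAm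
  have hH2m : Measurable H2 := hHm.indicator hAm.compl
  have hH1le : ∀ ξ, ‖H1 ξ‖ₑ ≤ 2 * L * (eInvSymb ζ ξ * g ξ) := by
    intro ξ
    by_cases hξ : ξ ∈ A
    · rw [hH1, Set.indicator_of_mem hξ]
      refine (hHle ξ).trans ?_
      calc _ ≤ L * ((eInvSymb ζ ξ + eInvSymb ζ ξ) * g ξ) := by gcongr; exact (le_of_lt hξ)
        _ = _ := by ring
    · rw [hH1, Set.indicator_of_notMem hξ]; simp
  have hH2le : ∀ ξ, ‖H2 ξ‖ₑ ≤ 2 * L * g ξ := by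
    intro ξ
    by_cases hξ : ξ ∈ A
    · rw [hH2, Set.indicator_of_notMem (by simpa using hξ)]; simp
    · rw [hH2, Set.indicator_of_mem (by simpa using hξ)]
      refine (hHle ξ).trans ?_
      calc _ ≤ L * ((1 + 1) * g ξ) := by
            gcongr; exact not_lt.1 hξ
        _ = _ := by ring
  have hL2 : 2 * L ≠ ∞ := ENNReal.mul_ne_top (by simp) hL
  have hH1i : Integrable H1 := by
    refine integrable_of_lintegral_ne_top hH1m hH1le ?_
    rw [lintegral_const_mul _ (by fun_prop)]
    refine ENNReal.mul_ne_top hL2 ?_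
    obtain ⟨C, hC, hCb⟩ := exists_lintegral_eBessel_eInvSymb_fourier_le hk hs hζ
    refine ne_top_of_le_ne_top ?_ ((le_of_eq ?_).trans (hCb f hf))
    · exact ENNReal.mul_ne_top hC (ENNReal.add_ne_top.2 ⟨hf.2.ne, hfs⟩)
    · refine lintegral_congr fun ξ ↦ ?_
      simp only [hg]; ring
  have hgsq : ∫⁻ ξ, g ξ ^ 2 = sobN s f ^ 2 := (sobN_sq s f).symm
  have hH2n : eLpNorm H2 2 volume ≤ 2 * L * sobN s f := by
    refine le_of_sq_le_sq_mul ?_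
    rw [eLpNorm_two_sq, mul_pow, ← hgsq, ← lintegral_const_mul _ (by fun_prop)]
    refine lintegral_mono fun ξ ↦ ?_
    rw [← mul_pow]
    exact pow_le_pow_left' (hH2le ξ) 2
  have hH2L : MemLp H2 2 := ⟨hH2m.aestronglyMeasurable,
    lt_of_le_of_lt hH2n (ENNReal.mul_ne_top hL2 hfs).lt_top⟩
  obtain ⟨w2, hw2, hw2n, hw2p⟩ := exists_isFourierPair_of_memLp hH2L
  have hsum : (fun ξ ↦ H1 ξ + H2 ξ) = H := by
    ext ξ
    exact congrFun (Set.indicator_self_add_compl A H) ξ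
  refine ⟨fun x ↦ 𝓕⁻ H1 x + w2 x,
    (continuous_fourierInv hH1i).aestronglyMeasurable.add hw2.1, ?_, ?_⟩
  · refine isBesselImage_of_isFourierPair (isFourierPair_fourierInv hi) ?_
    have := (isFourierPair_fourierInv hH1i).add hw2p
    rw [hsum] at this
    exact this
  · refine (wNorm_add_le δ (continuous_fourierInv hH1i).aestronglyMeasurable hw2.1).trans ?_
    rw [add_mul, add_mul]
    refine add_le_add ?_ ?_
    · refine le_of_sq_le_sq_mul ?_
      have hsq : ((C1 * 4 * C2) ^ (1 / 2 : ℝ)) ^ 2 = C1 * 4 * C2 := by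
        rw [← ENNReal.rpow_ofNat, ← ENNReal.rpow_mul]; norm_num
      rw [mul_pow, mul_pow, hsq]
      refine (hC1b ζ hζ H1 hH1i (2 * L) g hgm hH1le).trans ?_
      calc _ ≤ C1 * (2 * L) ^ 2 * (C2 * sobN s f ^ 2) :=
            mul_le_mul' le_rfl (hC2b ζ hζ f hf hχ)
        _ = _ := by ring
    · exact (wNorm_le_eLpNorm hδ'.le w2).trans (hw2n.le.trans hH2n)

/-! ### Mollification -/

/-- A function that vanishes outside the ball of radius `r`. -/
def VanishOff (r : ℝ) (f : E3 → ℂ) : Prop := ∀ x, r < ‖x‖ → f x = 0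

theorem VanishOff.hasCompactSupport {r : ℝ} {f : E3 → ℂ} (h : VanishOff r f) :
    HasCompactSupport f :=
  HasCompactSupport.intro (isCompact_closedBall (0 : E3) r) fun x hx ↦
    h x (by simpa using hx)

theorem VanishOff.mono {r r' : ℝ} {f : E3 → ℂ} (h : VanishOff r f) (hr : r ≤ r') :
    VanishOff r' f := fun x hx ↦ h x (hr.trans_lt hx)

theorem exists_vanishOff {f : E3 → ℂ} (h : HasCompactSupport f) : ∃ r, VanishOff r f := by
  obtain ⟨r, hr⟩ := h.isCompact.isBounded.subset_closedBall 0
  refine ⟨r, fun x hx ↦ ?_⟩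
  by_contra hf
  have := hr (subset_tsupport f hf)
  simp only [mem_closedBall_zero_iff] at this
  linarith

theorem VanishOff.D {r : ℝ} {f : E3 → ℂ} (h : VanishOff r f) (j : Fin 3) :
    VanishOff r (D j f) := by
  intro x hx
  have : f =ᶠ[nhds x] fun _ ↦ 0 := by
    filter_upwards [(isOpen_lt continuous_const continuous_norm).mem_nhds hx] with y hy
    exact h y hy
  simp [CGO.D, this.fderiv_eq]

theorem continuous_D {f : E3 → ℂ} (hf : ContDiff ℝ 1 f) (j : Fin 3) : Continuous (D j f) :=
  (hf.continuous_fderiv one_ne_zero).clm_apply continuous_const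

theorem contDiff_D {n : ℕ} {f : E3 → ℂ} (hf : ContDiff ℝ (n + 1 : ℕ) f) (j : Fin 3) :
    ContDiff ℝ n (D j f) :=
  (hf.fderiv_right (m := n) (by norm_cast)).clm_apply contDiff_const

theorem hasCompactSupport_D {f : E3 → ℂ} (hf : HasCompactSupport f) (j : Fin 3) :
    HasCompactSupport (D j f) :=
  hf.fderiv_apply ℝ (e j)

/-- Mollification of a continuous compactly supported function. The mollifiers are nonnegative of
integral one, so the Fourier transforms decrease pointwise in absolute value, and with them all
Sobolev norms. -/
theorem exists_mollify {w : E3 → ℂ} (hw : Continuous w) (hs : HasCompactSupport w) :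
    ∃ wn : ℕ → E3 → ℂ, (∀ n, ContDiff ℝ ((⊤ : ℕ∞) : WithTop ℕ∞) (wn n)) ∧
      (∃ r, VanishOff r w ∧ ∀ n, VanishOff r (wn n)) ∧
      TendstoUniformly wn w Filter.atTop ∧
      (∀ n ξ, ‖𝓕 (wn n) ξ‖ ≤ ‖𝓕 w ξ‖) ∧
      (ContDiff ℝ 1 w → ∀ j, TendstoUniformly (fun n ↦ D j (wn n)) (D j w) Filter.atTop) := by
  -- Bump functions with support radius `1 / (n + 1) ≤ 1`: all mollifications vanish outside the
  -- ball of radius `r + 1`.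
  let b : ℕ → ContDiffBump (0 : E3) := fun n ↦
    ⟨1 / (n + 2), 1 / (n + 1), by positivity, by
      apply one_div_lt_one_div_of_lt <;> [positivity; linarith]⟩
  have hb : Filter.Tendsto (fun n ↦ (b n).rOut) Filter.atTop (nhds 0) :=
    tendsto_one_div_add_atTop_nhds_zero_nat
  have hb1 : ∀ n, (b n).rOut ≤ 1 := fun n ↦ by
    change 1 / ((n : ℝ) + 1) ≤ 1
    rw [div_le_one (by positivity)]
    linarith [(Nat.cast_nonneg n : (0 : ℝ) ≤ n)]
  let L := ContinuousLinearMap.lsmul ℝ ℝ (E := ℂ)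
  let M : (E3 → ℂ) → ℕ → E3 → ℂ := fun v n ↦ convolution ((b n).normed volume) v L volume
  have hunif : ∀ v : E3 → ℂ, Continuous v → HasCompactSupport v →
      TendstoUniformly (M v) v Filter.atTop := by
    intro v hv hvs
    rw [Metric.tendstoUniformly_iff]
    intro ε hε
    obtain ⟨δ, hδ, hd⟩ := Metric.uniformContinuous_iff.1
      (hvs.uniformContinuous_of_continuous hv) (ε / 2) (by positivity)
    filter_upwards [hb.eventually (gt_mem_nhds hδ)] with n hn x
    rw [dist_comm]
    refine lt_of_le_of_lt ((b n).dist_normed_convolution_le hv.aestronglyMeasurable ?_)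
      (half_lt_self hε)
    intro y hy
    exact (hd (lt_trans (by simpa using hy) hn)).le
  obtain ⟨r, hr⟩ := exists_vanishOff hs
  have hwi : Integrable w := hw.integrable_of_hasCompactSupport hs
  refine ⟨M w, fun n ↦ ?_, ⟨r + 1, hr.mono (by linarith), fun n x hx ↦ ?_⟩, hunif w hw hs,
    fun n ξ ↦ ?_, fun h1 j ↦ ?_⟩
  · exact (b n).hasCompactSupport_normed.contDiff_convolution_left _ (b n).contDiff_normed
      hwi.locallyIntegrable
  · change ∫ t, (b n).normed volume t • w (x - t) = 0
    rw [← integral_zero E3 ℂ]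
    congr 1; ext t
    by_cases ht : t ∈ Function.support ((b n).normed volume)
    · rw [(b n).support_normed_eq] at ht
      rw [hr (x - t), smul_zero]
      have h2 := norm_sub_norm_le x t
      have h3 : ‖t‖ < 1 := (mem_ball_zero_iff.1 ht).trans_le (hb1 n)
      linarith
    · rw [Function.notMem_support.1 ht, zero_smul]
  · have hbi : Integrable (fun x ↦ (((b n).normed volume x : ℝ) : ℂ)) :=
      (b n).integrable_normed.ofReal
    have h1 : M w n = convolution (fun x ↦ (((b n).normed volume x : ℝ) : ℂ)) w
        (ContinuousLinearMap.lsmul ℂ ℂ) volume := by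
      ext x
      change ∫ t, (b n).normed volume t • w (x - t) = ∫ t, _
      congr 1
    rw [h1, Real.fourier_smul_convolution_eq hbi hwi, norm_smul]
    refine mul_le_of_le_one_left (norm_nonneg _) ((norm_fourier_le _ _).trans (le_of_eq ?_))
    rw [← (b n).integral_normed (μ := volume)]
    congr 1; ext x
    rw [Complex.norm_real, Real.norm_of_nonneg ((b n).nonneg_normed x)]
  -- Derivatives commute with mollification.
  · have h2 : (fun n ↦ D j (M w n)) = M (D j w) := by
      ext n x
      have h3 := hs.hasFDerivAt_convolution_right L
        ((b n).integrable_normed (μ := volume)).locallyIntegrable h1 x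
      rw [D, h3.fderiv, convolution_precompR_apply L
        ((b n).integrable_normed (μ := volume)).locallyIntegrable (hs.fderiv ℝ)
        (h1.continuous_fderiv one_ne_zero)]
      rfl
    rw [h2]
    exact hunif _ (continuous_D h1 j) (hasCompactSupport_D hs j)

/-- Uniform convergence with supports in a fixed ball passes to integrals against locally
integrable functions. -/
theorem tendsto_integral_mul_of_uniform {g : E3 → ℂ} (hg : LocallyIntegrable g) {r : ℝ}
    {F : E3 → ℂ} {Fn : ℕ → E3 → ℂ} (hF : Continuous F) (hFn : ∀ n, Continuous (Fn n))
    (hr : VanishOff r F) (hrn : ∀ n, VanishOff r (Fn n))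
    (h : TendstoUniformly Fn F Filter.atTop) :
    Filter.Tendsto (fun n ↦ ∫ x, g x * Fn n x) Filter.atTop (nhds (∫ x, g x * F x)) := by
  obtain ⟨M, hM⟩ := hr.hasCompactSupport.exists_bound_of_continuous hF
  refine tendsto_integral_filter_of_dominated_convergence
    ((Metric.closedBall 0 r).indicator fun x ↦ ‖g x‖ * (M + 1)) ?_ ?_ ?_ ?_
  · exact .of_forall fun n ↦ hg.aestronglyMeasurable.mul (hFn n).aestronglyMeasurable
  · filter_upwards [Metric.tendstoUniformly_iff.1 h 1 one_pos] with n hn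
    refine .of_forall fun x ↦ ?_
    by_cases hx : x ∈ Metric.closedBall (0 : E3) r
    · rw [Set.indicator_of_mem hx, norm_mul]
      gcongr
      have h1 := (hn x).le
      rw [dist_comm, dist_eq_norm] at h1
      have h2 := norm_le_norm_add_norm_sub' (Fn n x) (F x)
      linarith [hM x]
    · rw [Set.indicator_of_notMem hx, hrn n x (by simpa using hx)]
      simp
  · rw [integrable_indicator_iff measurableSet_closedBall]
    exact (hg.integrableOn_isCompact (isCompact_closedBall 0 r)).norm.mul_const _
  · exact .of_forall fun x ↦ (h.tendsto_at x).const_mul (g x)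

theorem tendsto_fourier_of_uniform {r : ℝ}
    {F : E3 → ℂ} {Fn : ℕ → E3 → ℂ} (hF : Continuous F) (hFn : ∀ n, Continuous (Fn n))
    (hr : VanishOff r F) (hrn : ∀ n, VanishOff r (Fn n))
    (h : TendstoUniformly Fn F Filter.atTop) (ξ : E3) :
    Filter.Tendsto (fun n ↦ 𝓕 (Fn n) ξ) Filter.atTop (nhds (𝓕 F ξ)) := by
  have hc : Continuous fun x : E3 ↦ (Real.fourierChar (-inner ℝ x ξ) : ℂ) := by
    have := Real.continuous_fourierChar
    fun_prop
  have := tendsto_integral_mul_of_uniform hc.locallyIntegrable hF hFn hr hrn h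
  simpa [Real.fourier_eq, Circle.smul_def] using this

/-- Fatou's lemma for the Sobolev norms. -/
theorem sobN_le_of_tendsto {s : ℝ} {F : E3 → ℂ} {Fn : ℕ → E3 → ℂ} {A : ℝ≥0∞}
    (hm : ∀ n, Continuous (𝓕 (Fn n)))
    (h : ∀ ξ, Filter.Tendsto (fun n ↦ 𝓕 (Fn n) ξ) Filter.atTop (nhds (𝓕 F ξ)))
    (hA : ∀ n, sobN s (Fn n) ≤ A) : sobN s F ≤ A := by
  refine le_of_sq_le_sq_mul ?_
  rw [sobN_sq]
  have hmB := measurable_eBessel s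
  calc _ = ∫⁻ ξ, Filter.liminf (fun n ↦ (eBessel s ξ * ‖𝓕 (Fn n) ξ‖ₑ) ^ 2) Filter.atTop := by
        refine lintegral_congr fun ξ ↦ (Filter.Tendsto.liminf_eq ?_).symm
        refine ((ENNReal.continuous_pow 2).tendsto _).comp ?_
        exact ENNReal.Tendsto.const_mul (continuous_enorm.tendsto _ |>.comp (h ξ))
          (Or.inr (eBessel_ne_top s ξ))
    _ ≤ Filter.liminf (fun n ↦ ∫⁻ ξ, (eBessel s ξ * ‖𝓕 (Fn n) ξ‖ₑ) ^ 2) Filter.atTop :=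
        lintegral_liminf_le fun n ↦ (hmB.mul (hm n).measurable.enorm).pow_const 2
    _ ≤ A ^ 2 := by
        refine Filter.liminf_le_of_le (by isBoundedDefault) fun b hb ↦ ?_
        obtain ⟨n, hn⟩ := hb.exists
        refine hn.trans ?_
        rw [← sobN_sq]
        exact pow_le_pow_left' (hA n) 2

/-! ### Multiplication in Sobolev spaces of integer order -/

theorem measurable_ofReal_besselSymbol (s : ℝ) : Measurable fun ξ ↦ (besselSymbol s ξ : ℂ) :=
  (Complex.continuous_ofReal.comp (continuous_besselSymbol s)).measurable

theorem sobN_zero {f : E3 → ℂ} (hf : Continuous f) (hs : HasCompactSupport f) :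
    sobN 0 f = eLpNorm f 2 volume := by
  rw [← eLpNorm_fourier (hf.integrable_of_hasCompactSupport hs)
    (hf.memLp_of_hasCompactSupport hs)]
  simp [sobN]

theorem sobN_add_le (s : ℝ) {f g : E3 → ℂ} (hf : Integrable f) (hg : Integrable g) :
    sobN s (fun x ↦ f x + g x) ≤ sobN s f + sobN s g := by
  have hb := measurable_ofReal_besselSymbol s
  refine le_trans (le_of_eq ?_) (eLpNorm_add_le
    (hb.mul (continuous_fourier hf).measurable).aestronglyMeasurable
    (hb.mul (continuous_fourier hg).measurable).aestronglyMeasurable (by norm_num))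
  unfold sobN
  congr 1; ext ξ
  rw [fourier_add' hf hg, mul_add]
  rfl

theorem sobN_const_mul (s : ℝ) (c : ℂ) (f : E3 → ℂ) :
    sobN s (fun x ↦ c * f x) = ‖c‖ₑ * sobN s f := by
  unfold sobN
  rw [← eLpNorm_const_smul]
  congr 1; ext ξ
  rw [fourier_const_mul, Pi.smul_apply, smul_eq_mul, mul_left_comm]

theorem integrable_sum {ι : Type*} (t : Finset ι) {f : ι → E3 → ℂ}
    (hf : ∀ i ∈ t, Integrable (f i)) : Integrable (fun x ↦ ∑ i ∈ t, f i x) :=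
  integrable_finsetSum t hf

theorem sobN_sum_le (s : ℝ) {ι : Type*} (t : Finset ι) {f : ι → E3 → ℂ}
    (hf : ∀ i ∈ t, Integrable (f i)) :
    sobN s (fun x ↦ ∑ i ∈ t, f i x) ≤ ∑ i ∈ t, sobN s (f i) := by
  classical
  induction t using Finset.induction_on with
  | empty =>
    have : 𝓕 (fun _ : E3 ↦ (0 : ℂ)) = 0 := by ext ξ; simp [Real.fourier_eq]
    simp [sobN, this]
  | insert a t ha ih =>
    simp_rw [Finset.sum_insert ha]
    refine (sobN_add_le s (hf a (by simp))
      (integrable_sum t fun i hi ↦ hf i (by simp [hi]))).trans ?_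
    gcongr
    exact ih fun i hi ↦ hf i (by simp [hi])

theorem sobN_D_le (s : ℝ) {f : E3 → ℂ} (hf : ContDiff ℝ 1 f) (hs : HasCompactSupport f)
    (j : Fin 3) : sobN s (D j f) ≤ sobN (s + 1) f := by
  unfold sobN
  refine eLpNorm_mono fun ξ ↦ ?_
  have hb : ∀ t, ‖(besselSymbol t ξ : ℂ)‖ = besselSymbol t ξ := fun t ↦ by
    rw [Complex.norm_real, Real.norm_of_nonneg (besselSymbol_pos _ _).le]
  rw [fourier_D_of_hasCompactSupport hf hs, norm_mul, norm_mul, norm_mul, hb, hb, besselSymbol_add,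
    mul_assoc]
  gcongr
  · exact (besselSymbol_pos _ _).le
  · exact (norm_dSymb_le j ξ).trans (norm_le_besselSymbol_one ξ)

/-- With `sobN_D_le`, this reduces statements in Sobolev spaces of integer order to the case of
order zero. -/
theorem sobN_succ_le (s : ℝ) {f : E3 → ℂ} (hf : ContDiff ℝ 1 f) (hs : HasCompactSupport f) :
    sobN (s + 1) f ≤ sobN s f + ∑ j, sobN s (D j f) := by
  have hb := measurable_ofReal_besselSymbol s
  have hi : ∀ j, Integrable (D j f) := fun j ↦
    (continuous_D hf j).integrable_of_hasCompactSupport (hasCompactSupport_D hs j)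
  have hfi : Integrable f := hf.continuous.integrable_of_hasCompactSupport hs
  have hm : ∀ j, AEStronglyMeasurable fun ξ ↦ ‖(besselSymbol s ξ : ℂ) * 𝓕 (D j f) ξ‖ := fun j ↦
    (hb.mul (continuous_fourier (hi j)).measurable).aestronglyMeasurable.norm
  have hm0 : AEStronglyMeasurable fun ξ ↦ ‖(besselSymbol s ξ : ℂ) * 𝓕 f ξ‖ :=
    (hb.mul (continuous_fourier hfi).measurable).aestronglyMeasurable.norm
  calc sobN (s + 1) f ≤ eLpNorm ((fun ξ ↦ ‖(besselSymbol s ξ : ℂ) * 𝓕 f ξ‖) +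
        ∑ j, fun ξ ↦ ‖(besselSymbol s ξ : ℂ) * 𝓕 (D j f) ξ‖) 2 volume := by
        refine eLpNorm_mono fun ξ ↦ ?_
        have hB : ∀ t, ‖(besselSymbol t ξ : ℂ)‖ = besselSymbol t ξ := fun t ↦ by
          rw [Complex.norm_real, Real.norm_of_nonneg (besselSymbol_pos _ _).le]
        rw [Pi.add_apply, Finset.sum_apply, Real.norm_of_nonneg (by positivity)]
        simp only [fourier_D_of_hasCompactSupport hf hs, norm_mul, hB, norm_dSymb]
        have h0 : 0 ≤ besselSymbol s ξ * ‖𝓕 f ξ‖ :=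
          mul_nonneg (besselSymbol_pos _ _).le (norm_nonneg _)
        calc _ = besselSymbol 1 ξ * (besselSymbol s ξ * ‖𝓕 f ξ‖) := by
              rw [besselSymbol_add]; ring
          _ ≤ (1 + ∑ j, |2 * Real.pi * ξ j|) * (besselSymbol s ξ * ‖𝓕 f ξ‖) := by
              gcongr; exact besselSymbol_one_le ξ
          _ = _ := by
              rw [add_mul, one_mul, Finset.sum_mul]
              congr 1
              refine Finset.sum_congr rfl fun j _ ↦ by ring
    _ ≤ eLpNorm (fun ξ ↦ ‖(besselSymbol s ξ : ℂ) * 𝓕 f ξ‖) 2 volume +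
          eLpNorm (∑ j, fun ξ ↦ ‖(besselSymbol s ξ : ℂ) * 𝓕 (D j f) ξ‖) 2 volume := by
        refine eLpNorm_add_le hm0 ?_ (by norm_num)
        exact Finset.aestronglyMeasurable_sum _ fun j _ ↦ hm j
    _ ≤ _ := by
        rw [eLpNorm_norm]
        refine add_le_add le_rfl
          ((eLpNorm_sum_le (fun j _ ↦ hm j) (by norm_num)).trans (le_of_eq ?_))
        simp_rw [eLpNorm_norm]
        rfl

theorem sobN_ne_top (l : ℕ) {f : E3 → ℂ} (hf : ContDiff ℝ l f) (hs : HasCompactSupport f) :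
    sobN l f ≠ ∞ := by
  induction l generalizing f with
  | zero =>
    rw [Nat.cast_zero, sobN_zero hf.continuous hs]
    exact (hf.continuous.memLp_of_hasCompactSupport hs).2.ne
  | succ l ih =>
    push_cast
    have h1 : ContDiff ℝ 1 f := hf.of_le (by norm_cast; omega)
    refine ne_top_of_le_ne_top ?_ (sobN_succ_le l h1 hs)
    refine ENNReal.add_ne_top.2 ⟨ih (hf.of_le (by norm_cast; omega)) hs, ?_⟩
    exact ENNReal.sum_ne_top.2 fun j _ ↦ ih (contDiff_D hf j) (hasCompactSupport_D hs j)

theorem D_mul {f g : E3 → ℂ} {x : E3} (hf : DifferentiableAt ℝ f x) (hg : DifferentiableAt ℝ g x)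
    (j : Fin 3) : D j (fun y ↦ f y * g y) x = D j f x * g x + f x * D j g x := by
  unfold D
  rw [fderiv_fun_mul hf hg]
  simp; ring

/-- Multiplication by a `C^l` function is bounded in the Sobolev norm of order `l`, by induction on
`l` and Leibniz' rule. The smoothness of `w` is removed in `exists_sobN_mul_le`. -/
theorem exists_sobN_mul_le_of_contDiff (l : ℕ) {V : E3 → ℂ} (hV : ContDiff ℝ l V)
    (hVs : HasCompactSupport V) :
    ∃ C : ℝ≥0∞, C ≠ ∞ ∧ ∀ w : E3 → ℂ, ContDiff ℝ l w → HasCompactSupport w →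
      sobN l (fun x ↦ V x * w x) ≤ C * sobN l w := by
  induction l generalizing V with
  | zero =>
    obtain ⟨M, hM⟩ := hVs.exists_bound_of_continuous hV.continuous
    refine ⟨ENNReal.ofReal M, ENNReal.ofReal_ne_top, fun w hw hws ↦ ?_⟩
    rw [Nat.cast_zero, sobN_zero hw.continuous hws,
      sobN_zero (f := fun x ↦ V x * w x) (hV.continuous.mul hw.continuous) hws.mul_left]
    refine eLpNorm_le_mul_eLpNorm_of_ae_le_mul (.of_forall fun x ↦ ?_) 2
    rw [norm_mul]
    gcongr
    exact hM x
  | succ l ih =>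
    have hV1 : ContDiff ℝ 1 V := hV.of_le (by norm_cast; omega)
    obtain ⟨C0, hC0, hC0b⟩ := ih (hV.of_le (by norm_cast; omega)) hVs
    choose C hC hCb using fun j ↦ ih (contDiff_D hV j) (hasCompactSupport_D hVs j)
    refine ⟨C0 + ∑ j, (C j + C0), ENNReal.add_ne_top.2 ⟨hC0, ENNReal.sum_ne_top.2
      fun j _ ↦ ENNReal.add_ne_top.2 ⟨hC j, hC0⟩⟩, fun w hw hws ↦ ?_⟩
    have hw1 : ContDiff ℝ 1 w := hw.of_le (by norm_cast; omega)
    have hwl : ContDiff ℝ l w := hw.of_le (by norm_cast; omega)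
    push_cast
    refine (sobN_succ_le l (hV1.mul hw1) hws.mul_left).trans ?_
    rw [add_mul, Finset.sum_mul]
    have hmono : sobN l w ≤ sobN (l + 1) w := sobN_mono (by linarith) w
    refine add_le_add ((hC0b w hwl hws).trans (mul_le_mul' le_rfl hmono))
      (Finset.sum_le_sum fun j _ ↦ ?_)
    have hD : D j (fun x ↦ V x * w x) = fun x ↦ D j V x * w x + V x * D j w x := by
      ext x
      exact D_mul (hV1.differentiable one_ne_zero x) (hw1.differentiable one_ne_zero x) j
    rw [hD, add_mul]
    refine (sobN_add_le l ?_ ?_).trans (add_le_add ?_ ?_)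
    · exact ((continuous_D hV1 j).mul hw1.continuous).integrable_of_hasCompactSupport hws.mul_left
    · exact (hV1.continuous.mul (continuous_D hw1 j)).integrable_of_hasCompactSupport
        (hasCompactSupport_D hws j).mul_left
    · exact (hCb j w hwl hws).trans (mul_le_mul' le_rfl hmono)
    · exact (hC0b _ (contDiff_D hw j) (hasCompactSupport_D hws j)).trans
        (mul_le_mul' le_rfl (sobN_D_le l hw1 hws j))

/-- Multiplication by a `C^l` function is bounded on continuous functions of finite Sobolev norm,
by mollifying and Fatou's lemma. -/
theorem exists_sobN_mul_le (l : ℕ) {V : E3 → ℂ} (hV : ContDiff ℝ l V)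
    (hVs : HasCompactSupport V) :
    ∃ C : ℝ≥0∞, C ≠ ∞ ∧ ∀ w : E3 → ℂ, Continuous w → HasCompactSupport w →
      sobN l (fun x ↦ V x * w x) ≤ C * sobN l w := by
  obtain ⟨C, hC, hCb⟩ := exists_sobN_mul_le_of_contDiff l hV hVs
  refine ⟨C, hC, fun w hw hws ↦ ?_⟩
  obtain ⟨wn, h1, ⟨r, hr, hrn⟩, h2, h3, -⟩ := exists_mollify hw hws
  have hVc := hV.continuous
  have hwc : ∀ n, Continuous (wn n) := fun n ↦ (h1 n).continuous
  refine sobN_le_of_tendsto (Fn := fun n x ↦ V x * wn n x) (fun n ↦ ?_) (fun ξ ↦ ?_) fun n ↦ ?_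
  · exact continuous_fourier ((hVc.mul (hwc n)).integrable_of_hasCompactSupport
      (hrn n).hasCompactSupport.mul_left)
  · have hc : Continuous fun x : E3 ↦ (Real.fourierChar (-inner ℝ x ξ) : ℂ) * V x := by
      have := Real.continuous_fourierChar
      fun_prop
    have := tendsto_integral_mul_of_uniform hc.locallyIntegrable hw hwc hr hrn h2
    simpa [Real.fourier_eq, Circle.smul_def, mul_assoc] using this
  · refine (hCb (wn n) ((h1 n).of_le (by exact_mod_cast le_top)) (hrn n).hasCompactSupport).trans ?_
    refine mul_le_mul' le_rfl (eLpNorm_mono fun ξ ↦ ?_)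
    rw [norm_mul, norm_mul]
    gcongr
    exact h3 n ξ

/-! ### The operator `Gop` on compactly supported functions -/

/-- Admissible right-hand sides: continuous functions with compact support and finite Sobolev norm
of order `l`. -/
structure Src (l : ℕ) (f : E3 → ℂ) : Prop where
  cont : Continuous f
  supp : HasCompactSupport f
  fin : sobN l f ≠ ∞

theorem Src.integrable {l : ℕ} {f : E3 → ℂ} (h : Src l f) : Integrable f :=
  h.cont.integrable_of_hasCompactSupport h.supp

theorem Src.of_contDiff {l : ℕ} {f : E3 → ℂ} (h : ContDiff ℝ l f) (hs : HasCompactSupport f) :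
    Src l f := ⟨h.continuous, hs, sobN_ne_top l h hs⟩

theorem Src.sobN_ne_top {l : ℕ} {f : E3 → ℂ} (h : Src l f) {s : ℝ} (hs : s ≤ l) : sobN s f ≠ ∞ :=
  ne_top_of_le_ne_top h.fin (sobN_mono hs f)

theorem Src.add {l : ℕ} {f g : E3 → ℂ} (h : Src l f) (h' : Src l g) :
    Src l (fun x ↦ f x + g x) :=
  ⟨h.cont.add h'.cont, h.supp.add h'.supp, ne_top_of_le_ne_top
    (ENNReal.add_ne_top.2 ⟨h.fin, h'.fin⟩) (sobN_add_le l h.integrable h'.integrable)⟩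

theorem Src.const_mul {l : ℕ} {f : E3 → ℂ} (h : Src l f) (c : ℂ) : Src l (fun x ↦ c * f x) :=
  ⟨continuous_const.mul h.cont, h.supp.mul_left, by
    rw [sobN_const_mul]; exact ENNReal.mul_ne_top (by simp) h.fin⟩

theorem Src.sum {l : ℕ} {ι : Type*} (t : Finset ι) {f : ι → E3 → ℂ} (h : ∀ i ∈ t, Src l (f i)) :
    Src l (fun x ↦ ∑ i ∈ t, f i x) := by
  classical
  induction t using Finset.induction_on with
  | empty =>
    have : ContDiff ℝ l (fun _ : E3 ↦ (0 : ℂ)) := contDiff_const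
    simpa using Src.of_contDiff this HasCompactSupport.zero
  | insert a t ha ih =>
    simp_rw [Finset.sum_insert ha]
    exact (h a (by simp)).add (ih fun i hi ↦ h i (by simp [hi]))

/-- The Fourier transform of `Gop ζ f`. -/
noncomputable def gHat (ζ : C3) (f : E3 → ℂ) (ξ : E3) : ℂ := (symb ζ ξ)⁻¹ * 𝓕 f ξ

theorem Gop_eq (ζ : C3) (f : E3 → ℂ) : Gop ζ f = 𝓕⁻ (gHat ζ f) := by
  unfold Gop gHat symb
  congr 1; ext ξ
  rw [div_eq_inv_mul]

theorem measurable_symb_inv (ζ : C3) : Measurable fun ξ ↦ (symb ζ ξ)⁻¹ := (measurable_symb ζ).inv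

theorem measurable_gHat (ζ : C3) {f : E3 → ℂ} (hf : Integrable f) : Measurable (gHat ζ f) :=
  (measurable_symb_inv ζ).mul (continuous_fourier hf).measurable

theorem enorm_symb_inv {ζ : C3} (h : 1 ≤ ‖ζ‖) (ξ : E3) :
    ‖(symb ζ ξ)⁻¹‖ₑ = (ENNReal.ofReal ‖ζ‖)⁻¹ * eInvSymb ζ ξ := by
  have h0 : 0 < ‖ζ‖ := by linarith
  rw [eInvSymb, invSymb, ENNReal.ofReal_mul h0.le, ← mul_assoc, ENNReal.inv_mul_cancel, one_mul,
    ofReal_norm]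
  · simpa using h0
  · simp

/-- The multiplier of `G_ζ` is `O(|ζ|⁻¹)`. -/
theorem isMult_symb_inv {ζ : C3} (h : 1 ≤ ‖ζ‖) :
    IsMult ζ (ENNReal.ofReal ‖ζ‖)⁻¹ fun ξ ↦ (symb ζ ξ)⁻¹ :=
  ⟨measurable_symb_inv ζ, fun ξ ↦ by rw [enorm_symb_inv h]; gcongr; simp⟩

/-- The multiplier of `∂_j G_ζ` is `O(1)`. -/
theorem isMult_dSymb_mul {ζ : C3} (h : 1 ≤ ‖ζ‖) (j : Fin 3) :
    IsMult ζ 4 fun ξ ↦ dSymb j ξ * (symb ζ ξ)⁻¹ := by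
  refine ⟨(continuous_dSymb j).measurable.mul (measurable_symb_inv ζ), fun ξ ↦ ?_⟩
  have h1 : ‖dSymb j ξ * (symb ζ ξ)⁻¹‖ ≤ 4 * (invSymb ζ ξ + 1) := by
    rw [norm_mul]
    refine le_trans ?_ (norm_mul_symb_inv_le h ξ)
    gcongr
    exact norm_dSymb_le j ξ
  rw [← ofReal_norm]
  refine (ENNReal.ofReal_le_ofReal h1).trans (le_of_eq ?_)
  rw [ENNReal.ofReal_mul (by norm_num), ENNReal.ofReal_add (invSymb_nonneg ζ ξ) zero_le_one]
  simp [eInvSymb]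

/-- The Fourier transform of `G_ζ f` is integrable with the Bessel weight. The constant depends on
`ζ`. -/
theorem exists_lintegral_gHat_le {k : ℝ} (hk : 0 < k) {s : ℝ} (hs : 0 ≤ s) {ζ : C3}
    (hζ : Adm k ζ) :
    ∃ C : ℝ≥0∞, C ≠ ∞ ∧ ∀ f : E3 → ℂ, Integrable f →
      ∫⁻ ξ, ‖(besselSymbol s ξ : ℂ) * gHat ζ f ξ‖ₑ ≤ C * ((∫⁻ x, ‖f x‖ₑ) + sobN s f) := by
  obtain ⟨C, hC, hCb⟩ := exists_lintegral_eBessel_eInvSymb_fourier_le hk hs hζ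
  refine ⟨C, hC, fun f hf ↦ le_trans (lintegral_mono fun ξ ↦ ?_) (hCb f hf)⟩
  simp only [gHat]
  rw [enorm_mul, enorm_mul, enorm_besselSymbol, enorm_symb_inv hζ.one_le]
  gcongr
  refine mul_le_of_le_one_left' ?_
  rw [ENNReal.inv_le_one]
  exact ENNReal.one_le_ofReal.2 hζ.one_le

theorem integrable_besselSymbol_mul_gHat {k : ℝ} (hk : 0 < k) {s : ℝ} (hs : 0 ≤ s) {ζ : C3}
    (hζ : Adm k ζ) {f : E3 → ℂ} (hf : Integrable f) (hfs : sobN s f ≠ ∞) :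
    Integrable fun ξ ↦ (besselSymbol s ξ : ℂ) * gHat ζ f ξ := by
  obtain ⟨C, hC, hCb⟩ := exists_lintegral_gHat_le hk hs hζ
  refine integrable_of_lintegral_ne_top
    ((measurable_ofReal_besselSymbol s).mul (measurable_gHat ζ hf)) (fun ξ ↦ le_rfl) ?_
  exact ne_top_of_le_ne_top (ENNReal.mul_ne_top hC (ENNReal.add_ne_top.2 ⟨hf.2.ne, hfs⟩)) (hCb f hf)

section

variable {k : ℝ} (hk : 0 < k) {ζ : C3} (hζ : Adm k ζ) {l : ℕ} {f g : E3 → ℂ}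
include hk hζ

theorem integrable_gHat (hf : Src l f) : Integrable (gHat ζ f) := by
  simpa using integrable_besselSymbol_mul_gHat hk le_rfl hζ hf.integrable
    (hf.sobN_ne_top (Nat.cast_nonneg l))

theorem integrable_norm_mul_gHat (hl : 1 ≤ l) (hf : Src l f) :
    Integrable fun ξ ↦ ‖ξ‖ * ‖gHat ζ f ξ‖ :=
  (integrable_norm_mul (measurable_gHat ζ hf.integrable).aestronglyMeasurable
    (integrable_besselSymbol_mul_gHat hk zero_le_one hζ hf.integrable
      (hf.sobN_ne_top (by exact_mod_cast hl)))).2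

theorem integrable_dSymb_mul_gHat (hl : 1 ≤ l) (hf : Src l f) (j : Fin 3) :
    Integrable fun ξ ↦ dSymb j ξ * gHat ζ f ξ := by
  refine ((integrable_norm_mul_gHat hk hζ hl hf).const_mul (2 * Real.pi)).mono'
    ((continuous_dSymb j).measurable.mul
      (measurable_gHat ζ hf.integrable)).aestronglyMeasurable (.of_forall fun ξ ↦ ?_)
  rw [norm_mul, ← mul_assoc]
  gcongr
  refine (norm_dSymb_le j ξ).trans (le_of_eq ?_)
  rw [norm_smul, Real.norm_of_nonneg (by positivity)]

theorem continuous_Gop (hf : Src l f) : Continuous (Gop ζ f) := by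
  rw [Gop_eq]; exact continuous_fourierInv (integrable_gHat hk hζ hf)

theorem contDiff_Gop (hl : 1 ≤ l) (hf : Src l f) : ContDiff ℝ 1 (Gop ζ f) := by
  rw [Gop_eq]
  exact contDiff_fourierInv (integrable_gHat hk hζ hf) (integrable_norm_mul_gHat hk hζ hl hf)

theorem D_Gop (hl : 1 ≤ l) (hf : Src l f) (j : Fin 3) :
    D j (Gop ζ f) = 𝓕⁻ fun ξ ↦ dSymb j ξ * gHat ζ f ξ := by
  ext x
  rw [Gop_eq]
  exact D_fourierInv (integrable_gHat hk hζ hf) (integrable_norm_mul_gHat hk hζ hl hf) j x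

theorem Gop_add (hf : Src l f) (hg : Src l g) (x : E3) :
    Gop ζ (fun y ↦ f y + g y) x = Gop ζ f x + Gop ζ g x := by
  simp only [Gop_eq]
  rw [← fourierInv_add' (integrable_gHat hk hζ hf) (integrable_gHat hk hζ hg)]
  refine congrFun (congrArg _ ?_) x
  ext ξ
  rw [gHat, fourier_add' hf.integrable hg.integrable, mul_add]
  rfl

omit hk hζ in
theorem Gop_const_mul (ζ : C3) (c : ℂ) (f : E3 → ℂ) (x : E3) :
    Gop ζ (fun y ↦ c * f y) x = c * Gop ζ f x := by
  simp only [Gop_eq]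
  rw [← fourierInv_const_mul]
  refine congrFun (congrArg _ ?_) x
  ext ξ
  rw [gHat, fourier_const_mul, gHat]
  ring

theorem Gop_sum {ι : Type*} (t : Finset ι) {f : ι → E3 → ℂ} (hf : ∀ i ∈ t, Src l (f i)) (x : E3) :
    Gop ζ (fun y ↦ ∑ i ∈ t, f i y) x = ∑ i ∈ t, Gop ζ (f i) x := by
  classical
  induction t using Finset.induction_on with
  | empty =>
    simp only [Finset.sum_empty]
    have := Gop_const_mul ζ 0 (fun _ ↦ 0) x
    simpa using this
  | insert a t ha ih =>
    simp_rw [Finset.sum_insert ha]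
    rw [Gop_add hk hζ (hf a (by simp)) (Src.sum t fun i hi ↦ hf i (by simp [hi])),
      ih fun i hi ↦ hf i (by simp [hi])]

/-- `Gop` commutes with derivatives. -/
theorem D_Gop_eq_Gop_D (hl : 1 ≤ l) (hf : Src l f) (hf1 : ContDiff ℝ 1 f) (j : Fin 3) :
    D j (Gop ζ f) = Gop ζ (D j f) := by
  rw [D_Gop hk hζ hl hf, Gop_eq]
  congr 1; ext ξ
  rw [gHat, gHat, fourier_D_of_hasCompactSupport hf1 hf.supp]
  ring

/-- `Gop` is bounded from `L²` with supports in a fixed ball to `L^∞`. -/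
theorem exists_enorm_Gop_le_sobN (r : ℝ) :
    ∃ C : ℝ≥0∞, C ≠ ∞ ∧ ∀ f : E3 → ℂ, Continuous f → VanishOff r f →
      ∀ x, ‖Gop ζ f x‖ₑ ≤ C * sobN 0 f := by
  obtain ⟨C, hC, hCb⟩ := exists_lintegral_gHat_le hk le_rfl hζ
  set b := volume (Metric.closedBall (0 : E3) r) with hb
  have hbt : b ≠ ∞ := measure_closedBall_lt_top.ne
  have hbt2 : b ^ (1 / 2 : ℝ) ≠ ∞ := ENNReal.rpow_ne_top_of_nonneg (by norm_num) hbt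
  refine ⟨C * (b ^ (1 / 2 : ℝ) + 1),
    ENNReal.mul_ne_top hC (ENNReal.add_ne_top.2 ⟨hbt2, by simp⟩), fun f hf hr x ↦ ?_⟩
  have hs := hr.hasCompactSupport
  have hfi : Integrable f := hf.integrable_of_hasCompactSupport hs
  -- On a ball, the `L¹` norm is controlled by the `L²` norm.
  have h1 : ∫⁻ x, ‖f x‖ₑ ≤ b ^ (1 / 2 : ℝ) * sobN 0 f := by
    have hm : Measurable fun x ↦ ‖f x‖ₑ := hf.measurable.enorm
    have hind : Measurable ((Metric.closedBall (0 : E3) r).indicator fun _ ↦ (1 : ℝ≥0∞)) :=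
      measurable_const.indicator measurableSet_closedBall
    have h2 := lintegral_mul_le_sqrt hind hm
    have h3 : ∀ x, (Metric.closedBall (0 : E3) r).indicator (fun _ ↦ (1 : ℝ≥0∞)) x * ‖f x‖ₑ =
        ‖f x‖ₑ := by
      intro x
      by_cases hx : x ∈ Metric.closedBall (0 : E3) r
      · simp [hx]
      · rw [hr x (by simpa using hx)]; simp
    have h4 : ∫⁻ x, (Metric.closedBall (0 : E3) r).indicator (fun _ ↦ (1 : ℝ≥0∞)) x ^ (2 : ℝ) =
        b := by
      rw [hb, ← lintegral_indicator_one measurableSet_closedBall]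
      refine lintegral_congr fun x ↦ ?_
      by_cases hx : x ∈ Metric.closedBall (0 : E3) r <;> simp [hx]
    simp_rw [h3] at h2
    rw [h4] at h2
    refine h2.trans (mul_le_mul' le_rfl (le_of_eq ?_))
    rw [sobN_zero hf hs]
    simp_rw [ENNReal.rpow_ofNat]
    rw [← eLpNorm_two_sq, ← ENNReal.rpow_ofNat, ← ENNReal.rpow_mul]
    norm_num
  have h3 := hCb f hfi
  simp only [besselSymbol_zero, Complex.ofReal_one, one_mul] at h3
  rw [Gop_eq, Real.fourierInv_eq_fourier_neg]
  refine (enorm_fourier_le _ _).trans (h3.trans ?_)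
  calc _ ≤ C * (b ^ (1 / 2 : ℝ) * sobN 0 f + sobN 0 f) := by gcongr
    _ = _ := by ring

omit hk hζ in
theorem sobN_zero_le_of_norm_le {r M : ℝ} (hf : Continuous f) (hr : VanishOff r f)
    (hM : ∀ x, ‖f x‖ ≤ M) :
    sobN 0 f ≤ ENNReal.ofReal M * volume (Metric.closedBall (0 : E3) r) ^ (1 / 2 : ℝ) := by
  rw [sobN_zero hf hr.hasCompactSupport]
  refine le_of_sq_le_sq_mul ?_
  rw [eLpNorm_two_sq, mul_pow, ← ENNReal.rpow_ofNat (_ ^ (1 / 2 : ℝ)), ← ENNReal.rpow_mul]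
  calc _ ≤ ∫⁻ x, (Metric.closedBall (0 : E3) r).indicator
        (fun _ ↦ ENNReal.ofReal M ^ 2) x := by
        refine lintegral_mono fun x ↦ ?_
        by_cases hx : x ∈ Metric.closedBall (0 : E3) r
        · rw [Set.indicator_of_mem hx, ← ofReal_norm]
          exact pow_le_pow_left' (ENNReal.ofReal_le_ofReal (hM x)) 2
        · rw [hr x (by simpa using hx)]; simp
    _ = ENNReal.ofReal M ^ 2 * volume (Metric.closedBall (0 : E3) r) := by
        rw [lintegral_indicator measurableSet_closedBall, setLIntegral_const]
    _ = _ := by norm_num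

/-- Continuity of `G_ζ` under uniform convergence with supports in a fixed ball. -/
theorem tendsto_Gop_of_uniform {r : ℝ} {F : E3 → ℂ} {Fn : ℕ → E3 → ℂ} (hF : Src l F)
    (hFn : ∀ n, Src l (Fn n)) (hr : VanishOff r F) (hrn : ∀ n, VanishOff r (Fn n))
    (h : TendstoUniformly Fn F Filter.atTop) (x : E3) :
    Filter.Tendsto (fun n ↦ Gop ζ (Fn n) x) Filter.atTop (nhds (Gop ζ F x)) := by
  obtain ⟨C, hC, hCb⟩ := exists_enorm_Gop_le_sobN hk hζ r
  set b := volume (Metric.closedBall (0 : E3) r) with hb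
  have hbt : b ^ (1 / 2 : ℝ) ≠ ∞ :=
    ENNReal.rpow_ne_top_of_nonneg (by norm_num) measure_closedBall_lt_top.ne
  have hCt : C * b ^ (1 / 2 : ℝ) ≠ ∞ := ENNReal.mul_ne_top hC hbt
  rw [EMetric.tendsto_nhds]
  intro ε hε
  obtain ⟨M, hM0, hM⟩ : ∃ M : ℝ, 0 < M ∧ C * (ENNReal.ofReal M * b ^ (1 / 2 : ℝ)) < ε := by
    have : Filter.Tendsto (fun M : ℝ ↦ C * (ENNReal.ofReal M * b ^ (1 / 2 : ℝ)))
        (nhdsWithin 0 (Set.Ioi 0)) (nhds 0) := by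
      have h1 : Filter.Tendsto (fun M : ℝ ↦ C * b ^ (1 / 2 : ℝ) * ENNReal.ofReal M)
          (nhds 0) (nhds (C * b ^ (1 / 2 : ℝ) * ENNReal.ofReal 0)) :=
        ENNReal.Tendsto.const_mul (ENNReal.continuous_ofReal.tendsto 0) (Or.inr hCt)
      rw [ENNReal.ofReal_zero, mul_zero] at h1
      refine (h1.mono_left nhdsWithin_le_nhds).congr fun M ↦ by ring
    obtain ⟨M, hM⟩ := ((this.eventually (gt_mem_nhds hε)).and self_mem_nhdsWithin).exists
    exact ⟨M, hM.2, hM.1⟩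
  filter_upwards [Metric.tendstoUniformly_iff.1 h M hM0] with n hn
  have h1 : Gop ζ (fun y ↦ Fn n y + (-1) * F y) x = Gop ζ (Fn n) x - Gop ζ F x := by
    rw [Gop_add hk hζ (hFn n) (hF.const_mul (-1)), Gop_const_mul]; ring
  rw [edist_eq_enorm_sub, ← h1]
  have hv : VanishOff r (fun y ↦ Fn n y + (-1) * F y) := fun y hy ↦ by
    simp [hrn n y hy, hr y hy]
  have hc : Continuous (fun y ↦ Fn n y + (-1) * F y) :=
    (hFn n).cont.add (continuous_const.mul hF.cont)
  refine (hCb _ hc hv x).trans_lt (lt_of_le_of_lt (mul_le_mul' le_rfl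
    (sobN_zero_le_of_norm_le hc hv fun y ↦ ?_)) hM)
  have := (hn y).le
  rw [dist_comm, dist_eq_norm] at this
  simpa [sub_eq_add_neg] using this

end

/-! ### Compactly supported systems: Neumann series -/

theorem mul_eq_of_cutoff {χ : 𝓢(E3, ℂ)} {V : E3 → ℂ} (hV : ∀ x, χ x * V x = V x) (w : E3 → ℂ) :
    ∀ x, χ x * (V x * w x) = V x * w x := fun x ↦ by rw [← mul_assoc, hV]

/-- Multiplication by a compactly supported coefficient after a multiplier with the singularities
of the inverse symbol. -/
theorem exists_sobN_mul_mult_le {k : ℝ} (hk : 0 < k) (l : ℕ) {V : E3 → ℂ} (hV : ContDiff ℝ l V)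
    (hVs : HasCompactSupport V) (χ : 𝓢(E3, ℂ)) :
    ∃ C : ℝ≥0∞, C ≠ ∞ ∧ ∀ ζ : C3, Adm k ζ → ∀ (L : ℝ≥0∞) (m : E3 → ℂ), IsMult ζ L m →
      ∀ f : E3 → ℂ, Integrable f → (∀ x, χ x * f x = f x) → Integrable (fun ξ ↦ m ξ * 𝓕 f ξ) →
        sobN l (fun x ↦ V x * 𝓕⁻ (fun ξ ↦ m ξ * 𝓕 f ξ) x) ≤ C * L * sobN l f := by
  obtain ⟨χ', hχ's, hχ'⟩ := exists_schwartz_bump_eq_one_on hVs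
  obtain ⟨C1, hC1, hC1b⟩ := exists_sobN_mul_le l hV hVs
  obtain ⟨C2, hC2, hC2b⟩ := exists_sobN_mult_le hk (s := l) (Nat.cast_nonneg l) χ χ'
  refine ⟨C1 * C2, ENNReal.mul_ne_top hC1 hC2, fun ζ hζ L m hm f hf hχ hi ↦ ?_⟩
  have h1 : (fun x ↦ V x * 𝓕⁻ (fun ξ ↦ m ξ * 𝓕 f ξ) x) =
      fun x ↦ V x * (χ' x * 𝓕⁻ (fun ξ ↦ m ξ * 𝓕 f ξ) x) := by
    ext x
    rw [← mul_assoc, mul_comm (V x) (χ' x), hχ']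
  rw [h1]
  refine (hC1b _ (χ'.continuous.mul (continuous_fourierInv hi)) hχ's.mul_right).trans ?_
  refine (mul_le_mul' le_rfl (hC2b ζ hζ L m hm f hf hχ hi)).trans (le_of_eq ?_)
  ring

/-- Localized decay of `G_ζ` in `|ζ|`, as used in the Neumann series. -/
theorem exists_sobN_mul_Gop_le {k : ℝ} (hk : 0 < k) (l : ℕ) {V : E3 → ℂ} (hV : ContDiff ℝ l V)
    (hVs : HasCompactSupport V) (χ : 𝓢(E3, ℂ)) :
    ∃ C : ℝ≥0∞, C ≠ ∞ ∧ ∀ ζ : C3, Adm k ζ → ∀ f : E3 → ℂ, Src l f → (∀ x, χ x * f x = f x) →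
      sobN l (fun x ↦ V x * Gop ζ f x) ≤ C * (ENNReal.ofReal ‖ζ‖)⁻¹ * sobN l f := by
  obtain ⟨C, hC, hCb⟩ := exists_sobN_mul_mult_le hk l hV hVs χ
  refine ⟨C, hC, fun ζ hζ f hf hχ ↦ ?_⟩
  rw [Gop_eq]
  exact hCb ζ hζ _ _ (isMult_symb_inv hζ.one_le) f hf.integrable hχ (integrable_gHat hk hζ hf)

/-- A derivative of `G_ζ f` costs the decay in `|ζ|`, but remains bounded. -/
theorem exists_sobN_mul_D_Gop_le {k : ℝ} (hk : 0 < k) {l : ℕ} (hl : 1 ≤ l) {V : E3 → ℂ}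
    (hV : ContDiff ℝ l V) (hVs : HasCompactSupport V) (χ : 𝓢(E3, ℂ)) :
    ∃ C : ℝ≥0∞, C ≠ ∞ ∧ ∀ ζ : C3, Adm k ζ → ∀ f : E3 → ℂ, Src l f → (∀ x, χ x * f x = f x) →
      ∀ j, sobN l (fun x ↦ V x * D j (Gop ζ f) x) ≤ C * sobN l f := by
  obtain ⟨C, hC, hCb⟩ := exists_sobN_mul_mult_le hk l hV hVs χ
  refine ⟨C * 4, ENNReal.mul_ne_top hC (by simp), fun ζ hζ f hf hχ j ↦ ?_⟩
  have hi := integrable_dSymb_mul_gHat hk hζ hl hf j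
  rw [D_Gop hk hζ hl hf]
  simp only [gHat, ← mul_assoc] at hi ⊢
  exact hCb ζ hζ _ _ (isMult_dSymb_mul hζ.one_le j) f hf.integrable hχ hi

theorem Src.mul_Gop {k : ℝ} (hk : 0 < k) {ζ : C3} (hζ : Adm k ζ) {l : ℕ} {V : E3 → ℂ}
    (hV : ContDiff ℝ l V) (hVs : HasCompactSupport V) {f : E3 → ℂ} (hf : Src l f) :
    Src l (fun x ↦ V x * Gop ζ f x) := by
  obtain ⟨χ, -, hχ⟩ := exists_schwartz_bump_eq_one_on hf.supp
  obtain ⟨C, hC, hCb⟩ := exists_sobN_mul_Gop_le hk l hV hVs χ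
  refine ⟨hV.continuous.mul (continuous_Gop hk hζ hf), hVs.mul_right, ne_top_of_le_ne_top
    (ENNReal.mul_ne_top (ENNReal.mul_ne_top hC ?_) hf.fin) (hCb ζ hζ f hf hχ)⟩
  rw [ENNReal.inv_ne_top]
  have := hζ.one_le
  simp only [ne_eq, ENNReal.ofReal_eq_zero, not_le]
  linarith

/-- For large frequencies, systems `f = f₀ + V (G_ζ f)` with compactly supported coefficients are
solved by the Neumann series. -/
theorem exists_system_solution {k : ℝ} (hk : 0 < k) (l : ℕ) {ι : Type*} [Fintype ι]
    {V : ι → ι → E3 → ℂ} (hV : ∀ i j, ContDiff ℝ l (V i j)) {χ : 𝓢(E3, ℂ)}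
    (hχs : HasCompactSupport χ) (hχV : ∀ i j x, χ x * V i j x = V i j x) :
    ∃ c : ℝ, ∀ ζ : C3, Adm k ζ → c ≤ ‖ζ‖ → ∀ f0 : ι → E3 → ℂ, (∀ i, Src l (f0 i)) →
      (∀ i x, χ x * f0 i x = f0 i x) →
      ∃ f : ι → E3 → ℂ, (∀ i, Src l (f i)) ∧ (∀ i x, χ x * f i x = f i x) ∧
        (∀ i x, f i x = f0 i x + ∑ j, V i j x * Gop ζ (f j) x) ∧
        ∑ i, sobN l (f i) ≤ 2 * ∑ i, sobN l (f0 i) := by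
  classical
  have hVs : ∀ i j, HasCompactSupport (V i j) := fun i j ↦ by
    have : V i j = fun x ↦ χ x * V i j x := by ext x; rw [hχV]
    rw [this]; exact hχs.mul_right
  choose C hC hCb using fun i j ↦ exists_sobN_mul_Gop_le hk l (hV i j) (hVs i j) χ
  set Ct := ∑ i, ∑ j, C i j with hCt
  have hCtt : Ct ≠ ∞ := ENNReal.sum_ne_top.2 fun i _ ↦ ENNReal.sum_ne_top.2 fun j _ ↦ hC i j
  refine ⟨2 * Ct.toReal, fun ζ hζ hc f0 hf0 hχf0 ↦ ?_⟩
  have hsmall : Ct * (ENNReal.ofReal ‖ζ‖)⁻¹ ≤ 2⁻¹ := by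
    have hpos : 0 < ‖ζ‖ := lt_of_lt_of_le one_pos hζ.one_le
    rw [← ENNReal.ofReal_toReal hCtt, ← ENNReal.ofReal_inv_of_pos hpos,
      ← ENNReal.ofReal_mul ENNReal.toReal_nonneg,
      show (2⁻¹ : ℝ≥0∞) = ENNReal.ofReal (2⁻¹ : ℝ) by
        rw [ENNReal.ofReal_inv_of_pos two_pos]; simp]
    refine ENNReal.ofReal_le_ofReal ?_
    rw [← div_eq_mul_inv, div_le_iff₀ hpos]
    linarith
  -- The terms of the Neumann series, `F n = (V G_ζ)ⁿ f₀`, halve in norm by the choice of the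
  -- threshold for `|ζ|`.
  let F : ℕ → ι → E3 → ℂ := fun n ↦ Nat.rec f0 (fun _ g i x ↦ ∑ j, V i j x * Gop ζ (g j) x) n
  have hF0 : F 0 = f0 := rfl
  have hFs : ∀ n i x, F (n + 1) i x = ∑ j, V i j x * Gop ζ (F n j) x := fun n i x ↦ rfl
  have hFsrc : ∀ n i, Src l (F n i) := by
    intro n
    induction n with
    | zero => exact hf0
    | succ n ih => exact fun i ↦ Src.sum _ fun j _ ↦ (ih j).mul_Gop hk hζ (hV i j) (hVs i j)
  have hFχ : ∀ n i x, χ x * F n i x = F n i x := by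
    intro n
    induction n with
    | zero => exact hχf0
    | succ n ih =>
      intro i x
      rw [hFs, Finset.mul_sum]
      exact Finset.sum_congr rfl fun j _ ↦ mul_eq_of_cutoff (hχV i j) _ x
  set A := ∑ i, sobN l (f0 i) with hA
  have hAt : A ≠ ∞ := ENNReal.sum_ne_top.2 fun i _ ↦ (hf0 i).fin
  have hFn : ∀ n, ∑ i, sobN l (F n i) ≤ 2⁻¹ ^ n * A := by
    intro n
    induction n with
    | zero => simp [hF0, hA]
    | succ n ih =>
      calc ∑ i, sobN l (F (n + 1) i)
          ≤ ∑ i, ∑ j, C i j * (ENNReal.ofReal ‖ζ‖)⁻¹ * ∑ j', sobN l (F n j') := by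
            refine Finset.sum_le_sum fun i _ ↦ ?_
            refine (sobN_sum_le (f := fun j x ↦ V i j x * Gop ζ (F n j) x) l _ fun j _ ↦
              ((hFsrc n j).mul_Gop hk hζ (hV i j) (hVs i j)).integrable).trans
              (Finset.sum_le_sum fun j _ ↦ ?_)
            refine (hCb i j ζ hζ _ (hFsrc n j) (hFχ n j)).trans (mul_le_mul' le_rfl ?_)
            exact Finset.single_le_sum (f := fun j ↦ sobN l (F n j)) (fun _ _ ↦ zero_le)
              (Finset.mem_univ j)
        _ = Ct * (ENNReal.ofReal ‖ζ‖)⁻¹ * ∑ j', sobN l (F n j') := by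
            rw [hCt, Finset.sum_mul, Finset.sum_mul]
            refine Finset.sum_congr rfl fun i _ ↦ ?_
            rw [Finset.sum_mul, Finset.sum_mul]
        _ ≤ 2⁻¹ * (2⁻¹ ^ n * A) := mul_le_mul' hsmall ih
        _ = _ := by rw [pow_succ]; ring
  obtain ⟨r, hr⟩ := exists_vanishOff hχs
  have hFr : ∀ n i, VanishOff r (F n i) := fun n i x hx ↦ by
    rw [← hFχ, hr x hx, zero_mul]
  -- uniform geometric bound for the terms of the series
  obtain ⟨M, hM0, hM⟩ : ∃ M : ℝ, 0 ≤ M ∧ ∀ n i x, ‖F n i x‖ ≤ M * (1 / 2) ^ n := by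
    obtain ⟨CG, hCG, hCGb⟩ := exists_enorm_Gop_le_sobN hk hζ r
    choose M0 hM0 using fun i ↦ (hf0 i).supp.exists_bound_of_continuous (hf0 i).cont
    choose MV hMV using fun i j ↦ (hVs i j).exists_bound_of_continuous (hV i j).continuous
    set B : ℝ := ∑ i, ∑ j, |MV i j| * (CG * A).toReal with hB
    have hB0 : 0 ≤ B := Finset.sum_nonneg fun i _ ↦ Finset.sum_nonneg fun j _ ↦ by positivity
    refine ⟨∑ i, |M0 i| + 2 * B, add_nonneg (Finset.sum_nonneg fun i _ ↦ abs_nonneg _)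
      (by positivity), fun n i x ↦ ?_⟩
    rcases n with _ | n
    · rw [hF0, pow_zero, mul_one]
      have h1 : |M0 i| ≤ ∑ i, |M0 i| :=
        Finset.single_le_sum (f := fun i ↦ |M0 i|) (fun _ _ ↦ abs_nonneg _) (Finset.mem_univ i)
      linarith [hM0 i x, le_abs_self (M0 i)]
    · have hG : ∀ j, ‖Gop ζ (F n j) x‖ ≤ (CG * A).toReal * (1 / 2) ^ n := by
        intro j
        have h1 : ‖Gop ζ (F n j) x‖ₑ ≤ CG * A * 2⁻¹ ^ n := by
          refine (hCGb _ (hFsrc n j).cont (hFr n j) x).trans ?_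
          calc CG * sobN 0 (F n j) ≤ CG * (2⁻¹ ^ n * A) := by
                refine mul_le_mul' le_rfl ((sobN_mono (Nat.cast_nonneg l) _).trans
                  (le_trans ?_ (hFn n)))
                exact Finset.single_le_sum (f := fun j ↦ sobN l (F n j)) (fun _ _ ↦ zero_le)
                  (Finset.mem_univ j)
            _ = _ := by ring
        have h2 := ENNReal.toReal_mono
          (ENNReal.mul_ne_top (ENNReal.mul_ne_top hCG hAt) (by simp)) h1
        rw [toReal_enorm, ENNReal.toReal_mul] at h2
        simpa using h2
      rw [hFs]
      calc ‖∑ j, V i j x * Gop ζ (F n j) x‖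
          ≤ ∑ j, |MV i j| * ((CG * A).toReal * (1 / 2) ^ n) := by
            refine (norm_sum_le _ _).trans (Finset.sum_le_sum fun j _ ↦ ?_)
            rw [norm_mul]
            gcongr
            · exact (hMV i j x).trans (le_abs_self _)
            · exact hG j
        _ = (∑ j, |MV i j| * (CG * A).toReal) * (1 / 2) ^ n := by
            rw [Finset.sum_mul]
            exact Finset.sum_congr rfl fun j _ ↦ by ring
        _ ≤ B * (1 / 2) ^ n := by
            gcongr
            exact Finset.single_le_sum (f := fun i ↦ ∑ j, |MV i j| * (CG * A).toReal)
              (fun _ _ ↦ Finset.sum_nonneg fun j _ ↦ by positivity) (Finset.mem_univ i)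
        _ = 2 * B * (1 / 2) ^ (n + 1) := by ring
        _ ≤ _ := by
            gcongr
            have : 0 ≤ ∑ i, |M0 i| := Finset.sum_nonneg fun i _ ↦ abs_nonneg _
            linarith
  have hsum : Summable fun n : ℕ ↦ M * (1 / 2 : ℝ) ^ n :=
    (summable_geometric_of_lt_one (by norm_num) (by norm_num)).mul_left M
  -- The series converges uniformly, and its Sobolev norm is controlled by Fatou's lemma for the
  -- partial sums `S N`.
  let f : ι → E3 → ℂ := fun i x ↦ ∑' n, F n i x
  let S : ℕ → ι → E3 → ℂ := fun N i x ↦ ∑ n ∈ Finset.range N, F n i x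
  have hSsrc : ∀ N i, Src l (S N i) := fun N i ↦ Src.sum _ fun n _ ↦ hFsrc n i
  have hunif : ∀ i, TendstoUniformly (fun N ↦ S N i) (f i) Filter.atTop := fun i ↦
    tendstoUniformly_tsum_nat hsum fun n x ↦ hM n i x
  have hfr : ∀ i, VanishOff r (f i) := fun i x hx ↦ by
    simp only [f]
    simp_rw [hFr _ i x hx]
    exact tsum_zero
  have hSr : ∀ N i, VanishOff r (S N i) := fun N i x hx ↦
    Finset.sum_eq_zero fun n _ ↦ hFr n i x hx
  have hfc : ∀ i, Continuous (f i) := fun i ↦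
    continuous_tsum (fun n ↦ (hFsrc n i).cont) hsum fun n x ↦ hM n i x
  have hfn : ∀ i, sobN l (f i) ≤ ∑' n, sobN l (F n i) := fun i ↦ by
    refine sobN_le_of_tendsto (Fn := fun N ↦ S N i)
      (fun N ↦ continuous_fourier (hSsrc N i).integrable)
      (tendsto_fourier_of_uniform (hfc i) (fun N ↦ (hSsrc N i).cont) (hfr i) (fun N ↦ hSr N i)
        (hunif i)) fun N ↦ ?_
    exact (sobN_sum_le l _ fun n _ ↦ (hFsrc n i).integrable).trans
      (ENNReal.sum_le_tsum (Finset.range N))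
  have htot : ∑ i, sobN l (f i) ≤ 2 * A := by
    calc _ ≤ ∑ i, ∑' n, sobN l (F n i) := Finset.sum_le_sum fun i _ ↦ hfn i
      _ = ∑' n, ∑ i, sobN l (F n i) :=
          (Summable.tsum_finsetSum fun _ _ ↦ ENNReal.summable).symm
      _ ≤ ∑' n : ℕ, 2⁻¹ ^ n * A := ENNReal.tsum_le_tsum hFn
      _ = 2 * A := by
          rw [ENNReal.tsum_mul_right, ENNReal.tsum_geometric, ENNReal.one_sub_inv_two, inv_inv]
  have hfsrc : ∀ i, Src l (f i) := fun i ↦ ⟨hfc i, (hfr i).hasCompactSupport, by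
    refine ne_top_of_le_ne_top (ENNReal.mul_ne_top (by simp) hAt) (le_trans ?_ htot)
    exact Finset.single_le_sum (f := fun i ↦ sobN l (f i)) (fun _ _ ↦ zero_le) (Finset.mem_univ i)⟩
  refine ⟨f, hfsrc, fun i x ↦ ?_, fun i x ↦ ?_, htot⟩
  · simp only [f]
    rw [← tsum_mul_left]
    exact tsum_congr fun n ↦ hFχ n i x
  -- The partial sums satisfy `S (N + 1) = f₀ + V (G_ζ (S N))`; pass to the limit.
  · have h1 : ∀ N, S (N + 1) i x = f0 i x + ∑ j, V i j x * Gop ζ (S N j) x := by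
      intro N
      have h2 : ∀ j, Gop ζ (S N j) x = ∑ n ∈ Finset.range N, Gop ζ (F n j) x := fun j ↦
        Gop_sum hk hζ _ (fun n _ ↦ hFsrc n j) x
      simp only [S] at h2 ⊢
      simp_rw [h2, Finset.mul_sum]
      rw [Finset.sum_range_succ', hF0, add_comm, Finset.sum_comm]
    refine tendsto_nhds_unique (((hunif i).tendsto_at x).comp (Filter.tendsto_add_atTop_nat 1)) ?_
    simp only [Function.comp_def, h1]
    refine tendsto_const_nhds.add (tendsto_finsetSum _ fun j _ ↦ ?_)
    exact (tendsto_Gop_of_uniform hk hζ (hfsrc j) (fun N ↦ hSsrc N j) (hfr j) (fun N ↦ hSr N j)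
      (hunif j) x).const_mul _

/-! ### Calculus of weak identities -/

/-- An integrable function with vanishing integral. Weak identities are stated in this form, so that
they can be combined linearly. -/
def ZeroInt (f : E3 → ℂ) : Prop := Integrable f ∧ ∫ x, f x = 0

theorem ZeroInt.congr {f g : E3 → ℂ} (h : ZeroInt f) (hfg : ∀ x, g x = f x) : ZeroInt g := by
  have : g = f := funext hfg
  rwa [this]

theorem ZeroInt.add {f g : E3 → ℂ} (h : ZeroInt f) (h' : ZeroInt g) :
    ZeroInt (fun x ↦ f x + g x) :=
  ⟨h.1.add h'.1, by rw [integral_add h.1 h'.1, h.2, h'.2, add_zero]⟩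

theorem ZeroInt.const_mul {f : E3 → ℂ} (h : ZeroInt f) (c : ℂ) : ZeroInt (fun x ↦ c * f x) :=
  ⟨h.1.const_mul c, by rw [integral_const_mul, h.2, mul_zero]⟩

theorem ZeroInt.sub {f g : E3 → ℂ} (h : ZeroInt f) (h' : ZeroInt g) :
    ZeroInt (fun x ↦ f x - g x) :=
  ⟨h.1.sub h'.1, by rw [integral_sub h.1 h'.1, h.2, h'.2, sub_zero]⟩

theorem ZeroInt.sum {ι : Type*} (t : Finset ι) {f : ι → E3 → ℂ} (h : ∀ i ∈ t, ZeroInt (f i)) :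
    ZeroInt (fun x ↦ ∑ i ∈ t, f i x) :=
  ⟨integrable_finsetSum t fun i hi ↦ (h i hi).1, by
    rw [integral_finsetSum t fun i hi ↦ (h i hi).1]
    exact Finset.sum_eq_zero fun i hi ↦ (h i hi).2⟩

/-- The conjugated derivative `∂_j + iζ_j = e^{-iζ·x} ∂_j e^{iζ·x}`. -/
noncomputable def Dz (ζ : C3) (j : Fin 3) (f : E3 → ℂ) (x : E3) : ℂ :=
  D j f x + Complex.I * ζ j * f x

theorem continuous_Dz (ζ : C3) (j : Fin 3) {f : E3 → ℂ} (hf : ContDiff ℝ 1 f) :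
    Continuous (Dz ζ j f) :=
  (continuous_D hf j).add (continuous_const.mul hf.continuous)

theorem contDiff_Dz (ζ : C3) (j : Fin 3) {n : ℕ} {f : E3 → ℂ} (hf : ContDiff ℝ (n + 1 : ℕ) f) :
    ContDiff ℝ n (Dz ζ j f) :=
  (contDiff_D hf j).add (contDiff_const.mul (hf.of_le (by norm_cast; omega)))

theorem hasCompactSupport_Dz (ζ : C3) (j : Fin 3) {f : E3 → ℂ} (hf : HasCompactSupport f) :
    HasCompactSupport (Dz ζ j f) :=
  (hasCompactSupport_D hf j).add hf.mul_left

theorem Dz_mul (ζ : C3) (j : Fin 3) {a f : E3 → ℂ} (ha : ContDiff ℝ 1 a) (hf : ContDiff ℝ 1 f)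
    (x : E3) : Dz ζ j (fun y ↦ a y * f y) x = D j a x * f x + a x * Dz ζ j f x := by
  unfold Dz
  rw [D_mul (ha.differentiable one_ne_zero x) (hf.differentiable one_ne_zero x)]
  ring

theorem D_add {f g : E3 → ℂ} (hf : ContDiff ℝ 1 f) (hg : ContDiff ℝ 1 g) (j : Fin 3) (x : E3) :
    D j (fun y ↦ f y + g y) x = D j f x + D j g x := by
  unfold D
  rw [fderiv_fun_add (hf.differentiable one_ne_zero x) (hg.differentiable one_ne_zero x)]
  rfl

theorem D_const_mul (c : ℂ) {f : E3 → ℂ} (hf : ContDiff ℝ 1 f) (j : Fin 3) (x : E3) :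
    D j (fun y ↦ c * f y) x = c * D j f x := by
  unfold D
  rw [fderiv_const_mul (hf.differentiable one_ne_zero x)]
  rfl

theorem D_const (c : ℂ) (j : Fin 3) (x : E3) : D j (fun _ ↦ c) x = 0 := by
  simp [D]

/-- Partial derivatives commute. -/
theorem D_comm {f : E3 → ℂ} (hf : ContDiff ℝ 2 f) (i j : Fin 3) (x : E3) :
    D i (D j f) x = D j (D i f) x := by
  have h1 : Differentiable ℝ (fderiv ℝ f) :=
    (hf.fderiv_right (m := 1) (by norm_num)).differentiable one_ne_zero
  have h2 : ∀ i j, D i (D j f) x = fderiv ℝ (fderiv ℝ f) x (e i) (e j) := by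
    intro i j
    unfold D
    rw [fderiv_clm_apply (h1 x) (differentiableAt_const _)]
    simp
  rw [h2, h2]
  exact (hf.contDiffAt.isSymmSndFDerivAt (by simp)) _ _

theorem Dz_comm (ζ : C3) {f : E3 → ℂ} (hf : ContDiff ℝ 2 f) (i j : Fin 3) (x : E3) :
    Dz ζ i (Dz ζ j f) x = Dz ζ j (Dz ζ i f) x := by
  have h1 : ContDiff ℝ 1 f := hf.of_le (by norm_num)
  have h2 : ∀ j, ContDiff ℝ 1 (D j f) := fun j ↦ by
    exact_mod_cast contDiff_D (n := 1) (by exact_mod_cast hf) j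
  have h3 : ∀ i j, Dz ζ i (Dz ζ j f) x = D i (D j f) x + Complex.I * ζ j * D i f x +
      Complex.I * ζ i * (D j f x + Complex.I * ζ j * f x) := by
    intro i j
    have : Dz ζ j f = fun y ↦ D j f y + Complex.I * ζ j * f y := rfl
    rw [this]
    unfold Dz
    rw [D_add (h2 j) (contDiff_const.mul h1), D_const_mul _ h1]
  rw [h3, h3, D_comm hf i j]
  ring

/-- Integration by parts. -/
theorem zeroInt_Dz (ζ : C3) (j : Fin 3) {u φ : E3 → ℂ} (hu : ContDiff ℝ 1 u)
    (hφ : ContDiff ℝ 1 φ) (hs : HasCompactSupport φ) :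
    ZeroInt (fun x ↦ Dz ζ j u x * φ x + u x * Dz (-ζ) j φ x) := by
  have h1 : Integrable (fun x ↦ fderiv ℝ u x (e j) * φ x) :=
    ((continuous_D hu j).mul hφ.continuous).integrable_of_hasCompactSupport hs.mul_left
  have h2 : Integrable (fun x ↦ u x * fderiv ℝ φ x (e j)) :=
    (hu.continuous.mul (continuous_D hφ j)).integrable_of_hasCompactSupport
      (hasCompactSupport_D hs j).mul_left
  have h3 : Integrable (fun x ↦ u x * φ x) :=
    (hu.continuous.mul hφ.continuous).integrable_of_hasCompactSupport hs.mul_left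
  have h := integral_mul_fderiv_eq_neg_fderiv_mul_of_integrable h1 h2 h3
    (fun x _ ↦ hu.differentiable one_ne_zero x) (fun x _ ↦ hφ.differentiable one_ne_zero x)
  have h4 : ZeroInt (fun x ↦ fderiv ℝ u x (e j) * φ x + u x * fderiv ℝ φ x (e j)) :=
    ⟨h1.add h2, by rw [integral_add h1 h2, h]; ring⟩
  refine h4.congr fun x ↦ ?_
  simp only [Dz, D, PiLp.neg_apply]
  ring

/-- Test functions. -/
structure IsTest (φ : E3 → ℂ) : Prop where
  smooth : ContDiff ℝ ((⊤ : ℕ∞) : WithTop ℕ∞) φ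
  supp : HasCompactSupport φ

theorem IsTest.contDiff {φ : E3 → ℂ} (h : IsTest φ) (n : ℕ) : ContDiff ℝ n φ :=
  h.smooth.of_le (by exact_mod_cast le_top)

theorem IsTest.contDiff_one {φ : E3 → ℂ} (h : IsTest φ) : ContDiff ℝ 1 φ := by
  exact_mod_cast h.contDiff 1

theorem IsTest.D {φ : E3 → ℂ} (h : IsTest φ) (j : Fin 3) : IsTest (D j φ) :=
  ⟨(h.smooth.fderiv_right (m := ((⊤ : ℕ∞) : WithTop ℕ∞)) (by exact_mod_cast le_top)).clm_apply
    contDiff_const, hasCompactSupport_D h.supp j⟩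

theorem IsTest.add {φ ψ : E3 → ℂ} (h : IsTest φ) (h' : IsTest ψ) : IsTest fun x ↦ φ x + ψ x :=
  ⟨h.smooth.add h'.smooth, h.supp.add h'.supp⟩

theorem IsTest.const_mul {φ : E3 → ℂ} (h : IsTest φ) (c : ℂ) : IsTest fun x ↦ c * φ x :=
  ⟨contDiff_const.mul h.smooth, h.supp.mul_left⟩

theorem IsTest.sum {ι : Type*} [Fintype ι] {φ : ι → E3 → ℂ} (h : ∀ i, IsTest (φ i)) :
    IsTest fun x ↦ ∑ i, φ i x := by
  refine ⟨ContDiff.sum fun i _ ↦ (h i).smooth, ?_⟩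
  choose r hr using fun i ↦ exists_vanishOff (h i).supp
  have : VanishOff (∑ i, |r i|) fun x ↦ ∑ i, φ i x := fun x hx ↦
    Finset.sum_eq_zero fun i _ ↦ hr i x (lt_of_le_of_lt ((le_abs_self _).trans
      (Finset.single_le_sum (f := fun i ↦ |r i|) (fun _ _ ↦ abs_nonneg _) (Finset.mem_univ i))) hx)
  exact this.hasCompactSupport

theorem IsTest.Dz {φ : E3 → ℂ} (h : IsTest φ) (ζ : C3) (j : Fin 3) : IsTest (Dz ζ j φ) :=
  (h.D j).add (h.const_mul _)

theorem IsTest.src {φ : E3 → ℂ} (h : IsTest φ) (l : ℕ) : Src l φ :=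
  Src.of_contDiff (h.contDiff l) h.supp

theorem IsTest.exists_schwartz {φ : E3 → ℂ} (h : IsTest φ) : ∃ ψ : 𝓢(E3, ℂ), (ψ : E3 → ℂ) = φ :=
  ⟨h.supp.toSchwartzMap h.smooth, rfl⟩

theorem integrable_mul_of_locallyIntegrable {g φ : E3 → ℂ} (hg : LocallyIntegrable g)
    (hφ : Continuous φ) (hs : HasCompactSupport φ) : Integrable (fun x ↦ g x * φ x) := by
  have := hg.integrable_smul_right_of_hasCompactSupport hφ hs
  simpa [mul_comm] using this

/-- A first-order weak identity for smooth test functions extends to `C¹` test functions. -/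
theorem zeroInt_extend (ζ : C3) {F : Fin 3 → E3 → ℂ} {g : E3 → ℂ}
    (hF : ∀ j, LocallyIntegrable (F j)) (hg : LocallyIntegrable g)
    (h : ∀ φ, IsTest φ → ZeroInt (fun x ↦ ∑ j, F j x * Dz ζ j φ x + g x * φ x)) {φ : E3 → ℂ}
    (hφ : ContDiff ℝ 1 φ) (hs : HasCompactSupport φ) :
    ZeroInt (fun x ↦ ∑ j, F j x * Dz ζ j φ x + g x * φ x) := by
  obtain ⟨φn, h1, ⟨r, hr, hrn⟩, h2, -, h3⟩ := exists_mollify hφ.continuous hs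
  have hT : ∀ n, IsTest (φn n) := fun n ↦ ⟨h1 n, (hrn n).hasCompactSupport⟩
  have hi : ∀ ψ : E3 → ℂ, ContDiff ℝ 1 ψ → HasCompactSupport ψ →
      (∀ j, Integrable (fun x ↦ F j x * Dz ζ j ψ x)) ∧ Integrable (fun x ↦ g x * ψ x) :=
    fun ψ hψ hψs ↦ ⟨fun j ↦ integrable_mul_of_locallyIntegrable (hF j) (continuous_Dz ζ j hψ)
      (hasCompactSupport_Dz ζ j hψs), integrable_mul_of_locallyIntegrable hg hψ.continuous hψs⟩
  have heq : ∀ ψ : E3 → ℂ, ContDiff ℝ 1 ψ → HasCompactSupport ψ →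
      ∫ x, (∑ j, F j x * Dz ζ j ψ x + g x * ψ x) =
        (∑ j, ∫ x, F j x * Dz ζ j ψ x) + ∫ x, g x * ψ x := by
    intro ψ hψ hψs
    rw [integral_add (integrable_finsetSum _ fun j _ ↦ (hi ψ hψ hψs).1 j) (hi ψ hψ hψs).2,
      integral_finsetSum _ fun j _ ↦ (hi ψ hψ hψs).1 j]
  refine ⟨(integrable_finsetSum _ fun j _ ↦ (hi φ hφ hs).1 j).add (hi φ hφ hs).2, ?_⟩
  have hu : ∀ j, TendstoUniformly (fun n ↦ Dz ζ j (φn n)) (Dz ζ j φ) Filter.atTop := by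
    intro j
    rw [Metric.tendstoUniformly_iff]
    intro ε hε
    have hc : 0 < ‖Complex.I * ζ j‖ + 1 := by positivity
    filter_upwards [Metric.tendstoUniformly_iff.1 (h3 hφ j) (ε / 2) (by positivity),
      Metric.tendstoUniformly_iff.1 h2 (ε / (2 * (‖Complex.I * ζ j‖ + 1))) (by positivity)]
      with n hn1 hn2 x
    have e1 := hn1 x
    have e2 := hn2 x
    rw [dist_eq_norm] at e1 e2 ⊢
    have h4 : Dz ζ j φ x - Dz ζ j (φn n) x =
        (D j φ x - D j (φn n) x) + Complex.I * ζ j * (φ x - φn n x) := by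
      unfold Dz; ring
    rw [h4]
    refine lt_of_le_of_lt (norm_add_le _ _) ?_
    rw [norm_mul]
    have h5 : ‖Complex.I * ζ j‖ * ‖φ x - φn n x‖ ≤
        (‖Complex.I * ζ j‖ + 1) * (ε / (2 * (‖Complex.I * ζ j‖ + 1))) := by
      gcongr
      linarith
    have h6 : (‖Complex.I * ζ j‖ + 1) * (ε / (2 * (‖Complex.I * ζ j‖ + 1))) = ε / 2 := by
      field_simp
    linarith
  -- Mollify `φ`: the values and first derivatives converge uniformly with supports in a fixed
  -- ball.
  have hlim : Filter.Tendsto (fun n ↦ (∑ j, ∫ x, F j x * Dz ζ j (φn n) x) + ∫ x, g x * φn n x)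
      Filter.atTop (nhds ((∑ j, ∫ x, F j x * Dz ζ j φ x) + ∫ x, g x * φ x)) := by
    refine (tendsto_finsetSum _ fun j _ ↦ ?_).add ?_
    · refine tendsto_integral_mul_of_uniform (r := r) (hF j) (continuous_Dz ζ j hφ)
        (fun n ↦ continuous_Dz ζ j (hT n).contDiff_one) ?_ (fun n ↦ ?_) (hu j)
      · intro x hx
        simp [Dz, hr.D j x hx, hr x hx]
      · intro x hx
        simp [Dz, (hrn n).D j x hx, hrn n x hx]
    · exact tendsto_integral_mul_of_uniform hg hφ.continuous (fun n ↦ (h1 n).continuous) hr hrn h2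
  rw [heq φ hφ hs]
  refine tendsto_nhds_unique hlim ?_
  have h0 : ∀ n, (∑ j, ∫ x, F j x * Dz ζ j (φn n) x) + ∫ x, g x * φn n x = 0 := fun n ↦ by
    rw [← heq _ (hT n).contDiff_one (hT n).supp]
    exact (h _ (hT n)).2
  simp only [h0]
  exact tendsto_const_nhds

/-! ### The equation satisfied by `Gop` -/

/-- The zeros of the symbol lie in the plane orthogonal to `Im ζ`, which is not zero. -/
theorem Adm.ae_symb_ne_zero {k : ℝ} (hk : 0 < k) {ζ : C3} (hζ : Adm k ζ) :
    ∀ᵐ ξ, symb ζ ξ ≠ 0 := by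
  have h0 : imPart ζ ≠ 0 := by
    intro h
    have h1 := hζ.norm_le_two_im hk
    rw [h, norm_zero] at h1
    linarith [hζ.one_le]
  let S : Submodule ℝ E3 := LinearMap.ker (innerₗ E3 (imPart ζ))
  have hS : S ≠ ⊤ := by
    intro h
    have h1 : imPart ζ ∈ S := h ▸ Submodule.mem_top
    have h2 : inner ℝ (imPart ζ) (imPart ζ) = 0 := h1
    exact h0 (inner_self_eq_zero.1 h2)
  refine measure_mono_null (fun ξ hξ ↦ ?_) (Measure.addHaar_submodule volume S hS)
  have h1 : symb ζ ξ = 0 := by simpa using hξ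
  have h2 := symb_im ζ ξ
  rw [h1, Complex.zero_im, inner_smul_right] at h2
  change inner ℝ (imPart ζ) ξ = 0
  have := Real.pi_pos
  by_contra h3
  have : (2 * (2 * Real.pi * inner ℝ (imPart ζ) ξ)) ≠ 0 := by positivity
  exact this h2.symm

theorem fourierInv_congr_ae {f g : E3 → ℂ} (h : f =ᵐ[volume] g) : 𝓕⁻ f = 𝓕⁻ g := by
  ext x
  rw [Real.fourierInv_eq, Real.fourierInv_eq]
  refine integral_congr_ae ?_
  filter_upwards [h] with ξ hξ
  rw [hξ]

theorem IsTest.fourierInv_fourier {f : E3 → ℂ} (hf : IsTest f) : 𝓕⁻ (𝓕 f) = f := by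
  obtain ⟨ψ, rfl⟩ := hf.exists_schwartz
  exact schwartz_fourierInv_fourier ψ

/-- The transpose of `Gop ζ` is `Gop (-ζ)`. -/
theorem integral_Gop_mul {k : ℝ} (hk : 0 < k) {ζ : C3} (hζ : Adm k ζ) {l : ℕ} {f h : E3 → ℂ}
    (hf : Src l f) (hh : Src l h) :
    ∫ x, Gop ζ f x * h x = ∫ x, f x * Gop (-ζ) h x := by
  have h1 := integrable_gHat hk hζ hf
  have h2 := (integrable_gHat hk hζ.neg hh).comp_neg
  rw [Gop_eq, integral_fourierInv_mul_flip h1 hh.integrable, Gop_eq,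
    Real.fourierInv_eq_fourier_comp_neg (gHat (-ζ) h), ← integral_fourier_mul_flip hf.integrable h2]
  congr 1; ext ξ
  rw [gHat, gHat, symb_neg, Real.fourierInv_eq_fourier_neg]
  ring

theorem fourier_Dz (ζ : C3) {f : E3 → ℂ} (hf : ContDiff ℝ 1 f) (hs : HasCompactSupport f)
    (j : Fin 3) (ξ : E3) : 𝓕 (Dz ζ j f) ξ = (dSymb j ξ + Complex.I * ζ j) * 𝓕 f ξ := by
  have h1 : Integrable (D j f) :=
    (continuous_D hf j).integrable_of_hasCompactSupport (hasCompactSupport_D hs j)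
  have h2 : Integrable f := hf.continuous.integrable_of_hasCompactSupport hs
  change 𝓕 (fun x ↦ D j f x + Complex.I * ζ j * f x) ξ = _
  rw [fourier_add' h1 (h2.const_mul _), fourier_const_mul, fourier_D_of_hasCompactSupport hf hs]
  ring

/-- The operator `∑ (∂_j + iζ_j)² + k²`, which is `Δ + 2iζ·∇` if `ζ·ζ = k²`. -/
noncomputable def helm (k : ℝ) (ζ : C3) (f : E3 → ℂ) (x : E3) : ℂ :=
  ∑ j, Dz ζ j (Dz ζ j f) x + (k : ℂ) ^ 2 * f x

theorem IsTest.helm {f : E3 → ℂ} (hf : IsTest f) (k : ℝ) (ζ : C3) : IsTest (helm k ζ f) :=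
  (IsTest.sum fun j ↦ (hf.Dz ζ j).Dz ζ j).add (hf.const_mul _)

/-- The operator `helm k ζ` has the symbol `-symb ζ`. -/
theorem sum_sq_dSymb_add {k : ℝ} {ζ : C3} (hζ : Adm k ζ) (ξ : E3) :
    ∑ j, (dSymb j ξ + Complex.I * ζ j) ^ 2 + (k : ℂ) ^ 2 = -symb ζ ξ := by
  have h1 := hζ.dot_self
  have h2 : ((‖(2 * Real.pi) • ξ‖ ^ 2 : ℝ) : ℂ) = ∑ j, (2 * Real.pi * (ξ j : ℂ)) ^ 2 := by
    rw [EuclideanSpace.norm_sq_eq]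
    push_cast
    refine Finset.sum_congr rfl fun j _ ↦ ?_
    rw [← Complex.ofReal_pow, Real.norm_eq_abs, sq_abs]
    simp
  rw [symb, h2, ← h1]
  simp only [dot, dotR, dSymb, Finset.mul_sum, ← Finset.sum_add_distrib, ← Finset.sum_neg_distrib,
    PiLp.smul_apply, smul_eq_mul]
  refine Finset.sum_congr rfl fun j _ ↦ ?_
  push_cast
  linear_combination (2 * Real.pi * (ξ j : ℂ) + ζ j) ^ 2 * Complex.I_sq

/-- `Gop ζ` inverts `-(Δ + 2iζ·∇)` on test functions. -/
theorem Gop_helm {k : ℝ} (hk : 0 < k) {ζ : C3} (hζ : Adm k ζ) {f : E3 → ℂ} (hf : IsTest f)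
    (x : E3) : Gop ζ (helm k ζ f) x = -f x := by
  have h1 : gHat ζ (helm k ζ f) =ᵐ[volume] fun ξ ↦ (-1) * 𝓕 f ξ := by
    filter_upwards [hζ.ae_symb_ne_zero hk] with ξ hξ
    have h2 : 𝓕 (helm k ζ f) ξ =
        (∑ j, (dSymb j ξ + Complex.I * ζ j) ^ 2 + (k : ℂ) ^ 2) * 𝓕 f ξ := by
      have hi : ∀ j, Integrable (Dz ζ j (Dz ζ j f)) := fun j ↦
        (((hf.Dz ζ j).Dz ζ j).src 0).integrable
      change 𝓕 (fun x ↦ ∑ j, Dz ζ j (Dz ζ j f) x + (k : ℂ) ^ 2 * f x) ξ = _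
      rw [fourier_add' (integrable_sum _ fun j _ ↦ hi j) ((hf.src 0).integrable.const_mul _),
        fourier_const_mul]
      have h3 : 𝓕 (fun x ↦ ∑ j, Dz ζ j (Dz ζ j f) x) ξ = ∑ j, 𝓕 (Dz ζ j (Dz ζ j f)) ξ := by
        simp only [Fin.sum_univ_three]
        rw [fourier_add' (f := fun x ↦ Dz ζ 0 (Dz ζ 0 f) x + Dz ζ 1 (Dz ζ 1 f) x)
          ((hi 0).add (hi 1)) (hi 2), fourier_add' (hi 0) (hi 1)]
      rw [h3, add_mul, Finset.sum_mul]
      congr 1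
      refine Finset.sum_congr rfl fun j _ ↦ ?_
      rw [fourier_Dz ζ (hf.Dz ζ j).contDiff_one (hf.Dz ζ j).supp,
        fourier_Dz ζ hf.contDiff_one hf.supp]
      ring
    rw [gHat, h2, sum_sq_dSymb_add hζ]
    field_simp
  rw [Gop_eq, fourierInv_congr_ae h1, fourierInv_const_mul, hf.fourierInv_fourier]
  ring

/-- The weak equation `(Δ + 2iζ·∇) (Gop ζ f) = -f`. -/
theorem zeroInt_Gop_helm {k : ℝ} (hk : 0 < k) {ζ : C3} (hζ : Adm k ζ) {l : ℕ} {f : E3 → ℂ}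
    (hf : Src l f) {φ : E3 → ℂ} (hφ : IsTest φ) :
    ZeroInt (fun x ↦ Gop ζ f x * helm k (-ζ) φ x + f x * φ x) := by
  have h1 : Integrable (fun x ↦ Gop ζ f x * helm k (-ζ) φ x) :=
    ((continuous_Gop hk hζ hf).mul (hφ.helm k _).smooth.continuous).integrable_of_hasCompactSupport
      (hφ.helm k _).supp.mul_left
  have h2 : Integrable (fun x ↦ f x * φ x) :=
    (hf.cont.mul hφ.smooth.continuous).integrable_of_hasCompactSupport hφ.supp.mul_left
  refine ⟨h1.add h2, ?_⟩
  rw [integral_add h1 h2, integral_Gop_mul hk hζ hf ((hφ.helm k _).src l),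
    ← integral_add (h2.neg.congr (.of_forall fun x ↦ ?_)) h2]
  · rw [← integral_zero E3 ℂ]
    congr 1; ext x
    rw [Gop_helm hk hζ.neg hφ]; ring
  · simp only [Pi.neg_apply]
    rw [Gop_helm hk hζ.neg hφ]; ring

/-- First-order form of the weak equation `(Δ + 2iζ·∇) (Gop ζ f) = -f`. -/
theorem zeroInt_Dz_Gop {k : ℝ} (hk : 0 < k) {ζ : C3} (hζ : Adm k ζ) {l : ℕ} (hl : 1 ≤ l)
    {f : E3 → ℂ} (hf : Src l f) {φ : E3 → ℂ} (hφ : ContDiff ℝ 1 φ) (hs : HasCompactSupport φ) :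
    ZeroInt (fun x ↦ ∑ j, Dz ζ j (Gop ζ f) x * Dz (-ζ) j φ x -
      ((k : ℂ) ^ 2 * Gop ζ f x + f x) * φ x) := by
  have hu := contDiff_Gop hk hζ hl hf
  refine (zeroInt_extend (-ζ) (F := fun j ↦ Dz ζ j (Gop ζ f))
    (g := fun x ↦ -((k : ℂ) ^ 2 * Gop ζ f x + f x))
    (fun j ↦ (continuous_Dz ζ j hu).locallyIntegrable)
    ((continuous_const.mul hu.continuous).add hf.cont).neg.locallyIntegrable
    (fun φ hφ ↦ ?_) hφ hs).congr fun x ↦ by ring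
  have h1 := ZeroInt.sum Finset.univ fun j _ ↦
    zeroInt_Dz ζ j hu (hφ.Dz (-ζ) j).contDiff_one (hφ.Dz (-ζ) j).supp
  refine (h1.sub (zeroInt_Gop_helm hk hζ hf hφ)).congr fun x ↦ ?_
  simp only [helm, Finset.sum_add_distrib, ← Finset.mul_sum]
  ring

/-! ### Growth of functions in weighted Sobolev spaces -/

/-- `u` grows, in a weak `L²` sense, at most like `r^σ`: pairings with test functions supported in
the ball of radius `r` are bounded by `C r^σ` times the `L²` norm. -/
def Growth (σ : ℝ) (u : E3 → ℂ) : Prop :=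
  ∃ C : ℝ≥0∞, C ≠ ∞ ∧ ∀ r : ℝ, 1 ≤ r → ∀ φ : E3 → ℂ, IsTest φ → VanishOff r φ →
    ‖∫ x, u x * φ x‖ₑ ≤ C * ENNReal.ofReal (r ^ σ) * eLpNorm φ 2 volume

theorem jap_mul_jap_neg (δ : ℝ) (x : E3) : jap δ x * jap (-δ) x = 1 := by
  have h : (0 : ℝ) < 1 + ‖x‖ ^ 2 := by positivity
  rw [jap, jap, ← ENNReal.ofReal_mul (by positivity), ← Real.rpow_add h]
  simp [neg_div]

theorem wNorm_eq (δ : ℝ) (w : E3 → ℂ) :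
    wNorm δ w = (∫⁻ x, (jap δ x * ‖w x‖ₑ) ^ (2 : ℝ)) ^ (1 / 2 : ℝ) := by
  have h := wNorm_sq δ w
  simp only [ENNReal.rpow_ofNat]
  rw [← h, ← ENNReal.rpow_natCast_mul]
  norm_num

/-- Duality of weighted `L²` spaces. -/
theorem enorm_integral_mul_le (δ : ℝ) {u v : E3 → ℂ} (hu : AEStronglyMeasurable u)
    (hv : AEStronglyMeasurable v) :
    ‖∫ x, u x * v x‖ₑ ≤ wNorm δ u * wNorm (-δ) v := by
  refine (enorm_integral_le_lintegral_enorm _).trans ?_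
  have h1 : ∀ x, ‖u x * v x‖ₑ = (jap δ x * ‖u x‖ₑ) * (jap (-δ) x * ‖v x‖ₑ) := by
    intro x
    rw [enorm_mul, mul_mul_mul_comm, jap_mul_jap_neg, one_mul]
  simp only [h1]
  rw [wNorm_eq, wNorm_eq]
  exact ENNReal.lintegral_mul_le_Lp_mul_Lq volume (p := 2) (q := 2)
    (Real.HolderConjugate.two_two) ((measurable_jap _).aemeasurable.mul hu.enorm)
    ((measurable_jap _).aemeasurable.mul hv.enorm)

/-- The weight `⟨x⟩^{2σ}` is dominated by `r^{2σ} + r^{2σ-2}⟨x⟩²`. -/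
theorem jap_sq_le {σ : ℝ} (h0 : 0 ≤ σ) (h1 : σ ≤ 1) {r : ℝ} (hr : 1 ≤ r) (x : E3) :
    jap σ x ^ 2 ≤ ENNReal.ofReal (r ^ σ) ^ 2 * (1 + ENNReal.ofReal ((1 + ‖x‖ ^ 2) / r ^ 2)) := by
  have hr0 : 0 < r := by linarith
  have hx : (0 : ℝ) < 1 + ‖x‖ ^ 2 := by positivity
  rw [jap, ← ENNReal.ofReal_pow (by positivity), ← ENNReal.ofReal_pow (by positivity),
    ← ENNReal.ofReal_one, ← ENNReal.ofReal_add (by norm_num) (by positivity),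
    ← ENNReal.ofReal_mul (by positivity)]
  refine ENNReal.ofReal_le_ofReal ?_
  rw [← Real.rpow_natCast, ← Real.rpow_mul hx.le, ← Real.rpow_natCast (r ^ σ),
    ← Real.rpow_mul hr0.le]
  have e1 : σ / 2 * ((2 : ℕ) : ℝ) = σ := by push_cast; ring
  have e2 : r ^ (σ * ((2 : ℕ) : ℝ)) = (r ^ 2) ^ σ := by
    rw [← Real.rpow_natCast r 2, ← Real.rpow_mul hr0.le, mul_comm]
  rw [e1, e2]
  have e3 : (1 + ‖x‖ ^ 2) ^ σ = (r ^ 2) ^ σ * ((1 + ‖x‖ ^ 2) / r ^ 2) ^ σ := by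
    rw [← Real.mul_rpow (by positivity) (by positivity)]
    congr 1
    field_simp
  rw [e3]
  gcongr
  set t := (1 + ‖x‖ ^ 2) / r ^ 2 with ht
  have ht0 : 0 ≤ t := by positivity
  rcases le_total t 1 with h | h
  · exact (Real.rpow_le_one ht0 h h0).trans (by linarith)
  · calc t ^ σ ≤ t ^ (1 : ℝ) := Real.rpow_le_rpow_of_exponent_le h h1
      _ ≤ _ := by rw [Real.rpow_one]; linarith

/-- Interpolation of the weighted norm with exponent `σ ∈ [0,1]` between the `L²` norms of `ψ`
and of the `x_j ψ`. -/
theorem wNorm_sq_le {σ : ℝ} (h0 : 0 ≤ σ) (h1 : σ ≤ 1) {r : ℝ} (hr : 1 ≤ r) {ψ : E3 → ℂ}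
    (hψ : Continuous ψ) {A : ℝ≥0∞} (hA0 : eLpNorm ψ 2 volume ≤ A)
    (hA : ∀ j : Fin 3, eLpNorm (fun x ↦ (x j : ℂ) * ψ x) 2 volume ≤ ENNReal.ofReal r * A) :
    wNorm σ ψ ^ 2 ≤ (5 * (ENNReal.ofReal (r ^ σ) * A) ^ 2) := by
  have hr0 : 0 < r := by linarith
  have hq : ENNReal.ofReal ((r ^ 2)⁻¹) * ENNReal.ofReal r ^ 2 = 1 := by
    rw [← ENNReal.ofReal_pow hr0.le, ← ENNReal.ofReal_mul (by positivity),
      inv_mul_cancel₀ (by positivity)]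
    simp
  have hq1 : ENNReal.ofReal ((r ^ 2)⁻¹) ≤ 1 := by
    rw [← ENNReal.ofReal_one]
    exact ENNReal.ofReal_le_ofReal (inv_le_one_of_one_le₀ (by nlinarith))
  -- Write `⟨x⟩²` as `1 + ∑ x_j²` in the pointwise bound.
  have hpt : ∀ x, (jap σ x * ‖ψ x‖ₑ) ^ 2 ≤ ENNReal.ofReal (r ^ σ) ^ 2 *
      (2 * ‖ψ x‖ₑ ^ 2 + ENNReal.ofReal ((r ^ 2)⁻¹) * ∑ j : Fin 3, ‖(x j : ℂ) * ψ x‖ₑ ^ 2) := by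
    intro x
    have e1 : ENNReal.ofReal ((1 + ‖x‖ ^ 2) / r ^ 2) = ENNReal.ofReal ((r ^ 2)⁻¹) +
        ENNReal.ofReal ((r ^ 2)⁻¹) * ∑ j : Fin 3, ‖(x j : ℂ)‖ₑ ^ 2 := by
      have : ∀ j : Fin 3, ‖(x j : ℂ)‖ₑ ^ 2 = ENNReal.ofReal (x j ^ 2) := by
        intro j
        rw [← ofReal_norm, ← ENNReal.ofReal_pow (norm_nonneg _), Complex.norm_real,
          Real.norm_eq_abs, sq_abs]
      simp only [this]
      rw [← ENNReal.ofReal_sum_of_nonneg fun j _ ↦ sq_nonneg _,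
        ← ENNReal.ofReal_mul (by positivity),
        ← ENNReal.ofReal_add (by positivity)
          (mul_nonneg (by positivity) (Finset.sum_nonneg fun j _ ↦ sq_nonneg _)),
        EuclideanSpace.real_norm_sq_eq]
      congr 1
      field_simp
    rw [mul_pow]
    calc _ ≤ ENNReal.ofReal (r ^ σ) ^ 2 * (1 + ENNReal.ofReal ((1 + ‖x‖ ^ 2) / r ^ 2)) *
          ‖ψ x‖ₑ ^ 2 := by gcongr; exact jap_sq_le h0 h1 hr x
      _ = ENNReal.ofReal (r ^ σ) ^ 2 * ((1 + ENNReal.ofReal ((r ^ 2)⁻¹)) * ‖ψ x‖ₑ ^ 2 +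
          ENNReal.ofReal ((r ^ 2)⁻¹) * ∑ j : Fin 3, ‖(x j : ℂ) * ψ x‖ₑ ^ 2) := by
        simp only [enorm_mul, mul_pow, ← Finset.sum_mul]
        rw [e1]; ring
      _ ≤ _ := by
        gcongr
        calc (1 + ENNReal.ofReal ((r ^ 2)⁻¹)) ≤ 1 + 1 := by gcongr
          _ = 2 := by norm_num
  have hm : ∀ j : Fin 3, Measurable fun x : E3 ↦ ‖(x j : ℂ) * ψ x‖ₑ ^ 2 := by
    intro j
    have : Continuous fun x : E3 ↦ (x j : ℂ) * ψ x := by fun_prop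
    exact (this.enorm.measurable).pow_const 2
  have hm0 : Measurable fun x : E3 ↦ ‖ψ x‖ₑ ^ 2 := hψ.enorm.measurable.pow_const 2
  rw [wNorm_sq]
  refine (lintegral_mono hpt).trans ?_
  have hms : Measurable fun x : E3 ↦ ∑ j : Fin 3, ‖(x j : ℂ) * ψ x‖ₑ ^ 2 :=
    Finset.measurable_fun_sum _ fun j _ ↦ hm j
  rw [lintegral_const_mul _ (by fun_prop), lintegral_add_left (hm0.const_mul _),
    lintegral_const_mul _ hm0, lintegral_const_mul _ hms,
    lintegral_finsetSum _ fun j _ ↦ hm j]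
  simp only [← eLpNorm_two_sq]
  have h2 : ∑ j : Fin 3, eLpNorm (fun x ↦ (x j : ℂ) * ψ x) 2 volume ^ 2 ≤
      3 * (ENNReal.ofReal r * A) ^ 2 := by
    calc _ ≤ ∑ j : Fin 3, (ENNReal.ofReal r * A) ^ 2 := by
          gcongr with j; exact hA j
      _ = _ := by simp
  calc _ ≤ ENNReal.ofReal (r ^ σ) ^ 2 * (2 * A ^ 2 + ENNReal.ofReal ((r ^ 2)⁻¹) *
        (3 * (ENNReal.ofReal r * A) ^ 2)) := by gcongr
    _ = ENNReal.ofReal (r ^ σ) ^ 2 * (2 * A ^ 2 +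
        3 * (ENNReal.ofReal ((r ^ 2)⁻¹) * ENNReal.ofReal r ^ 2) * A ^ 2) := by ring
    _ = _ := by rw [hq]; ring

theorem hasFDerivAt_besselSymbol (s : ℝ) (ξ : E3) :
    HasFDerivAt (besselSymbol s) ((s / 2 * (1 + ‖(2 * Real.pi) • ξ‖ ^ 2) ^ (s / 2 - 1)) •
      (2 * (2 * Real.pi) ^ 2) • innerSL ℝ ξ) ξ := by
  have h1 : HasFDerivAt (fun ξ : E3 ↦ 1 + ‖(2 * Real.pi) • ξ‖ ^ 2)
      ((2 * (2 * Real.pi) ^ 2) • innerSL ℝ ξ) ξ := by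
    have h2 : (fun ξ : E3 ↦ 1 + ‖(2 * Real.pi) • ξ‖ ^ 2) =
        fun ξ ↦ 1 + (2 * Real.pi) ^ 2 * ‖ξ‖ ^ 2 := by
      ext ξ
      rw [norm_smul, mul_pow, Real.norm_eq_abs, sq_abs]
    rw [h2]
    have h3 := ((hasStrictFDerivAt_norm_sq ξ).hasFDerivAt.const_mul ((2 * Real.pi) ^ 2)).const_add 1
    have e1 : (2 * (2 * Real.pi) ^ 2) • innerSL ℝ ξ =
        (2 * Real.pi) ^ 2 • (2 • innerSL ℝ ξ : E3 →L[ℝ] ℝ) := by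
      ext v
      simp
      ring
    rw [e1]
    exact h3
  have h4 := h1.rpow_const (p := s / 2) (Or.inl (by positivity))
  exact h4

/-- The symbol of `(I - Δ)^{-s/2}` has bounded first derivatives. -/
theorem abs_fderiv_besselSymbol_le {s : ℝ} (hs : 0 ≤ s) (ξ : E3) (j : Fin 3) :
    |fderiv ℝ (besselSymbol (-s)) ξ (e j)| ≤ 2 * Real.pi * s := by
  rw [(hasFDerivAt_besselSymbol (-s) ξ).fderiv]
  simp only [smul_apply, innerSL_apply_apply, smul_eq_mul, inner_e]
  set t := ‖(2 * Real.pi) • ξ‖ with ht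
  have ht' : t = 2 * Real.pi * ‖ξ‖ := by
    rw [ht, norm_smul, Real.norm_of_nonneg (by positivity)]
  have h1 : (1 + t ^ 2) ^ (-s / 2 - 1) ≤ (1 + t ^ 2)⁻¹ := by
    rw [← Real.rpow_neg_one]
    exact Real.rpow_le_rpow_of_exponent_le (by nlinarith [sq_nonneg t]) (by linarith)
  have h2 : |-s / 2 * (1 + t ^ 2) ^ (-s / 2 - 1) * (2 * (2 * Real.pi) ^ 2 * ξ j)| =
      s * (2 * Real.pi) * ((1 + t ^ 2) ^ (-s / 2 - 1) * (2 * Real.pi * |ξ j|)) := by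
    simp only [abs_mul, abs_div, abs_neg, abs_of_nonneg hs]
    rw [abs_of_nonneg (show (0 : ℝ) ≤ (1 + t ^ 2) ^ (-s / 2 - 1) by positivity),
      abs_of_nonneg (show (0 : ℝ) ≤ (2 * Real.pi) ^ 2 by positivity)]
    norm_num
    ring
  rw [h2]
  have h3 : (1 + t ^ 2) ^ (-s / 2 - 1) * (2 * Real.pi * |ξ j|) ≤ 1 := by
    calc _ ≤ (1 + t ^ 2)⁻¹ * t := by
          gcongr
          rw [ht']
          gcongr
          exact abs_apply_le ξ j
      _ ≤ 1 := by
          rw [inv_mul_le_iff₀ (by positivity)]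
          nlinarith [sq_nonneg (t - 1), sq_nonneg t]
  nlinarith [mul_nonneg hs (show (0 : ℝ) ≤ 2 * Real.pi by positivity)]

theorem eLpNorm_schwartz_fourierInv (f : 𝓢(E3, ℂ)) :
    eLpNorm (𝓕⁻ f : 𝓢(E3, ℂ)) 2 volume = eLpNorm f 2 volume := by
  rw [SchwartzMap.fourierInv_coe]
  exact eLpNorm_fourierInv_of_memLp f.integrable (f.memLp 2 volume)

/-- Multiplication by the coordinate `x_j` corresponds to `∂_j` on the Fourier side. -/
theorem eLpNorm_D_schwartz_fourierInv (f : 𝓢(E3, ℂ)) (j : Fin 3) :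
    eLpNorm (D j (𝓕⁻ f : 𝓢(E3, ℂ))) 2 volume =
      ‖(2 * Real.pi * Complex.I : ℂ)‖ₑ * eLpNorm (fun x ↦ (x j : ℂ) * f x) 2 volume := by
  have h1 : D j (𝓕⁻ f : 𝓢(E3, ℂ)) = (∂_{e j} (𝓕⁻ f : 𝓢(E3, ℂ)) : 𝓢(E3, ℂ)) := by
    ext x
    rw [SchwartzMap.lineDerivOp_apply_eq_fderiv]
    rfl
  have h2 : (fun x : E3 ↦ inner ℝ x (e j)).HasTemperateGrowth := by fun_prop
  rw [h1, SchwartzMap.lineDerivOp_fourierInv_eq, eLpNorm_schwartz_fourierInv]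
  change eLpNorm ((2 * Real.pi * Complex.I : ℂ) •
    (SchwartzMap.smulLeftCLM ℂ (fun x : E3 ↦ inner ℝ x (e j)) f : E3 → ℂ)) 2 volume = _
  rw [eLpNorm_const_smul]
  congr 2
  ext x
  rw [SchwartzMap.smulLeftCLM_apply_apply h2, inner_e]
  rfl

/-- Functions with a Bessel image in the weighted space `L²_δ` grow at most like `r^{-δ}`. -/
theorem growth_of_isBesselImage {s δ : ℝ} (hs : 0 ≤ s) (hδ : -1 < δ) (hδ' : δ < 0) {u w : E3 → ℂ}
    (h : IsBesselImage s u w) (hw : wNorm δ w ≠ ∞) : Growth (-δ) u := by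
  obtain ⟨U, W, hU, hW, hUW⟩ := h
  have hwm : AEStronglyMeasurable w := hW.locallyIntegrable.aestronglyMeasurable
  refine ⟨wNorm δ w * (3 * ENNReal.ofReal (s + 1)), ENNReal.mul_ne_top hw
    (ENNReal.mul_ne_top (by simp) (by simp)), fun r hr φ hφ hφr ↦ ?_⟩
  obtain ⟨f, rfl⟩ := hφ.exists_schwartz
  have hr0 : 0 < r := by linarith
  -- `ψ = (I - Δ)^{-s/2} f`, with `g` and `h` the inverse Fourier transforms of `f` and `ψ`.
  set g : 𝓢(E3, ℂ) := 𝓕⁻ f with hg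
  set h : 𝓢(E3, ℂ) := SchwartzMap.smulLeftCLM ℂ (fun ξ ↦ (besselSymbol (-s) ξ : ℂ)) g with hh
  set ψ : 𝓢(E3, ℂ) := 𝓕 h with hψ
  have hb := hasTemperateGrowth_besselSymbol s
  have hb' := hasTemperateGrowth_besselSymbol (-s)
  have hhx : ∀ ξ, h ξ = (besselSymbol (-s) ξ : ℂ) * g ξ := fun ξ ↦ by
    rw [hh, SchwartzMap.smulLeftCLM_apply_apply hb']; rfl
  have hψh : 𝓕⁻ ψ = h := by rw [hψ, FourierTransform.fourierInv_fourier_eq]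
  -- the pairing is transferred from `u` to `w`
  have h1 : ∫ x, u x * f x = ∫ x, w x * ψ x := by
    have e1 : U f = W ψ := by
      rw [← hUW, TemperedDistribution.fourierMultiplierCLM_apply]
      change U f = U (𝓕 (SchwartzMap.smulLeftCLM ℂ (fun ξ ↦ (besselSymbol s ξ : ℂ)) (𝓕⁻ ψ)))
      congr 1
      have : SchwartzMap.smulLeftCLM ℂ (fun ξ ↦ (besselSymbol s ξ : ℂ)) (𝓕⁻ ψ) = 𝓕⁻ f := by
        ext ξ
        rw [SchwartzMap.smulLeftCLM_apply_apply hb, hψh, hhx, smul_eq_mul, ← mul_assoc,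
          ← Complex.ofReal_mul, ← besselSymbol_add, add_neg_cancel, besselSymbol_zero]
        simp [hg]
      rw [this, FourierTransform.fourier_fourierInv_eq]
    rw [(hU f).2, (hW ψ).2] at e1
    simpa [smul_eq_mul, mul_comm] using e1
  have hgn : eLpNorm g 2 volume = eLpNorm f 2 volume := eLpNorm_schwartz_fourierInv f
  have hle : ∀ ξ, ‖h ξ‖ₑ ≤ ‖g ξ‖ₑ := fun ξ ↦ by
    rw [hhx, enorm_mul, enorm_besselSymbol]
    refine mul_le_of_le_one_left' ?_
    rw [← eBessel_zero ξ]
    exact eBessel_mono (by linarith) ξ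
  have hψn : eLpNorm ψ 2 volume ≤ eLpNorm f 2 volume := by
    rw [← eLpNorm_schwartz_fourierInv, hψh, ← hgn]
    exact eLpNorm_mono_enorm hle
  have hc : ‖(2 * Real.pi * Complex.I : ℂ)‖ₑ = ENNReal.ofReal (2 * Real.pi) := by
    rw [← ofReal_norm]
    simp [abs_of_pos Real.pi_pos]
  have hc0 : ENNReal.ofReal (2 * Real.pi) ≠ 0 := by
    simpa using Real.pi_pos
  have hxf : ∀ j : Fin 3, eLpNorm (fun x ↦ (x j : ℂ) * f x) 2 volume ≤
      ENNReal.ofReal r * eLpNorm f 2 volume := by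
    intro j
    have : ENNReal.ofReal r * eLpNorm f 2 volume = eLpNorm ((r : ℂ) • (f : E3 → ℂ)) 2 volume := by
      rw [eLpNorm_const_smul, ← ofReal_norm, Complex.norm_real, Real.norm_of_nonneg hr0.le]
    rw [this]
    refine eLpNorm_mono_enorm fun x ↦ ?_
    rcases le_or_gt ‖x‖ r with hx | hx
    · rw [enorm_mul, Pi.smul_apply, smul_eq_mul, enorm_mul]
      gcongr
      rw [← ofReal_norm, ← ofReal_norm, Complex.norm_real, Complex.norm_real,
        Real.norm_of_nonneg hr0.le]
      exact ENNReal.ofReal_le_ofReal ((abs_apply_le x j).trans hx)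
    · rw [hφr x hx]; simp
  -- The operator `(I - Δ)^{-s/2}` is not local, but its commutator with `x_j` is bounded on `L²`,
  -- so `x_j ψ` is as small as if `ψ` were supported in the ball of radius `r`.
  have hD : ∀ j : Fin 3, eLpNorm (fun x ↦ (x j : ℂ) * ψ x) 2 volume ≤
      ENNReal.ofReal r * (ENNReal.ofReal (s + 1) * eLpNorm f 2 volume) := by
    intro j
    have e1 : eLpNorm (D j h) 2 volume ≤
        eLpNorm (fun ξ ↦ ((2 * Real.pi * s : ℝ) : ℂ) * g ξ) 2 volume +
          eLpNorm (D j g) 2 volume := by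
      have hgD : D j g = (∂_{e j} g : 𝓢(E3, ℂ)) := by
        ext x
        rw [SchwartzMap.lineDerivOp_apply_eq_fderiv]
        rfl
      have hbD : ∀ ξ, HasFDerivAt (fun ξ ↦ (besselSymbol (-s) ξ : ℂ))
          (Complex.ofRealCLM.comp (fderiv ℝ (besselSymbol (-s)) ξ)) ξ := fun ξ ↦
        Complex.ofRealCLM.hasFDerivAt.comp ξ
          (hasFDerivAt_besselSymbol (-s) ξ).differentiableAt.hasFDerivAt
      have hDh : ∀ ξ, D j h ξ = D j (fun ξ ↦ (besselSymbol (-s) ξ : ℂ)) ξ * g ξ +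
          (besselSymbol (-s) ξ : ℂ) * D j g ξ := fun ξ ↦ by
        rw [← D_mul (hbD ξ).differentiableAt g.differentiableAt]
        congr 1
        ext ξ
        exact hhx ξ
      have hDb : ∀ ξ, ‖D j (fun ξ ↦ (besselSymbol (-s) ξ : ℂ)) ξ‖ ≤ 2 * Real.pi * s := fun ξ ↦ by
        rw [D, (hbD ξ).fderiv, ContinuousLinearMap.comp_apply, Complex.ofRealCLM_apply,
          Complex.norm_real, Real.norm_eq_abs]
        exact abs_fderiv_besselSymbol_le hs ξ j
      refine le_trans (eLpNorm_mono_real (g := fun ξ ↦ ‖((2 * Real.pi * s : ℝ) : ℂ) * g ξ‖ +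
        ‖D j g ξ‖) fun ξ ↦ ?_) (le_trans (eLpNorm_add_le ?_ ?_ (by norm_num)) ?_)
      · rw [hDh]
        refine (norm_add_le _ _).trans ?_
        rw [norm_mul, norm_mul, norm_mul]
        gcongr
        · rw [Complex.norm_real, Real.norm_of_nonneg (by positivity)]
          exact hDb ξ
        · refine mul_le_of_le_one_left (norm_nonneg _) ?_
          rw [Complex.norm_real, Real.norm_of_nonneg (besselSymbol_pos _ _).le,
            ← besselSymbol_zero ξ]
          exact besselSymbol_mono (by linarith) ξ
      · exact (continuous_const.mul g.continuous).norm.aestronglyMeasurable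
      · rw [hgD]; exact (SchwartzMap.continuous _).norm.aestronglyMeasurable
      · rw [eLpNorm_norm, eLpNorm_norm]
    have e2 : eLpNorm (fun ξ ↦ ((2 * Real.pi * s : ℝ) : ℂ) * g ξ) 2 volume =
        ENNReal.ofReal (2 * Real.pi) * (ENNReal.ofReal s * eLpNorm f 2 volume) := by
      have : (fun ξ ↦ ((2 * Real.pi * s : ℝ) : ℂ) * g ξ) =
        ((2 * Real.pi * s : ℝ) : ℂ) • (g : E3 → ℂ) := rfl
      rw [this, eLpNorm_const_smul, hgn, ← ofReal_norm, Complex.norm_real,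
        Real.norm_of_nonneg (by positivity), ENNReal.ofReal_mul (by positivity), mul_assoc]
    rw [← hψh, eLpNorm_D_schwartz_fourierInv, hg, eLpNorm_D_schwartz_fourierInv, ← hg, hc, e2,
      ← mul_add] at e1
    refine ((ENNReal.mul_le_mul_iff_right hc0 ENNReal.ofReal_ne_top).1 e1).trans ?_
    rw [ENNReal.ofReal_add hs zero_le_one, ENNReal.ofReal_one]
    calc _ ≤ ENNReal.ofReal s * eLpNorm f 2 volume + ENNReal.ofReal r * eLpNorm f 2 volume := by
          gcongr; exact hxf j
      _ ≤ ENNReal.ofReal r * (ENNReal.ofReal s * eLpNorm f 2 volume) +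
          ENNReal.ofReal r * eLpNorm f 2 volume := by
          exact add_le_add (le_mul_of_one_le_left' (ENNReal.one_le_ofReal.2 hr)) le_rfl
      _ = _ := by ring
  have hA0 : eLpNorm ψ 2 volume ≤ ENNReal.ofReal (s + 1) * eLpNorm f 2 volume :=
    hψn.trans (le_mul_of_one_le_left' (ENNReal.one_le_ofReal.2 (by linarith)))
  have hfin := wNorm_sq_le (σ := -δ) (by linarith) (by linarith) hr ψ.continuous hA0 hD
  have hfin2 : wNorm (-δ) ψ ≤ 3 * (ENNReal.ofReal (r ^ (-δ)) *
      (ENNReal.ofReal (s + 1) * eLpNorm f 2 volume)) := by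
    refine le_of_sq_le_sq_mul (hfin.trans ?_)
    rw [mul_pow 3]
    gcongr
    norm_num
  rw [h1]
  refine (enorm_integral_mul_le δ hwm ψ.continuous.aestronglyMeasurable).trans ?_
  calc _ ≤ wNorm δ w * (3 * (ENNReal.ofReal (r ^ (-δ)) *
      (ENNReal.ofReal (s + 1) * eLpNorm f 2 volume))) := by gcongr
    _ = _ := by ring

/-! ### Representation of slowly growing solutions -/

theorem IsBesselImage.ae_eq {u w : E3 → ℂ} (h : IsBesselImage 0 u w) : u =ᵐ[volume] w := by
  obtain ⟨U, W, hU, hW, hUW⟩ := h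
  have h1 : (fun ξ ↦ (besselSymbol 0 ξ : ℂ)) = fun _ ↦ 1 := by
    ext ξ; simp [besselSymbol_zero]
  rw [h1, TemperedDistribution.fourierMultiplierCLM_const, one_smul] at hUW
  have h2 : U = W := hUW
  subst h2
  exact hU.ae_eq hW

section

variable {k : ℝ} (hk : 0 < k) {ζ : C3} (hζ : Adm k ζ) {l : ℕ} {f : E3 → ℂ} {δ : ℝ} (hδ : -1 < δ)
  (hδ' : δ < 0)
include hk hζ hδ hδ'

/-- Multipliers with the singularities of the inverse symbol produce functions in `L²_δ` for every
`δ ∈ (-1, 0)`, in particular of growth `-δ`. -/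
theorem growth_mult {L : ℝ≥0∞} {m : E3 → ℂ} (hm : IsMult ζ L m) (hL : L ≠ ∞) (hf : Src l f)
    (hi : Integrable (fun ξ ↦ m ξ * 𝓕 f ξ)) :
    Growth (-δ) (𝓕⁻ fun ξ ↦ m ξ * 𝓕 f ξ) ∧ wNorm δ (𝓕⁻ fun ξ ↦ m ξ * 𝓕 f ξ) ≠ ∞ := by
  obtain ⟨χ, -, hχ⟩ := exists_schwartz_bump_eq_one_on hf.supp
  obtain ⟨C, hC, hCb⟩ := exists_isBesselImage_mult_le hk hδ hδ' le_rfl χ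
  have h0 : sobN 0 f ≠ ∞ := hf.sobN_ne_top (Nat.cast_nonneg l)
  obtain ⟨w, -, hw, hwn⟩ := hCb ζ hζ L m hm hL f hf.integrable hχ h0 hi
  have hfin : wNorm δ w ≠ ∞ := ne_top_of_le_ne_top
    (ENNReal.mul_ne_top (ENNReal.mul_ne_top hC hL) h0) hwn
  refine ⟨growth_of_isBesselImage le_rfl hδ hδ' hw hfin, ?_⟩
  convert hfin using 1
  refine eLpNorm_congr_ae ?_
  filter_upwards [hw.ae_eq] with x hx
  rw [hx]

theorem growth_Gop (hf : Src l f) : Growth (-δ) (Gop ζ f) ∧ wNorm δ (Gop ζ f) ≠ ∞ := by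
  rw [Gop_eq]
  exact growth_mult hk hζ hδ hδ' (isMult_symb_inv hζ.one_le)
    (by simpa using (show 0 < ‖ζ‖ by linarith [hζ.one_le])) hf (integrable_gHat hk hζ hf)

theorem growth_D_Gop (hl : 1 ≤ l) (hf : Src l f) (j : Fin 3) :
    Growth (-δ) (D j (Gop ζ f)) ∧ wNorm δ (D j (Gop ζ f)) ≠ ∞ := by
  have h := integrable_dSymb_mul_gHat hk hζ hl hf j
  rw [D_Gop hk hζ hl hf]
  simp only [gHat, ← mul_assoc] at h ⊢
  exact growth_mult hk hζ hδ hδ' (isMult_dSymb_mul hζ.one_le j) (by simp) hf h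

end

/-- Compactly supported functions have the growth of any of the weighted spaces. -/
theorem growth_of_hasCompactSupport {δ : ℝ} (hδ : -1 < δ) (hδ' : δ < 0) {f : E3 → ℂ}
    (hf : Continuous f) (hs : HasCompactSupport f) : Growth (-δ) f := by
  have h1 := isFourierPair_fourier (hf.integrable_of_hasCompactSupport hs)
  refine growth_of_isBesselImage le_rfl hδ hδ' (isBesselImage_of_isFourierPair h1 ?_)
    (ne_top_of_le_ne_top (hf.memLp_of_hasCompactSupport hs).2.ne (wNorm_le_eLpNorm hδ'.le f))
  simpa [besselSymbol_zero] using h1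

theorem Growth.add {σ : ℝ} {u v : E3 → ℂ} (hu : Growth σ u) (hv : Growth σ v)
    (hul : LocallyIntegrable u) (hvl : LocallyIntegrable v) : Growth σ (fun x ↦ u x + v x) := by
  obtain ⟨C, hC, h⟩ := hu
  obtain ⟨C', hC', h'⟩ := hv
  refine ⟨C + C', ENNReal.add_ne_top.2 ⟨hC, hC'⟩, fun r hr φ hφ hφr ↦ ?_⟩
  simp only [add_mul]
  rw [integral_add (integrable_mul_of_locallyIntegrable hul hφ.smooth.continuous hφ.supp)
    (integrable_mul_of_locallyIntegrable hvl hφ.smooth.continuous hφ.supp)]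
  exact (enorm_add_le _ _).trans (add_le_add (h r hr φ hφ hφr) (h' r hr φ hφ hφr))

theorem Growth.const_mul {σ : ℝ} {u : E3 → ℂ} (hu : Growth σ u) (c : ℂ) :
    Growth σ (fun x ↦ c * u x) := by
  obtain ⟨C, hC, h⟩ := hu
  refine ⟨‖c‖ₑ * C, ENNReal.mul_ne_top (by simp) hC, fun r hr φ hφ hφr ↦ ?_⟩
  simp only [mul_assoc]
  rw [integral_const_mul, enorm_mul]
  gcongr
  simpa [mul_assoc] using h r hr φ hφ hφr

theorem Growth.sum {σ : ℝ} {ι : Type*} (t : Finset ι) {u : ι → E3 → ℂ} (hu : ∀ i, Growth σ (u i))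
    (hul : ∀ i, LocallyIntegrable (u i)) : Growth σ (fun x ↦ ∑ i ∈ t, u i x) := by
  classical
  induction t using Finset.induction_on with
  | empty => exact ⟨0, by simp, by simp⟩
  | insert a t ha ih =>
    simp only [Finset.sum_insert ha]
    exact (hu a).add ih (hul a) (locallyIntegrable_finsetSum t fun i _ ↦ hul i)

theorem IsTest.contDiff_Gop {k : ℝ} (hk : 0 < k) {ζ : C3} (hζ : Adm k ζ) {f : E3 → ℂ}
    (hf : IsTest f) : ContDiff ℝ ((⊤ : ℕ∞) : WithTop ℕ∞) (Gop ζ f) := by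
  have h1 : Gop ζ f = (𝓕 (gHat ζ f)) ∘ (fun x ↦ -x) := by
    ext x; rw [Gop_eq, Real.fourierInv_eq_fourier_neg]; rfl
  rw [h1]
  refine ContDiff.comp (Real.contDiff_fourier (N := ⊤) fun n _ ↦ ?_) contDiff_neg
  have h2 := integrable_besselSymbol_mul_gHat hk (Nat.cast_nonneg n) hζ (hf.src n).integrable
    ((hf.src n).sobN_ne_top le_rfl)
  refine h2.norm.mono' ?_ (.of_forall fun ξ ↦ ?_)
  · exact ((continuous_norm.pow n).aestronglyMeasurable).mul
      (measurable_gHat ζ (hf.src 0).integrable).norm.aestronglyMeasurable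
  · rw [norm_mul, norm_mul, norm_norm, norm_pow, norm_norm, Complex.norm_real,
      Real.norm_of_nonneg (besselSymbol_pos _ _).le]
    gcongr
    have h3 : besselSymbol n ξ = besselSymbol 1 ξ ^ n := by
      rw [besselSymbol, besselSymbol, ← Real.rpow_mul_natCast (by positivity)]
      congr 1; ring
    rw [h3]
    gcongr
    refine le_trans ?_ (norm_le_besselSymbol_one ξ)
    rw [norm_smul, Real.norm_of_nonneg (by positivity)]
    nlinarith [norm_nonneg ξ, Real.pi_gt_three]

/-- The Leibniz rule for `helm`. -/
theorem helm_mul (k : ℝ) (ζ : C3) {χ g : E3 → ℂ} (hχ : ContDiff ℝ 2 χ) (hg : ContDiff ℝ 2 g)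
    (x : E3) : helm k ζ (fun y ↦ χ y * g y) x = χ x * helm k ζ g x +
      ∑ i, (2 * D i χ x * Dz ζ i g x + D i (D i χ) x * g x) := by
  have hχ1 : ContDiff ℝ 1 χ := hχ.of_le (by norm_num)
  have hg1 : ContDiff ℝ 1 g := hg.of_le (by norm_num)
  have hχD : ∀ i, ContDiff ℝ 1 (D i χ) := fun i ↦ by
    exact_mod_cast contDiff_D (n := 1) (by exact_mod_cast hχ) i
  have hgD : ∀ i, ContDiff ℝ 1 (Dz ζ i g) := fun i ↦ by
    exact_mod_cast contDiff_Dz ζ i (n := 1) (by exact_mod_cast hg)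
  have h1 : ∀ i, Dz ζ i (Dz ζ i (fun y ↦ χ y * g y)) x =
      χ x * Dz ζ i (Dz ζ i g) x + (2 * D i χ x * Dz ζ i g x + D i (D i χ) x * g x) := by
    intro i
    have e1 : Dz ζ i (fun y ↦ χ y * g y) = fun y ↦ D i χ y * g y + χ y * Dz ζ i g y :=
      funext fun y ↦ Dz_mul ζ i hχ1 hg1 y
    have e2 : ∀ {p q : E3 → ℂ}, ContDiff ℝ 1 p → ContDiff ℝ 1 q →
        Dz ζ i (fun y ↦ p y + q y) x = Dz ζ i p x + Dz ζ i q x := by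
      intro p q hp hq
      unfold Dz
      rw [D_add hp hq]; ring
    rw [e1, e2 ((hχD i).mul hg1) (hχ1.mul (hgD i)), Dz_mul ζ i (hχD i) hg1,
      Dz_mul ζ i hχ1 (hgD i)]
    ring
  unfold helm
  simp only [h1, Finset.sum_add_distrib]
  rw [mul_add, Finset.mul_sum]
  ring

theorem D_comp_smul {ψ : E3 → ℂ} (hψ : ContDiff ℝ 1 ψ) (t : ℝ) (j : Fin 3) (x : E3) :
    D j (fun y ↦ ψ (t • y)) x = t * D j ψ (t • x) := by
  have h1 : HasFDerivAt (fun y : E3 ↦ t • y) (t • ContinuousLinearMap.id ℝ E3) x :=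
    (hasFDerivAt_id x).const_smul t
  have h2 := ((hψ.differentiable one_ne_zero (t • x)).hasFDerivAt).comp x h1
  have h3 : fderiv ℝ (fun y ↦ ψ (t • y)) x =
      (fderiv ℝ ψ (t • x)).comp (t • ContinuousLinearMap.id ℝ E3) := h2.fderiv
  rw [D, h3]
  simp [D]

theorem jap_neg_le {δ r : ℝ} (hδ : δ ≤ 0) (hr : 1 ≤ r) {x : E3} (hx : ‖x‖ ≤ r) :
    jap (-δ) x ≤ ENNReal.ofReal ((2 * r) ^ (-δ)) := by
  refine ENNReal.ofReal_le_ofReal ?_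
  have h1 : (2 * r) ^ (-δ) = ((2 * r) ^ 2) ^ (-δ / 2) := by
    rw [← Real.rpow_natCast, ← Real.rpow_mul (by positivity)]
    congr 1; push_cast; ring
  rw [h1]
  refine Real.rpow_le_rpow (by positivity) ?_ (by linarith)
  nlinarith [norm_nonneg x, mul_self_nonneg r]

/-- On a ball of radius `r` the `L²` norm is controlled by the weighted one. -/
theorem eLpNorm_mul_le_wNorm {δ r M : ℝ} (hδ : δ ≤ 0) (hr : 1 ≤ r) {τ v : E3 → ℂ}
    (hτ : VanishOff r τ) (hM : ∀ x, ‖τ x‖ ≤ M) :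
    eLpNorm (fun x ↦ τ x * v x) 2 volume ≤
      ENNReal.ofReal M * ENNReal.ofReal ((2 * r) ^ (-δ)) * wNorm δ v := by
  have hM0 : 0 ≤ M := (norm_nonneg _).trans (hM 0)
  refine le_of_sq_le_sq_mul ?_
  rw [eLpNorm_two_sq, mul_pow, wNorm_sq, ← lintegral_const_mul' _ _ (by
    simp only [ne_eq]; exact ENNReal.pow_ne_top (ENNReal.mul_ne_top (by simp) (by simp)))]
  refine lintegral_mono fun x ↦ ?_
  rw [← mul_pow]
  gcongr
  rcases le_or_gt ‖x‖ r with hx | hx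
  · rw [enorm_mul]
    calc ‖τ x‖ₑ * ‖v x‖ₑ = ‖τ x‖ₑ * (jap δ x * jap (-δ) x) * ‖v x‖ₑ := by
          rw [jap_mul_jap_neg, mul_one]
      _ ≤ ENNReal.ofReal M * (jap δ x * ENNReal.ofReal ((2 * r) ^ (-δ))) * ‖v x‖ₑ := by
          gcongr
          · rw [← ofReal_norm]; exact ENNReal.ofReal_le_ofReal (hM x)
          · exact jap_neg_le hδ hr hx
      _ = _ := by ring
  · rw [hτ x hx]; simp

theorem integrable_mul_of_vanishOff {A h : E3 → ℂ} {r : ℝ} (hA : LocallyIntegrable A)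
    (hr : VanishOff r A) (hh : Continuous h) : Integrable (fun x ↦ A x * h x) := by
  obtain ⟨χ, hχs, hχ, -⟩ := exists_schwartz_bump r
  have h1 := integrable_mul_of_locallyIntegrable hA (χ.continuous.mul hh) (hχs.mul_right (f' := h))
  refine h1.congr (.of_forall fun x ↦ ?_)
  rcases le_or_gt ‖x‖ r with hx | hx
  · simp [hχ x hx]
  · simp [hr x hx]

/-- A compactly supported smooth function, dilated: bounds for its first two derivatives. -/
theorem exists_dilated_cutoff : ∃ ρ M : ℝ, 1 ≤ ρ ∧ 0 ≤ M ∧ ∀ R : ℝ, 1 ≤ R →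
    ∃ χ : E3 → ℂ, IsTest χ ∧ VanishOff (ρ * R) χ ∧ (∀ x, ‖x‖ ≤ R → χ x = 1 ∧ ∀ i, D i χ x = 0) ∧
    (∀ i x, ‖D i χ x‖ ≤ M / R) ∧ ∀ i x, ‖D i (D i χ) x‖ ≤ M / R := by
  obtain ⟨ψ, hψs, hψ, -⟩ := exists_schwartz_bump 2
  have hT : IsTest ψ := ⟨ψ.smooth _, hψs⟩
  obtain ⟨ρ, hρ⟩ := exists_vanishOff hψs
  have hbd : ∀ f : E3 → ℂ, IsTest f → ∃ M, ∀ x, ‖f x‖ ≤ M := fun f hf ↦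
    hf.smooth.continuous.bounded_above_of_compact_support hf.supp
  choose M1 hM1 using fun i ↦ hbd _ (hT.D i)
  choose M2 hM2 using fun i ↦ hbd _ ((hT.D i).D i)
  have hM1' : ∀ i, 0 ≤ M1 i := fun i ↦ (norm_nonneg _).trans (hM1 i 0)
  have hM2' : ∀ i, 0 ≤ M2 i := fun i ↦ (norm_nonneg _).trans (hM2 i 0)
  refine ⟨max ρ 1, ∑ i, (M1 i + M2 i), le_max_right _ _,
    Finset.sum_nonneg fun i _ ↦ add_nonneg (hM1' i) (hM2' i), fun R hR ↦ ?_⟩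
  have hR0 : 0 < R := by linarith
  have hle : ∀ i, M1 i + M2 i ≤ ∑ i, (M1 i + M2 i) := fun i ↦
    Finset.single_le_sum (f := fun i ↦ M1 i + M2 i)
      (fun i _ ↦ add_nonneg (hM1' i) (hM2' i)) (Finset.mem_univ i)
  have hnorm : ∀ x : E3, ‖R⁻¹ • x‖ = R⁻¹ * ‖x‖ := fun x ↦ by
    rw [norm_smul, Real.norm_of_nonneg (by positivity)]
  have hv : VanishOff (max ρ 1 * R) fun x ↦ ψ (R⁻¹ • x) := by
    intro x hx
    refine hρ _ ?_
    rw [hnorm, inv_mul_eq_div, lt_div_iff₀ hR0]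
    exact lt_of_le_of_lt (by gcongr; exact le_max_left _ _) hx
  have hD : ∀ i, D i (fun x ↦ ψ (R⁻¹ • x)) = fun x ↦ (R⁻¹ : ℝ) * D i ψ (R⁻¹ • x) := fun i ↦
    funext fun x ↦ D_comp_smul hT.contDiff_one R⁻¹ i x
  have hDD : ∀ i x, D i (D i (fun x ↦ ψ (R⁻¹ • x))) x =
      (R⁻¹ : ℝ) * ((R⁻¹ : ℝ) * D i (D i ψ) (R⁻¹ • x)) := by
    intro i x
    rw [hD, D_const_mul (f := fun x ↦ D i ψ (R⁻¹ • x)) _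
        ((hT.D i).contDiff_one.comp (contDiff_const_smul _)),
      D_comp_smul (hT.D i).contDiff_one]
  refine ⟨fun x ↦ ψ (R⁻¹ • x), ⟨hT.smooth.comp (contDiff_const_smul _), hv.hasCompactSupport⟩, hv,
    fun x hx ↦ ⟨hψ _ ?_, fun i ↦ ?_⟩, fun i x ↦ ?_, fun i x ↦ ?_⟩
  · rw [hnorm]
    calc R⁻¹ * ‖x‖ ≤ R⁻¹ * R := by gcongr
      _ = 1 := inv_mul_cancel₀ hR0.ne'
      _ ≤ 2 := by norm_num
  · have h1 : D i ψ (R⁻¹ • x) = 0 := by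
      have h2 : (ψ : E3 → ℂ) =ᶠ[nhds (R⁻¹ • x)] fun _ ↦ 1 := by
        have : Metric.ball (0 : E3) 2 ∈ nhds (R⁻¹ • x) := by
          refine Metric.isOpen_ball.mem_nhds ?_
          rw [mem_ball_zero_iff, hnorm]
          calc R⁻¹ * ‖x‖ ≤ R⁻¹ * R := by gcongr
            _ = 1 := inv_mul_cancel₀ hR0.ne'
            _ < 2 := by norm_num
        filter_upwards [this] with y hy
        exact hψ y (mem_ball_zero_iff.1 hy).le
      rw [D, h2.fderiv_eq]
      simp
    rw [hD]
    simp [h1]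
  · rw [hD]
    simp only [norm_mul, Complex.norm_real, Real.norm_of_nonneg (inv_nonneg.2 hR0.le)]
    rw [div_eq_inv_mul]
    gcongr
    exact (hM1 i _).trans (by linarith [hle i, hM2' i])
  · rw [hDD]
    simp only [norm_mul, Complex.norm_real, Real.norm_of_nonneg (inv_nonneg.2 hR0.le)]
    rw [div_eq_inv_mul]
    gcongr
    calc R⁻¹ * ‖D i (D i ψ) (R⁻¹ • x)‖ ≤ 1 * ‖D i (D i ψ) (R⁻¹ • x)‖ := by
          gcongr
          exact inv_le_one_of_one_le₀ hR
      _ ≤ _ := by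
          rw [one_mul]
          exact (hM2 i _).trans (by linarith [hle i, hM1' i])

/-- Representation of slowly growing solutions `u` of `(Δ + 2iζ·∇) u = -∑ (∂_i + iζ_i) A_i + b`,
tested against a test function. The commutator with a cutoff at radius `R` tends to zero. -/
theorem representation_of_isTest {k : ℝ} (hk : 0 < k) {ζ : C3} (hζ : Adm k ζ) {δ : ℝ} (hδ : -1 < δ)
    (hδ' : δ < 0) {u b : E3 → ℂ} {A : Fin 3 → E3 → ℂ} (hu : LocallyIntegrable u)
    (hgr : Growth (-δ) u) (hA : ∀ i, LocallyIntegrable (A i)) (hb : LocallyIntegrable b) {ρ : ℝ}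
    (hAs : ∀ i, VanishOff ρ (A i)) (hbs : VanishOff ρ b)
    (h : ∀ φ, IsTest φ → ZeroInt (fun x ↦ u x * helm k (-ζ) φ x -
      (∑ i, A i x * Dz (-ζ) i φ x + b x * φ x))) {f : E3 → ℂ} (hf : IsTest f) :
    ZeroInt (fun x ↦ u x * f x + (∑ i, A i x * Dz (-ζ) i (Gop (-ζ) f) x + b x * Gop (-ζ) f x)) := by
  set g := Gop (-ζ) f with hg
  have hgs : ContDiff ℝ ((⊤ : ℕ∞) : WithTop ℕ∞) g := hf.contDiff_Gop hk hζ.neg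
  have hgn : ∀ n : ℕ, ContDiff ℝ n g := fun n ↦ hgs.of_le (by exact_mod_cast le_top)
  have hg2 : ContDiff ℝ 2 g := by exact_mod_cast hgn 2
  have hg1 : ContDiff ℝ 1 g := by exact_mod_cast hgn 1
  -- `g = G_{-ζ} f` is smooth and solves the transposed equation pointwise.
  have hhelm : ∀ x, helm k (-ζ) g x = -f x := by
    intro x
    have e1 : ∀ F, IsTest F → ∀ i, Dz (-ζ) i (Gop (-ζ) F) = Gop (-ζ) (Dz (-ζ) i F) := by
      intro F hF i
      ext x
      unfold Dz
      rw [D_Gop_eq_Gop_D hk hζ.neg le_rfl (hF.src 1) hF.contDiff_one,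
        Gop_add hk hζ.neg ((hF.D i).src 0) ((hF.src 0).const_mul _), Gop_const_mul]
    rw [← Gop_helm hk hζ.neg hf x]
    change _ = Gop (-ζ) (fun x ↦ ∑ j, Dz (-ζ) j (Dz (-ζ) j f) x + (k : ℂ) ^ 2 * f x) x
    rw [Gop_add hk hζ.neg (Src.sum _ fun j _ ↦ ((hf.Dz _ j).Dz _ j).src 0)
      ((hf.src 0).const_mul _), Gop_const_mul,
      Gop_sum hk hζ.neg _ fun j _ ↦ ((hf.Dz _ j).Dz _ j).src 0]
    unfold helm
    congr 1
    refine Finset.sum_congr rfl fun j _ ↦ ?_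
    rw [hg, e1 f hf, e1 _ (hf.Dz _ j)]
  set T : E3 → ℂ := fun x ↦ u x * f x + (∑ i, A i x * Dz (-ζ) i g x + b x * g x) with hT
  have hTi : Integrable T :=
    (integrable_mul_of_locallyIntegrable hu hf.smooth.continuous hf.supp).add
      ((integrable_finsetSum _ fun i _ ↦ integrable_mul_of_vanishOff (hA i) (hAs i)
        (continuous_Dz _ i hg1)).add (integrable_mul_of_vanishOff hb hbs hg1.continuous))
  refine ⟨hTi, ?_⟩
  obtain ⟨rf, hrf⟩ := exists_vanishOff hf.supp
  obtain ⟨ρ', M, hρ', hM, hcut⟩ := exists_dilated_cutoff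
  obtain ⟨C, hC, hCb⟩ := hgr
  -- a second weight exponent, chosen so that `-δ - 1 - δ2 = -(1 + δ) / 2 < 0`
  set δ2 : ℝ := -(1 + δ) / 2 with hδ2
  have hw0 : wNorm δ2 g ≠ ∞ := (growth_Gop hk hζ.neg (by linarith) (by linarith) (hf.src 1)).2
  have hw1 : ∀ i, wNorm δ2 (Dz (-ζ) i g) ≠ ∞ := by
    intro i
    have e1 := (growth_D_Gop hk hζ.neg (δ := δ2) (by linarith) (by linarith) le_rfl (hf.src 1) i).2
    have e2 : wNorm δ2 (fun x ↦ Complex.I * (-ζ) i * g x) ≠ ∞ := by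
      have e3 := (growth_Gop hk hζ.neg (δ := δ2) (by linarith) (by linarith)
        ((hf.src 1).const_mul (Complex.I * (-ζ) i))).2
      convert e3 using 2
      ext x
      rw [Gop_const_mul]
    exact ne_top_of_le_ne_top (ENNReal.add_ne_top.2 ⟨e1, e2⟩) (wNorm_add_le δ2
      (continuous_D hg1 i).aestronglyMeasurable
      (continuous_const.mul hg1.continuous).aestronglyMeasurable)
  set K : ℝ≥0∞ := ∑ i, (2 * wNorm δ2 (Dz (-ζ) i g) + wNorm δ2 g) with hK
  have hKt : K ≠ ∞ := ENNReal.sum_ne_top.2 fun i _ ↦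
    ENNReal.add_ne_top.2 ⟨ENNReal.mul_ne_top (by simp) (hw1 i), hw0⟩
  -- For large `R` test the equation against the cutoff `χ g`; only the commutator term `c`
  -- survives, and it is supported in the ball of radius `ρ' R`, outside the ball of radius `R`.
  have hbound : ∀ R : ℝ, max (max 1 rf) ρ ≤ R → ‖∫ x, T x‖ₑ ≤ C * ENNReal.ofReal
      (ρ' ^ (-δ) * M * (2 * ρ') ^ (-δ2)) * K * ENNReal.ofReal (R ^ (-((1 + δ) / 2))) := by
    intro R hR
    have hR1 : 1 ≤ R := le_trans ((le_max_left _ _).trans (le_max_left _ _)) hR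
    have hRf : rf ≤ R := le_trans ((le_max_right _ _).trans (le_max_left _ _)) hR
    have hRρ : ρ ≤ R := le_trans (le_max_right _ _) hR
    have hR0 : 0 < R := by linarith
    obtain ⟨χ, hχt, hχv, hχ1, hχD, hχDD⟩ := hcut R hR1
    have hφ : IsTest fun x ↦ χ x * g x := ⟨hχt.smooth.mul hgs, hχt.supp.mul_right⟩
    set c : E3 → ℂ := fun x ↦
      ∑ i, (2 * D i χ x * Dz (-ζ) i g x + D i (D i χ) x * g x) with hc
    have hχ2 : ContDiff ℝ 2 χ := by exact_mod_cast hχt.contDiff 2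
    have hceq : ∀ x, helm k (-ζ) (fun x ↦ χ x * g x) x = -f x + c x := by
      intro x
      rw [helm_mul k (-ζ) hχ2 hg2, hhelm]
      congr 1
      rcases le_or_gt ‖x‖ R with hx | hx
      · rw [(hχ1 x hx).1, one_mul]
      · rw [hrf x (by linarith)]; simp
    -- The growth of `u` may be tested against `c`, which is smooth because `helm` of `χ g` and `f`
    -- are.
    have hct : IsTest c := by
      have : c = fun x ↦ helm k (-ζ) (fun x ↦ χ x * g x) x + f x := by
        ext x; rw [hceq]; ring
      rw [this]
      exact (hφ.helm k _).add hf
    have hcv : VanishOff (ρ' * R) c := by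
      intro x hx
      have e1 : ∀ i, D i χ x = 0 := fun i ↦ hχv.D i x hx
      have e2 : ∀ i, D i (D i χ) x = 0 := fun i ↦ (hχv.D i).D i x hx
      simp [hc, e1, e2]
    have hTc : ∫ x, T x = ∫ x, u x * c x := by
      have e1 := h _ hφ
      have hci := integrable_mul_of_locallyIntegrable hu hct.smooth.continuous hct.supp
      have e2 : ∀ x, u x * helm k (-ζ) (fun x ↦ χ x * g x) x -
          (∑ i, A i x * Dz (-ζ) i (fun x ↦ χ x * g x) x + b x * (χ x * g x)) =
          u x * c x - T x := by
        intro x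
        rw [hceq]
        rcases le_or_gt ‖x‖ R with hx | hx
        · simp only [Dz_mul _ _ hχt.contDiff_one hg1, (hχ1 x hx).1, (hχ1 x hx).2, hT]
          simp only [zero_mul, zero_add, one_mul]
          ring
        · simp only [hT, hAs _ x (lt_of_le_of_lt hRρ hx), hbs x (lt_of_le_of_lt hRρ hx)]
          simp
          ring
      have e3 := (e1.congr fun x ↦ (e2 x).symm).2
      rw [integral_sub hci hTi] at e3
      exact (sub_eq_zero.1 e3).symm
    have hρR : 1 ≤ ρ' * R := by nlinarith
    -- Each term of `c` has a derivative of the cutoff, hence the factor `1 / R`.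
    have hcn : eLpNorm c 2 volume ≤ ENNReal.ofReal (M / R) *
        ENNReal.ofReal ((2 * (ρ' * R)) ^ (-δ2)) * K := by
      have hδ2' : δ2 ≤ 0 := by linarith
      have t1 : ∀ i, eLpNorm (fun x ↦ D i χ x * Dz (-ζ) i g x) 2 volume ≤ ENNReal.ofReal (M / R) *
          ENNReal.ofReal ((2 * (ρ' * R)) ^ (-δ2)) * wNorm δ2 (Dz (-ζ) i g) := fun i ↦
        eLpNorm_mul_le_wNorm hδ2' hρR (hχv.D i) (hχD i)
      have t2 : ∀ i, eLpNorm (fun x ↦ D i (D i χ) x * g x) 2 volume ≤ ENNReal.ofReal (M / R) *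
          ENNReal.ofReal ((2 * (ρ' * R)) ^ (-δ2)) * wNorm δ2 g := fun i ↦
        eLpNorm_mul_le_wNorm hδ2' hρR ((hχv.D i).D i) (hχDD i)
      have m1 : ∀ i, Continuous fun x ↦ D i χ x * Dz (-ζ) i g x := fun i ↦
        (hχt.D i).smooth.continuous.mul (continuous_Dz _ i hg1)
      have m2 : ∀ i, Continuous fun x ↦ D i (D i χ) x * g x := fun i ↦
        ((hχt.D i).D i).smooth.continuous.mul hg1.continuous
      have hcsum : c = ∑ i, ((2 : ℂ) • (fun x ↦ D i χ x * Dz (-ζ) i g x) +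
          fun x ↦ D i (D i χ) x * g x) := by
        ext x
        simp [hc, mul_assoc]
      rw [hcsum, hK, Finset.mul_sum]
      refine (eLpNorm_sum_le (fun i _ ↦ (((m1 i).const_smul (2 : ℂ)).add
        (m2 i)).aestronglyMeasurable) (by norm_num)).trans (Finset.sum_le_sum fun i _ ↦ ?_)
      refine (eLpNorm_add_le ((m1 i).const_smul (2 : ℂ)).aestronglyMeasurable
        (m2 i).aestronglyMeasurable (by norm_num)).trans ?_
      rw [eLpNorm_const_smul, mul_add]
      refine add_le_add ?_ (t2 i)
      have : ‖(2 : ℂ)‖ₑ = 2 := by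
        rw [← ofReal_norm]; simp
      rw [this]
      calc _ ≤ 2 * (ENNReal.ofReal (M / R) *
          ENNReal.ofReal ((2 * (ρ' * R)) ^ (-δ2)) * wNorm δ2 (Dz (-ζ) i g)) := by
            gcongr; exact t1 i
        _ = _ := by ring
    rw [hTc]
    refine (hCb (ρ' * R) hρR c hct hcv).trans ?_
    calc _ ≤ C * ENNReal.ofReal ((ρ' * R) ^ (-δ)) * (ENNReal.ofReal (M / R) *
          ENNReal.ofReal ((2 * (ρ' * R)) ^ (-δ2)) * K) := by gcongr
      _ = C * (ENNReal.ofReal ((ρ' * R) ^ (-δ)) * (ENNReal.ofReal (M / R) *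
          ENNReal.ofReal ((2 * (ρ' * R)) ^ (-δ2)))) * K := by ring
      _ = C * (ENNReal.ofReal (ρ' ^ (-δ) * M * (2 * ρ') ^ (-δ2)) *
          ENNReal.ofReal (R ^ (-((1 + δ) / 2)))) * K := by
        congr 2
        rw [← ENNReal.ofReal_mul (by positivity), ← ENNReal.ofReal_mul (by positivity),
          ← ENNReal.ofReal_mul (by positivity), Real.mul_rpow (by positivity) hR0.le,
          ← mul_assoc 2 ρ' R, Real.mul_rpow (by positivity) hR0.le]
        congr 1
        have e1 : R ^ (-((1 + δ) / 2)) = R ^ (-δ) * R ^ (-1 : ℝ) * R ^ (-δ2) := by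
          rw [← Real.rpow_add hR0, ← Real.rpow_add hR0]
          congr 1
          rw [hδ2]; ring
        rw [e1, Real.rpow_neg_one]
        ring
      _ = _ := by ring
  have hlim : Filter.Tendsto (fun R : ℝ ↦ C * ENNReal.ofReal
      (ρ' ^ (-δ) * M * (2 * ρ') ^ (-δ2)) * K * ENNReal.ofReal (R ^ (-((1 + δ) / 2))))
      Filter.atTop (nhds 0) := by
    have e1 := ENNReal.tendsto_ofReal (tendsto_rpow_neg_atTop (y := (1 + δ) / 2) (by linarith))
    rw [ENNReal.ofReal_zero] at e1
    have e2 := ENNReal.Tendsto.const_mul (a := C * ENNReal.ofReal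
      (ρ' ^ (-δ) * M * (2 * ρ') ^ (-δ2)) * K) e1 (Or.inr (ENNReal.mul_ne_top
        (ENNReal.mul_ne_top hC (by simp)) hKt))
    rwa [mul_zero] at e2
  have := ge_of_tendsto hlim ((Filter.eventually_ge_atTop _).mono hbound)
  simpa using this

/-- Dominated convergence for Fourier multipliers, for a sequence whose Fourier transforms are
dominated by that of the limit. -/
theorem tendsto_fourierInv_mult {m : E3 → ℂ} (hm : Measurable m) {f : E3 → ℂ} {fn : ℕ → E3 → ℂ}
    (hfn : ∀ n, Integrable (fn n)) (hi : Integrable (fun ξ ↦ m ξ * 𝓕 f ξ))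
    (hle : ∀ n ξ, ‖𝓕 (fn n) ξ‖ ≤ ‖𝓕 f ξ‖)
    (hlim : ∀ ξ, Filter.Tendsto (fun n ↦ 𝓕 (fn n) ξ) Filter.atTop (nhds (𝓕 f ξ))) (x : E3) :
    Filter.Tendsto (fun n ↦ 𝓕⁻ (fun ξ ↦ m ξ * 𝓕 (fn n) ξ) x) Filter.atTop
      (nhds (𝓕⁻ (fun ξ ↦ m ξ * 𝓕 f ξ) x)) ∧
    ∀ n, ‖𝓕⁻ (fun ξ ↦ m ξ * 𝓕 (fn n) ξ) x‖ ≤ ∫ ξ, ‖m ξ * 𝓕 f ξ‖ := by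
  have hb : ∀ n ξ, ‖m ξ * 𝓕 (fn n) ξ‖ ≤ ‖m ξ * 𝓕 f ξ‖ := fun n ξ ↦ by
    rw [norm_mul, norm_mul]
    gcongr
    exact hle n ξ
  have hmeas : ∀ n, AEStronglyMeasurable (fun ξ ↦ m ξ * 𝓕 (fn n) ξ) := fun n ↦
    (hm.mul (continuous_fourier (hfn n)).measurable).aestronglyMeasurable
  refine ⟨?_, fun n ↦ (norm_fourierInv_le _ x).trans ?_⟩
  · simp only [Real.fourierInv_eq]
    refine tendsto_integral_of_dominated_convergence (fun ξ ↦ ‖m ξ * 𝓕 f ξ‖) (fun n ↦ ?_) hi.norm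
      (fun n ↦ .of_forall fun ξ ↦ ?_) (.of_forall fun ξ ↦ ?_)
    · have h1 : Integrable (fun ξ ↦ m ξ * 𝓕 (fn n) ξ) :=
        hi.mono (hmeas n) (.of_forall (hb n))
      have h2 := (Real.fourierIntegral_convergent_iff (-x)).2 h1
      simpa using h2.aestronglyMeasurable
    · rw [Circle.norm_smul]; exact hb n ξ
    · exact ((hlim ξ).const_mul _).const_smul _
  · exact integral_mono ((hi.mono (hmeas n) (.of_forall (hb n))).norm) hi.norm (hb n)

/-- Representation of slowly growing solutions, tested against a source: in effect
`u = G_ζ (∑ (∂_i + iζ_i) A_i - b)`, where `G_ζ` has been moved to the source as its transpose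
`G_{-ζ}`. -/
theorem representation {k : ℝ} (hk : 0 < k) {ζ : C3} (hζ : Adm k ζ) {δ : ℝ} (hδ : -1 < δ)
    (hδ' : δ < 0) {u b : E3 → ℂ} {A : Fin 3 → E3 → ℂ} (hu : LocallyIntegrable u)
    (hgr : Growth (-δ) u) (hA : ∀ i, LocallyIntegrable (A i)) (hb : LocallyIntegrable b) {ρ : ℝ}
    (hAs : ∀ i, VanishOff ρ (A i)) (hbs : VanishOff ρ b)
    (h : ∀ φ, IsTest φ → ZeroInt (fun x ↦ u x * helm k (-ζ) φ x -
      (∑ i, A i x * Dz (-ζ) i φ x + b x * φ x))) {l : ℕ} (hl : 1 ≤ l) {f : E3 → ℂ} (hf : Src l f) :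
    ZeroInt (fun x ↦ u x * f x + (∑ i, A i x * Dz (-ζ) i (Gop (-ζ) f) x + b x * Gop (-ζ) f x)) := by
  obtain ⟨fn, h1, ⟨r, hr, hrn⟩, h2, h3, -⟩ := exists_mollify hf.cont hf.supp
  have hT : ∀ n, IsTest (fn n) := fun n ↦ ⟨h1 n, (hrn n).hasCompactSupport⟩
  have hlim := tendsto_fourier_of_uniform hf.cont (fun n ↦ (h1 n).continuous) hr hrn h2
  have hfi : ∀ n, Integrable (fn n) := fun n ↦ ((hT n).src 0).integrable
  have hG := tendsto_fourierInv_mult (measurable_symb_inv (-ζ)) hfi (integrable_gHat hk hζ.neg hf)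
    h3 hlim
  have hDG : ∀ j x, _ := fun j x ↦ tendsto_fourierInv_mult
    ((continuous_dSymb j).measurable.mul (measurable_symb_inv (-ζ))) hfi
    (by simpa only [gHat, mul_assoc, Pi.mul_apply] using
      integrable_dSymb_mul_gHat hk hζ.neg hl hf j)
    h3 hlim x
  have hG' : ∀ F : E3 → ℂ, Gop (-ζ) F = 𝓕⁻ (fun ξ ↦ (symb (-ζ) ξ)⁻¹ * 𝓕 F ξ) := fun F ↦
    Gop_eq _ F
  have hDG' : ∀ j (F : E3 → ℂ), Src l F → D j (Gop (-ζ) F) =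
      𝓕⁻ (fun ξ ↦ (dSymb j * fun ξ ↦ (symb (-ζ) ξ)⁻¹) ξ * 𝓕 F ξ) := fun j F hF ↦ by
    rw [D_Gop hk hζ.neg hl hF]
    simp only [gHat, mul_assoc, Pi.mul_apply]
  have hgc : ∀ F, Src l F → ContDiff ℝ 1 (Gop (-ζ) F) := fun F hF ↦ contDiff_Gop hk hζ.neg hl hF
  have hi1 : ∀ F, Src l F → Integrable (fun x ↦ u x * F x) := fun F hF ↦
    integrable_mul_of_locallyIntegrable hu hF.cont hF.supp
  have hi2 : ∀ F, Src l F → ∀ i, Integrable (fun x ↦ A i x * Dz (-ζ) i (Gop (-ζ) F) x) :=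
    fun F hF i ↦ integrable_mul_of_vanishOff (hA i) (hAs i) (continuous_Dz _ i (hgc F hF))
  have hi3 : ∀ F, Src l F → Integrable (fun x ↦ b x * Gop (-ζ) F x) := fun F hF ↦
    integrable_mul_of_vanishOff hb hbs (hgc F hF).continuous
  have heq : ∀ F, Src l F → ∫ x, (u x * F x + (∑ i, A i x * Dz (-ζ) i (Gop (-ζ) F) x +
      b x * Gop (-ζ) F x)) = (∫ x, u x * F x) + ((∑ i, ∫ x, A i x * Dz (-ζ) i (Gop (-ζ) F) x) +
        ∫ x, b x * Gop (-ζ) F x) := fun F hF ↦ by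
    have hi23 : Integrable (fun x ↦ ∑ i, A i x * Dz (-ζ) i (Gop (-ζ) F) x + b x * Gop (-ζ) F x) :=
      (integrable_finsetSum _ fun i _ ↦ hi2 F hF i).add (hi3 F hF)
    rw [integral_add (hi1 F hF) hi23,
      integral_add (integrable_finsetSum _ fun i _ ↦ hi2 F hF i) (hi3 F hF),
      integral_finsetSum _ fun i _ ↦ hi2 F hF i]
  have hcpt : ∀ {B : E3 → ℂ}, LocallyIntegrable B → VanishOff ρ B → Integrable B := fun hB hBs ↦ by
    simpa using integrable_mul_of_vanishOff hB hBs (continuous_const (y := (1 : ℂ)))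
  -- Approximate the source `f` by mollifications `fn`, for which the representation is known.
  have hlimit : Filter.Tendsto (fun n ↦ (∫ x, u x * fn n x) +
      ((∑ i, ∫ x, A i x * Dz (-ζ) i (Gop (-ζ) (fn n)) x) + ∫ x, b x * Gop (-ζ) (fn n) x))
      Filter.atTop (nhds ((∫ x, u x * f x) + ((∑ i, ∫ x, A i x * Dz (-ζ) i (Gop (-ζ) f) x) +
        ∫ x, b x * Gop (-ζ) f x))) := by
    refine (tendsto_integral_mul_of_uniform hu hf.cont (fun n ↦ (h1 n).continuous) hr hrn h2).add
      ((tendsto_finsetSum _ fun i _ ↦ ?_).add ?_)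
    · refine tendsto_integral_of_dominated_convergence (fun x ↦ ‖A i x‖ *
        ((∫ ξ, ‖(dSymb i * fun ξ ↦ (symb (-ζ) ξ)⁻¹) ξ * 𝓕 f ξ‖) +
          ‖Complex.I * (-ζ) i‖ * ∫ ξ, ‖(symb (-ζ) ξ)⁻¹ * 𝓕 f ξ‖))
        (fun n ↦ (hi2 _ ((hT n).src l) i).aestronglyMeasurable)
        ((hcpt (hA i) (hAs i)).norm.mul_const _)
        (fun n ↦ .of_forall fun x ↦ ?_) (.of_forall fun x ↦ ?_)
      · rw [norm_mul]
        gcongr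
        unfold Dz
        refine (norm_add_le _ _).trans (add_le_add ?_ ?_)
        · rw [hDG' i _ ((hT n).src l)]
          exact (hDG i x).2 n
        · rw [norm_mul, hG']
          gcongr
          exact (hG x).2 n
      · refine Filter.Tendsto.const_mul _ ?_
        have e1 : ∀ F, Src l F → Dz (-ζ) i (Gop (-ζ) F) x =
            𝓕⁻ (fun ξ ↦ (dSymb i * fun ξ ↦ (symb (-ζ) ξ)⁻¹) ξ * 𝓕 F ξ) x +
              Complex.I * (-ζ) i * 𝓕⁻ (fun ξ ↦ (symb (-ζ) ξ)⁻¹ * 𝓕 F ξ) x := fun F hF ↦ by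
          rw [Dz, hDG' i F hF, hG']
        simp only [e1 _ ((hT _).src l), e1 _ hf]
        exact (hDG i x).1.add ((hG x).1.const_mul _)
    · refine tendsto_integral_of_dominated_convergence (fun x ↦ ‖b x‖ *
        ∫ ξ, ‖(symb (-ζ) ξ)⁻¹ * 𝓕 f ξ‖)
        (fun n ↦ (hi3 _ ((hT n).src l)).aestronglyMeasurable)
        ((hcpt hb hbs).norm.mul_const _)
        (fun n ↦ .of_forall fun x ↦ ?_) (.of_forall fun x ↦ ?_)
      · rw [norm_mul, hG']
        gcongr
        exact (hG x).2 n
      · simp only [hG']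
        exact (hG x).1.const_mul _
  refine ⟨(hi1 f hf).add ((integrable_finsetSum _ fun i _ ↦ hi2 f hf i).add (hi3 f hf)), ?_⟩
  rw [heq f hf]
  refine tendsto_nhds_unique hlimit ?_
  have h0 : ∀ n, (∫ x, u x * fn n x) + ((∑ i, ∫ x, A i x * Dz (-ζ) i (Gop (-ζ) (fn n)) x) +
      ∫ x, b x * Gop (-ζ) (fn n) x) = 0 := fun n ↦ by
    rw [← heq _ ((hT n).src l)]
    exact (representation_of_isTest hk hζ hδ hδ' hu hgr hA hb hAs hbs h (hT n)).2
  simp only [h0]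
  exact tendsto_const_nhds

/-! ### Uniqueness for the scalar equation -/

/-- The fixed-point system of `exists_system_solution`, for sources that need not be supported near
the coefficients. -/
theorem exists_system_solution_of_src {k : ℝ} (hk : 0 < k) (l : ℕ) {ι : Type*} [Fintype ι]
    {V : ι → ι → E3 → ℂ} (hV : ∀ i j, ContDiff ℝ l (V i j)) {r : ℝ}
    (hVr : ∀ i j, VanishOff r (V i j)) :
    ∃ c : ℝ, ∀ ζ : C3, Adm k ζ → c ≤ ‖ζ‖ → ∀ f0 : ι → E3 → ℂ, (∀ i, Src l (f0 i)) →
      ∃ f : ι → E3 → ℂ, (∀ i, Src l (f i)) ∧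
        (∀ i x, f i x = f0 i x + ∑ j, V i j x * Gop ζ (f j) x) := by
  obtain ⟨χ, hχs, hχ1, -⟩ := exists_schwartz_bump r
  have hχ : ∀ i j x, χ x * V i j x = V i j x := fun i j x ↦ by
    rcases le_or_gt ‖x‖ r with hx | hx
    · rw [hχ1 x hx, one_mul]
    · rw [hVr i j x hx, mul_zero]
  obtain ⟨c, hc⟩ := exists_system_solution hk l hV hχs hχ
  refine ⟨c, fun ζ hζ hcζ f0 hf0 ↦ ?_⟩
  have hs : ∀ (h : ι → E3 → ℂ), (∀ i, Src l (h i)) → ∀ i j,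
      Src l (fun x ↦ V i j x * Gop ζ (h j) x) := fun h hh i j ↦
    Src.mul_Gop hk hζ (hV i j) (hVr i j).hasCompactSupport (hh j)
  -- The difference `g = f - f0` solves the system with the source `V (G_ζ f0)`, which is supported
  -- near the coefficients.
  obtain ⟨g, hg, -, hgeq, -⟩ := hc ζ hζ hcζ (fun i x ↦ ∑ j, V i j x * Gop ζ (f0 j) x)
    (fun i ↦ Src.sum _ fun j _ ↦ hs f0 hf0 i j) (fun i x ↦ by
      rw [Finset.mul_sum]
      exact Finset.sum_congr rfl fun j _ ↦ by rw [← mul_assoc, hχ])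
  refine ⟨fun i x ↦ f0 i x + g i x, fun i ↦ (hf0 i).add (hg i), fun i x ↦ ?_⟩
  simp only [Gop_add hk hζ (hf0 _) (hg _)]
  rw [hgeq, ← Finset.sum_add_distrib]
  simp only [mul_add]

theorem ae_eq_zero_of_test {u : E3 → ℂ} (hu : LocallyIntegrable u)
    (h : ∀ φ, IsTest φ → ∫ x, u x * φ x = 0) : u =ᵐ[volume] 0 := by
  refine ae_eq_zero_of_integral_contDiff_smul_eq_zero hu fun g hg hgs ↦ ?_
  have h1 : IsTest fun x ↦ (g x : ℂ) :=
    ⟨Complex.ofRealCLM.contDiff.comp hg, hgs.comp_left (g := fun t : ℝ ↦ (t : ℂ)) (by simp)⟩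
  rw [← h _ h1]
  congr 1; ext x
  rw [Complex.real_smul, mul_comm]

/-- A slowly growing solution of `(Δ + 2iζ·∇) u = q u` with compactly supported `q` vanishes, if `ζ`
is large. -/
theorem exists_scalar_uniqueness {k : ℝ} (hk : 0 < k) {δ : ℝ} (hδ : -1 < δ) (hδ' : δ < 0) {l : ℕ}
    (hl : 1 ≤ l) {q : E3 → ℂ} (hq : ContDiff ℝ l q) {r : ℝ} (hqr : VanishOff r q) :
    ∃ c : ℝ, ∀ ζ : C3, Adm k ζ → c ≤ ‖ζ‖ → ∀ u : E3 → ℂ, Continuous u → Growth (-δ) u →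
      (∀ φ, IsTest φ → ZeroInt (fun x ↦ u x * helm k (-ζ) φ x - q x * u x * φ x)) →
      ∀ x, u x = 0 := by
  obtain ⟨c, hc⟩ := exists_system_solution_of_src hk l (ι := Unit) (V := fun _ _ x ↦ (-1) * q x)
    (fun _ _ ↦ contDiff_const.mul hq) (r := r) (fun _ _ x hx ↦ by simp [hqr x hx])
  refine ⟨c, fun ζ hζ hcζ u hu hgr h ↦ ?_⟩
  have hul : LocallyIntegrable u := hu.locallyIntegrable
  have h0 : u =ᵐ[volume] 0 := by
    refine ae_eq_zero_of_test hul fun Φ hΦ ↦ ?_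
    -- By duality: `f` solves the transposed integral equation `f = Φ - q (G_{-ζ} f)`, so that the
    -- representation against `f` becomes `∫ u Φ = 0`.
    obtain ⟨f, hf, hfeq⟩ := hc (-ζ) hζ.neg (by rwa [norm_neg]) (fun _ ↦ Φ) (fun _ ↦ hΦ.src l)
    have h1 := representation hk hζ hδ hδ' (A := fun _ _ ↦ 0) (b := fun x ↦ q x * u x) hul hgr
      (fun _ ↦ locallyIntegrable_zero) (hq.continuous.mul hu).locallyIntegrable (ρ := r)
      (fun _ _ _ ↦ rfl) (fun x hx ↦ by simp [hqr x hx]) (fun φ hφ ↦ by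
        simpa using h φ hφ) hl (hf ())
    have h2 := h1.congr (g := fun x ↦ u x * Φ x) fun x ↦ by
      have e1 := hfeq () x
      simp only [Finset.univ_unique, Finset.sum_singleton] at e1
      have e2 : Φ x = f () x + q x * Gop (-ζ) (f ()) x := by
        rw [e1]
        simp
      rw [e2]
      simp
      ring
    exact h2.2
  have h3 := (hu.ae_eq_iff_eq volume continuous_const (g := fun _ ↦ 0)).1 h0
  exact fun x ↦ congrFun h3 x

/-! ### The medium -/

/-- The square root `a = n^{1/2}` of the refractive index: of class `C^{l+2}`, without zeros, and
equal to `1` outside a compact set. -/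
structure Medium (l : ℕ) (a : E3 → ℂ) : Prop where
  smooth : ContDiff ℝ (l + 2 : ℕ) a
  ne_zero : ∀ x, a x ≠ 0
  supp : HasCompactSupport fun x ↦ a x - 1

/-- The Laplacian of a function of class `C²`. -/
noncomputable def lap (a : E3 → ℂ) (x : E3) : ℂ := ∑ j, D j (D j a) x

/-- `k²(1 - n)`, with `n = a²`. -/
noncomputable def pot (k : ℝ) (a : E3 → ℂ) (x : E3) : ℂ := (k : ℂ) ^ 2 * (1 - a x ^ 2)

theorem D_sub_const (c : ℂ) (a : E3 → ℂ) (j : Fin 3) : D j (fun x ↦ a x - c) = D j a := by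
  ext x; simp [D, fderiv_sub_const]

section

variable {l : ℕ} {a : E3 → ℂ} (ha : Medium l a)
include ha

theorem Medium.contDiff_one : ContDiff ℝ 1 a :=
  ha.smooth.of_le (by norm_cast; omega)

theorem Medium.contDiff_D (j : Fin 3) : ContDiff ℝ (l + 1 : ℕ) (D j a) :=
  CGO.contDiff_D (n := l + 1) (by exact_mod_cast ha.smooth) j

theorem Medium.contDiff_D_one (j : Fin 3) : ContDiff ℝ 1 (D j a) :=
  (ha.contDiff_D j).of_le (by norm_cast; omega)

theorem Medium.contDiff_lap : ContDiff ℝ l (lap a) :=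
  ContDiff.sum fun j _ ↦ CGO.contDiff_D (n := l) (by exact_mod_cast ha.contDiff_D j) j

theorem Medium.contDiff_pot (k : ℝ) : ContDiff ℝ l (pot k a) :=
  contDiff_const.mul (contDiff_const.sub ((ha.smooth.of_le (by norm_cast; omega)).pow 2))

theorem Medium.contDiff_inv : ContDiff ℝ (l + 2 : ℕ) (fun x ↦ (a x)⁻¹) :=
  ha.smooth.inv ha.ne_zero

theorem Medium.exists_vanishOff (k : ℝ) : ∃ r, VanishOff r (fun x ↦ a x - 1) ∧
    (∀ j, VanishOff r (D j a)) ∧ VanishOff r (lap a) ∧ VanishOff r (pot k a) := by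
  obtain ⟨r, hr⟩ := CGO.exists_vanishOff ha.supp
  have h1 : ∀ j, VanishOff r (D j a) := fun j ↦ by
    have := hr.D j
    rwa [D_sub_const] at this
  refine ⟨r, hr, h1, fun x hx ↦ Finset.sum_eq_zero fun j _ ↦ (h1 j).D j x hx, fun x hx ↦ ?_⟩
  have : a x = 1 := sub_eq_zero.1 (hr x hx)
  simp [pot, this]

end

/-- The coefficients of the system for the potentials: the unknowns are indexed by `some j` for the
components of the vector potential and by `none` for the scalar one. -/
noncomputable def sysV (k : ℝ) (a : E3 → ℂ) : Option (Fin 3) → Option (Fin 3) → E3 → ℂ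
  | some i, some j => fun x ↦ if i = j then -pot k a x else 0
  | some i, none => fun x ↦ 2 * (k : ℂ) ^ 2 * D i a x
  | none, some j => fun x ↦ -2 * D j a x
  | none, none => fun x ↦ -pot k a x - lap a x * (a x)⁻¹

theorem Medium.contDiff_sysV {l : ℕ} {a : E3 → ℂ} (ha : Medium l a) (k : ℝ) (i j) :
    ContDiff ℝ l (sysV k a i j) := by
  have h1 : ∀ j, ContDiff ℝ l (D j a) := fun j ↦ (ha.contDiff_D j).of_le (by norm_cast; omega)
  rcases i with _ | i <;> rcases j with _ | j
  · exact (ha.contDiff_pot k).neg.sub (ha.contDiff_lap.mul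
      (ha.contDiff_inv.of_le (by norm_cast; omega)))
  · exact contDiff_const.mul (h1 j)
  · exact contDiff_const.mul (h1 i)
  · by_cases h : i = j
    · simpa [sysV, h] using (ha.contDiff_pot k).neg
    · simpa [sysV, h] using contDiff_const

theorem Medium.exists_vanishOff_sysV {l : ℕ} {a : E3 → ℂ} (ha : Medium l a) (k : ℝ) :
    ∃ r, VanishOff r (fun x ↦ a x - 1) ∧ (∀ j, VanishOff r (D j a)) ∧ VanishOff r (pot k a) ∧
      ∀ i j, VanishOff r (sysV k a i j) := by
  obtain ⟨r, h0, h1, h2, h3⟩ := ha.exists_vanishOff k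
  refine ⟨r, h0, h1, h3, fun i j x hx ↦ ?_⟩
  rcases i with _ | i <;> rcases j with _ | j <;> simp [sysV, h1 _ x hx, h2 x hx, h3 x hx]

/-! ### The equations for the potentials -/

/-- The weak form of `-∑ (∂_i + iζ_i)² u = F`. -/
def WeakHelm (ζ : C3) (u F : E3 → ℂ) : Prop :=
  ∀ φ : E3 → ℂ, ContDiff ℝ 1 φ → HasCompactSupport φ →
    ZeroInt (fun x ↦ ∑ i, Dz ζ i u x * Dz (-ζ) i φ x - F x * φ x)

theorem WeakHelm.congr {ζ : C3} {u F G : E3 → ℂ} (h : WeakHelm ζ u F) (hFG : ∀ x, G x = F x) :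
    WeakHelm ζ u G := by
  have : G = F := funext hFG
  rwa [this]

theorem Dz_add (ζ : C3) (j : Fin 3) {f g : E3 → ℂ} (hf : ContDiff ℝ 1 f) (hg : ContDiff ℝ 1 g)
    (x : E3) : Dz ζ j (fun y ↦ f y + g y) x = Dz ζ j f x + Dz ζ j g x := by
  unfold Dz
  rw [D_add hf hg]; ring

theorem Dz_const_mul (ζ : C3) (j : Fin 3) (c : ℂ) {f : E3 → ℂ} (hf : ContDiff ℝ 1 f)
    (x : E3) : Dz ζ j (fun y ↦ c * f y) x = c * Dz ζ j f x := by
  unfold Dz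
  rw [D_const_mul c hf]; ring

theorem Dz_const (ζ : C3) (j : Fin 3) (c : ℂ) (x : E3) :
    Dz ζ j (fun _ ↦ c) x = Complex.I * ζ j * c := by
  rw [Dz, D_const, zero_add]

theorem WeakHelm.add {ζ : C3} {u v F G : E3 → ℂ} (hu : WeakHelm ζ u F) (hv : WeakHelm ζ v G)
    (hu1 : ContDiff ℝ 1 u) (hv1 : ContDiff ℝ 1 v) :
    WeakHelm ζ (fun x ↦ u x + v x) (fun x ↦ F x + G x) := by
  intro φ hφ hφs
  refine ((hu φ hφ hφs).add (hv φ hφ hφs)).congr fun x ↦ ?_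
  simp only [Dz_add ζ _ hu1 hv1, Fin.sum_univ_three]
  ring

/-- Constants are in the kernel of `∑ (∂_i + iζ_i)² + k²`, because `ζ·ζ = k²`. -/
theorem weakHelm_const {k : ℝ} {ζ : C3} (hζ : Adm k ζ) (c : ℂ) :
    WeakHelm ζ (fun _ ↦ c) (fun _ ↦ (k : ℂ) ^ 2 * c) := by
  intro φ hφ hφs
  have h := ZeroInt.sum Finset.univ fun i _ ↦
    zeroInt_Dz ζ i (u := fun _ ↦ Complex.I * ζ i * c) contDiff_const hφ hφs
  refine h.congr fun x ↦ ?_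
  have h1 := hζ.dot_self
  simp only [dot, Fin.sum_univ_three] at h1
  simp only [Dz_const, Fin.sum_univ_three, ← h1]
  linear_combination (-(ζ 0 ^ 2 + ζ 1 ^ 2 + ζ 2 ^ 2) * c * φ x) * Complex.I_sq

theorem weakHelm_Gop {k : ℝ} (hk : 0 < k) {ζ : C3} (hζ : Adm k ζ) {l : ℕ} (hl : 1 ≤ l)
    {f : E3 → ℂ} (hf : Src l f) :
    WeakHelm ζ (Gop ζ f) (fun x ↦ (k : ℂ) ^ 2 * Gop ζ f x + f x) :=
  fun _ hφ hφs ↦ zeroInt_Dz_Gop hk hζ hl hf hφ hφs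

/-- The principal part of `helm`. -/
noncomputable def lapz (ζ : C3) (φ : E3 → ℂ) (x : E3) : ℂ := ∑ i, Dz ζ i (Dz ζ i φ) x

theorem IsTest.lapz {φ : E3 → ℂ} (hφ : IsTest φ) (ζ : C3) : IsTest (lapz ζ φ) :=
  IsTest.sum fun i ↦ (hφ.Dz ζ i).Dz ζ i

theorem Dz_lapz (ζ : C3) (j : Fin 3) {φ : E3 → ℂ} (hφ : IsTest φ) (x : E3) :
    Dz ζ j (lapz ζ φ) x = lapz ζ (Dz ζ j φ) x := by
  have h2 : ∀ {ψ : E3 → ℂ}, IsTest ψ → ContDiff ℝ 2 ψ := fun hψ ↦ by exact_mod_cast hψ.contDiff 2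
  have h1 : ∀ i, Dz ζ j (Dz ζ i (Dz ζ i φ)) x = Dz ζ i (Dz ζ i (Dz ζ j φ)) x := fun i ↦ by
    rw [Dz_comm ζ (h2 (hφ.Dz ζ i)) j i]
    congr 1
    exact funext fun y ↦ Dz_comm ζ (h2 hφ) j i y
  have h3 : lapz ζ φ = fun y ↦ Dz ζ 0 (Dz ζ 0 φ) y + Dz ζ 1 (Dz ζ 1 φ) y + Dz ζ 2 (Dz ζ 2 φ) y :=
    funext fun y ↦ Fin.sum_univ_three _
  have h4 : ∀ i, IsTest (Dz ζ i (Dz ζ i φ)) := fun i ↦ (hφ.Dz ζ i).Dz ζ i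
  rw [h3, Dz_add ζ j (((h4 0).add (h4 1)).contDiff_one) (h4 2).contDiff_one,
    Dz_add ζ j (h4 0).contDiff_one (h4 1).contDiff_one, h1, h1, h1, CGO.lapz, Fin.sum_univ_three]

/-- The very weak form of an equation `-∑ (∂_i + iζ_i)² u = F`. -/
theorem WeakHelm.zeroInt_lapz {ζ : C3} {u F : E3 → ℂ} (h : WeakHelm ζ u F) (hu : ContDiff ℝ 1 u)
    {φ : E3 → ℂ} (hφ : IsTest φ) : ZeroInt (fun x ↦ u x * lapz (-ζ) φ x + F x * φ x) := by
  have h1 := ZeroInt.sum Finset.univ fun i _ ↦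
    zeroInt_Dz ζ i hu (hφ.Dz (-ζ) i).contDiff_one (hφ.Dz (-ζ) i).supp
  refine (h1.sub (h φ hφ.contDiff_one hφ.supp)).congr fun x ↦ ?_
  simp only [lapz, Fin.sum_univ_three]
  ring

/-- If `-∑ (∂_i + iζ_i)² u = F` then `∂_j + iζ_j` may be applied to both sides. -/
theorem WeakHelm.zeroInt_Dz_lapz {ζ : C3} {u F : E3 → ℂ} (h : WeakHelm ζ u F)
    (hu : ContDiff ℝ 1 u) (j : Fin 3) {φ : E3 → ℂ} (hφ : IsTest φ) :
    ZeroInt (fun x ↦ Dz ζ j u x * lapz (-ζ) φ x - F x * Dz (-ζ) j φ x) := by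
  have h1 := zeroInt_Dz ζ j hu (hφ.lapz (-ζ)).contDiff_one (hφ.lapz (-ζ)).supp
  refine (h1.sub (h.zeroInt_lapz hu (hφ.Dz (-ζ) j))).congr fun x ↦ ?_
  rw [Dz_lapz _ j hφ]
  ring

/-- The equation for `a z`, if `-∑ (∂_i + iζ_i)² z = F`. -/
theorem WeakHelm.zeroInt_mul {l : ℕ} {a : E3 → ℂ} (ha : Medium l a) {ζ : C3} {z F : E3 → ℂ}
    (h : WeakHelm ζ z F) (hz : ContDiff ℝ 1 z) {φ : E3 → ℂ} (hφ : IsTest φ) :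
    ZeroInt (fun x ↦ a x * z x * lapz (-ζ) φ x + 2 * ∑ i, D i a x * z x * Dz (-ζ) i φ x +
      (a x * F x + lap a x * z x) * φ x) := by
  have ha1 := ha.contDiff_one
  have haD := ha.contDiff_D_one
  have h1 := ZeroInt.sum Finset.univ fun i _ ↦
    zeroInt_Dz ζ i (ha1.mul hz) (hφ.Dz (-ζ) i).contDiff_one (hφ.Dz (-ζ) i).supp
  have h2 := h _ (ha1.mul hφ.contDiff_one) (hφ.supp.mul_left (f := a))
  have h3 := ZeroInt.sum Finset.univ fun i _ ↦
    zeroInt_Dz ζ i hz ((haD i).mul hφ.contDiff_one) (hφ.supp.mul_left (f := D i a))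
  refine ((h1.sub h2).add h3).congr fun x ↦ ?_
  simp only [Dz_mul _ _ ha1 hz, Dz_mul _ _ ha1 hφ.contDiff_one, Dz_mul _ _ (haD _) hφ.contDiff_one,
    lapz, lap, Fin.sum_univ_three]
  ring

/-- The scalar `Y = ∑ (∂_j + iζ_j) X_j + k² a z` formed from the potentials solves a homogeneous
scalar equation. -/
theorem zeroInt_gauge {l : ℕ} {a : E3 → ℂ} (ha : Medium l a) {k : ℝ} {ζ : C3}
    {X Φ : Fin 3 → E3 → ℂ} {z : E3 → ℂ} (hX : ∀ j, ContDiff ℝ 1 (X j)) (hz : ContDiff ℝ 1 z)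
    (hΦ : ∀ j, ContDiff ℝ 1 (Φ j))
    (hXw : ∀ j, WeakHelm ζ (X j) (fun x ↦ (k : ℂ) ^ 2 * a x ^ 2 * X j x +
      2 * (k : ℂ) ^ 2 * D j a x * z x + (k : ℂ) ^ 2 * Φ j x))
    (hzw : WeakHelm ζ z (fun x ↦ (k : ℂ) ^ 2 * a x ^ 2 * z x - 2 * (∑ j, D j a x * X j x) -
      lap a x * (a x)⁻¹ * z x - (a x)⁻¹ * ∑ j, Dz ζ j (Φ j) x)) {φ : E3 → ℂ} (hφ : IsTest φ) :
    ZeroInt (fun x ↦ (∑ j, Dz ζ j (X j) x + (k : ℂ) ^ 2 * a x * z x) * helm k (-ζ) φ x -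
      pot k a x * (∑ j, Dz ζ j (X j) x + (k : ℂ) ^ 2 * a x * z x) * φ x) := by
  have ha1 := ha.contDiff_one
  -- Apply `∂_j + iζ_j` to the equations for the `X_j` and add `k² a` times the equation for `z`.
  -- The source `Φ` cancels through `h3`, and `h4` turns the terms `a² ∂_j X_j + 2 a ∂_j a X_j`
  -- into a divergence.
  have h1 := ZeroInt.sum Finset.univ fun j _ ↦ (hXw j).zeroInt_Dz_lapz (hX j) j hφ
  have h2 := (hzw.zeroInt_mul ha hz hφ).const_mul ((k : ℂ) ^ 2)
  have h3 := (ZeroInt.sum Finset.univ fun j _ ↦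
    zeroInt_Dz ζ j (hΦ j) hφ.contDiff_one hφ.supp).const_mul ((k : ℂ) ^ 2)
  have h4 := (ZeroInt.sum Finset.univ fun j _ ↦
    zeroInt_Dz ζ j (ha1.mul (ha1.mul (hX j))) hφ.contDiff_one hφ.supp).const_mul ((k : ℂ) ^ 2)
  refine (((h1.add h2).add h3).add h4).congr fun x ↦ ?_
  have ha0 := ha.ne_zero x
  simp only [Dz_mul _ _ ha1 (ha1.mul (hX _)), Dz_mul _ _ ha1 (hX _), helm, lapz, pot,
    Fin.sum_univ_three]
  field_simp
  ring

/-! ### Solving for the potentials -/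

/-- The sources `f` of the potentials `X_j = η_j + G_ζ f_j` and `z = G_ζ f_∗` solve the fixed-point
system with extra forcing `Φ`. -/
structure IsPot (k : ℝ) (l : ℕ) (a : E3 → ℂ) (ζ η : C3) (Φ : Fin 3 → E3 → ℂ)
    (f : Option (Fin 3) → E3 → ℂ) : Prop where
  src : ∀ i, Src l (f i)
  vec : ∀ j x, f (some j) x = -pot k a x * (η j + Gop ζ (f (some j)) x) +
    2 * (k : ℂ) ^ 2 * D j a x * Gop ζ (f none) x + (k : ℂ) ^ 2 * Φ j x
  scal : ∀ x, f none x = -(pot k a x + lap a x * (a x)⁻¹) * Gop ζ (f none) x -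
    2 * (∑ j, D j a x * (η j + Gop ζ (f (some j)) x)) - (a x)⁻¹ * ∑ j, Dz ζ j (Φ j) x

/-- The forcing of the system for the potentials. -/
noncomputable def sysF (k : ℝ) (a : E3 → ℂ) (ζ η : C3) (Φ : Fin 3 → E3 → ℂ) :
    Option (Fin 3) → E3 → ℂ
  | some j => fun x ↦ -η j * pot k a x + (k : ℂ) ^ 2 * Φ j x
  | none => fun x ↦ ∑ j, (-2 * η j) * D j a x + (-1) * ((a x)⁻¹ * ∑ j, Dz ζ j (Φ j) x)

/-- The equations for the sources are the system with coefficients `sysV` and forcing `sysF`. -/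
theorem isPot_of_fixedPoint {k : ℝ} {l : ℕ} {a : E3 → ℂ} {ζ η : C3} {Φ : Fin 3 → E3 → ℂ}
    {f : Option (Fin 3) → E3 → ℂ} (hf : ∀ i, Src l (f i))
    (h : ∀ i x, f i x = sysF k a ζ η Φ i x + ∑ j, sysV k a i j x * Gop ζ (f j) x) :
    IsPot k l a ζ η Φ f := by
  refine ⟨hf, fun j x ↦ ?_, fun x ↦ ?_⟩
  · rw [h, Fintype.sum_option]
    simp only [sysF, sysV, ite_mul, zero_mul, Finset.sum_ite_eq, Finset.mem_univ, if_true]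
    ring
  · rw [h, Fintype.sum_option]
    simp only [sysF, sysV, Fin.sum_univ_three]
    ring

theorem Medium.src_sysF {l : ℕ} {a : E3 → ℂ} (ha : Medium l a) (k : ℝ) (ζ η : C3)
    {Φ : Fin 3 → E3 → ℂ} (hΦ : ∀ j, IsTest (Φ j)) (i) : Src l (sysF k a ζ η Φ i) := by
  obtain ⟨r, -, h1, -, h3⟩ := ha.exists_vanishOff k
  have e1 : Src l (pot k a) := .of_contDiff (ha.contDiff_pot k) h3.hasCompactSupport
  have e2 : ∀ j, Src l (D j a) := fun j ↦
    .of_contDiff ((ha.contDiff_D j).of_le (by norm_cast; omega)) (h1 j).hasCompactSupport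
  rcases i with _ | j
  · have e3 : IsTest fun x ↦ ∑ j, Dz ζ j (Φ j) x := IsTest.sum fun j ↦ (hΦ j).Dz ζ j
    have e4 : Src l (fun x ↦ (a x)⁻¹ * ∑ j, Dz ζ j (Φ j) x) :=
      .of_contDiff ((ha.contDiff_inv.of_le (by norm_cast; omega)).mul (e3.contDiff l))
        (e3.supp.mul_left (f := fun x ↦ (a x)⁻¹))
    exact (Src.sum _ fun j _ ↦ (e2 j).const_mul _).add (e4.const_mul (-1))
  · exact (e1.const_mul _).add (((hΦ j).src l).const_mul _)

/-- For large `ζ` the system for the sources is solvable, for every amplitude and every forcing. -/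
theorem exists_isPot {k : ℝ} (hk : 0 < k) {l : ℕ} {a : E3 → ℂ} (ha : Medium l a) :
    ∃ c : ℝ, ∀ ζ : C3, Adm k ζ → c ≤ ‖ζ‖ → ∀ (η : C3) (Φ : Fin 3 → E3 → ℂ), (∀ j, IsTest (Φ j)) →
      ∃ f, IsPot k l a ζ η Φ f := by
  obtain ⟨r, -, -, -, hr⟩ := ha.exists_vanishOff_sysV k
  obtain ⟨c, hc⟩ := exists_system_solution_of_src hk l (ha.contDiff_sysV k) hr
  refine ⟨c, fun ζ hζ hcζ η Φ hΦ ↦ ?_⟩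
  obtain ⟨f, hf, hfeq⟩ := hc ζ hζ hcζ _ (ha.src_sysF k ζ η hΦ)
  exact ⟨f, isPot_of_fixedPoint hf hfeq⟩

/-- Without extra forcing the sources are supported near the inhomogeneity and bounded by `|η|`. -/
theorem exists_isPot_bound {k : ℝ} (hk : 0 < k) {l : ℕ} {a : E3 → ℂ} (ha : Medium l a) :
    ∃ (χ : 𝓢(E3, ℂ)) (r : ℝ), HasCompactSupport χ ∧ (∀ x, ‖x‖ ≤ r → χ x = 1) ∧
      VanishOff r (fun x ↦ a x - 1) ∧ (∀ j, VanishOff r (D j a)) ∧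
      (∀ i j, VanishOff r (sysV k a i j)) ∧
      ∃ (c : ℝ) (C : ℝ≥0∞), C ≠ ∞ ∧ ∀ ζ : C3, Adm k ζ → c ≤ ‖ζ‖ → ∀ η : C3,
      ∃ f, IsPot k l a ζ η (fun _ _ ↦ 0) f ∧ (∀ i x, χ x * f i x = f i x) ∧
        ∑ i, sobN l (f i) ≤ C * ENNReal.ofReal ‖η‖ := by
  obtain ⟨r, h0, h1, h2, hr⟩ := ha.exists_vanishOff_sysV k
  obtain ⟨χ, hχs, hχ1, -⟩ := exists_schwartz_bump r
  have hχ : ∀ {F : E3 → ℂ}, VanishOff r F → ∀ x, χ x * F x = F x := fun {F} hF x ↦ by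
    rcases le_or_gt ‖x‖ r with hx | hx
    · rw [hχ1 x hx, one_mul]
    · rw [hF x hx, mul_zero]
  obtain ⟨c, hc⟩ := exists_system_solution hk l (ha.contDiff_sysV k) hχs fun i j ↦ hχ (hr i j)
  have hT : ∀ j : Fin 3, IsTest ((fun _ _ ↦ 0 : Fin 3 → E3 → ℂ) j) := fun _ ↦
    ⟨contDiff_const, HasCompactSupport.zero⟩
  have e1 : Src l (pot k a) := .of_contDiff (ha.contDiff_pot k) h2.hasCompactSupport
  have e2 : ∀ j, Src l (D j a) := fun j ↦
    .of_contDiff ((ha.contDiff_D j).of_le (by norm_cast; omega)) (h1 j).hasCompactSupport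
  have hF0 : ∀ (ζ η : C3), sysF k a ζ η (fun _ _ ↦ 0) = fun
      | some j => fun x ↦ -η j * pot k a x
      | none => fun x ↦ ∑ j, (-2 * η j) * D j a x := by
    intro ζ η
    ext i x
    rcases i with _ | j <;> simp [sysF, Dz, D]
  refine ⟨χ, r, hχs, hχ1, h0, h1, hr, c,
    2 * (2 * (∑ j : Fin 3, sobN l (D j a)) + 3 * sobN l (pot k a)), ?_, fun ζ hζ hcζ η ↦ ?_⟩
  · refine ENNReal.mul_ne_top (by simp) (ENNReal.add_ne_top.2 ⟨ENNReal.mul_ne_top (by simp) ?_,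
      ENNReal.mul_ne_top (by simp) e1.fin⟩)
    exact ENNReal.sum_ne_top.2 fun j _ ↦ (e2 j).fin
  obtain ⟨f, hf, hχf, hfeq, hle⟩ := hc ζ hζ hcζ _ (ha.src_sysF k ζ η hT) (fun i ↦ by
    rw [hF0]
    rcases i with _ | j
    · exact hχ fun x hx ↦ by simp [h1 _ x hx]
    · exact hχ fun x hx ↦ by simp [h2 x hx])
  refine ⟨f, isPot_of_fixedPoint hf hfeq, hχf, hle.trans ?_⟩
  have hη : ∀ j, ‖η j‖ₑ ≤ ENNReal.ofReal ‖η‖ := fun j ↦ by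
    rw [← ofReal_norm]
    exact ENNReal.ofReal_le_ofReal (PiLp.norm_apply_le η j)
  rw [Fintype.sum_option, hF0, mul_assoc, add_mul]
  gcongr
  · refine (sobN_sum_le l _ fun j _ ↦ ((e2 j).const_mul _).integrable).trans ?_
    rw [mul_assoc, Finset.sum_mul, Finset.mul_sum]
    refine Finset.sum_le_sum fun j _ ↦ ?_
    rw [sobN_const_mul, enorm_mul, mul_assoc]
    have : ‖(-2 : ℂ)‖ₑ = 2 := by rw [← ofReal_norm]; simp
    rw [this, mul_comm (sobN _ _)]
    gcongr
    exact hη j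
  · calc ∑ j : Fin 3, sobN l (fun x ↦ -η j * pot k a x)
        ≤ ∑ j : Fin 3, sobN l (pot k a) * ENNReal.ofReal ‖η‖ := by
          refine Finset.sum_le_sum fun j _ ↦ ?_
          rw [sobN_const_mul, mul_comm, enorm_neg]
          gcongr
          exact hη j
      _ = _ := by simp [mul_assoc]

section

variable {k : ℝ} (hk : 0 < k) {l : ℕ} (hl : 1 ≤ l) {a : E3 → ℂ} {ζ η : C3} (hζ : Adm k ζ)
  {Φ : Fin 3 → E3 → ℂ} {f : Option (Fin 3) → E3 → ℂ} (hf : IsPot k l a ζ η Φ f)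
include hk hl hζ hf

theorem IsPot.contDiff_vec (j : Fin 3) : ContDiff ℝ 1 (fun x ↦ η j + Gop ζ (f (some j)) x) :=
  contDiff_const.add (contDiff_Gop hk hζ hl (hf.src _))

theorem IsPot.contDiff_scal : ContDiff ℝ 1 (Gop ζ (f none)) :=
  contDiff_Gop hk hζ hl (hf.src _)

/-- The vector potential solves `-∑ (∂_i + iζ_i)² X_j = k² n X_j + 2k² ∂_j a z + k² Φ_j`. -/
theorem IsPot.weakHelm_vec (j : Fin 3) : WeakHelm ζ (fun x ↦ η j + Gop ζ (f (some j)) x)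
    (fun x ↦ (k : ℂ) ^ 2 * a x ^ 2 * (η j + Gop ζ (f (some j)) x) +
      2 * (k : ℂ) ^ 2 * D j a x * Gop ζ (f none) x + (k : ℂ) ^ 2 * Φ j x) := by
  refine ((weakHelm_const hζ (η j)).add (weakHelm_Gop hk hζ hl (hf.src (some j))) contDiff_const
    (contDiff_Gop hk hζ hl (hf.src _))).congr fun x ↦ ?_
  rw [hf.vec, pot]
  ring

/-- The scalar potential solves `-∑ (∂_i + iζ_i)² z = k² n z - 2 ∇a·X - a⁻¹ Δa z - a⁻¹ (∇ + iζ)·Φ`.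
-/
theorem IsPot.weakHelm_scal : WeakHelm ζ (Gop ζ (f none)) (fun x ↦
    (k : ℂ) ^ 2 * a x ^ 2 * Gop ζ (f none) x -
      2 * (∑ j, D j a x * (η j + Gop ζ (f (some j)) x)) -
      lap a x * (a x)⁻¹ * Gop ζ (f none) x - (a x)⁻¹ * ∑ j, Dz ζ j (Φ j) x) := by
  refine (weakHelm_Gop hk hζ hl (hf.src none)).congr fun x ↦ ?_
  rw [hf.scal, pot]
  ring

end

/-- For large `ζ` the potentials satisfy the gauge condition `∑ (∂_j + iζ_j) X_j + k² a z = 0`: the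
left-hand side is slowly growing and solves a homogeneous scalar equation. -/
theorem exists_gauge {k : ℝ} (hk : 0 < k) {δ : ℝ} (hδ : -1 < δ) (hδ' : δ < 0) {l : ℕ} (hl : 1 ≤ l)
    {a : E3 → ℂ} (ha : Medium l a) :
    ∃ c : ℝ, ∀ ζ : C3, Adm k ζ → c ≤ ‖ζ‖ → ∀ (η : C3) (Φ : Fin 3 → E3 → ℂ)
      (f : Option (Fin 3) → E3 → ℂ), dot ζ η = 0 → (∀ j, IsTest (Φ j)) → IsPot k l a ζ η Φ f →
      ∀ x, ∑ j, Dz ζ j (fun y ↦ η j + Gop ζ (f (some j)) y) x +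
        (k : ℂ) ^ 2 * a x * Gop ζ (f none) x = 0 := by
  obtain ⟨r, h0, h1, h2, -⟩ := ha.exists_vanishOff_sysV k
  obtain ⟨c, hc⟩ := exists_scalar_uniqueness hk hδ hδ' hl (ha.contDiff_pot k) h2
  refine ⟨c, fun ζ hζ hcζ η Φ f hη hΦ hf ↦ ?_⟩
  have hX := hf.contDiff_vec hk hl hζ
  have hz := hf.contDiff_scal hk hl hζ
  have hG : ∀ j, ContDiff ℝ 1 (Gop ζ (f (some j))) := fun j ↦ contDiff_Gop hk hζ hl (hf.src _)
  refine hc ζ hζ hcζ _ ?_ ?_ fun φ hφ ↦ zeroInt_gauge ha hX hz (fun j ↦ (hΦ j).contDiff_one)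
    (hf.weakHelm_vec hk hl hζ) (hf.weakHelm_scal hk hl hζ) hφ
  · exact (continuous_finsetSum _ fun j _ ↦ continuous_Dz ζ j (hX j)).add
      ((continuous_const.mul ha.smooth.continuous).mul hz.continuous)
  -- The divergence of the constant part of `X` is `iζ·η = 0`. What remains is a sum of terms `G_ζ
  -- f`, `∂_j G_ζ f` and a compactly supported function.
  · have e1 : (fun x ↦ ∑ j, Dz ζ j (fun y ↦ η j + Gop ζ (f (some j)) y) x +
        (k : ℂ) ^ 2 * a x * Gop ζ (f none) x) = fun x ↦
        (∑ j, (D j (Gop ζ (f (some j))) x + Complex.I * ζ j * Gop ζ (f (some j)) x) +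
          ((k : ℂ) ^ 2 * Gop ζ (f none) x +
            (k : ℂ) ^ 2 * ((a x - 1) * Gop ζ (f none) x))) := by
      ext x
      simp only [dot, Fin.sum_univ_three] at hη
      simp only [Dz_add ζ _ contDiff_const (hG _), Dz_const, Fin.sum_univ_three]
      unfold Dz
      linear_combination Complex.I * hη
    rw [e1]
    have g1 : ∀ i, Growth (-δ) (Gop ζ (f i)) := fun i ↦ (growth_Gop hk hζ hδ hδ' (hf.src i)).1
    have g2 : ∀ j, Growth (-δ) (D j (Gop ζ (f (some j)))) := fun j ↦
      (growth_D_Gop hk hζ hδ hδ' hl (hf.src _) j).1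
    have g3 : Growth (-δ) (fun x ↦ (a x - 1) * Gop ζ (f none) x) :=
      growth_of_hasCompactSupport hδ hδ' ((ha.smooth.continuous.sub continuous_const).mul
        hz.continuous) ha.supp.mul_right
    have c1 : ∀ i, Continuous (Gop ζ (f i)) := fun i ↦ continuous_Gop hk hζ (hf.src i)
    have c3 : Continuous (fun x ↦ (a x - 1) * Gop ζ (f none) x) :=
      (ha.smooth.continuous.sub continuous_const).mul (c1 _)
    have c2 : ∀ j, Continuous fun x ↦
        (D j (Gop ζ (f (some j))) x + Complex.I * ζ j * Gop ζ (f (some j)) x) := fun j ↦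
      (continuous_D (hG j) j).add (continuous_const.mul (c1 _))
    refine Growth.add (Growth.sum _ (fun j ↦ (g2 j).add ((g1 _).const_mul _)
      (continuous_D (hG j) j).locallyIntegrable (continuous_const.mul (c1 _)).locallyIntegrable)
      fun j ↦ (c2 j).locallyIntegrable) (((g1 _).const_mul _).add (g3.const_mul _)
      (continuous_const.mul (c1 _)).locallyIntegrable
      (continuous_const.mul c3).locallyIntegrable)
      (continuous_finsetSum _ fun j _ ↦ c2 j).locallyIntegrable
      ((continuous_const.mul (c1 _)).add (continuous_const.mul c3)).locallyIntegrable

/-! ### The field built from the potentials -/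

/-- The components of `α = ∇n/n`, for `n = a²`. -/
noncomputable def alf (a : E3 → ℂ) (j : Fin 3) (x : E3) : ℂ := 2 * D j a x * (a x)⁻¹

/-- The scalar potential `W = a⁻¹ z`. -/
noncomputable def potW (a : E3 → ℂ) (ζ : C3) (f : Option (Fin 3) → E3 → ℂ) (x : E3) : ℂ :=
  (a x)⁻¹ * Gop ζ (f none) x

/-- The conjugated field `E = X - (∇ + iζ) W`. -/
noncomputable def potE (a : E3 → ℂ) (ζ η : C3) (f : Option (Fin 3) → E3 → ℂ) (j : Fin 3)
    (x : E3) : ℂ := η j + Gop ζ (f (some j)) x - Dz ζ j (potW a ζ f) x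

theorem Medium.D_inv {l : ℕ} {a : E3 → ℂ} (ha : Medium l a) (j : Fin 3) (x : E3) :
    D j (fun y ↦ (a y)⁻¹) x = -(a x)⁻¹ ^ 2 * D j a x := by
  have ha1 := ha.contDiff_one
  have hb1 : ContDiff ℝ 1 fun y ↦ (a y)⁻¹ := ha.contDiff_inv.of_le (by norm_cast; omega)
  have h1 := D_mul (ha1.differentiable one_ne_zero x) (hb1.differentiable one_ne_zero x) j
  have h2 : (fun y ↦ a y * (a y)⁻¹) = fun _ ↦ 1 := funext fun y ↦ mul_inv_cancel₀ (ha.ne_zero y)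
  rw [h2, D_const] at h1
  have h3 := ha.ne_zero x
  field_simp at h1 ⊢
  linear_combination -h1

section

variable {k : ℝ} (hk : 0 < k) {l : ℕ} (hl : 1 ≤ l) {a : E3 → ℂ} (ha : Medium l a) {ζ η : C3}
  (hζ : Adm k ζ) {f : Option (Fin 3) → E3 → ℂ} (hf : IsPot k l a ζ η (fun _ _ ↦ 0) f)
include hk hl ha hζ hf

theorem IsPot.contDiff_potW : ContDiff ℝ 1 (potW a ζ f) :=
  (ha.contDiff_inv.of_le (by norm_cast; omega)).mul (hf.contDiff_scal hk hl hζ)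

theorem IsPot.continuous_potE (j : Fin 3) : Continuous (potE a ζ η f j) :=
  (hf.contDiff_vec hk hl hζ j).continuous.sub
    (continuous_Dz ζ j (hf.contDiff_potW hk hl ha hζ))

/-- The equation for the scalar potential. -/
theorem IsPot.weakHelm_potW : WeakHelm ζ (potW a ζ f) (fun x ↦
    (k : ℂ) ^ 2 * a x ^ 2 * potW a ζ f x - ∑ i, alf a i x * potE a ζ η f i x) := by
  intro ψ hψ hψs
  have ha1 := ha.contDiff_one
  have hb1 : ContDiff ℝ 1 fun y ↦ (a y)⁻¹ := ha.contDiff_inv.of_le (by norm_cast; omega)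
  have hW := hf.contDiff_potW hk hl ha hζ
  have haD := ha.contDiff_D_one
  have h1 := hf.weakHelm_scal hk hl hζ _ (hb1.mul hψ) (hψs.mul_left (f := fun y ↦ (a y)⁻¹))
  have h2 := ZeroInt.sum Finset.univ fun i _ ↦
    zeroInt_Dz ζ i (hb1.mul ((haD i).mul hW)) hψ hψs
  have hz : Gop ζ (f none) = fun x ↦ a x * potW a ζ f x := by
    ext x
    rw [potW, mul_inv_cancel_left₀ (ha.ne_zero x)]
  refine (h1.sub h2).congr fun x ↦ ?_
  have hD0 : ∀ j, Dz ζ j (fun _ : E3 ↦ (0 : ℂ)) x = 0 := fun j ↦ by simp [Dz_const]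
  rw [hz]
  simp only [Dz_mul _ _ ha1 hW, Dz_mul _ _ hb1 hψ, Dz_mul _ _ hb1 ((haD _).mul hW),
    Dz_mul _ _ (haD _) hW, ha.D_inv, alf, potE, lap, Fin.sum_univ_three, hD0]
  have h0 := ha.ne_zero x
  field_simp
  ring

/-- The second-order equation satisfied by the components of the field. -/
theorem IsPot.zeroInt_potE_lapz (j : Fin 3) {φ : E3 → ℂ} (hφ : IsTest φ) :
    ZeroInt (fun x ↦ potE a ζ η f j x * lapz (-ζ) φ x +
      (k : ℂ) ^ 2 * a x ^ 2 * potE a ζ η f j x * φ x -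
      (∑ i, alf a i x * potE a ζ η f i x) * Dz (-ζ) j φ x) := by
  have ha1 := ha.contDiff_one
  have hW := hf.contDiff_potW hk hl ha hζ
  have h1 := (hf.weakHelm_vec hk hl hζ j).zeroInt_lapz (hf.contDiff_vec hk hl hζ j) hφ
  have h2 := (hf.weakHelm_potW hk hl ha hζ).zeroInt_Dz_lapz hW j hφ
  have h3 := (zeroInt_Dz ζ j (ha1.mul (ha1.mul hW)) hφ.contDiff_one hφ.supp).const_mul ((k : ℂ) ^ 2)
  have hz : Gop ζ (f none) = fun x ↦ a x * potW a ζ f x := by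
    ext x
    rw [potW, mul_inv_cancel_left₀ (ha.ne_zero x)]
  refine ((h1.sub h2).sub h3).congr fun x ↦ ?_
  have e1 : potE a ζ η f j x = η j + Gop ζ (f (some j)) x - Dz ζ j (potW a ζ f) x := rfl
  rw [hz, e1]
  simp only [Dz_mul _ _ ha1 (ha1.mul hW), Dz_mul _ _ ha1 hW]
  ring

/-- The remainder `E - η` solves the remainder equation. -/
theorem IsPot.zeroInt_remainder (j : Fin 3) {φ : E3 → ℂ} (hφ : IsTest φ) :
    ZeroInt (fun x ↦ (potE a ζ η f j x - η j) * helm k (-ζ) φ x -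
      ((∑ i, alf a i x * potE a ζ η f i x) * Dz (-ζ) j φ x +
        pot k a x * potE a ζ η f j x * φ x)) := by
  have h1 := hf.zeroInt_potE_lapz hk hl ha hζ j hφ
  have h2 := (weakHelm_const hζ (η j)).zeroInt_lapz contDiff_const hφ
  refine (h1.sub h2).congr fun x ↦ ?_
  simp only [helm, lapz, pot]
  ring

/-- The gauge condition implies that `nE` is divergence free. -/
theorem IsPot.zeroInt_div (hY : ∀ x, ∑ j, Dz ζ j (fun y ↦ η j + Gop ζ (f (some j)) y) x +
      (k : ℂ) ^ 2 * a x * Gop ζ (f none) x = 0) {φ : E3 → ℂ} (hφ : ContDiff ℝ 1 φ)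
    (hφs : HasCompactSupport φ) :
    ZeroInt (fun x ↦ a x ^ 2 * ∑ j, potE a ζ η f j x * Dz (-ζ) j φ x) := by
  have ha1 := ha.contDiff_one
  have hX := hf.contDiff_vec hk hl hζ
  have h1 := ZeroInt.sum Finset.univ fun j _ ↦
    zeroInt_Dz ζ j (ha1.mul (ha1.mul (hX j))) hφ hφs
  have h2 := hf.weakHelm_potW hk hl ha hζ _ (ha1.mul (ha1.mul hφ))
    ((hφs.mul_left (f := a)).mul_left (f := a))
  refine (h1.sub h2).congr fun x ↦ ?_
  have h0 := ha.ne_zero x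
  have e1 : ∀ j, potE a ζ η f j x = η j + Gop ζ (f (some j)) x - Dz ζ j (potW a ζ f) x :=
    fun _ ↦ rfl
  have e2 := hY x
  have hz : Gop ζ (f none) x = a x * potW a ζ f x := by
    rw [potW, mul_inv_cancel_left₀ h0]
  rw [hz] at e2
  simp only [Dz_mul _ _ ha1 (ha1.mul (hX _)), Dz_mul _ _ ha1 (hX _), Dz_mul _ _ ha1 (ha1.mul hφ),
    Dz_mul _ _ ha1 hφ, e1, alf, Fin.sum_univ_three] at e2 ⊢
  field_simp
  linear_combination (-a x * φ x) * e2

end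

/-- Uniqueness for the homogeneous remainder equation, among slowly growing fields. -/
theorem exists_field_uniqueness {k : ℝ} (hk : 0 < k) {δ : ℝ} (hδ : -1 < δ) (hδ' : δ < 0) {l : ℕ}
    (hl : 1 ≤ l) {a : E3 → ℂ} (ha : Medium l a) :
    ∃ c : ℝ, ∀ ζ : C3, Adm k ζ → c ≤ ‖ζ‖ → ∀ U : Fin 3 → E3 → ℂ, (∀ j, LocallyIntegrable (U j)) →
      (∀ j, Growth (-δ) (U j)) →
      (∀ j φ, IsTest φ → ZeroInt (fun x ↦ U j x * helm k (-ζ) φ x -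
        ((∑ i, alf a i x * U i x) * Dz (-ζ) j φ x + pot k a x * U j x * φ x))) →
      ∀ j, U j =ᵐ[volume] 0 := by
  obtain ⟨c1, hc1⟩ := exists_isPot hk ha
  obtain ⟨c2, hc2⟩ := exists_gauge hk hδ hδ' hl ha
  obtain ⟨r, -, hr1, hr2, -⟩ := ha.exists_vanishOff_sysV k
  refine ⟨max c1 c2, fun ζ hζ hcζ U hU hgr h j0 ↦ ae_eq_zero_of_test (hU j0) fun Φ0 hΦ0 ↦ ?_⟩
  have hn : ‖-ζ‖ = ‖ζ‖ := norm_neg ζ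
  -- It suffices to test one component at a time.
  set Φ : Fin 3 → E3 → ℂ := fun j x ↦ if j = j0 then Φ0 x else 0 with hΦ
  have hΦt : ∀ j, IsTest (Φ j) := fun j ↦ by
    by_cases hj : j = j0
    · simpa [hΦ, hj] using hΦ0
    · simpa [hΦ, hj] using (⟨contDiff_const, HasCompactSupport.zero⟩ : IsTest fun _ ↦ 0)
  -- Duality: the system is solved for `-ζ`, with amplitude `0` and with the test function as
  -- forcing.
  obtain ⟨f, hf⟩ := hc1 (-ζ) hζ.neg (by rw [hn]; exact (le_max_left _ _).trans hcζ) 0 Φ hΦt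
  have hY := hc2 (-ζ) hζ.neg (by rw [hn]; exact (le_max_right _ _).trans hcζ) 0 Φ f
    (by simp [dot]) hΦt hf
  have hac : ∀ i, Continuous (alf a i) := fun i ↦
    (continuous_const.mul (ha.contDiff_D_one i).continuous).mul ha.contDiff_inv.continuous
  have har : ∀ i, VanishOff r (alf a i) := fun i x hx ↦ by simp [alf, hr1 i x hx]
  have hloc : ∀ g : E3 → ℂ, Continuous g → VanishOff r g → ∀ i,
      LocallyIntegrable (fun x ↦ g x * U i x) := fun g hg hgr i ↦ by
    have := integrable_mul_of_locallyIntegrable (hU i) hg hgr.hasCompactSupport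
    simpa only [mul_comm] using this.locallyIntegrable
  have hS : LocallyIntegrable (fun x ↦ ∑ i, alf a i x * U i x) :=
    locallyIntegrable_finsetSum _ fun i _ ↦ hloc _ (hac i) (har i) i
  -- Each `U_j` is tested against the source of the `j`-th component of that solution; the gauge
  -- condition `hY` turns the divergence of the vector potential into a multiple of the scalar one.
  have hrep := ZeroInt.sum Finset.univ fun j _ ↦
    representation hk hζ hδ hδ' (u := U j) (b := fun x ↦ pot k a x * U j x)
      (A := fun i x ↦ if i = j then ∑ i, alf a i x * U i x else 0) (hU j) (hgr j)
      (fun i ↦ by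
        by_cases hi : i = j
        · simpa [hi] using hS
        · simpa [hi] using locallyIntegrable_zero)
      (hloc _ (ha.contDiff_pot k).continuous hr2 j) (ρ := r)
      (fun i x hx ↦ by simp [har _ x hx]) (fun x hx ↦ by simp [hr2 x hx])
      (fun φ hφ ↦ by simpa [ite_mul] using h j φ hφ) hl (hf.src (some j))
  have hk0 : (k : ℂ) ≠ 0 := by exact_mod_cast hk.ne'
  refine ((hrep.const_mul ((k : ℂ) ^ 2)⁻¹).congr (g := fun x ↦ U j0 x * Φ0 x) fun x ↦ ?_).2
  have e1 := hf.vec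
  have e2 := hY x
  have h0 := ha.ne_zero x
  have e3 : U j0 x * Φ0 x = ∑ j, U j x * Φ j x := by
    simp [hΦ]
  rw [e3]
  simp only [PiLp.zero_apply, zero_add] at e1 e2
  simp only [ite_mul, zero_mul, Finset.sum_ite_eq', Finset.mem_univ, if_true, e1, alf] at e2 ⊢
  simp only [Fin.sum_univ_three] at e2 ⊢
  field_simp
  linear_combination (-2 * (D 0 a x * U 0 x + D 1 a x * U 1 x + D 2 a x * U 2 x)) * e2

/-- The conjugated Maxwell equation: `∇×∇×` is `∇(∇·) - Δ`, and `∇·(nE) = 0` gives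
`∇·E = -α·E`. -/
theorem IsPot.zeroInt_curl {k : ℝ} (hk : 0 < k) {l : ℕ} (hl : 1 ≤ l) {a : E3 → ℂ}
    (ha : Medium l a) {ζ η : C3} (hζ : Adm k ζ) {f : Option (Fin 3) → E3 → ℂ}
    (hf : IsPot k l a ζ η (fun _ _ ↦ 0) f)
    (hY : ∀ x, ∑ j, Dz ζ j (fun y ↦ η j + Gop ζ (f (some j)) y) x +
      (k : ℂ) ^ 2 * a x * Gop ζ (f none) x = 0) (j : Fin 3) {φ : E3 → ℂ} (hφ : IsTest φ) :
    ZeroInt (fun x ↦ ∑ i, potE a ζ η f i x * Dz (-ζ) i (Dz (-ζ) j φ) x -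
      potE a ζ η f j x * lapz (-ζ) φ x - (k : ℂ) ^ 2 * a x ^ 2 * potE a ζ η f j x * φ x) := by
  have hb1 : ContDiff ℝ 1 fun y ↦ (a y)⁻¹ := ha.contDiff_inv.of_le (by norm_cast; omega)
  have hψ := hφ.Dz (-ζ) j
  have h1 := hf.zeroInt_div hk hl ha hζ hY (hb1.mul (hb1.mul hψ.contDiff_one))
    ((hψ.supp.mul_left (f := fun y ↦ (a y)⁻¹)).mul_left (f := fun y ↦ (a y)⁻¹))
  refine (h1.sub (hf.zeroInt_potE_lapz hk hl ha hζ j hφ)).congr fun x ↦ ?_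
  have h0 := ha.ne_zero x
  simp only [Dz_mul _ _ hb1 (hb1.mul hψ.contDiff_one), Dz_mul _ _ hb1 hψ.contDiff_one, ha.D_inv,
    alf, Fin.sum_univ_three]
  field_simp
  ring

/-! ### Translation to distributions -/

/-- An integrable function with a given integral. -/
def HasInt (f : E3 → ℂ) (c : ℂ) : Prop := Integrable f ∧ ∫ x, f x = c

theorem HasInt.add {f g : E3 → ℂ} {c d : ℂ} (hf : HasInt f c) (hg : HasInt g d) :
    HasInt (fun x ↦ f x + g x) (c + d) :=
  ⟨hf.1.add hg.1, by rw [integral_add hf.1 hg.1, hf.2, hg.2]⟩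

theorem HasInt.sub {f g : E3 → ℂ} {c d : ℂ} (hf : HasInt f c) (hg : HasInt g d) :
    HasInt (fun x ↦ f x - g x) (c - d) :=
  ⟨hf.1.sub hg.1, by rw [integral_sub hf.1 hg.1, hf.2, hg.2]⟩

theorem HasInt.const_mul {f : E3 → ℂ} {c : ℂ} (hf : HasInt f c) (t : ℂ) :
    HasInt (fun x ↦ t * f x) (t * c) :=
  ⟨hf.1.const_mul t, by rw [integral_const_mul, hf.2]⟩

theorem HasInt.congr {f g : E3 → ℂ} {c d : ℂ} (hf : HasInt f c) (h : ∀ x, g x = f x) (hd : d = c) :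
    HasInt g d := by
  rw [show g = f from funext h, hd]; exact hf

/-- Real test functions. -/
abbrev RTest := 𝓓((⊤ : TopologicalSpace.Opens E3), ℝ)

/-- A real test function, viewed as a complex-valued function. -/
noncomputable def cx (φ : RTest) (x : E3) : ℂ := (φ x : ℂ)

theorem isTest_cx (φ : RTest) : IsTest (cx φ) :=
  ⟨Complex.ofRealCLM.contDiff.comp φ.contDiff,
    φ.hasCompactSupport.comp_left (g := fun t : ℝ ↦ (t : ℂ)) (by simp)⟩

/-- The partial derivative of a real test function. -/
noncomputable def dT (j : Fin 3) (φ : RTest) : RTest := ∂_{e j} φ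

theorem cx_dT (j : Fin 3) (φ : RTest) : cx (dT j φ) = D j (cx φ) := by
  ext x
  have h1 : dT j φ x = lineDeriv ℝ φ x (e j) :=
    TestFunction.lineDerivCLM_apply_of_le (𝕜 := ℝ) (n := ⊤) (k := ⊤) (f := φ) (by simp)
  have h2 : DifferentiableAt ℝ φ x := (φ.contDiff.differentiable (by simp)).differentiableAt
  rw [cx, h1, h2.lineDeriv_eq_fderiv]
  have h3 := (Complex.ofRealCLM.hasFDerivAt (x := φ x)).comp x h2.hasFDerivAt
  have h4 : fderiv ℝ (cx φ) x = Complex.ofRealCLM.comp (fderiv ℝ φ x) := h3.fderiv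
  rw [D, h4]
  rfl

theorem pd_apply (j : Fin 3) (T : Distr) (φ : RTest) : pd j T φ = -T (dT j φ) := by
  rw [pd, Distribution.lineDerivOp_apply_apply, map_neg]
  rfl

theorem hasInt_toDistr {u : E3 → ℂ} (hu : LocallyIntegrable u) (φ : RTest) :
    HasInt (fun x ↦ u x * cx φ x) (toDistr u φ) := by
  refine ⟨integrable_mul_of_locallyIntegrable hu (isTest_cx φ).smooth.continuous
    (isTest_cx φ).supp, ?_⟩
  have h1 : toDistr u φ = ∫ x, ContinuousLinearMap.lsmul ℝ ℝ (φ x) (u x) :=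
    TestFunction.integralAgainstBilinCLM_eq_integral (hu.locallyIntegrableOn _)
  rw [h1]
  congr 1; ext x
  simp only [ContinuousLinearMap.lsmul_apply, Complex.real_smul, cx, mul_comm]

theorem add_distr_apply (S T : Distr) (φ : RTest) : (S + T) φ = S φ + T φ := rfl

theorem sub_distr_apply (S T : Distr) (φ : RTest) : (S - T) φ = S φ - T φ := rfl

theorem neg_distr_apply (T : Distr) (φ : RTest) : (-T) φ = -T φ := rfl

theorem smul_distr_apply (c : ℂ) (T : Distr) (φ : RTest) : (c • T) φ = c * T φ := rfl

theorem distr_ext {S T : Distr} (h : ∀ φ : RTest, S φ = T φ) : S = T :=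
  DFunLike.ext _ _ h

/-- Every complex test function is a combination of real ones. -/
theorem IsTest.exists_cx {φ : E3 → ℂ} (hφ : IsTest φ) :
    ∃ φ1 φ2 : RTest, φ = fun x ↦ cx φ1 x + Complex.I * cx φ2 x := by
  refine ⟨⟨fun x ↦ (φ x).re, Complex.reCLM.contDiff.comp hφ.smooth,
    hφ.supp.comp_left (g := Complex.re) (by simp), fun _ _ ↦ trivial⟩,
    ⟨fun x ↦ (φ x).im, Complex.imCLM.contDiff.comp hφ.smooth,
    hφ.supp.comp_left (g := Complex.im) (by simp), fun _ _ ↦ trivial⟩, ?_⟩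
  ext x
  change φ x = ((φ x).re : ℂ) + Complex.I * ((φ x).im : ℂ)
  rw [mul_comm, Complex.re_add_im]

/-- The remainder equation, tested against real test functions. -/
theorem remainder_apply {k : ℝ} {ζ : C3} (hζ : dot ζ ζ = (k : ℂ) ^ 2) {u S b : E3 → ℂ}
    (hu : LocallyIntegrable u) (hS : LocallyIntegrable S) (hb : LocallyIntegrable b) (j : Fin 3)
    (φ : RTest) :
    HasInt (fun x ↦ u x * helm k (-ζ) (cx φ) x - (S x * Dz (-ζ) j (cx φ) x + b x * cx φ x))
      ((laplacian (toDistr u) + (2 * Complex.I) • dirDeriv ζ (toDistr u)) φ -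
        (-(pd j (toDistr S) + (Complex.I * ζ j) • toDistr S) + toDistr b) φ) := by
  have h1 : ∀ i, HasInt _ _ := fun i ↦ hasInt_toDistr hu (dT i (dT i φ))
  have h2 : ∀ i, HasInt _ _ := fun i ↦ (hasInt_toDistr hu (dT i φ)).const_mul
    (-2 * Complex.I * ζ i)
  have h3 := hasInt_toDistr hS (dT j φ)
  have h4 := (hasInt_toDistr hS φ).const_mul (Complex.I * ζ j)
  have h5 := hasInt_toDistr hb φ
  have hφ := isTest_cx φ
  refine ((((((h1 0).add (h1 1)).add (h1 2)).add (((h2 0).add (h2 1)).add (h2 2))).sub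
    (h3.sub h4)).sub h5).congr (fun x ↦ ?_) ?_
  · have e1 : ∀ i, Dz (-ζ) i (Dz (-ζ) i (cx φ)) x = D i (D i (cx φ)) x -
        2 * (Complex.I * ζ i) * D i (cx φ) x - ζ i ^ 2 * cx φ x := by
      intro i
      have e2 : Dz (-ζ) i (cx φ) = fun y ↦ D i (cx φ) y + Complex.I * (-ζ) i * cx φ y := rfl
      rw [e2, Dz_add _ _ (hφ.D i).contDiff_one (contDiff_const.mul hφ.contDiff_one),
        Dz_const_mul _ _ _ hφ.contDiff_one]
      unfold Dz
      simp only [PiLp.neg_apply]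
      linear_combination (ζ i ^ 2 * cx φ x) * Complex.I_sq
    simp only [dot, Fin.sum_univ_three] at hζ
    simp only [cx_dT, helm, e1, Fin.sum_univ_three]
    simp only [Dz, PiLp.neg_apply]
    linear_combination (-u x * cx φ x) * hζ
  · simp only [laplacian, dirDeriv, Fin.sum_univ_three, add_distr_apply, neg_distr_apply,
      smul_distr_apply, pd_apply]
    ring

theorem helm_add_const_mul (k : ℝ) (ζ : C3) {φ ψ : E3 → ℂ} (hφ : IsTest φ) (hψ : IsTest ψ) (c : ℂ)
    (x : E3) :
    helm k ζ (fun y ↦ φ y + c * ψ y) x = helm k ζ φ x + c * helm k ζ ψ x := by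
  have h1 : ∀ {p q : E3 → ℂ}, IsTest p → IsTest q → ∀ i, Dz ζ i (fun y ↦ p y + c * q y) =
      fun y ↦ Dz ζ i p y + c * Dz ζ i q y := fun hp hq i ↦ funext fun y ↦ by
    rw [Dz_add ζ i hp.contDiff_one (hq.const_mul c).contDiff_one,
      Dz_const_mul _ _ _ hq.contDiff_one]
  simp only [helm, h1 hφ hψ, h1 (hφ.Dz ζ _) (hψ.Dz ζ _), Fin.sum_univ_three]
  ring

/-- The remainder equation for distributions is equivalent to its weak form. -/
theorem remainder_iff {k : ℝ} {ζ : C3} (hζ : dot ζ ζ = (k : ℂ) ^ 2) {u S b : E3 → ℂ}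
    (hu : LocallyIntegrable u) (hS : LocallyIntegrable S) (hb : LocallyIntegrable b) (j : Fin 3) :
    laplacian (toDistr u) + (2 * Complex.I) • dirDeriv ζ (toDistr u) =
        -(pd j (toDistr S) + (Complex.I * ζ j) • toDistr S) + toDistr b ↔
      ∀ φ, IsTest φ → ZeroInt (fun x ↦ u x * helm k (-ζ) φ x -
        (S x * Dz (-ζ) j φ x + b x * φ x)) := by
  constructor
  · intro h φ hφ
    have h1 : ∀ φ : RTest, ZeroInt (fun x ↦ u x * helm k (-ζ) (cx φ) x -
        (S x * Dz (-ζ) j (cx φ) x + b x * cx φ x)) := fun φ ↦ by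
      have := remainder_apply hζ hu hS hb j φ
      rw [h, sub_self] at this
      exact this
    -- Distributions act on real test functions, the weak form uses complex ones.
    obtain ⟨φ1, φ2, rfl⟩ := hφ.exists_cx
    refine ((h1 φ1).add ((h1 φ2).const_mul Complex.I)).congr fun x ↦ ?_
    rw [helm_add_const_mul _ _ (isTest_cx φ1) (isTest_cx φ2),
      Dz_add _ _ (isTest_cx φ1).contDiff_one ((isTest_cx φ2).const_mul _).contDiff_one,
      Dz_const_mul _ _ _ (isTest_cx φ2).contDiff_one]
    ring
  · intro h
    refine distr_ext fun φ ↦ sub_eq_zero.1 ?_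
    rw [← (remainder_apply hζ hu hS hb j φ).2]
    exact (h _ (isTest_cx φ)).2

/-- The exponential `e^{iζ·x}`. -/
noncomputable def expz (ζ : C3) (x : E3) : ℂ := Complex.exp (Complex.I * dotR ζ x)

theorem contDiff_expz (ζ : C3) {n : WithTop ℕ∞} : ContDiff ℝ n (expz ζ) := by
  unfold expz dotR
  refine ContDiff.cexp (contDiff_const.mul (ContDiff.sum fun j _ ↦ contDiff_const.mul ?_))
  exact Complex.ofRealCLM.contDiff.comp (contDiff_piLp_apply (p := 2) (i := j))

theorem D_expz (ζ : C3) (j : Fin 3) (x : E3) : D j (expz ζ) x = Complex.I * ζ j * expz ζ x := by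
  have h1 : HasFDerivAt (fun x : E3 ↦ Complex.I * dotR ζ x)
      (Complex.I • ∑ j, ζ j • Complex.ofRealCLM.comp (EuclideanSpace.proj (𝕜 := ℝ) j)) x := by
    refine HasFDerivAt.const_mul ?_ _
    unfold dotR
    exact HasFDerivAt.fun_sum fun j _ ↦ HasFDerivAt.const_mul
      (Complex.ofRealCLM.comp (EuclideanSpace.proj (𝕜 := ℝ) j)).hasFDerivAt _
  have h2 : fderiv ℝ (expz ζ) x = _ := h1.cexp.fderiv
  rw [D, h2]
  fin_cases j <;> simp [Fin.sum_univ_three, e, expz] <;> ring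

/-- Conjugation with the exponential turns `∂_j - iζ_j` into `∂_j`. -/
theorem Dz_expz_mul (ζ : C3) (j : Fin 3) {φ : E3 → ℂ} (hφ : ContDiff ℝ 1 φ) :
    Dz (-ζ) j (fun y ↦ expz ζ y * φ y) = fun x ↦ expz ζ x * D j φ x := by
  ext x
  rw [Dz_mul _ _ (contDiff_expz ζ) hφ, D_expz, Dz, PiLp.neg_apply]
  ring

theorem dT_comm (i j : Fin 3) (φ : RTest) : dT i (dT j φ) = dT j (dT i φ) := by
  ext x
  have h : cx (dT i (dT j φ)) x = cx (dT j (dT i φ)) x := by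
    simp only [cx_dT]
    exact D_comm (by exact_mod_cast (isTest_cx φ).contDiff 2) i j x
  exact Complex.ofReal_injective h

/-- `∇×∇× = ∇(∇·) - Δ`, tested against `φ`. -/
theorem curl_curl_apply (T : Fin 3 → Distr) (j : Fin 3) (φ : RTest) :
    curl (curl T) j φ = ∑ i, T i (dT i (dT j φ)) - ∑ i, T j (dT i (dT i φ)) := by
  fin_cases j <;>
  simp only [curl, Fin.zero_eta, Fin.mk_one, Fin.reduceFinMk, Matrix.cons_val, sub_distr_apply,
    pd_apply, Fin.sum_univ_three, dT_comm 1 0, dT_comm 2 0, dT_comm 2 1] <;> ring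

/-- Maxwell's equations for the field `e^{iζ·x} E` follow from the conjugated weak equations. -/
theorem solvesMaxwell_of_weak {k : ℝ} {n : E3 → ℂ} (hn : Continuous n) {ζ η : C3} {R : E3 → C3}
    {E : Fin 3 → E3 → ℂ} (hE : ∀ j, Continuous (E j)) (hRE : ∀ x j, (η + R x) j = E j x)
    (hcurl : ∀ j φ, IsTest φ → ZeroInt (fun x ↦ ∑ i, E i x * Dz (-ζ) i (Dz (-ζ) j φ) x -
      E j x * lapz (-ζ) φ x - (k : ℂ) ^ 2 * n x * E j x * φ x))
    (hdiv : ∀ φ, IsTest φ → ZeroInt (fun x ↦ n x * ∑ j, E j x * Dz (-ζ) j φ x)) :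
    SolvesMaxwell k n (cgoField ζ η R) := by
  have hfield : ∀ x j, cgoField ζ η R x j = expz ζ x * E j x := fun x j ↦ by
    rw [← hRE]; rfl
  have hexp : Continuous (expz ζ) := (contDiff_expz ζ (n := 0)).continuous
  -- Testing with `e^{iζ·x} φ` turns the derivatives `∂_j - iζ_j` into `∂_j`.
  have htest : ∀ φ : RTest, IsTest fun x ↦ expz ζ x * cx φ x := fun φ ↦
    ⟨(contDiff_expz ζ).mul (isTest_cx φ).smooth, (isTest_cx φ).supp.mul_left⟩
  have hT : ∀ j, toDistr3 (cgoField ζ η R) j = toDistr fun x ↦ expz ζ x * E j x := fun j ↦ by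
    simp only [toDistr3, hfield]
  have hM : ∀ (p : E3 → ℂ) j, toDistr3 (fun x ↦ p x • cgoField ζ η R x) j =
      toDistr fun x ↦ p x * (expz ζ x * E j x) := fun p j ↦ by
    simp only [toDistr3, PiLp.smul_apply, hfield, smul_eq_mul]
  have hI : ∀ (p : E3 → ℂ), Continuous p → ∀ j φ, HasInt
      (fun x ↦ p x * (expz ζ x * E j x) * cx φ x)
      (toDistr (fun x ↦ p x * (expz ζ x * E j x)) φ) := fun p hp j φ ↦
    hasInt_toDistr (hp.mul (hexp.mul (hE j))).locallyIntegrable φ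
  have hI' : ∀ j φ, HasInt (fun x ↦ expz ζ x * E j x * cx φ x)
      (toDistr (fun x ↦ expz ζ x * E j x) φ) := fun j φ ↦
    hasInt_toDistr (hexp.mul (hE j)).locallyIntegrable φ
  have hDz : ∀ (φ : RTest) i, Dz (-ζ) i (fun y ↦ expz ζ y * cx φ y) =
      fun x ↦ expz ζ x * cx (dT i φ) x := fun φ i ↦ by
    rw [Dz_expz_mul ζ i (isTest_cx φ).contDiff_one, cx_dT]
  refine ⟨funext fun j ↦ distr_ext fun φ ↦ ?_, distr_ext fun φ ↦ ?_⟩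
  · have h1 := hcurl j _ (htest φ)
    simp only [lapz, hDz] at h1
    have h2 := ((((hI' 0 (dT 0 (dT j φ))).add (hI' 1 (dT 1 (dT j φ)))).add
      (hI' 2 (dT 2 (dT j φ)))).sub (((hI' j (dT 0 (dT 0 φ))).add (hI' j (dT 1 (dT 1 φ)))).add
        (hI' j (dT 2 (dT 2 φ))))).sub (hI (fun x ↦ (k : ℂ) ^ 2 * n x) (by fun_prop) j φ)
    change curl (curl _) j φ - toDistr3 _ j φ = 0
    rw [curl_curl_apply, hM (fun x ↦ (k : ℂ) ^ 2 * n x)]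
    simp only [hT, Fin.sum_univ_three]
    rw [← h2.2]
    refine (h1.congr fun x ↦ ?_).2
    simp only [Fin.sum_univ_three]
    ring
  · have h1 := hdiv _ (htest φ)
    simp only [hDz] at h1
    have h2 := (((hI n hn 0 (dT 0 φ)).add (hI n hn 1 (dT 1 φ))).add
      (hI n hn 2 (dT 2 φ)))
    have h3 : divergence (toDistr3 fun x ↦ n x • cgoField ζ η R x) φ =
        -(toDistr (fun x ↦ n x * (expz ζ x * E 0 x)) (dT 0 φ) +
          toDistr (fun x ↦ n x * (expz ζ x * E 1 x)) (dT 1 φ) +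
          toDistr (fun x ↦ n x * (expz ζ x * E 2 x)) (dT 2 φ)) := by
      simp only [divergence, Fin.sum_univ_three, add_distr_apply, pd_apply, hM n]
      ring
    rw [h3, ← h2.2]
    refine neg_eq_zero.mpr (h1.congr fun x ↦ ?_).2
    simp only [Fin.sum_univ_three]
    ring

/-! ### Norm bounds for the remainder -/

section

variable {F : Type*} [NormedAddCommGroup F] [NormedSpace ℂ F] {s δ : ℝ}

/-- `‖u‖_{H^s_δ} ≤ B`, witnessed by a measurable representative of `(I - Δ)^{s/2} u`. -/
def SobLE (s δ : ℝ) (u : E3 → F) (B : ℝ≥0∞) : Prop :=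
  ∃ w : E3 → F, AEStronglyMeasurable w ∧ IsBesselImage s u w ∧ wNorm δ w ≤ B

theorem SobLE.mono {u : E3 → F} {B B' : ℝ≥0∞} (h : SobLE s δ u B) (hB : B ≤ B') :
    SobLE s δ u B' := by
  obtain ⟨w, h1, h2, h3⟩ := h
  exact ⟨w, h1, h2, h3.trans hB⟩

theorem SobLE.congr {u v : E3 → F} {B : ℝ≥0∞} (h : SobLE s δ u B) (huv : ∀ x, v x = u x) :
    SobLE s δ v B := by
  rwa [show v = u from funext huv]

theorem SobLE.add {u v : E3 → F} {B B' : ℝ≥0∞} (h : SobLE s δ u B) (h' : SobLE s δ v B') :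
    SobLE s δ (fun x ↦ u x + v x) (B + B') := by
  obtain ⟨w, h1, h2, h3⟩ := h
  obtain ⟨w', h1', h2', h3'⟩ := h'
  exact ⟨_, h1.add h1', h2.add h2', (wNorm_add_le δ h1 h1').trans (add_le_add h3 h3')⟩

theorem wNorm_mono_of_norm_le {F G : Type*} [NormedAddCommGroup F] [NormedAddCommGroup G]
    {w : E3 → F} {v : E3 → G}
    (h : ∀ x, ‖v x‖ ≤ ‖w x‖) : wNorm δ v ≤ wNorm δ w := by
  refine eLpNorm_mono fun x ↦ ?_
  rw [norm_smul, norm_smul, norm_norm, norm_norm]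
  exact mul_le_mul_of_nonneg_left (h x) (norm_nonneg _)

theorem wNorm_const_smul {w : E3 → F} (c : ℂ) : wNorm δ (fun x ↦ c • w x) = ‖c‖ₑ * wNorm δ w := by
  unfold wNorm
  have h : (fun x ↦ ((1 + ‖x‖ ^ 2) ^ (δ / 2) : ℝ) • ‖c • w x‖) =
      ‖c‖ • fun x : E3 ↦ ((1 + ‖x‖ ^ 2) ^ (δ / 2) : ℝ) • ‖w x‖ := by
    ext x
    simp only [norm_smul, Pi.smul_apply, smul_eq_mul]
    ring
  rw [h, eLpNorm_const_smul, enorm_norm]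

theorem SobLE.const_smul [CompleteSpace F] {u : E3 → F} {B : ℝ≥0∞} (h : SobLE s δ u B) (c : ℂ) :
    SobLE s δ (fun x ↦ c • u x) (‖c‖ₑ * B) := by
  obtain ⟨w, h1, h2, h3⟩ := h
  refine ⟨fun x ↦ c • w x, h1.const_smul c, h2.clm (c • ContinuousLinearMap.id ℂ F), ?_⟩
  rw [wNorm_const_smul]
  exact mul_le_mul' le_rfl h3

theorem SobLE.sobolevNorm_le {u : E3 → F} {B : ℝ≥0∞} (h : SobLE s δ u B) :
    sobolevNorm s δ u ≤ B := by
  obtain ⟨w, -, h2, h3⟩ := h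
  exact (iInf₂_le w h2).trans h3

end

/-- A vector field is in `H^s_δ` if its components are. -/
theorem SobLE.of_components {s δ : ℝ} {u : E3 → C3} {B : Fin 3 → ℝ≥0∞}
    (h : ∀ j, SobLE s δ (fun x ↦ u x j) (B j)) : SobLE s δ u (∑ j, B j) := by
  have h1 : ∀ j, SobLE s δ (fun x ↦ EuclideanSpace.single j (u x j)) (B j) := fun j ↦ by
    obtain ⟨w, h1, h2, h3⟩ := h j
    let L : ℂ →L[ℂ] C3 := ContinuousLinearMap.toSpanSingleton ℂ (EuclideanSpace.single j 1)
    have hL : ∀ z, L z = EuclideanSpace.single j z := fun z ↦ by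
      ext i
      simp [L, ContinuousLinearMap.toSpanSingleton_apply]
    refine ⟨fun x ↦ L (w x), L.continuous.comp_aestronglyMeasurable h1, ?_,
      (wNorm_mono_of_norm_le fun x ↦ ?_).trans h3⟩
    · simpa only [hL] using h2.clm L
    · rw [hL, PiLp.norm_single]
  rw [Fin.sum_univ_three]
  refine (((h1 0).add (h1 1)).add (h1 2)).congr fun x ↦ ?_
  ext i
  fin_cases i <;> simp

/-- A field in `H^s_δ` has a Bessel image with components of finite weighted norm. -/
theorem MemSobolev.exists_components {s δ : ℝ} {u : E3 → C3} (h : MemSobolev s δ u) :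
    ∃ w : Fin 3 → E3 → ℂ, ∀ j, IsBesselImage s (fun x ↦ u x j) (w j) ∧ wNorm δ (w j) ≠ ∞ := by
  unfold MemSobolev sobolevNorm at h
  simp only [iInf_lt_iff] at h
  obtain ⟨w, hw, hlt⟩ := h
  refine ⟨fun j x ↦ w x j, fun j ↦ ⟨hw.clm (EuclideanSpace.proj j : C3 →L[ℂ] ℂ), ?_⟩⟩
  exact ((wNorm_mono_of_norm_le fun x ↦ PiLp.norm_apply_le (w x) j).trans_lt hlt).ne

/-- A compactly supported function is bounded in `H^s_δ` by its `H^s` norm. -/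
theorem sobLE_of_sobN {s δ : ℝ} (hδ' : δ < 0) {v : E3 → ℂ} (hv : Integrable v)
    (hs : sobN s v ≠ ∞) : SobLE s δ v (sobN s v) := by
  have hm : MemLp (fun ξ ↦ (besselSymbol s ξ : ℂ) * 𝓕 v ξ) 2 :=
    ⟨(Complex.continuous_ofReal.comp (continuous_besselSymbol s)).aestronglyMeasurable.mul
      (continuous_fourier hv).aestronglyMeasurable, hs.lt_top⟩
  obtain ⟨w, h1, h2, h3⟩ := exists_isFourierPair_of_memLp hm
  exact ⟨w, h1.1, isBesselImage_of_isFourierPair (isFourierPair_fourier hv) h3,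
    (wNorm_le_eLpNorm hδ'.le w).trans h2.le⟩

theorem enorm_mul_inv_le (ζ : C3) (j : Fin 3) :
    ‖ζ j‖ₑ * (ENNReal.ofReal ‖ζ‖)⁻¹ ≤ 1 := by
  have h1 : ‖ζ j‖ₑ ≤ ENNReal.ofReal ‖ζ‖ := by
    rw [← ofReal_norm]
    exact ENNReal.ofReal_le_ofReal (PiLp.norm_apply_le ζ j)
  refine (mul_le_mul' h1 le_rfl).trans (ENNReal.mul_inv_le_one _)

/-- The bounds for `G_ζ` and `∂_j G_ζ` in `H^s_δ`, also after multiplication by a compactly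
supported coefficient. -/
theorem exists_sobLE_Gop {k : ℝ} (hk : 0 < k) {δ : ℝ} (hδ : -1 < δ) (hδ' : δ < 0) {s : ℝ}
    (hs : 0 ≤ s) {l : ℕ} (hl : 1 ≤ l) (hsl : s ≤ l) {V : E3 → ℂ} (hV : ContDiff ℝ l V)
    (hVs : HasCompactSupport V) (χ : 𝓢(E3, ℂ)) :
    ∃ C : ℝ≥0∞, C ≠ ∞ ∧ ∀ ζ : C3, Adm k ζ → ∀ f : E3 → ℂ, Src l f → (∀ x, χ x * f x = f x) →
      SobLE s δ (Gop ζ f) (C * (ENNReal.ofReal ‖ζ‖)⁻¹ * sobN l f) ∧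
      (∀ j, SobLE s δ (D j (Gop ζ f)) (C * sobN l f)) ∧
      SobLE s δ (fun x ↦ V x * Gop ζ f x) (C * (ENNReal.ofReal ‖ζ‖)⁻¹ * sobN l f) ∧
      ∀ j, SobLE s δ (fun x ↦ V x * D j (Gop ζ f) x) (C * sobN l f) := by
  obtain ⟨C1, h1t, h1⟩ := exists_isBesselImage_mult_le hk hδ hδ' hs χ
  obtain ⟨C2, h2t, h2⟩ := exists_sobN_mul_Gop_le hk l hV hVs χ
  obtain ⟨C3, h3t, h3⟩ := exists_sobN_mul_D_Gop_le hk hl hV hVs χ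
  refine ⟨C1 * 4 + C2 + C3, by simp [ENNReal.mul_eq_top, *], fun ζ hζ f hf hχ ↦ ?_⟩
  have hζ0 : ENNReal.ofReal ‖ζ‖ ≠ 0 := by
    have := hζ.one_le
    simp only [ne_eq, ENNReal.ofReal_eq_zero, not_le]
    linarith
  have hi := hf.integrable
  have hsN := sobN_mono hsl f
  have hft := hf.sobN_ne_top hsl
  have e1 : C1 ≤ C1 * 4 + C2 + C3 := by
    rw [add_assoc]
    exact le_add_right (le_mul_of_one_le_right zero_le (by norm_num))
  have e1' : C1 * 4 ≤ C1 * 4 + C2 + C3 := by rw [add_assoc]; exact le_self_add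
  have e2 : C2 ≤ C1 * 4 + C2 + C3 := le_add_right le_add_self
  have e3 : C3 ≤ C1 * 4 + C2 + C3 := le_add_self
  refine ⟨?_, fun j ↦ ?_, ?_, fun j ↦ ?_⟩
  · obtain ⟨w, w1, w2, w3⟩ := h1 ζ hζ _ _ (isMult_symb_inv hζ.one_le) (ENNReal.inv_ne_top.2 hζ0) f
      hi hχ hft (integrable_gHat hk hζ hf)
    rw [Gop_eq]
    exact ⟨w, w1, w2, w3.trans (by gcongr)⟩
  · have he : (fun ξ ↦ dSymb j ξ * gHat ζ f ξ) = fun ξ ↦ dSymb j ξ * (symb ζ ξ)⁻¹ * 𝓕 f ξ := by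
      ext ξ; rw [gHat, mul_assoc]
    have hI := integrable_dSymb_mul_gHat hk hζ hl hf j
    rw [he] at hI
    obtain ⟨w, w1, w2, w3⟩ := h1 ζ hζ _ _ (isMult_dSymb_mul hζ.one_le j) (by simp) f hi hχ hft hI
    rw [D_Gop hk hζ hl hf, he]
    exact ⟨w, w1, w2, w3.trans (by gcongr)⟩
  · have h4 := h2 ζ hζ f hf hχ
    have hsrc := hf.mul_Gop hk hζ hV hVs
    refine (sobLE_of_sobN hδ' hsrc.integrable (hsrc.sobN_ne_top hsl)).mono
      ((sobN_mono hsl _).trans (h4.trans (by gcongr)))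
  · have h4 := (sobN_mono hsl _).trans (h3 ζ hζ f hf hχ j)
    refine (sobLE_of_sobN hδ' ?_ (ne_top_of_le_ne_top (ENNReal.mul_ne_top h3t hf.fin) h4)).mono
      (h4.trans (by gcongr))
    have hc := hV.continuous.mul (continuous_D (contDiff_Gop hk hζ hl hf) j)
    exact hc.integrable_of_hasCompactSupport hVs.mul_right

/-! ### The leading term -/

/-- The leading term `i a⁻¹ G_ζ(a α·η) ζ`, for `n = a²`. -/
noncomputable def lead (a : E3 → ℂ) (ζ η : C3) (j : Fin 3) (x : E3) : ℂ :=
  Complex.I * (a x)⁻¹ * Gop ζ (fun y ↦ a y * ∑ i, alf a i y * η i) x * ζ j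

/-- The source `-2 ∇a·η` of the first approximation to `z`. -/
noncomputable def src0 (a : E3 → ℂ) (η : C3) (x : E3) : ℂ := ∑ i, (-2 * η i) * D i a x

/-- The leading term comes from the first approximation `z ≈ G_ζ src0`, because `a α·η = 2 ∇a·η =
-src0`. -/
theorem lead_eq {l : ℕ} {a : E3 → ℂ} (ha : Medium l a) (ζ η : C3) (j : Fin 3) (x : E3) :
    lead a ζ η j x = -(Complex.I * ζ j * (a x)⁻¹ * Gop ζ (src0 a η) x) := by
  have h : (fun y ↦ a y * ∑ i, alf a i y * η i) = fun y ↦ (-1) * src0 a η y := by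
    ext y
    have := ha.ne_zero y
    simp only [alf, src0, Fin.sum_univ_three]
    field_simp
    ring
  rw [lead, h, Gop_const_mul]
  ring

theorem Medium.contDiff_src0 {l : ℕ} {a : E3 → ℂ} (ha : Medium l a) (η : C3) :
    ContDiff ℝ (l + 1 : ℕ) (src0 a η) :=
  ContDiff.sum fun i _ ↦ contDiff_const.mul (ha.contDiff_D i)

theorem vanishOff_src0 {a : E3 → ℂ} {r : ℝ} (hr : ∀ j, VanishOff r (D j a)) (η : C3) :
    VanishOff r (src0 a η) := fun x hx ↦
  Finset.sum_eq_zero fun i _ ↦ by rw [hr i x hx, mul_zero]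

theorem D_src0 {l : ℕ} {a : E3 → ℂ} (ha : Medium l a) (η : C3) (j : Fin 3) :
    D j (src0 a η) = fun x ↦ ∑ i, (-2 * η i) * D j (D i a) x := by
  ext x
  have h := fun i ↦ ha.contDiff_D_one i
  have h' : src0 a η = fun x ↦ (-2 * η 0) * D 0 a x + (-2 * η 1) * D 1 a x +
      (-2 * η 2) * D 2 a x := by ext y; simp only [src0, Fin.sum_univ_three]
  rw [h', D_add ((contDiff_const.mul (h 0)).add (contDiff_const.mul (h 1)))
    (contDiff_const.mul (h 2)), D_add (contDiff_const.mul (h 0)) (contDiff_const.mul (h 1)),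
    D_const_mul _ (h 0), D_const_mul _ (h 1), D_const_mul _ (h 2), Fin.sum_univ_three]

theorem enorm_apply_le (η : C3) (j : Fin 3) : ‖η j‖ₑ ≤ ENNReal.ofReal ‖η‖ := by
  rw [← ofReal_norm]
  exact ENNReal.ofReal_le_ofReal (PiLp.norm_apply_le η j)

/-- The derivatives of `src0` are bounded by `|η|`. Since `∂_j G_ζ src0 = G_ζ ∂_j src0`, a
derivative of the first approximation does not cost the decay in `|ζ|`. -/
theorem exists_sobN_D_src0_le {l : ℕ} {a : E3 → ℂ} (ha : Medium l a) :
    ∃ C : ℝ≥0∞, C ≠ ∞ ∧ ∀ (η : C3) j, sobN l (D j (src0 a η)) ≤ C * ENNReal.ofReal ‖η‖ := by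
  obtain ⟨r, -, hr, -, -⟩ := ha.exists_vanishOff 0
  have hs : ∀ j i, Src l (D j (D i a)) := fun j i ↦
    .of_contDiff (contDiff_D (ha.contDiff_D i) j) ((hr i).D j).hasCompactSupport
  refine ⟨∑ j, ∑ i, 2 * sobN l (D j (D i a)), ENNReal.sum_ne_top.2 fun j _ ↦
    ENNReal.sum_ne_top.2 fun i _ ↦ ENNReal.mul_ne_top (by simp) (hs j i).fin, fun η j ↦ ?_⟩
  rw [D_src0 ha]
  refine (sobN_sum_le (f := fun i x ↦ (-2 * η i) * D j (D i a) x) l _ fun i _ ↦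
    ((hs j i).const_mul _).integrable).trans ?_
  refine le_trans ?_ (mul_le_mul' (Finset.single_le_sum
    (f := fun j ↦ ∑ i, 2 * sobN l (D j (D i a))) (fun _ _ ↦ zero_le) (Finset.mem_univ j)) le_rfl)
  rw [Finset.sum_mul]
  refine Finset.sum_le_sum fun i _ ↦ ?_
  rw [sobN_const_mul, enorm_mul, enorm_neg]
  have h2 : ‖(2 : ℂ)‖ₑ = 2 := by
    rw [← ofReal_norm]; simp
  rw [h2, mul_right_comm]
  exact mul_le_mul' le_rfl (enorm_apply_le η i)

theorem mul_eq_of_vanishOff {χ : E3 → ℂ} {r : ℝ} (hχ : ∀ x, ‖x‖ ≤ r → χ x = 1) {f : E3 → ℂ}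
    (hf : VanishOff r f) (x : E3) : χ x * f x = f x := by
  by_cases h : ‖x‖ ≤ r
  · rw [hχ x h, one_mul]
  · rw [hf x (not_le.1 h), mul_zero]

/-- The remainder minus its leading term, written as a sum of terms each of size `|η|/|ζ|`; here
`f = src0 + g` is the source of `z`, and `b = a⁻¹ - 1`. -/
theorem potE_sub_lead {k : ℝ} (hk : 0 < k) {l : ℕ} (hl : 1 ≤ l) {a : E3 → ℂ} (ha : Medium l a)
    {ζ η : C3} (hζ : Adm k ζ) {f : Option (Fin 3) → E3 → ℂ} (hf : ∀ i, Src l (f i)) {g : E3 → ℂ}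
    (hg : Src l g) (hfg : ∀ x, f none x = src0 a η x + g x) (h0 : Src l (src0 a η)) (j : Fin 3)
    (x : E3) :
    potE a ζ η f j x - η j - lead a ζ η j x =
      Gop ζ (f (some j)) x + (-1 : ℂ) • (D j (fun y ↦ (a y)⁻¹ - 1) x * Gop ζ (f none) x) +
      (-1 : ℂ) • Gop ζ (D j (src0 a η)) x + (-1 : ℂ) • D j (Gop ζ g) x +
      (-1 : ℂ) • (((a x)⁻¹ - 1) * Gop ζ (D j (src0 a η)) x) +
      (-1 : ℂ) • (((a x)⁻¹ - 1) * D j (Gop ζ g) x) + (-(Complex.I * ζ j)) • Gop ζ g x +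
      (-(Complex.I * ζ j)) • (((a x)⁻¹ - 1) * Gop ζ g x) := by
  have hz : Gop ζ (f none) = fun y ↦ Gop ζ (src0 a η) y + Gop ζ g y := by
    rw [show f none = fun y ↦ src0 a η y + g y from funext hfg]
    ext y
    exact Gop_add hk hζ h0 hg y
  have hb1 : ContDiff ℝ 1 fun y ↦ (a y)⁻¹ := ha.contDiff_inv.of_le (by norm_cast; omega)
  have hs1 : ContDiff ℝ 1 (src0 a η) := (ha.contDiff_src0 η).of_le (by norm_cast; omega)
  have hDz : Dz ζ j (potW a ζ f) x = D j (fun y ↦ (a y)⁻¹) x * Gop ζ (f none) x +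
      (a x)⁻¹ * Dz ζ j (Gop ζ (f none)) x :=
    Dz_mul ζ j hb1 (contDiff_Gop hk hζ hl (hf none)) x
  have hD : Dz ζ j (Gop ζ (f none)) x = Gop ζ (D j (src0 a η)) x + D j (Gop ζ g) x +
      Complex.I * ζ j * (Gop ζ (src0 a η) x + Gop ζ g x) := by
    rw [Dz, hz, D_add (contDiff_Gop hk hζ hl h0) (contDiff_Gop hk hζ hl hg),
      D_Gop_eq_Gop_D hk hζ hl h0 hs1]
  rw [potE, hDz, hD, lead_eq ha, D_sub_const]
  simp only [smul_eq_mul]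
  rw [hz]
  ring

/-- The remainder belongs to `H^s_δ`, and is `O(|η|/|ζ|)`-close to the leading term. -/
theorem exists_field_estimate {k : ℝ} (hk : 0 < k) {δ : ℝ} (hδ : -1 < δ) (hδ' : δ < 0) {s : ℝ}
    (hs : 0 ≤ s) {l : ℕ} (hl : 1 ≤ l) (hsl : s ≤ l) {a : E3 → ℂ} (ha : Medium l a) :
    ∃ (c : ℝ) (K : ℝ≥0∞), K ≠ ∞ ∧ ∀ ζ : C3, Adm k ζ → c ≤ ‖ζ‖ → ∀ η : C3,
      ∃ f, IsPot k l a ζ η (fun _ _ ↦ 0) f ∧ ∀ j,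
        SobLE s δ (fun x ↦ potE a ζ η f j x - η j - lead a ζ η j x)
          (K * ((ENNReal.ofReal ‖ζ‖)⁻¹ * ENNReal.ofReal ‖η‖)) ∧
        ∃ B, B ≠ ∞ ∧ SobLE s δ (fun x ↦ potE a ζ η f j x - η j) B := by
  obtain ⟨χ, r, hχs, hχ1, hra, hrD, hrV, c, C0, hC0, hc⟩ := exists_isPot_bound hk ha
  have hχ : ∀ {F : E3 → ℂ}, VanishOff r F → ∀ x, χ x * F x = F x := fun hF ↦
    mul_eq_of_vanishOff hχ1 hF
  have hb : ContDiff ℝ (l + 2 : ℕ) fun x ↦ (a x)⁻¹ - 1 := ha.contDiff_inv.sub contDiff_const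
  have hbr : VanishOff r fun x ↦ (a x)⁻¹ - 1 := fun x hx ↦ by
    simp [sub_eq_zero.1 (hra x hx)]
  have hDb : ∀ j, ContDiff ℝ l (D j fun x ↦ (a x)⁻¹ - 1) := fun j ↦
    (contDiff_D (n := l + 1) hb j).of_le (by norm_cast; omega)
  obtain ⟨Cb, hCb, hB⟩ := exists_sobLE_Gop hk hδ hδ' hs hl hsl
    (hb.of_le (by norm_cast; omega)) hbr.hasCompactSupport χ
  choose Cd hCd hBd using fun j ↦ exists_sobLE_Gop hk hδ hδ' hs hl hsl (hDb j)
    (hbr.D j).hasCompactSupport χ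
  choose Cg hCg hBg using fun j ↦ exists_sobN_mul_Gop_le hk l (ha.contDiff_sysV k none j)
    (hrV none j).hasCompactSupport χ
  obtain ⟨CD, hCD, hBD⟩ := exists_sobN_D_src0_le ha
  obtain ⟨K, hKdef⟩ : ∃ K, K = Cb * C0 + (∑ j, Cd j) * C0 + Cb * CD + Cb * ((∑ j, Cg j) * C0) +
    Cb * CD + Cb * ((∑ j, Cg j) * C0) + Cb * ((∑ j, Cg j) * C0) +
    Cb * ((∑ j, Cg j) * C0) := ⟨_, rfl⟩
  have hK : K ≠ ∞ := by
    have h1 : ∑ j, Cd j ≠ ∞ := ENNReal.sum_ne_top.2 fun j _ ↦ hCd j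
    have h2 : (∑ j, Cg j) * C0 ≠ ∞ := ENNReal.mul_ne_top (ENNReal.sum_ne_top.2 fun j _ ↦ hCg j) hC0
    have h3 := ENNReal.mul_ne_top hCb h2
    have h4 := ENNReal.mul_ne_top hCb hCD
    simp only [hKdef, ne_eq, ENNReal.add_eq_top, not_or]
    exact ⟨⟨⟨⟨⟨⟨⟨ENNReal.mul_ne_top hCb hC0, ENNReal.mul_ne_top h1 hC0⟩, h4⟩, h3⟩, h4⟩, h3⟩, h3⟩,
      h3⟩
  refine ⟨c, K, hK, fun ζ hζ hcζ η ↦ ?_⟩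
  obtain ⟨f, hf, hχf, hfN⟩ := hc ζ hζ hcζ η
  have hζ0 : ENNReal.ofReal ‖ζ‖ ≠ 0 := by
    have := hζ.one_le
    simp only [ne_eq, ENNReal.ofReal_eq_zero, not_le]
    linarith
  set τ := (ENNReal.ofReal ‖ζ‖)⁻¹ with hτ
  have hτt : τ ≠ ∞ := ENNReal.inv_ne_top.2 hζ0
  set H := ENNReal.ofReal ‖η‖
  have hfi : ∀ i, sobN l (f i) ≤ C0 * H := fun i ↦ (Finset.single_le_sum
    (f := fun i ↦ sobN l (f i)) (fun _ _ ↦ zero_le) (Finset.mem_univ i)).trans hfN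
  have h0r := vanishOff_src0 hrD η
  have h0 : Src l (src0 a η) := .of_contDiff ((ha.contDiff_src0 η).of_le (by norm_cast; omega))
    h0r.hasCompactSupport
  have hD0 : ∀ j, Src l (D j (src0 a η)) := fun j ↦
    .of_contDiff (contDiff_D (ha.contDiff_src0 η) j) (h0r.D j).hasCompactSupport
  have hgi : ∀ j, Src l fun x ↦ sysV k a none j x * Gop ζ (f j) x := fun j ↦
    (hf.src j).mul_Gop hk hζ (ha.contDiff_sysV k none j) (hrV none j).hasCompactSupport
  -- The source of `z` is `src0 + g`, where `g` has the size `|η|/|ζ|`.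
  let g : E3 → ℂ := fun x ↦ ∑ j, sysV k a none j x * Gop ζ (f j) x
  have hg : Src l g := Src.sum _ fun j _ ↦ hgi j
  have hgr : VanishOff r g := fun x hx ↦ Finset.sum_eq_zero fun j _ ↦ by
    rw [hrV none j x hx, zero_mul]
  have hgN : sobN l g ≤ (∑ j, Cg j) * C0 * (τ * H) := by
    refine (sobN_sum_le (f := fun j x ↦ sysV k a none j x * Gop ζ (f j) x) l _
      fun j _ ↦ (hgi j).integrable).trans ?_
    rw [Finset.sum_mul, Finset.sum_mul]
    refine Finset.sum_le_sum fun j _ ↦ (hBg j ζ hζ _ (hf.src j) (hχf j)).trans ?_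
    calc Cg j * τ * sobN l (f j) ≤ Cg j * τ * (C0 * H) := mul_le_mul' le_rfl (hfi j)
      _ = _ := by ring
  have hfg : ∀ x, f none x = src0 a η x + g x := fun x ↦ by
    have hDz : ∀ j, Dz ζ j (fun _ : E3 ↦ (0 : ℂ)) x = 0 := fun j ↦ by simp [Dz_const]
    rw [hf.scal]
    simp only [hDz, g, src0, Fintype.sum_option, sysV, Fin.sum_univ_three]
    ring
  refine ⟨f, hf, fun j ↦ ?_⟩
  have key : SobLE s δ (fun x ↦ potE a ζ η f j x - η j - lead a ζ η j x)
      (K * (τ * H)) := by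
    have hneg : ‖(-1 : ℂ)‖ₑ = 1 := by simp
    have hG : Cb * sobN l g ≤ Cb * ((∑ j, Cg j) * C0) * (τ * H) := by
      rw [mul_assoc Cb]; exact mul_le_mul' le_rfl hgN
    -- Here the factor `ζ_j` uses up the decay of `G_ζ`, but `g` itself is `O(|η|/|ζ|)`.
    have hζG : ‖-(Complex.I * ζ j)‖ₑ * (Cb * τ * sobN l g) ≤
        Cb * ((∑ j, Cg j) * C0) * (τ * H) := by
      refine le_trans ?_ hG
      have hI : ‖Complex.I‖ₑ = 1 := by rw [← ofReal_norm]; simp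
      rw [enorm_neg, enorm_mul, hI, one_mul]
      calc ‖ζ j‖ₑ * (Cb * τ * sobN l g) = ‖ζ j‖ₑ * τ * (Cb * sobN l g) := by ring
        _ ≤ 1 * (Cb * sobN l g) := mul_le_mul' (enorm_mul_inv_le ζ j) le_rfl
        _ = _ := one_mul _
    -- The derivative of `G_ζ src0` has been moved to the source, so that the decay of `G_ζ`
    -- remains.
    have hDD : Cb * τ * sobN l (D j (src0 a η)) ≤ Cb * CD * (τ * H) :=
      calc _ ≤ Cb * τ * (CD * H) := mul_le_mul' le_rfl (hBD η j)
        _ = _ := by ring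
    simp only [hKdef, add_mul _ _ (τ * H)]
    refine SobLE.congr ?_ fun x ↦ potE_sub_lead hk hl ha hζ hf.src hg hfg h0 j x
    obtain ⟨g1, g2, g3, g4⟩ := hB ζ hζ g hg (hχ hgr)
    obtain ⟨d1, -, d3, -⟩ := hB ζ hζ _ (hD0 j) (hχ (h0r.D j))
    refine (((((((SobLE.mono (hB ζ hζ _ (hf.src (some j)) (hχf _)).1 ?_).add
      (((hBd j ζ hζ _ (hf.src none) (hχf _)).2.2.1.const_smul (-1)).mono ?_)).add
      ((d1.const_smul (-1)).mono ?_)).add (((g2 j).const_smul (-1)).mono ?_)).add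
      ((d3.const_smul (-1)).mono ?_)).add (((g4 j).const_smul (-1)).mono ?_)).add
      ((g1.const_smul _).mono hζG)).add ((g3.const_smul _).mono hζG)
    · calc _ ≤ Cb * τ * (C0 * H) := mul_le_mul' le_rfl (hfi _)
        _ = _ := by ring
    · rw [hneg, one_mul]
      calc _ ≤ (∑ j, Cd j) * τ * (C0 * H) := by
            refine mul_le_mul' (mul_le_mul' ?_ le_rfl) (hfi _)
            exact Finset.single_le_sum (f := Cd) (fun _ _ ↦ zero_le) (Finset.mem_univ j)
        _ = _ := by ring
    all_goals rw [hneg, one_mul]; assumption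
  -- The leading term is bounded in `H^s_δ` for each fixed `ζ`.
  obtain ⟨z1, -, z3, -⟩ := hB ζ hζ _ h0 (hχ h0r)
  refine ⟨key, _, ?_, (key.add ((z1.add z3).const_smul (-(Complex.I * ζ j)))).congr fun x ↦ ?_⟩
  · have h1 := ENNReal.mul_ne_top (ENNReal.mul_ne_top hCb hτt) h0.fin
    exact ENNReal.add_ne_top.2
      ⟨ENNReal.mul_ne_top hK (ENNReal.mul_ne_top hτt ENNReal.ofReal_ne_top), ENNReal.mul_ne_top
        enorm_ne_top (ENNReal.add_ne_top.2 ⟨h1, h1⟩)⟩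
  · rw [lead_eq ha, smul_eq_mul]
    ring

/-! ### The refractive index and its square root -/

theorem cpow_half_sq (z : ℂ) : (z ^ (1 / 2 : ℂ)) ^ 2 = z := by
  simp [← Complex.cpow_nat_mul]

/-- The principal square root of `n` is as smooth as `n`, because `n` avoids the branch cut `(-∞,
0]`. -/
theorem medium_cpow_half {l : ℕ} {n : E3 → ℂ} (hn : ContDiff ℝ (l + 2 : ℕ) n)
    (hs : HasCompactSupport fun x ↦ n x - 1) (hslit : ∀ x, n x ∈ Complex.slitPlane) :
    Medium l fun x ↦ n x ^ (1 / 2 : ℂ) where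
  smooth := by
    have h : (fun x ↦ n x ^ (1 / 2 : ℂ)) = fun x ↦ Complex.exp (Complex.log (n x) * (1 / 2)) :=
      funext fun x ↦ Complex.cpow_def_of_ne_zero (Complex.slitPlane_ne_zero (hslit x)) _
    rw [h]
    refine ContDiff.cexp (ContDiff.mul (contDiff_iff_contDiffAt.2 fun x ↦ ?_) contDiff_const)
    exact ((Complex.contDiffAt_log (hslit x)).restrict_scalars ℝ).comp x hn.contDiffAt
  ne_zero x h := by
    have h2 := cpow_half_sq (n x)
    rw [h] at h2
    exact Complex.slitPlane_ne_zero (hslit x) (by simpa using h2.symm)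
  supp := by
    have h := hs.comp_left (g := fun z ↦ (z + 1) ^ (1 / 2 : ℂ) - 1) (by simp)
    simpa [Function.comp_def] using h

/-- `∇n/n = 2 ∇a/a` for `n = a²`. -/
theorem alpha_eq {l : ℕ} {a n : E3 → ℂ} (ha : Medium l a) (hn : ∀ x, n x = a x ^ 2) (x : E3)
    (j : Fin 3) : alpha n x j = alf a j x := by
  have h : n = fun y ↦ a y * a y := funext fun y ↦ by rw [hn, sq]
  have hd := ha.contDiff_one.differentiable one_ne_zero x
  have h1 := D_mul hd hd j
  have h0 := ha.ne_zero x
  change D j n x / n x = _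
  rw [h, h1, alf]
  field_simp
  ring

/-! ### The remainder equation -/

theorem Medium.continuous_alf {l : ℕ} {a : E3 → ℂ} (ha : Medium l a) (j : Fin 3) :
    Continuous (alf a j) :=
  (continuous_const.mul (ha.contDiff_D j).continuous).mul ha.contDiff_inv.continuous

/-- The weak form of the equation for the remainder. -/
theorem solvesRemainderEq_iff {k : ℝ} {l : ℕ} {a n : E3 → ℂ} (ha : Medium l a)
    (hn : ∀ x, n x = a x ^ 2) {ζ η : C3} (hζ : dot ζ ζ = (k : ℂ) ^ 2) {R : E3 → C3}
    (hR : ∀ j, LocallyIntegrable fun x ↦ R x j) :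
    SolvesRemainderEq k n ζ η R ↔ ∀ j φ, IsTest φ → ZeroInt (fun x ↦ R x j * helm k (-ζ) φ x -
      ((∑ i, alf a i x * (η i + R x i)) * Dz (-ζ) j φ x +
        pot k a x * (η j + R x j) * φ x)) := by
  have hS : (fun x ↦ dot (alpha n x) (η + R x)) = fun x ↦ ∑ i, alf a i x * (η i + R x i) := by
    ext x
    simp only [dot, alpha_eq ha hn, PiLp.add_apply]
  have hb : ∀ j, (fun x ↦ (k : ℂ) ^ 2 * (1 - n x) * (η + R x) j) =
      fun x ↦ pot k a x * (η j + R x j) := fun j ↦ by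
    ext x
    rw [pot, hn, PiLp.add_apply]
  have hηR : ∀ j, LocallyIntegrable fun x ↦ η j + R x j := fun j ↦
    (locallyIntegrable_const _).add (hR j)
  have hSi : LocallyIntegrable fun x ↦ ∑ i, alf a i x * (η i + R x i) := by
    simp only [Fin.sum_univ_three]
    have h := fun i ↦ (hηR i).continuous_mul (ha.continuous_alf i)
    exact ((h 0).add (h 1)).add (h 2)
  refine forall_congr' fun j ↦ ?_
  rw [hS, hb]
  exact remainder_iff hζ (hR j) hSi
    ((hηR j).continuous_mul (ha.contDiff_pot k).continuous) j

/-- A field of class `H^s_δ` is locally integrable and grows at most like `r^{-δ}`. -/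
theorem MemSobolev.growth {s δ : ℝ} (hs : 0 ≤ s) (hδ : -1 < δ) (hδ' : δ < 0) {u : E3 → C3}
    (h : MemSobolev s δ u) (j : Fin 3) :
    LocallyIntegrable (fun x ↦ u x j) ∧ Growth (-δ) fun x ↦ u x j := by
  obtain ⟨w, hw⟩ := h.exists_components
  obtain ⟨h1, h2⟩ := hw j
  refine ⟨?_, growth_of_isBesselImage hs hδ hδ' h1 h2⟩
  obtain ⟨U, -, hU, -⟩ := h1
  exact hU.locallyIntegrable

end CGO

open CGO in
theorem proposition3p2 (k : ℝ) (hk : 0 < k) (s δ : ℝ) (hs : 0 < s) (hδ : -1 < δ) (hδ' : δ < 0)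
    (m : ℕ) (hm : s + 2 ≤ m) (n : CGO.E3 → ℂ) (hn : ContDiff ℝ m n)
    (hn_supp : HasCompactSupport fun x ↦ n x - 1) (hn_slit : ∀ x, n x ∈ Complex.slitPlane) :
    ∃ c C : ℝ, 0 < c ∧ 0 < C ∧
      ∀ ζ η : CGO.C3, (∃ j, (ζ j).im ≠ 0) → CGO.dot ζ ζ = (k : ℂ) ^ 2 → CGO.dot ζ η = 0 →
        c ≤ ‖ζ‖ →
        ∃ R : CGO.E3 → CGO.C3,
          (CGO.MemSobolev s δ R ∧ CGO.SolvesRemainderEq k n ζ η R) ∧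
          (∀ R' : CGO.E3 → CGO.C3,
            CGO.MemSobolev s δ R' → CGO.SolvesRemainderEq k n ζ η R' →
              R' =ᵐ[MeasureTheory.volume] R) ∧
          CGO.SolvesMaxwell k n (CGO.cgoField ζ η R) ∧
          CGO.sobolevNorm s δ (fun x ↦ R x - CGO.leadingTerm n ζ η x) ≤
            ENNReal.ofReal (C * ‖η‖ / ‖ζ‖) := by
  have hm2 : (2 : ℝ) < m := by linarith
  have hm3 : 2 < m := by exact_mod_cast hm2
  obtain ⟨l, rfl⟩ : ∃ l, m = l + 2 := ⟨m - 2, by omega⟩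
  have hl : 1 ≤ l := by omega
  have hsl : s ≤ l := by push_cast at hm; linarith
  set a : E3 → ℂ := fun x ↦ n x ^ (1 / 2 : ℂ) with hadef
  have ha : Medium l a := medium_cpow_half hn hn_supp hn_slit
  have hna : ∀ x, n x = a x ^ 2 := fun x ↦ (cpow_half_sq (n x)).symm
  obtain ⟨c1, K, hK, h1⟩ := exists_field_estimate hk hδ hδ' hs.le hl hsl ha
  obtain ⟨c2, h2⟩ := exists_gauge hk hδ hδ' hl ha
  obtain ⟨c3, h3⟩ := exists_field_uniqueness hk hδ hδ' hl ha
  -- Beyond the thresholds for solvability, gauge and uniqueness, `|ζ| ≥ 2k` and `|ζ| ≥ 1` are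
  -- required for `ζ` to be admissible.
  refine ⟨max (max c1 (max c2 c3)) (max (2 * k) 1), 3 * K.toReal + 1, by positivity,
    by positivity, fun ζ η _ hζζ hζη hc ↦ ?_⟩
  simp only [max_le_iff] at hc
  obtain ⟨⟨hc1, hc2, hc3⟩, hck, hc0⟩ := hc
  have hζ : Adm k ζ := ⟨hζζ, hck, hc0⟩
  obtain ⟨f, hf, hfb⟩ := h1 ζ hζ hc1 η
  have hT : ∀ j : Fin 3, IsTest ((fun _ _ ↦ 0 : Fin 3 → E3 → ℂ) j) := fun _ ↦
    ⟨contDiff_const, HasCompactSupport.zero⟩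
  have hY := h2 ζ hζ hc2 η _ f hζη hT hf
  have hE := hf.continuous_potE hk hl ha hζ
  let R : E3 → C3 := fun x ↦ WithLp.toLp 2 fun j ↦ potE a ζ η f j x - η j
  have hR : ∀ x j, R x j = potE a ζ η f j x - η j := fun x j ↦ rfl
  have hRE : ∀ x j, η j + R x j = potE a ζ η f j x := fun x j ↦ by rw [hR]; ring
  have hRl : ∀ j, LocallyIntegrable fun x ↦ R x j := fun j ↦
    ((hE j).sub continuous_const).locallyIntegrable
  have hRmem : MemSobolev s δ R := by
    choose B hB hSB using fun j ↦ (hfb j).2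
    exact (SobLE.of_components hSB).sobolevNorm_le.trans_lt
      (ENNReal.sum_ne_top.2 fun j _ ↦ hB j).lt_top
  have hReq : SolvesRemainderEq k n ζ η R := by
    rw [solvesRemainderEq_iff ha hna hζζ hRl]
    intro j φ hφ
    simp only [hRE]
    exact hf.zeroInt_remainder hk hl ha hζ j hφ
  refine ⟨R, ⟨hRmem, hReq⟩, fun R' hR'mem hR'eq ↦ ?_, ?_, ?_⟩
  -- The difference of two solutions solves the homogeneous equation.
  · have hg := hRmem.growth hs.le hδ hδ'
    have hg' := hR'mem.growth hs.le hδ hδ'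
    rw [solvesRemainderEq_iff ha hna hζζ hRl] at hReq
    rw [solvesRemainderEq_iff ha hna hζζ fun j ↦ (hg' j).1] at hR'eq
    have h0 := h3 ζ hζ hc3 (fun j x ↦ R' x j + (-1) * R x j)
      (fun j ↦ (hg' j).1.add ((hg j).1.continuous_mul continuous_const))
      (fun j ↦ (hg' j).2.add ((hg j).2.const_mul _) (hg' j).1
        ((hg j).1.continuous_mul continuous_const))
      fun j φ hφ ↦ ((hR'eq j φ hφ).sub (hReq j φ hφ)).congr fun x ↦ by
        simp only [Fin.sum_univ_three]
        ring
    filter_upwards [h0 0, h0 1, h0 2] with x hx0 hx1 hx2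
    ext j
    have : R' x j + (-1) * R x j = 0 := by fin_cases j <;> assumption
    linear_combination this
  · refine solvesMaxwell_of_weak hn.continuous hE (fun x j ↦ hRE x j) (fun j φ hφ ↦ ?_)
      fun φ hφ ↦ ?_
    · simp only [hna]
      exact hf.zeroInt_curl hk hl ha hζ hY j hφ
    · simp only [hna]
      exact hf.zeroInt_div hk hl ha hζ hY hφ.contDiff_one hφ.supp
  · have hlead : ∀ x j, leadingTerm n ζ η x j = lead a ζ η j x := fun x j ↦ by
      simp only [leadingTerm, lead, PiLp.smul_apply, smul_eq_mul, dot, alpha_eq ha hna,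
        Complex.cpow_neg, hadef]
    have h4 : SobLE s δ (fun x ↦ R x - leadingTerm n ζ η x) _ :=
      SobLE.of_components fun j ↦ (hfb j).1.congr fun x ↦ by
        rw [PiLp.sub_apply, hlead, hR]
    refine h4.sobolevNorm_le.trans ?_
    have hζ0 : 0 < ‖ζ‖ := lt_of_lt_of_le one_pos hc0
    obtain ⟨K', hK'0, rfl⟩ : ∃ K' : ℝ, 0 ≤ K' ∧ K = ENNReal.ofReal K' :=
      ⟨_, ENNReal.toReal_nonneg, (ENNReal.ofReal_toReal hK).symm⟩
    rw [ENNReal.toReal_ofReal hK'0, ← ENNReal.ofReal_inv_of_pos hζ0,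
      ← ENNReal.ofReal_mul (by positivity), ← ENNReal.ofReal_mul (by positivity),
      Finset.sum_const, Finset.card_univ, Fintype.card_fin, nsmul_eq_mul,
      show ((3 : ℕ) : ℝ≥0∞) = ENNReal.ofReal 3 by simp, ← ENNReal.ofReal_mul (by positivity)]
    refine ENNReal.ofReal_le_ofReal ?_
    rw [mul_div_assoc, div_eq_inv_mul]
    have : 0 ≤ ‖ζ‖⁻¹ * ‖η‖ := by positivity
    nlinarith
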